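/- **Setting.** Let $\mathcal O$ be a complete discrete valuation ring whose residue field $k$ has characteristic $p>0$ ($k$ need not be algebraically closed). Let $\omega:G\to\bar G$ and $\omega':G'\to\bar G$ be epimorphisms of finite groups with kernels $H$ and $H'$; let $b$ be a $G$-invariant block of $\mathcal OH$ and $b'$ a $G'$-invariant block of $\mathcal OH'$, and put $A=\mathcal OGb$, $B=\mathcal OHb$, $A'=\mathcal OG'b'$, $B'=\mathcal OH'b'$. Let $\ddot G=\{(g,g')\in G\times G'\mid\omega(g)=\omega'(g')\}$, $A''=\mathcal O\ddot G(b\otimes b')$ (the diagonal subalgebra of $A\otimes_{\mathcal O}A'$) and $B''=B\otimes_{\mathcal O} B'$; these are attached to the epimorphism $\ddot G\to\bar G$, whose kernel is $H''=H\times H'$. Let $P$ be a $p$-group that is a common subgroup of $G$ and $G'$ with $\omega(u)=\omega'(u)$ for all $u\in P$, so that $P$ embeds diagonally in $\ddot G$. Let $\gamma$, $\gamma'$ be local points of $P$ on $B$, $B'$, and let $\gamma''=\gamma\times\gamma'$ be the local point of $P$ on $B''$ such that $\mathrm{Br}_P(\gamma)\otimes\mathrm{Br}_P(\gamma')\subseteq\mathrm{Br}_P(\gamma'')$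 (such a point is unique; its existence is part of the setting). Choose $i\in\gamma$, $i'\in\gamma'$, $i''\in\gamma''$. **Notation**, for $(G,H,A,B,\gamma,i)$, and likewise with $'$ and $''$. * $F\le\mathrm{Aut}(P)\times\bar G$ is the group of all $(\varphi,\bar g)$ such that $\overline{\varphi(u)}=\bar g\,\bar u\,\bar g^{-1}$ for all $u\in P$ and $Ai\simeq (Ai)(\bar g^{-1})_\varphi$ as $\bar G$-graded $(A,\mathcal OP)$-bimodules. Here $M(y)_x=M_{xy}$, and $u$ acts on the right of $M_\varphi$ as $\varphi(u)$ does on $M$. * $E=N_G(P_\gamma)/C_H(P)$, viewed in $\mathrm{Aut}(P)\times\bar G$ through $n\mapsto(c_n|_P,\bar n)$; this identifies $E$ with $F$. * $C=\mathcal OP*F=\mathcal O[P\rtimes F]$, and $\mathcal F$ is the opposite of the algebra of endomorphisms of the $(A,C)$-bimodule $M=Ai\otimes_{\mathcal OP}C$ that preserve the $\bar G$-grading ($m\otimes u(\varphi,\bar g)$ has degree $\deg(m)\bar u\bar g$). It is $F$-graded, an endomorphism $f$ having degree $x$ if $f(M_y)\subseteq M_{x^{-1}y}$ for all $y\in F$.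 Put $\overline{\mathcal F}=\mathcal F/J_{\mathrm{gr}}(\mathcal F)$. * $\mathcal E=\mathrm{End}_{B^P*E}(B^P*E\otimes_{B^P}B^Pi)^{\mathrm{op}}$, where $R*E=R\otimes_{\mathcal OC_H(P)}\mathcal ON_G(P_\gamma)$ is the crossed product. * $\overline{\mathcal E}=\mathrm{End}_{B(P_\gamma)*E}(B(P_\gamma)*E\otimes V_\gamma)^{\mathrm{op}}$, where $B(P_\gamma)=B^P/m_\gamma$ is the simple quotient attached to $\gamma$ and $V_\gamma$ is its simple module. * $\overline{\mathcal E}(P)=\mathrm{End}_{S*E}(S*E\otimes_S V_\gamma)^{\mathrm{op}}$ with $S=B(P)b_\gamma/m^*$, where $B(P)$ is the Brauer quotient, $b_\gamma$ is the block of $B(P)$ containing $\mathrm{Br}_P(\gamma)$, $m^*=m_{\mathrm{Br}_P(\gamma)}\cap B(P)b_\gamma$, and $V_\gamma$ is viewed as an $S$-module through the isomorphism $B(P_\gamma)\simeq S$ induced by $\mathrm{Br}_P$. * $\theta:\overline{\mathcal E}\to\overline{\mathcal F}$ is the canonical isomorphism of $E\simeq F$-graded algebras. It is induced by the isomorphism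 $\mathcal E\simeq\mathcal F$ that sends an endomorphism with $1\otimes i\mapsto(\beta\otimes n)\otimes i$ (where $\beta\in B^P$ and $n\in N_G(P_\gamma)$ has image $x\in E\simeq F$) to the endomorphism with $i\otimes1\mapsto\beta ni\otimes x^{-1}$. And $\eta:\overline{\mathcal E}\to\overline{\mathcal E}(P)$ is the canonical isomorphism induced by $B(P_\gamma)\simeq S$. For a graded algebra $X$ and a subgroup $K$ of the grading group, $X_K=\bigoplus_{x\in K}X_x$. For $K$-graded algebras $X,Y$, $\Delta(X\otimes Y)=\bigoplus_{x\in K}X_x\otimes Y_x$. **Proposition.** Let $K=F\cap F'$, the intersection being taken in $\mathrm{Aut}(P)\times\bar G$. Then $K\subseteq F''$. Moreover the canonical isomorphisms $\theta,\theta',\theta'',\eta,\eta',\eta''$ exist, and there are isomorphisms of $K$-graded $k$-algebras $$\alpha:\overline{\mathcal F''}_K\to\Delta(\overline{\mathcal F}_K\otimes\overline{\mathcal F'}_K),\quad \beta:\overline{\mathcal E''}_K\to\Delta(\overline{\mathcal E}_K\otimes\overline{\mathcal E'}_K),\quad \delta:\overline{\mathcal E''}(P)_K\to\Delta(\overline{\mathcal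 E}(P)_K\otimes\overline{\mathcal E'}(P)_K)$$ such that $\alpha\circ\theta''_K=\Delta(\theta_K\otimes\theta'_K)\circ\beta$ and $\delta\circ\eta''_K=\Delta(\eta_K\otimes\eta'_K)\circ\beta$. -/

import Mathlib

open scoped TensorProduct

noncomputable section

namespace BlockExt

/-! ### Corner algebras -/

section Corner

variable {O R : Type*} [CommRing O] [Ring R] [Algebra O R] {e : R}

/-- The inclusion of the corner (it does not preserve the identity). -/
def cornerIncl (he : IsIdempotentElem e) : he.Corner →ₙ+* R where
  toFun x := x.1
  map_mul' _ _ := rfl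
  map_zero' := rfl
  map_add' _ _ := rfl

theorem corner_ext (he : IsIdempotentElem e) {x y : he.Corner}
    (h : cornerIncl he x = cornerIncl he y) : x = y := Subtype.ext h

theorem corner_left (he : IsIdempotentElem e) (x : he.Corner) :
    e * cornerIncl he x = cornerIncl he x :=
  ((Subsemigroup.mem_corner_iff he).mp x.2).1

theorem corner_right (he : IsIdempotentElem e) (x : he.Corner) :
    cornerIncl he x * e = cornerIncl he x :=
  ((Subsemigroup.mem_corner_iff he).mp x.2).2

/-- An element `x` with `e x = x = x e`, as an element of the corner `e R e`. -/
def toCorner (he : IsIdempotentElem e) (x : R) (h1 : e * x = x) (h2 : x * e = x) : he.Corner :=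
  ⟨x, (Subsemigroup.mem_corner_iff he).mpr ⟨h1, h2⟩⟩

theorem cornerIncl_toCorner (he : IsIdempotentElem e) (x : R) (h1 : e * x = x) (h2 : x * e = x) :
    cornerIncl he (toCorner he x h1 h2) = x := rfl

/-- Scalar multiplication on a corner. -/
abbrev cornerSMul (he : IsIdempotentElem e) : SMul O he.Corner where
  smul r x := toCorner he (r • cornerIncl he x)
    (by rw [mul_smul_comm, corner_left]) (by rw [smul_mul_assoc, corner_right])

/-- The module structure of a corner. -/
abbrev cornerModule (he : IsIdempotentElem e) : Module O he.Corner where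
  toSMul := cornerSMul he
  one_smul x := corner_ext he (one_smul O (cornerIncl he x))
  mul_smul r s x := corner_ext he (mul_smul r s (cornerIncl he x))
  smul_zero r := corner_ext he (smul_zero r)
  smul_add r x y := corner_ext he (smul_add r (cornerIncl he x) (cornerIncl he y))
  add_smul r s x := corner_ext he (add_smul r s (cornerIncl he x))
  zero_smul x := corner_ext he (zero_smul O (cornerIncl he x))

/-- The corner `e R e` of an `O`-algebra is an `O`-algebra with identity `e`. -/
instance (he : IsIdempotentElem e) : Algebra O he.Corner :=
  letI : Module O he.Corner := cornerModule he
  Algebra.ofModule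
    (fun r x y => corner_ext he (smul_mul_assoc r (cornerIncl he x) (cornerIncl he y)))
    (fun r x y => corner_ext he (mul_smul_comm r (cornerIncl he x) (cornerIncl he y)))

end Corner

/-! ### Interior algebras -/

/-- A `Z`-interior `N`-algebra over `O`: an `O`-algebra with an action of the group `N` by algebra
automorphisms and an `N`-equivariant homomorphism from `Z` to its multiplicative monoid, such that
`Z` acts by conjugation. -/
structure InteriorAlgebra.{w, u, v} (O : Type u) [CommRing O] (N : Type v) [Group N]
    (Z : Subgroup N) where
  carrier : Type w
  [ring : Ring carrier]
  [algebra : Algebra O carrier]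
  act : N →* (carrier ≃ₐ[O] carrier)
  str : Z →* carrier
  act_str : ∀ (n : N) (z w : Z), (w : N) = n * z * n⁻¹ → act n (str z) = str w
  str_mul : ∀ (z : Z) (x : carrier), str z * x = act z x * str z

namespace InteriorAlgebra

universe w u v
variable {O : Type u} [CommRing O] {N : Type v} [Group N] {Z : Subgroup N}

instance (R : InteriorAlgebra.{w} O N Z) : Ring R.carrier := R.ring
instance (R : InteriorAlgebra.{w} O N Z) : Algebra O R.carrier := R.algebra
instance (R : InteriorAlgebra.{w} O N Z) : MulSemiringAction N R.carrier :=
  MulSemiringAction.compHom R.carrier R.act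

theorem smul_def (R : InteriorAlgebra.{w} O N Z) (n : N) (x : R.carrier) :
    n • x = R.act n x := rfl

instance (R : InteriorAlgebra.{w} O N Z) : SMulCommClass N O R.carrier where
  smul_comm n r x := map_smul (R.act n) r x

/-- The image of `x` in the quotient by a two-sided ideal. -/
abbrev qmk {S : Type*} [Ring S] (I : TwoSidedIdeal S) (x : S) : I.ringCon.Quotient :=
  I.ringCon.mk' x

/-- The endomorphism of a quotient algebra induced by an endomorphism preserving the ideal. -/
def quotMap {S : Type*} [Ring S] [Algebra O S] (I : TwoSidedIdeal S) (f : S →ₐ[O] S)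
    (hf : ∀ x ∈ I, f x ∈ I) : I.ringCon.Quotient →ₐ[O] I.ringCon.Quotient :=
  I.ringCon.liftₐ ((I.ringCon.mkₐ (α := O)).comp f) (by
    intro x y h
    have h2 : I.ringCon (f x) (f y) := by
      rw [TwoSidedIdeal.rel_iff] at h ⊢
      rw [← map_sub]
      exact hf _ h
    exact (I.ringCon.eq).mpr h2)

theorem quotMap_mk {S : Type*} [Ring S] [Algebra O S] (I : TwoSidedIdeal S) (f : S →ₐ[O] S)
    (hf : ∀ x ∈ I, f x ∈ I) (x : S) : quotMap I f hf (qmk I x) = qmk I (f x) := rfl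

theorem qmk_surj {S : Type*} [Ring S] (I : TwoSidedIdeal S) : Function.Surjective (qmk I) :=
  I.ringCon.mk'_surjective

/-- The quotient of an interior algebra by an invariant two-sided ideal. -/
def quot (R : InteriorAlgebra.{w} O N Z) (I : TwoSidedIdeal R.carrier)
    (hI : ∀ n, ∀ x ∈ I, R.act n x ∈ I) : InteriorAlgebra.{w} O N Z where
  carrier := I.ringCon.Quotient
  act :=
    { toFun := fun n => AlgEquiv.ofAlgHom (quotMap I (R.act n).toAlgHom (hI n))
        (quotMap I (R.act n⁻¹).toAlgHom (hI n⁻¹))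
        (by
          refine AlgHom.ext fun x => ?_
          obtain ⟨x, rfl⟩ := qmk_surj I x
          change qmk I (R.act n (R.act n⁻¹ x)) = qmk I x
          rw [← AlgEquiv.mul_apply, ← map_mul, mul_inv_cancel, map_one]; rfl)
        (by
          refine AlgHom.ext fun x => ?_
          obtain ⟨x, rfl⟩ := qmk_surj I x
          change qmk I (R.act n⁻¹ (R.act n x)) = qmk I x
          rw [← AlgEquiv.mul_apply, ← map_mul, inv_mul_cancel, map_one]; rfl)
      map_one' := by
        ext x
        obtain ⟨x, rfl⟩ := qmk_surj I x
        change qmk I (R.act 1 x) = qmk I x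
        rw [map_one]; rfl
      map_mul' := by
        intro m n
        ext x
        obtain ⟨x, rfl⟩ := qmk_surj I x
        change qmk I (R.act (m * n) x) = qmk I (R.act m (R.act n x))
        rw [map_mul]; rfl }
  str := (I.ringCon.mk' : R.carrier →* I.ringCon.Quotient).comp R.str
  act_str n z w h := congrArg (qmk I) (R.act_str n z w h)
  str_mul z x := by
    obtain ⟨x, rfl⟩ := qmk_surj I x
    change qmk I (R.str z) * qmk I x = qmk I (R.act z x) * qmk I (R.str z)
    rw [← map_mul, ← map_mul, R.str_mul]

theorem corner_act_left (R : InteriorAlgebra.{w} O N Z) {e : R.carrier} (he : IsIdempotentElem e)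
    (hinv : ∀ n, R.act n e = e) (n : N) (x : he.Corner) :
    e * R.act n (cornerIncl he x) = R.act n (cornerIncl he x) := by
  have h := congrArg (R.act n) (corner_left he x)
  rwa [map_mul, hinv] at h

theorem corner_act_right (R : InteriorAlgebra.{w} O N Z) {e : R.carrier} (he : IsIdempotentElem e)
    (hinv : ∀ n, R.act n e = e) (n : N) (x : he.Corner) :
    R.act n (cornerIncl he x) * e = R.act n (cornerIncl he x) := by
  have h := congrArg (R.act n) (corner_right he x)
  rwa [map_mul, hinv] at h

/-- The corner of an interior algebra at an invariant central idempotent. -/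
def corner (R : InteriorAlgebra.{w} O N Z) {e : R.carrier} (he : IsIdempotentElem e)
    (hc : ∀ x, e * x = x * e) (hinv : ∀ n, R.act n e = e) : InteriorAlgebra.{w} O N Z where
  carrier := he.Corner
  act :=
    { toFun := fun n => AlgEquiv.ofLinearEquiv
        { toFun := fun x => toCorner he (R.act n (cornerIncl he x))
            (corner_act_left R he hinv n x)
            (corner_act_right R he hinv n x)
          invFun := fun x => toCorner he (R.act n⁻¹ (cornerIncl he x))
            (corner_act_left R he hinv n⁻¹ x)
            (corner_act_right R he hinv n⁻¹ x)
          map_add' := fun x y => corner_ext he (map_add (R.act n) (cornerIncl he x) (cornerIncl he y))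
          map_smul' := fun r x => corner_ext he (map_smul (R.act n) r (cornerIncl he x))
          left_inv := fun x => corner_ext he (by
            change R.act n⁻¹ (R.act n (cornerIncl he x)) = cornerIncl he x
            rw [← AlgEquiv.mul_apply, ← map_mul, inv_mul_cancel, map_one]; rfl)
          right_inv := fun x => corner_ext he (by
            change R.act n (R.act n⁻¹ (cornerIncl he x)) = cornerIncl he x
            rw [← AlgEquiv.mul_apply, ← map_mul, mul_inv_cancel, map_one]; rfl) }
        (corner_ext he (hinv n))
        (fun x y => corner_ext he (map_mul (R.act n) (cornerIncl he x) (cornerIncl he y)))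
      map_one' := by
        ext x
        refine corner_ext he ?_
        change R.act 1 (cornerIncl he x) = cornerIncl he x
        rw [map_one]; rfl
      map_mul' := by
        intro m n
        ext x
        refine corner_ext he ?_
        change R.act (m * n) (cornerIncl he x) = R.act m (R.act n (cornerIncl he x))
        rw [map_mul]; rfl }
  str :=
    { toFun := fun z => toCorner he (e * R.str z) (by rw [← mul_assoc, he.eq])
        (by rw [hc, mul_assoc, he.eq])
      map_one' := corner_ext he (by change e * R.str 1 = e; rw [map_one, mul_one])
      map_mul' := by
        intro z w
        refine corner_ext he ?_
        change e * R.str (z * w) = e * R.str z * (e * R.str w)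
        rw [map_mul, hc (R.str z), mul_assoc, ← mul_assoc e e, he.eq, ← mul_assoc, hc, mul_assoc] }
  act_str n z w h := by
    refine corner_ext he ?_
    change R.act n (e * R.str z) = e * R.str w
    rw [map_mul, hinv, R.act_str n z w h]
  str_mul z x := by
    refine corner_ext he ?_
    change e * R.str z * cornerIncl he x = R.act z (cornerIncl he x) * (e * R.str z)
    rw [mul_assoc, R.str_mul, ← mul_assoc, ← mul_assoc, hc]

end InteriorAlgebra

/-! ### Graded algebras -/

/-- An `O`-algebra with a multiplicative family of components indexed by a group `Θ`. Gradings by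
subgroups of `Θ` are written as `Θ`-gradings whose components outside the subgroup vanish. -/
structure GradedAlg.{w, u, v} (O : Type u) [CommRing O] (Θ : Type v) [Group Θ] where
  carrier : Type w
  [ring : Ring carrier]
  [algebra : Algebra O carrier]
  comp : Θ → Submodule O carrier
  one_mem : 1 ∈ comp 1
  mul_mem : ∀ {x y a b}, a ∈ comp x → b ∈ comp y → a * b ∈ comp (x * y)

namespace GradedAlg

universe w w' w₁ w₁' u v
variable {O : Type u} [CommRing O] {Θ : Type v} [Group Θ]

instance (X : GradedAlg.{w} O Θ) : Ring X.carrier := X.ring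
instance (X : GradedAlg.{w} O Θ) : Algebra O X.carrier := X.algebra

/-- Graded left ideals: those generated additively by their homogeneous elements. -/
def IsGradedLeftIdeal (X : GradedAlg.{w} O Θ) (I : Ideal X.carrier) : Prop :=
  ∀ a ∈ I, a ∈ AddSubgroup.closure {h : X.carrier | h ∈ I ∧ ∃ x, h ∈ X.comp x}

/-- Maximal graded left ideals. -/
def IsMaximalGradedLeftIdeal (X : GradedAlg.{w} O Θ) (I : Ideal X.carrier) : Prop :=
  X.IsGradedLeftIdeal I ∧ I ≠ ⊤ ∧ ∀ J, X.IsGradedLeftIdeal J → I < J → J = ⊤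

/-- The graded Jacobson radical: the intersection of the maximal graded left ideals (which is a
two-sided ideal for a grading in the usual sense, so that taking the span changes nothing). -/
def gradedRadical (X : GradedAlg.{w} O Θ) : TwoSidedIdeal X.carrier :=
  TwoSidedIdeal.span {a | ∀ I, X.IsMaximalGradedLeftIdeal I → a ∈ I}

/-- The quotient of a graded algebra by its graded Jacobson radical. -/
def residual (X : GradedAlg.{w} O Θ) : GradedAlg.{w} O Θ where
  carrier := X.gradedRadical.ringCon.Quotient
  comp x := (X.comp x).map (X.gradedRadical.ringCon.mkₐ (α := O)).toLinearMap
  one_mem := ⟨1, X.one_mem, rfl⟩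
  mul_mem := by
    rintro x y _ _ ⟨a, ha, rfl⟩ ⟨b, hb, rfl⟩
    exact ⟨a * b, X.mul_mem ha hb, rfl⟩

/-- The canonical map to the quotient by the graded Jacobson radical. -/
def toResidual (X : GradedAlg.{w} O Θ) : X.carrier →ₐ[O] X.residual.carrier :=
  RingCon.mkₐ (α := O) X.gradedRadical.ringCon

/-- The subalgebra `⨁_{x ∈ K} X_x`. -/
def truncSub (X : GradedAlg.{w} O Θ) (K : Subgroup Θ) : Subalgebra O X.carrier :=
  (⨆ x : K, X.comp x).toSubalgebra
    (Submodule.mem_iSup_of_mem (p := fun x : K => X.comp x) 1 X.one_mem)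
    (by
      intro a b ha hb
      have h : (⨆ x : K, X.comp x) * (⨆ x : K, X.comp x) ≤ ⨆ x : K, X.comp x := by
        rw [Submodule.iSup_mul]
        refine iSup_le fun x => ?_
        rw [Submodule.mul_iSup]
        refine iSup_le fun y => ?_
        refine Submodule.mul_le.mpr fun a ha b hb => ?_
        exact Submodule.mem_iSup_of_mem (p := fun x : K => X.comp x) (x * y) (X.mul_mem ha hb)
      exact h (Submodule.mul_mem_mul ha hb))

/-- The `K`-graded algebra `X_K = ⨁_{x ∈ K} X_x`. -/
def trunc (X : GradedAlg.{w} O Θ) (K : Subgroup Θ) : GradedAlg.{w} O K where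
  carrier := X.truncSub K
  comp x := (X.comp x).comap (X.truncSub K).val.toLinearMap
  one_mem := X.one_mem
  mul_mem := X.mul_mem

/-- `X_x ⊗ Y_x` inside `X ⊗ Y`. -/
def diagComp (X : GradedAlg.{w} O Θ) (Y : GradedAlg.{w'} O Θ) (x : Θ) :
    Submodule O (X.carrier ⊗[O] Y.carrier) :=
  Submodule.map₂ (TensorProduct.mk O X.carrier Y.carrier) (X.comp x) (Y.comp x)

theorem diagComp_mul (X : GradedAlg.{w} O Θ) (Y : GradedAlg.{w'} O Θ) (x y : Θ) :
    diagComp X Y x * diagComp X Y y ≤ diagComp X Y (x * y) := by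
  unfold diagComp
  rw [Submodule.map₂_eq_span_image2, Submodule.map₂_eq_span_image2, Submodule.span_mul_span,
    Submodule.span_le]
  rintro _ ⟨_, ⟨a, ha, b, hb, rfl⟩, _, ⟨c, hc, d, hd, rfl⟩, rfl⟩
  change (a ⊗ₜ[O] b) * (c ⊗ₜ[O] d) ∈ _
  rw [Algebra.TensorProduct.tmul_mul_tmul]
  exact Submodule.apply_mem_map₂ _ (X.mul_mem ha hc) (Y.mul_mem hb hd)

/-- The underlying subalgebra of the diagonal subalgebra. -/
def diagSub (X : GradedAlg.{w} O Θ) (Y : GradedAlg.{w'} O Θ) :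
    Subalgebra O (X.carrier ⊗[O] Y.carrier) :=
  (⨆ x, diagComp X Y x).toSubalgebra
    (Submodule.mem_iSup_of_mem (p := fun x => diagComp X Y x) 1
      (Submodule.apply_mem_map₂ _ X.one_mem Y.one_mem))
    (by
      intro a b ha hb
      have h : (⨆ x, diagComp X Y x) * (⨆ x, diagComp X Y x) ≤ ⨆ x, diagComp X Y x := by
        rw [Submodule.iSup_mul]
        refine iSup_le fun x => ?_
        rw [Submodule.mul_iSup]
        refine iSup_le fun y => ?_
        exact (diagComp_mul X Y x y).trans (le_iSup (fun x => diagComp X Y x) (x * y))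
      exact h (Submodule.mul_mem_mul ha hb))

/-- The diagonal subalgebra `Δ(X ⊗ Y) = ⨁_x X_x ⊗ Y_x`. (For algebras over a residue field `k` of
`O`, the tensor products over `O` and over `k` coincide.) -/
def diag (X : GradedAlg.{w} O Θ) (Y : GradedAlg.{w'} O Θ) : GradedAlg.{max w w'} O Θ where
  carrier := diagSub X Y
  comp x := (diagComp X Y x).comap (diagSub X Y).val.toLinearMap
  one_mem := Submodule.apply_mem_map₂ _ X.one_mem Y.one_mem
  mul_mem := by
    intro x y a b ha hb
    exact diagComp_mul X Y x y (Submodule.mul_mem_mul ha hb)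

/-- Isomorphisms of graded algebras. -/
structure Iso (X : GradedAlg.{w} O Θ) (Y : GradedAlg.{w'} O Θ) where
  toAlgEquiv : X.carrier ≃ₐ[O] Y.carrier
  map_comp : ∀ x, (X.comp x).map toAlgEquiv.toLinearMap = Y.comp x

namespace Iso

variable {X : GradedAlg.{w} O Θ} {Y : GradedAlg.{w'} O Θ} {X' : GradedAlg.{w₁} O Θ}
  {Y' : GradedAlg.{w₁'} O Θ}

theorem mem_iff (e : Iso X Y) (x : Θ) (a : X.carrier) :
    e.toAlgEquiv a ∈ Y.comp x ↔ a ∈ X.comp x := by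
  rw [← e.map_comp x]
  constructor
  · rintro ⟨b, hb, h⟩
    exact e.toAlgEquiv.injective h ▸ hb
  · intro h
    exact ⟨a, h, rfl⟩

theorem map_truncSub (e : Iso X Y) (K : Subgroup Θ) :
    (X.truncSub K).map (e.toAlgEquiv : X.carrier →ₐ[O] Y.carrier) = Y.truncSub K := by
  apply Subalgebra.toSubmodule_injective
  change (⨆ x : K, X.comp x).map e.toAlgEquiv.toLinearMap = ⨆ x : K, Y.comp x
  rw [Submodule.map_iSup]
  exact iSup_congr fun x => e.map_comp x

/-- The restriction of an isomorphism to the `K`-parts. -/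
def trunc (e : Iso X Y) (K : Subgroup Θ) : Iso (X.trunc K) (Y.trunc K) where
  toAlgEquiv := (e.toAlgEquiv.subalgebraMap (X.truncSub K)).trans
    (Subalgebra.equivOfEq _ _ (e.map_truncSub K))
  map_comp x := by
    refine Submodule.ext fun b => ?_
    obtain ⟨b, hb⟩ := b
    constructor
    · rintro ⟨a, ha, h⟩
      rw [← h]
      exact (e.mem_iff x a.1).mpr ha
    · intro h
      have hb' := hb
      rw [← e.map_truncSub K] at hb'
      obtain ⟨a, ha, rfl⟩ := hb'
      exact ⟨⟨a, ha⟩, (e.mem_iff x a).mp h, rfl⟩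

theorem map_diagComp (e : Iso X Y) (e' : Iso X' Y') (x : Θ) :
    (diagComp X X' x).map (Algebra.TensorProduct.congr e.toAlgEquiv e'.toAlgEquiv).toLinearMap
      = diagComp Y Y' x := by
  unfold diagComp
  rw [← e.map_comp x, ← e'.map_comp x, Submodule.map_map₂, Submodule.map₂_map_map]
  rfl

theorem map_diagSub (e : Iso X Y) (e' : Iso X' Y') :
    (diagSub X X').map ((Algebra.TensorProduct.congr e.toAlgEquiv e'.toAlgEquiv :
        X.carrier ⊗[O] X'.carrier ≃ₐ[O] Y.carrier ⊗[O] Y'.carrier) :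
        X.carrier ⊗[O] X'.carrier →ₐ[O] Y.carrier ⊗[O] Y'.carrier) = diagSub Y Y' := by
  apply Subalgebra.toSubmodule_injective
  change (⨆ x, diagComp X X' x).map
    (Algebra.TensorProduct.congr e.toAlgEquiv e'.toAlgEquiv).toLinearMap = ⨆ x, diagComp Y Y' x
  rw [Submodule.map_iSup]
  exact iSup_congr fun x => map_diagComp e e' x

/-- The isomorphism of diagonal subalgebras induced by `e ⊗ e'`. -/
def diag (e : Iso X Y) (e' : Iso X' Y') : Iso (GradedAlg.diag X X') (GradedAlg.diag Y Y') where
  toAlgEquiv := ((Algebra.TensorProduct.congr e.toAlgEquiv e'.toAlgEquiv).subalgebraMap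
    (diagSub X X')).trans (Subalgebra.equivOfEq _ _ (map_diagSub e e'))
  map_comp x := by
    ext ⟨b, hb⟩
    constructor
    · rintro ⟨a, ha, h⟩
      rw [← h]
      change Algebra.TensorProduct.congr e.toAlgEquiv e'.toAlgEquiv a.1 ∈ diagComp Y Y' x
      rw [← map_diagComp e e' x]
      exact ⟨a.1, ha, rfl⟩
    · intro h
      change b ∈ diagComp Y Y' x at h
      rw [← map_diagComp e e' x] at h
      obtain ⟨a, ha, rfl⟩ := h
      exact ⟨⟨a, Submodule.mem_iSup_of_mem (p := fun x => diagComp X X' x) x ha⟩, ha, rfl⟩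

end Iso

end GradedAlg

/-! ### Crossed products and Clifford extensions -/

namespace InteriorAlgebra

universe w u v v'
variable {O : Type u} [CommRing O] {N : Type v} [Group N] {Z : Subgroup N}

/-- The ideal of the skew group algebra of `N` over `R` that identifies the two images of `Z`. -/
def crossedRel (R : InteriorAlgebra.{w} O N Z) : TwoSidedIdeal (SkewMonoidAlgebra R.carrier N) :=
  TwoSidedIdeal.span {t | ∃ z : Z, t = SkewMonoidAlgebra.single (z : N) 1
    - SkewMonoidAlgebra.single 1 (R.str z)}

/-- The crossed product `R * (N / Z) = R ⊗_{O Z} O N` of a `Z`-interior `N`-algebra, with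
multiplication `(r ⊗ m) (s ⊗ n) = r (m • s) ⊗ m n`. -/
abbrev Crossed (R : InteriorAlgebra.{w} O N Z) : Type (max v w) := R.crossedRel.ringCon.Quotient

/-- The element `r ⊗ n` of the crossed product. -/
def cr (R : InteriorAlgebra.{w} O N Z) (r : R.carrier) (n : N) : R.Crossed :=
  qmk R.crossedRel (SkewMonoidAlgebra.single n r)

/-- The submodule of relations `x r ⊗ v = x ⊗ r v`. -/
def indRel (R : InteriorAlgebra.{w} O N Z) (V : Type w) [AddCommGroup V] [Module O V]
    [Module R.carrier V] : Submodule R.Crossed (R.Crossed ⊗[O] V) :=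
  Submodule.span R.Crossed {t | ∃ (x : R.Crossed) (r : R.carrier) (v : V),
    t = (x * R.cr r 1) ⊗ₜ[O] v - x ⊗ₜ[O] (r • v)}

/-- The induced module `(R * (N / Z)) ⊗_R V`. -/
abbrev Ind (R : InteriorAlgebra.{w} O N Z) (V : Type w) [AddCommGroup V] [Module O V]
    [Module R.carrier V] : Type (max v w) := (R.Crossed ⊗[O] V) ⧸ R.indRel V

/-- The element `(r ⊗ n) ⊗ v` of the induced module. -/
def ind (R : InteriorAlgebra.{w} O N Z) {V : Type w} [AddCommGroup V] [Module O V]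
    [Module R.carrier V] (r : R.carrier) (n : N) (v : V) : R.Ind V :=
  (R.indRel V).mkQ (R.cr r n ⊗ₜ[O] v)

/-- The component of the induced module spanned by the `(r ⊗ n) ⊗ v` with `n` of degree `x`, where
the degree is prescribed by the relation `deg`. -/
def indComp (R : InteriorAlgebra.{w} O N Z) (V : Type w) [AddCommGroup V] [Module O V]
    [Module R.carrier V] {Θ : Type v'} (deg : N → Θ → Prop) (x : Θ) : Submodule O (R.Ind V) :=
  Submodule.span O {t | ∃ (r : R.carrier) (n : N) (v : V), deg n x ∧ t = R.ind r n v}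

/-- The graded endomorphism algebra `End_{R * (N / Z)}((R * (N / Z)) ⊗_R V)ᵒᵖ`; an endomorphism
`f` has degree `x` if `f (M_y) ⊆ M_{y x}` for all `y`. -/
def cliffordAlg (R : InteriorAlgebra.{w} O N Z) (V : Type w) [AddCommGroup V] [Module O V]
    [Module R.carrier V] {Θ : Type v'} [Group Θ] (deg : N → Θ → Prop) :
    GradedAlg.{max v w} O Θ where
  carrier := (Module.End R.Crossed (R.Ind V))ᵐᵒᵖ
  comp x :=
    { carrier := {f | ∀ y, ∀ m ∈ R.indComp V deg y, f.unop m ∈ R.indComp V deg (y * x)}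
      add_mem' := fun hf hg y m hm => Submodule.add_mem _ (hf y m hm) (hg y m hm)
      zero_mem' := fun y m hm => Submodule.zero_mem _
      smul_mem' := fun c f hf y m hm => Submodule.smul_mem _ c (hf y m hm) }
  one_mem := fun y m hm => by rw [mul_one]; exact hm
  mul_mem := by
    intro x x' f g hf hg y m hm
    rw [← mul_assoc]
    exact hg _ _ (hf y m hm)

end InteriorAlgebra
/-! ### Idempotents, points and maximal ideals -/

/-- Primitive idempotents. -/
def IsPrimitiveIdem {R : Type*} [Ring R] (e : R) : Prop :=
  IsIdempotentElem e ∧ e ≠ 0 ∧ ∀ f, IsIdempotentElem f → e * f = f → f * e = f → f = 0 ∨ f = e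

/-- The conjugacy class of an element under the unit group. -/
def conjClass {R : Type*} [Ring R] (e : R) : Set R :=
  {f | ∃ a : Rˣ, f = a * e * (↑a⁻¹ : R)}

/-- The maximal two-sided ideal not containing a primitive idempotent `e` (it is unique in a finite
algebra over a complete local ring). -/
def maxIdealOf {R : Type*} [Ring R] (e : R) : TwoSidedIdeal R :=
  sSup {I | IsCoatom I ∧ e ∉ I}

theorem conjClass_mem_iff {R : Type*} [Ring R] {e f : R} (h : f ∈ conjClass e)
    (I : TwoSidedIdeal R) : f ∈ I ↔ e ∈ I := by
  obtain ⟨a, rfl⟩ := h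
  constructor
  · intro h
    have := I.mul_mem_right _ (a : R) (I.mul_mem_left (↑a⁻¹ : R) _ h)
    simpa [← mul_assoc] using this
  · intro h
    exact I.mul_mem_right _ _ (I.mul_mem_left _ _ h)

theorem maxIdealOf_invariant {O R : Type*} [CommRing O] [Ring R] [Algebra O R] (e : R)
    (s : R ≃ₐ[O] R) (hs : s.symm e ∈ conjClass e) :
    ∀ x ∈ maxIdealOf e, s x ∈ maxIdealOf e := by
  have h : maxIdealOf e ≤ TwoSidedIdeal.comap s.toRingEquiv (maxIdealOf e) := by
    refine sSup_le ?_
    rintro I ⟨hI, he⟩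
    have h2 : s.toRingEquiv.mapTwoSidedIdeal I ≤ maxIdealOf e := by
      refine le_sSup ⟨(OrderIso.isCoatom_iff _ _).mpr hI, ?_⟩
      rw [RingEquiv.mapTwoSidedIdeal_apply, TwoSidedIdeal.mem_comap]
      exact fun h => he ((conjClass_mem_iff hs I).mp h)
    intro x hx
    rw [TwoSidedIdeal.mem_comap]
    apply h2
    rw [RingEquiv.mapTwoSidedIdeal_apply, TwoSidedIdeal.mem_comap]
    simpa using hx
  intro x hx
  have h' := h hx
  rwa [TwoSidedIdeal.mem_comap] at h'

/-! ### Block extensions -/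

section Extension

universe u v v' vP
variable {O : Type u} [CommRing O] {G : Type v} [Group G] {Γ : Type v'} [Group Γ]
  {P : Type vP} [Group P]

/-- A `G`-invariant central idempotent of `O H`, where `H` is the kernel of `ω : G → Γ`. -/
structure InvIdem (O : Type u) [CommRing O] (ω : G →* Γ) where
  val : MonoidAlgebra O ω.ker
  idem : IsIdempotentElem val
  central : ∀ x, val * x = x * val
  inv : ∀ g : G, MonoidAlgebra.domCongr O O (MulAut.conjNormal g) val = val

/-- `b` is a block of `O H`, that is, a primitive idempotent of the center of `O H`. -/
def InvIdem.IsBlock {ω : G →* Γ} (b : InvIdem O ω) : Prop :=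
  b.val ≠ 0 ∧ ∀ f : MonoidAlgebra O ω.ker, IsIdempotentElem f → (∀ x, f * x = x * f) →
    b.val * f = f → f = 0 ∨ f = b.val

/-- The inclusion `O H → O G`. -/
def inclG (O : Type u) [CommRing O] (ω : G →* Γ) :
    MonoidAlgebra O ω.ker →ₐ[O] MonoidAlgebra O G :=
  MonoidAlgebra.mapDomainAlgHom O O ω.ker.subtype

theorem inclG_act (ω : G →* Γ) (g : G) (x : MonoidAlgebra O ω.ker) :
    inclG O ω (MonoidAlgebra.domCongr O O (MulAut.conjNormal g) x) * MonoidAlgebra.of O G g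
      = MonoidAlgebra.of O G g * inclG O ω x := by
  induction x using MonoidAlgebra.induction_on with
  | of h =>
    simp [inclG, MonoidAlgebra.single_mul_single]
  | add x y hx hy => rw [map_add, map_add, add_mul, hx, hy, map_add, mul_add]
  | smul r x hx => rw [map_smul, map_smul, smul_mul_assoc, hx, map_smul, mul_smul_comm]

/-- `O H` as an `H`-interior `G`-algebra. -/
def kerAlg (O : Type u) [CommRing O] (ω : G →* Γ) : InteriorAlgebra O G ω.ker where
  carrier := MonoidAlgebra O ω.ker
  act :=
    { toFun := fun g => MonoidAlgebra.domCongr O O (MulAut.conjNormal g)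
      map_one' := by rw [map_one]; exact MonoidAlgebra.domCongr_refl
      map_mul' := by
        intro g h
        rw [map_mul]
        exact (MonoidAlgebra.trans_domCongr_domCongr _ _).symm }
  str := MonoidAlgebra.of O ω.ker
  act_str g z w h := by
    have : MulAut.conjNormal g z = w := Subtype.ext (by rw [MulAut.conjNormal_apply, h])
    simp [this]
  str_mul z x := by
    have h : ∀ t : MonoidAlgebra O ω.ker,
        inclG O ω t = 0 → t = 0 := by
      intro t ht
      exact MonoidAlgebra.mapDomain_injective Subtype.val_injective (ht.trans (map_zero (inclG O ω)).symm)
    rw [← sub_eq_zero]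
    apply h
    rw [map_sub, sub_eq_zero, map_mul, map_mul]
    have h2 : inclG O ω (MonoidAlgebra.of O ω.ker z) = MonoidAlgebra.of O G z := by
      simp [inclG]
    rw [h2]
    exact (inclG_act ω (z : G) x).symm

/-- The algebra `B = O H b`, as an `H`-interior `G`-algebra. -/
def algB {ω : G →* Γ} (b : InvIdem O ω) : InteriorAlgebra O G ω.ker :=
  (kerAlg O ω).corner (e := b.val) b.idem b.central b.inv

theorem idemG {ω : G →* Γ} (b : InvIdem O ω) : IsIdempotentElem (inclG O ω b.val) := by
  change _ * _ = _
  rw [← map_mul, b.idem.eq]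

theorem centralG {ω : G →* Γ} (b : InvIdem O ω) (g : G) :
    inclG O ω b.val * MonoidAlgebra.of O G g = MonoidAlgebra.of O G g * inclG O ω b.val := by
  rw [← inclG_act, b.inv]

/-- The algebra `A = O G b`. -/
def AlgA {ω : G →* Γ} (b : InvIdem O ω) : Type (max u v) := (idemG b).Corner

instance {ω : G →* Γ} (b : InvIdem O ω) : Ring (AlgA b) := inferInstanceAs (Ring (idemG b).Corner)

instance {ω : G →* Γ} (b : InvIdem O ω) : Algebra O (AlgA b) :=
  inferInstanceAs (Algebra O (idemG b).Corner)

/-- The inclusion `A → O G`. -/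
def valA {ω : G →* Γ} (b : InvIdem O ω) : AlgA b →ₙ+* MonoidAlgebra O G := cornerIncl (idemG b)

/-- The inclusion `B = O H b → O H`. -/
def valB {ω : G →* Γ} (b : InvIdem O ω) (x : (algB b).carrier) : MonoidAlgebra O ω.ker :=
  cornerIncl b.idem x

/-- The inclusion `B → A`. -/
def toA {ω : G →* Γ} (b : InvIdem O ω) (x : (algB b).carrier) : AlgA b :=
  toCorner (idemG b) (inclG O ω (valB b x))
    (by rw [← map_mul]; exact congrArg _ (corner_left b.idem x))
    (by rw [← map_mul]; exact congrArg _ (corner_right b.idem x))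

/-- The structural map `G → A`, `g ↦ g b`. -/
def grpA {ω : G →* Γ} (b : InvIdem O ω) (g : G) : AlgA b :=
  toCorner (idemG b) (inclG O ω b.val * MonoidAlgebra.of O G g)
    (by rw [← mul_assoc, (idemG b).eq])
    (by rw [centralG, mul_assoc, (idemG b).eq])

/-- The component of degree `x` of `A`: the elements supported on `ω ⁻¹ {x}`. -/
def compA {ω : G →* Γ} (b : InvIdem O ω) (x : Γ) : Submodule O (AlgA b) where
  carrier := {a | ∀ g, (valA b a).coeff g ≠ 0 → ω g = x}
  add_mem' := by
    intro a c ha hc g hg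
    by_cases h : (valA b a).coeff g = 0
    · refine hc g fun h' => hg ?_
      rw [map_add, MonoidAlgebra.coeff_add, Finsupp.add_apply, h, h', add_zero]
    · exact ha g h
  zero_mem' := by
    intro g hg
    rw [map_zero] at hg
    exact absurd rfl hg
  smul_mem' := by
    intro r a ha g hg
    refine ha g fun h => hg ?_
    change (r • valA b a).coeff g = 0
    rw [MonoidAlgebra.coeff_smul, Finsupp.smul_apply, h, smul_zero]

/-! ### Pointed groups -/

/-- The fixed algebra `B^P`, where `P` acts through `ι : P → G`. -/
def fixedSub {ω : G →* Γ} (b : InvIdem O ω) (ι : P →* G) : Subalgebra O (algB b).carrier where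
  carrier := {x | ∀ u, (algB b).act (ι u) x = x}
  mul_mem' := fun hx hy u => by rw [map_mul, hx u, hy u]
  add_mem' := fun hx hy u => by rw [map_add, hx u, hy u]
  algebraMap_mem' := fun r u => AlgEquiv.commutes _ r

/-- The point of `B^P` containing `i`, as a subset of `B`. -/
def pointSet {ω : G →* Γ} {b : InvIdem O ω} {ι : P →* G} (i : fixedSub b ι) :
    Set (algB b).carrier :=
  Subtype.val '' conjClass i

/-- The stabilizer in `G` of the point containing `i`. -/
def pointStab {ω : G →* Γ} {b : InvIdem O ω} {ι : P →* G} (i : fixedSub b ι) : Subgroup G where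
  carrier := {g | (algB b).act g '' pointSet i = pointSet i}
  one_mem' := by
    change (algB b).act 1 '' pointSet i = pointSet i
    rw [map_one]
    exact Set.image_id _
  mul_mem' := by
    intro g h hg hh
    change (algB b).act (g * h) '' pointSet i = pointSet i
    rw [map_mul]
    change (fun x => (algB b).act g ((algB b).act h x)) '' pointSet i = pointSet i
    rw [← Set.image_image]
    exact (congrArg _ hh).trans hg
  inv_mem' := by
    intro g hg
    change (algB b).act g⁻¹ '' pointSet i = pointSet i
    have h : (algB b).act g '' pointSet i = pointSet i := hg
    conv_lhs => rw [← h]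
    rw [Set.image_image]
    have h2 : (fun x => (algB b).act g⁻¹ ((algB b).act g x)) = id := by
      funext x
      rw [← AlgEquiv.mul_apply, ← map_mul, inv_mul_cancel, map_one]
      rfl
    rw [h2, Set.image_id]

/-- The normalizer `N_G(P_γ)`, where `γ` is the point containing `i`. -/
def normP {ω : G →* Γ} {b : InvIdem O ω} {ι : P →* G} (i : fixedSub b ι) : Subgroup G :=
  Subgroup.normalizer (ι.range : Set G) ⊓ pointStab i

/-- `C_H(P)` as a subgroup of `N_G(P_γ)`. -/
def centP {ω : G →* Γ} {b : InvIdem O ω} {ι : P →* G} (i : fixedSub b ι) :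
    Subgroup (normP i) where
  carrier := {n | ω n = 1 ∧ ∀ u, (n : G) * ι u = ι u * n}
  one_mem' := ⟨map_one _, fun u => by simp⟩
  mul_mem' := by
    rintro m n ⟨hm, hm'⟩ ⟨hn, hn'⟩
    refine ⟨by rw [Subgroup.coe_mul, map_mul, hm, hn, mul_one], fun u => ?_⟩
    rw [Subgroup.coe_mul, mul_assoc, hn', ← mul_assoc, hm', mul_assoc]
  inv_mem' := by
    rintro n ⟨hn, hn'⟩
    refine ⟨by rw [Subgroup.coe_inv, map_inv, hn, inv_one], fun u => ?_⟩
    rw [Subgroup.coe_inv, inv_mul_eq_iff_eq_mul, ← mul_assoc, hn', mul_inv_cancel_right]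

/-- The restriction of an action to a subgroup and an invariant subalgebra. -/
def restrictAct {Z : Subgroup G} (R : InteriorAlgebra O G Z) (S : Subalgebra O R.carrier)
    (N : Subgroup G) (hS : ∀ n ∈ N, ∀ x ∈ S, R.act n x ∈ S) : N →* (S ≃ₐ[O] S) where
  toFun n := AlgEquiv.ofLinearEquiv
    { toFun := fun x => ⟨R.act n x.1, hS n n.2 x.1 x.2⟩
      invFun := fun x => ⟨R.act (n : G)⁻¹ x.1, hS _ (N.inv_mem n.2) x.1 x.2⟩
      map_add' := fun x y => Subtype.ext (map_add (R.act n) x.1 y.1)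
      map_smul' := fun r x => Subtype.ext (map_smul (R.act n) r x.1)
      left_inv := fun x => Subtype.ext (by
        change R.act (n : G)⁻¹ (R.act n x.1) = x.1
        rw [← AlgEquiv.mul_apply, ← map_mul, inv_mul_cancel, map_one]; rfl)
      right_inv := fun x => Subtype.ext (by
        change R.act n (R.act (n : G)⁻¹ x.1) = x.1
        rw [← AlgEquiv.mul_apply, ← map_mul, mul_inv_cancel, map_one]; rfl) }
    (Subtype.ext (map_one (R.act n)))
    (fun x y => Subtype.ext (map_mul (R.act n) x.1 y.1))
  map_one' := by
    refine AlgEquiv.ext fun x => Subtype.ext ?_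
    change R.act 1 x.1 = x.1
    rw [map_one]; rfl
  map_mul' := by
    intro m n
    refine AlgEquiv.ext fun x => Subtype.ext ?_
    change R.act ((m : G) * n) x.1 = R.act m (R.act n x.1)
    rw [map_mul]; rfl

theorem act_mem_fixedSub {ω : G →* Γ} {b : InvIdem O ω} {ι : P →* G} {n : G}
    (hn : n ∈ Subgroup.normalizer (ι.range : Set G)) (x : (algB b).carrier)
    (hx : x ∈ fixedSub b ι) : (algB b).act n x ∈ fixedSub b ι := by
  intro u
  have h : n⁻¹ * ι u * n ∈ (ι.range : Set G) := by
    have h1 := Subgroup.inv_mem _ hn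
    have h2 := (h1 (ι u)).mp ⟨u, rfl⟩
    rwa [inv_inv] at h2
  obtain ⟨t, ht⟩ := h
  have e : ι u * n = n * ι t := by rw [ht]; group
  rw [← AlgEquiv.mul_apply, ← map_mul, e, map_mul, AlgEquiv.mul_apply, hx t]

/-- The `Z`-interior `N`-algebra structure on an `N`-invariant subalgebra containing the image
of `Z`. -/
def restr {H : Subgroup G} (R : InteriorAlgebra O G H) (S : Subalgebra O R.carrier)
    (N : Subgroup G) (hS : ∀ n ∈ N, ∀ x ∈ S, R.act n x ∈ S) (Z : Subgroup N)
    (hZ : ∀ z : Z, ((z : N) : G) ∈ H) (hstr : ∀ z : Z, R.str ⟨(z : N), hZ z⟩ ∈ S) :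
    InteriorAlgebra O N Z where
  carrier := S
  act := restrictAct R S N hS
  str :=
    { toFun := fun z => ⟨R.str ⟨(z : N), hZ z⟩, hstr z⟩
      map_one' := Subtype.ext (map_one R.str)
      map_mul' := fun z w => Subtype.ext (map_mul R.str ⟨(z : N), hZ z⟩ ⟨(w : N), hZ w⟩) }
  act_str n z w h := Subtype.ext (R.act_str n ⟨(z : N), hZ z⟩ ⟨(w : N), hZ w⟩
    (congrArg Subtype.val h))
  str_mul z x := Subtype.ext (R.str_mul ⟨(z : N), hZ z⟩ x.1)

/-- `B^P` as a `C_H(P)`-interior `N_G(P_γ)`-algebra. -/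
def algBP {ω : G →* Γ} {b : InvIdem O ω} {ι : P →* G} (i : fixedSub b ι) :
    InteriorAlgebra O (normP i) (centP i) :=
  restr (algB b) (fixedSub b ι) (normP i) (fun _ hn x hx => act_mem_fixedSub hn.1 x hx)
    (centP i) (fun z => z.2.1) (fun z u => (algB b).act_str (ι u) _ _ (by
      change ((z : normP i) : G) = ι u * (z : normP i) * (ι u)⁻¹
      rw [← z.2.2 u, mul_inv_cancel_right]))

/-- An element of `B^P`, as an element of the underlying algebra of `algBP i`. -/
def toBP {ω : G →* Γ} {b : InvIdem O ω} {ι : P →* G} (i : fixedSub b ι) (x : fixedSub b ι) :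
    (algBP i).carrier := x

theorem act_inv_mem_conjClass {ω : G →* Γ} {b : InvIdem O ω} {ι : P →* G} (i : fixedSub b ι)
    (n : normP i) : ((algBP i).act n).symm (toBP i i) ∈ conjClass (toBP i i) := by
  have h : (algB b).act n '' pointSet i = pointSet i := n.2.2
  have hi : (i : (algB b).carrier) ∈ pointSet i := ⟨i, ⟨1, by simp⟩, rfl⟩
  rw [← h] at hi
  obtain ⟨_, ⟨j, hj, rfl⟩, hji⟩ := hi
  have : ((algBP i).act n).symm (toBP i i) = toBP i j := by
    exact (AlgEquiv.symm_apply_eq _).mpr (Subtype.ext hji.symm)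
  rw [this]
  exact hj

/-! ### The algebra `B(P_γ)` and the Brauer quotient `B(P)` -/

/-- The simple quotient `B(P_γ) = B^P / m_γ`. -/
def algBPγ {ω : G →* Γ} {b : InvIdem O ω} {ι : P →* G} (i : fixedSub b ι) :
    InteriorAlgebra O (normP i) (centP i) :=
  (algBP i).quot (maxIdealOf (toBP i i))
    (fun n => maxIdealOf_invariant _ ((algBP i).act n) (act_inv_mem_conjClass i n))

/-- The relative trace from `B^Q` to `B^P`: `y = ∑_{t ∈ T} t • x` with `x ∈ B^Q` and `T` a set of
representatives of `P / Q`. -/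
def IsRelTrace {ω : G →* Γ} (b : InvIdem O ω) (ι : P →* G) (Q : Subgroup P)
    (y : (algB b).carrier) : Prop :=
  ∃ (x : (algB b).carrier) (T : Finset P), (∀ u ∈ Q, (algB b).act (ι u) x = x) ∧
    (∀ u : P, ∃! t, t ∈ T ∧ t⁻¹ * u ∈ Q) ∧ y = ∑ t ∈ T, (algB b).act (ι t) x

/-- The kernel `∑_{Q < P} B_Q^P + J(O) B^P` of the Brauer map of `B^P`. -/
def brauerKer [IsLocalRing O] {ω : G →* Γ} (b : InvIdem O ω) (ι : P →* G) :
    TwoSidedIdeal (fixedSub b ι) :=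
  TwoSidedIdeal.span ({y | ∃ Q : Subgroup P, Q ≠ ⊤ ∧ IsRelTrace b ι Q y} ∪
    {y | ∃ r ∈ IsLocalRing.maximalIdeal O, ∃ x, y = r • x})

theorem isRelTrace_act {ω : G →* Γ} {b : InvIdem O ω} {ι : P →* G} (hι : Function.Injective ι)
    {n : G} (hn : n ∈ Subgroup.normalizer (ι.range : Set G)) {Q : Subgroup P} (hQ : Q ≠ ⊤)
    {y : (algB b).carrier} (hy : IsRelTrace b ι Q y) :
    ∃ Q' : Subgroup P, Q' ≠ ⊤ ∧ IsRelTrace b ι Q' ((algB b).act n y) := by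
  have h1 : ∀ u : P, ∃ v : P, ι v = n * ι u * n⁻¹ := fun u => (hn (ι u)).mp ⟨u, rfl⟩
  have h2 : ∀ u : P, ∃ v : P, ι v = n⁻¹ * ι u * n := fun u => by
    have h := ((Subgroup.inv_mem _ hn) (ι u)).mp ⟨u, rfl⟩
    rwa [inv_inv] at h
  choose f hf using h1
  choose g hg using h2
  let φ : P ≃* P :=
    { toFun := f
      invFun := g
      left_inv := fun u => hι (by rw [hg, hf]; group)
      right_inv := fun u => hι (by rw [hf, hg]; group)
      map_mul' := fun u v => hι (by rw [hf, map_mul, map_mul, hf, hf]; group) }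
  have hφ : ∀ u, ι (φ u) = n * ι u * n⁻¹ := hf
  have hact : ∀ u x, (algB b).act (ι (φ u)) ((algB b).act n x)
      = (algB b).act n ((algB b).act (ι u) x) := by
    intro u x
    rw [← AlgEquiv.mul_apply, ← map_mul, ← AlgEquiv.mul_apply, ← map_mul, hφ,
      inv_mul_cancel_right]
  obtain ⟨x, T, hx, hT, rfl⟩ := hy
  refine ⟨Q.map φ.toMonoidHom, ?_, (algB b).act n x, T.map φ.toEquiv.toEmbedding, ?_, ?_, ?_⟩
  · intro h
    apply hQ
    rw [eq_top_iff]
    intro u _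
    have hu : φ u ∈ Q.map φ.toMonoidHom := by rw [h]; trivial
    obtain ⟨q, hq, hqu⟩ := hu
    rwa [← φ.injective hqu]
  · rintro _ ⟨q, hq, rfl⟩
    exact (hact q x).trans (congrArg _ (hx q hq))
  · intro u
    obtain ⟨t, ⟨ht, htq⟩, huniq⟩ := hT (φ.symm u)
    refine ⟨φ t, ⟨Finset.mem_map_of_mem _ ht, ⟨t⁻¹ * φ.symm u, htq, ?_⟩⟩, ?_⟩
    · change φ (t⁻¹ * φ.symm u) = _
      rw [map_mul, map_inv, MulEquiv.apply_symm_apply]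
    · rintro s ⟨hs, q, hq, hqs⟩
      obtain ⟨t', ht', rfl⟩ := Finset.mem_map.mp hs
      have e : t' = t := by
        refine huniq t' ⟨ht', ?_⟩
        have : t'⁻¹ * φ.symm u = q := by
          apply φ.injective
          rw [map_mul, map_inv, MulEquiv.apply_symm_apply]
          exact hqs.symm
        rwa [this]
      rw [e]
      rfl
  · rw [map_sum, Finset.sum_map]
    exact Finset.sum_congr rfl fun t _ => (hact t x).symm

theorem brauerKer_invariant [IsLocalRing O] {ω : G →* Γ} {b : InvIdem O ω} {ι : P →* G}
    (hι : Function.Injective ι) (i : fixedSub b ι) (n : normP i) :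
    ∀ x ∈ (brauerKer b ι : TwoSidedIdeal (algBP i).carrier), (algBP i).act n x ∈
      (brauerKer b ι : TwoSidedIdeal (algBP i).carrier) := by
  have h : (brauerKer b ι : TwoSidedIdeal (algBP i).carrier) ≤
      TwoSidedIdeal.comap ((algBP i).act n) (brauerKer b ι) := by
    refine TwoSidedIdeal.span_le.mpr ?_
    rintro y (⟨Q, hQ, hy⟩ | ⟨r, hr, x, rfl⟩)
    · obtain ⟨Q', hQ', hy'⟩ := isRelTrace_act hι n.2.1 hQ hy
      refine SetLike.mem_coe.mpr ((TwoSidedIdeal.mem_comap _).mpr ?_)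
      exact TwoSidedIdeal.subset_span (Or.inl ⟨Q', hQ', hy'⟩)
    · refine SetLike.mem_coe.mpr ((TwoSidedIdeal.mem_comap _).mpr ?_)
      exact TwoSidedIdeal.subset_span (Or.inr ⟨r, hr, (algBP i).act n x,
        map_smul ((algBP i).act n) r x⟩)
  intro x hx
  exact (TwoSidedIdeal.mem_comap _).mp (h hx)

/-- The Brauer quotient `B(P)`, as a `C_H(P)`-interior `N_G(P_γ)`-algebra. -/
def algBofP [IsLocalRing O] {ω : G →* Γ} {b : InvIdem O ω} {ι : P →* G}
    (hι : Function.Injective ι) (i : fixedSub b ι) : InteriorAlgebra O (normP i) (centP i) :=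
  (algBP i).quot (brauerKer b ι : TwoSidedIdeal (algBP i).carrier) (brauerKer_invariant hι i)

/-- The Brauer map `B^P → B(P)`. -/
def brP [IsLocalRing O] {ω : G →* Γ} {b : InvIdem O ω} {ι : P →* G}
    (hι : Function.Injective ι) (i : fixedSub b ι) (x : fixedSub b ι) :
    (algBofP hι i).carrier :=
  InteriorAlgebra.qmk (brauerKer b ι) x

/-- `i` represents a local point of `P` on `B`. -/
def IsLocalPoint [IsLocalRing O] {ω : G →* Γ} {b : InvIdem O ω} {ι : P →* G}
    (i : fixedSub b ι) : Prop :=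
  IsPrimitiveIdem i ∧ i ∉ brauerKer b ι

/-- `c` is the block of `B(P)` containing the point `Br_P(γ)`. -/
structure IsPointBlock [IsLocalRing O] {ω : G →* Γ} {b : InvIdem O ω} {ι : P →* G}
    (hι : Function.Injective ι) (i : fixedSub b ι) (c : (algBofP hι i).carrier) : Prop where
  idem : IsIdempotentElem c
  central : ∀ x, c * x = x * c
  ne_zero : c ≠ 0
  primitive : ∀ f, IsIdempotentElem f → (∀ x, f * x = x * f) → c * f = f → f = 0 ∨ f = c
  br_ne_zero : brP hι i i ≠ 0
  mul_br : c * brP hι i i = brP hι i i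

theorem conjClass_map {R S : Type*} [Ring R] [Ring S] (f : R →+* S) {e e' : R}
    (h : e' ∈ conjClass e) : f e' ∈ conjClass (f e) := by
  obtain ⟨a, rfl⟩ := h
  exact ⟨Units.map (f : R →* S) a, by simp⟩

theorem act_inv_br [IsLocalRing O] {ω : G →* Γ} {b : InvIdem O ω} {ι : P →* G}
    (hι : Function.Injective ι) (i : fixedSub b ι) (n : normP i) :
    ((algBofP hι i).act n).symm (brP hι i i) ∈ conjClass (brP hι i i) := by
  have h := conjClass_map ((brauerKer b ι : TwoSidedIdeal (algBP i).carrier).ringCon.mk')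
    (act_inv_mem_conjClass i n)
  have e : ((algBofP hι i).act n).symm (brP hι i i)
      = (brauerKer b ι : TwoSidedIdeal (algBP i).carrier).ringCon.mk'
          (((algBP i).act n).symm (toBP i i)) := by
    refine (AlgEquiv.symm_apply_eq _).mpr ?_
    exact congrArg (InteriorAlgebra.qmk (brauerKer b ι : TwoSidedIdeal (algBP i).carrier))
      (AlgEquiv.apply_symm_apply ((algBP i).act n) (toBP i i)).symm
  rw [e]
  exact h

theorem primitive_central_unique {R : Type*} [Ring R] {c d e : R} (he : e ≠ 0)
    (hci : IsIdempotentElem c) (hcc : ∀ x, c * x = x * c)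
    (hcp : ∀ f, IsIdempotentElem f → (∀ x, f * x = x * f) → c * f = f → f = 0 ∨ f = c)
    (hdi : IsIdempotentElem d) (hdc : ∀ x, d * x = x * d) (hce : c * e = e) (hde : d * e = e) :
    c * d = c := by
  have h1 : IsIdempotentElem (c * d) := hci.mul_of_commute (hcc d) hdi
  have h2 : ∀ x, c * d * x = x * (c * d) := fun x => by
    rw [mul_assoc, hdc, ← mul_assoc, hcc, mul_assoc]
  rcases hcp (c * d) h1 h2 (by rw [← mul_assoc, hci.eq]) with h | h
  · exact absurd (by rw [← hce, ← hde, ← mul_assoc, h, zero_mul]) he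
  · exact h

theorem IsPointBlock.inv [IsLocalRing O] {ω : G →* Γ} {b : InvIdem O ω} {ι : P →* G}
    {hι : Function.Injective ι} {i : fixedSub b ι} {c : (algBofP hι i).carrier}
    (hc : IsPointBlock hι i c) (n : normP i) : (algBofP hι i).act n c = c := by
  set s := (algBofP hι i).act n with hs
  obtain ⟨a, ha⟩ := act_inv_br hι i n
  have hd : s.symm c * brP hι i i = brP hι i i → s c * brP hι i i = brP hι i i → s c = c := by
    intro h1 h2
    have hsi : IsIdempotentElem (s c) := hc.idem.map s
    have hsc : ∀ x, s c * x = x * s c := fun x => by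
      obtain ⟨y, rfl⟩ := s.surjective x
      rw [← map_mul, hc.central, map_mul]
    have hti : IsIdempotentElem (s.symm c) := hc.idem.map s.symm
    have htc : ∀ x, s.symm c * x = x * s.symm c := fun x => by
      obtain ⟨y, rfl⟩ := s.symm.surjective x
      rw [← map_mul, hc.central, map_mul]
    have e1 := primitive_central_unique hc.br_ne_zero hc.idem hc.central hc.primitive hsi hsc
      hc.mul_br h2
    have e2 := primitive_central_unique hc.br_ne_zero hc.idem hc.central hc.primitive hti htc
      hc.mul_br h1
    have e3 := congrArg s e2
    rw [map_mul, AlgEquiv.apply_symm_apply] at e3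
    rw [← e3, hsc, e1]
  have hcs : s.symm (brP hι i i) * a = a * brP hι i i := by
    rw [ha, mul_assoc, Units.inv_mul, mul_one]
  have hss : a * brP hι i i * (↑a⁻¹ : (algBofP hι i).carrier) = s.symm (brP hι i i) := ha.symm
  apply hd
  · have h1 : s.symm c * s.symm (brP hι i i) = s.symm (brP hι i i) := by
      rw [← map_mul, hc.mul_br]
    have htc : s.symm c * a = a * s.symm c := by
      obtain ⟨y, hy⟩ := s.symm.surjective (a : (algBofP hι i).carrier)
      rw [← hy, ← map_mul, hc.central, map_mul]
    have h2 : a * (s.symm c * brP hι i i) = a * brP hι i i := by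
      rw [← mul_assoc, ← htc, mul_assoc, ← hcs, ← mul_assoc, h1]
    exact a.isUnit.mul_left_cancel h2
  · have h1 : c * s.symm (brP hι i i) = s.symm (brP hι i i) := by
      rw [ha, ← mul_assoc, ← mul_assoc, hc.central, mul_assoc (a : (algBofP hι i).carrier),
        hc.mul_br]
    have h2 := congrArg s h1
    rwa [map_mul, AlgEquiv.apply_symm_apply] at h2

/-- The algebra `B(P) b_γ`. -/
def algBPb [IsLocalRing O] {ω : G →* Γ} {b : InvIdem O ω} {ι : P →* G}
    {hι : Function.Injective ι} {i : fixedSub b ι} {c : (algBofP hι i).carrier}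
    (hc : IsPointBlock hι i c) : InteriorAlgebra O (normP i) (centP i) :=
  (algBofP hι i).corner hc.idem hc.central hc.inv

/-- The ideal `m^* = m_{Br_P(γ)} ∩ B(P) b_γ` of `B(P) b_γ`. -/
def mStar [IsLocalRing O] {ω : G →* Γ} {b : InvIdem O ω} {ι : P →* G}
    {hι : Function.Injective ι} {i : fixedSub b ι} {c : (algBofP hι i).carrier}
    (hc : IsPointBlock hι i c) : TwoSidedIdeal (algBPb hc).carrier :=
  TwoSidedIdeal.comap (cornerIncl hc.idem) (maxIdealOf (brP hι i i))

theorem mStar_invariant [IsLocalRing O] {ω : G →* Γ} {b : InvIdem O ω} {ι : P →* G}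
    {hι : Function.Injective ι} {i : fixedSub b ι} {c : (algBofP hι i).carrier}
    (hc : IsPointBlock hι i c) (n : normP i) :
    ∀ x ∈ mStar hc, (algBPb hc).act n x ∈ mStar hc := by
  intro x hx
  have hx' := (TwoSidedIdeal.mem_comap (cornerIncl hc.idem)).mp hx
  exact (TwoSidedIdeal.mem_comap (cornerIncl hc.idem)).mpr
    (maxIdealOf_invariant (brP hι i i) ((algBofP hι i).act n) (act_inv_br hι i n) _ hx')

/-- The simple algebra `B(P) b_γ / m^*`. -/
def algBPm [IsLocalRing O] {ω : G →* Γ} {b : InvIdem O ω} {ι : P →* G}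
    {hι : Function.Injective ι} {i : fixedSub b ι} {c : (algBofP hι i).carrier}
    (hc : IsPointBlock hι i c) : InteriorAlgebra O (normP i) (centP i) :=
  (algBPb hc).quot (mStar hc) (mStar_invariant hc)

/-- The canonical map `B^P → B(P_γ)`. -/
def toBPγ {ω : G →* Γ} {b : InvIdem O ω} {ι : P →* G} (i : fixedSub b ι) (x : fixedSub b ι) :
    (algBPγ i).carrier :=
  InteriorAlgebra.qmk (maxIdealOf (toBP i i)) (toBP i x)

/-- The canonical map `B^P → B(P) b_γ / m^*`, induced by `x ↦ Br_P(x) b_γ`. -/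
def toBPm [IsLocalRing O] {ω : G →* Γ} {b : InvIdem O ω} {ι : P →* G}
    {hι : Function.Injective ι} {i : fixedSub b ι} {c : (algBofP hι i).carrier}
    (hc : IsPointBlock hι i c) (x : fixedSub b ι) : (algBPm hc).carrier :=
  InteriorAlgebra.qmk (mStar hc) (toCorner hc.idem (c * brP hι i x)
    (by rw [← mul_assoc, hc.idem.eq]) (by rw [hc.central, mul_assoc, hc.idem.eq]))

/-! ### The Clifford extensions -/

/-- `n ∈ N_G(P)` induces the pair `x = (φ, ḡ)`: `φ` is conjugation by `n` on `P`, and `ḡ` is the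
image of `n`. The relation defines an injection of `E = N_G(P_γ) / C_H(P)` into `Aut(P) × Γ`, by
means of which `E` is regarded as a subgroup of `Aut(P) × Γ`. -/
def Induces (ω : G →* Γ) (ι : P →* G) (n : G) (x : MulAut P × Γ) : Prop :=
  (∀ u, ι (x.1 u) = n * ι u * n⁻¹) ∧ x.2 = ω n

/-- The degree relation on `N_G(P_γ)`. -/
def degN {ω : G →* Γ} {b : InvIdem O ω} {ι : P →* G} (i : fixedSub b ι) (n : normP i)
    (x : MulAut P × Γ) : Prop :=
  Induces ω ι n x

/-- The module `B^P i`. -/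
abbrev modBPi {ω : G →* Γ} {b : InvIdem O ω} {ι : P →* G} (i : fixedSub b ι) :=
  ↥(Ideal.span {toBP i i})

/-- The simple `B(P_γ)`-module `V_γ`, realized as the left ideal generated by the image of `i`. -/
abbrev modVγ {ω : G →* Γ} {b : InvIdem O ω} {ι : P →* G} (i : fixedSub b ι) :=
  ↥(Ideal.span {toBPγ i i})

/-- The module `V_γ`, regarded as a module over `B(P) b_γ / m^*`. -/
abbrev modVm [IsLocalRing O] {ω : G →* Γ} {b : InvIdem O ω} {ι : P →* G}
    {hι : Function.Injective ι} {i : fixedSub b ι} {c : (algBofP hι i).carrier}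
    (hc : IsPointBlock hι i c) :=
  ↥(Ideal.span {toBPm hc i})

/-- `ℰ = End_{B^P * E}(B^P * E ⊗ B^P i)ᵒᵖ`. -/
def calE {ω : G →* Γ} {b : InvIdem O ω} {ι : P →* G} (i : fixedSub b ι) :
    GradedAlg O (MulAut P × Γ) :=
  (algBP i).cliffordAlg (modBPi i) (degN i)

/-- `ℰ̄ = End_{B(P_γ) * E}(B(P_γ) * E ⊗ V_γ)ᵒᵖ`. -/
def calEbar {ω : G →* Γ} {b : InvIdem O ω} {ι : P →* G} (i : fixedSub b ι) :
    GradedAlg O (MulAut P × Γ) :=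
  (algBPγ i).cliffordAlg (modVγ i) (degN i)

/-- `ℰ̄(P) = End_{(B(P) b_γ / m^*) * E}((B(P) b_γ / m^*) * E ⊗ V_γ)ᵒᵖ`. -/
def calEbarP [IsLocalRing O] {ω : G →* Γ} {b : InvIdem O ω} {ι : P →* G}
    {hι : Function.Injective ι} {i : fixedSub b ι} {c : (algBofP hι i).carrier}
    (hc : IsPointBlock hι i c) : GradedAlg O (MulAut P × Γ) :=
  (algBPm hc).cliffordAlg (modVm hc) (degN i)

/-! ### Fusions and the algebra `ℱ` -/

/-- The group `Aut^Γ(P)`. -/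
def autP (ω : G →* Γ) (ι : P →* G) : Subgroup (MulAut P × Γ) where
  carrier := {x | ∀ u, ω (ι (x.1 u)) = x.2 * ω (ι u) * x.2⁻¹}
  one_mem' := fun u => by simp
  mul_mem' := by
    intro x y hx hy u
    change ω (ι (x.1 (y.1 u))) = x.2 * y.2 * ω (ι u) * (x.2 * y.2)⁻¹
    rw [hx, hy]; group
  inv_mem' := by
    intro x hx u
    have h := hx (x.1⁻¹ u)
    rw [MulAut.apply_inv_self] at h
    change ω (ι (x.1⁻¹ u)) = x.2⁻¹ * ω (ι u) * x.2⁻¹⁻¹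
    rw [h]; group

/-- The element `i` of `A`. -/
def iA {ω : G →* Γ} {b : InvIdem O ω} {ι : P →* G} (i : fixedSub b ι) : AlgA b := toA b i.1

/-- The left `A`-module `A i`. -/
abbrev modAi {ω : G →* Γ} {b : InvIdem O ω} {ι : P →* G} (i : fixedSub b ι) :=
  ↥(Ideal.span {iA i})

theorem iA_comm {ω : G →* Γ} {b : InvIdem O ω} {ι : P →* G} (i : fixedSub b ι) (u : P) :
    iA i * grpA b (ι u) = grpA b (ι u) * iA i := by
  have h1 : valB b ((algB b).act (ι u) i.1) = valB b i.1 := congrArg (valB b) (i.2 u)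
  have h2 : inclG O ω (valB b i.1) * MonoidAlgebra.of O G (ι u)
      = MonoidAlgebra.of O G (ι u) * inclG O ω (valB b i.1) := by
    rw [← inclG_act]
    exact congrArg (fun t => inclG O ω t * MonoidAlgebra.of O G (ι u)) h1.symm
  have h3 : inclG O ω b.val * inclG O ω (valB b i.1) = inclG O ω (valB b i.1) :=
    corner_left (idemG b) (iA i)
  have h4 : inclG O ω (valB b i.1) * inclG O ω b.val = inclG O ω (valB b i.1) :=
    corner_right (idemG b) (iA i)
  refine corner_ext (idemG b) ?_
  change inclG O ω (valB b i.1) * (inclG O ω b.val * MonoidAlgebra.of O G (ι u))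
    = inclG O ω b.val * MonoidAlgebra.of O G (ι u) * inclG O ω (valB b i.1)
  rw [← mul_assoc, h4, mul_assoc, ← h2, ← mul_assoc, h3]

/-- The right action of `u ∈ P` on `A i`. -/
def rightAi {ω : G →* Γ} {b : InvIdem O ω} {ι : P →* G} (i : fixedSub b ι) (u : P) :
    modAi i →ₗ[AlgA b] modAi i :=
  (LinearMap.toSpanSingleton (AlgA b) (AlgA b) (grpA b (ι u))).restrict (by
    intro x hx
    obtain ⟨a, rfl⟩ := Ideal.mem_span_singleton'.mp hx
    refine Ideal.mem_span_singleton'.mpr ⟨a * grpA b (ι u), ?_⟩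
    rw [LinearMap.toSpanSingleton_apply, smul_eq_mul, mul_assoc, mul_assoc, iA_comm])

/-- The component of degree `x` of `A i`. -/
def compAi {ω : G →* Γ} {b : InvIdem O ω} {ι : P →* G} (i : fixedSub b ι) (x : Γ) :
    Submodule O (modAi i) :=
  (compA b x).comap ((Ideal.span {iA i}).subtype.restrictScalars O)

/-- The group `F` of `(A, Γ)`-fusions of `P_γ`: the pairs `(φ, ḡ)` in `Aut^Γ(P)` such that `A i` is
isomorphic to `(A i)(ḡ⁻¹)_φ` as a `Γ`-graded `(A, O P)`-bimodule. Here `M(y)_x = M_{x y}`, and `u`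
acts on the right of `M_φ` as `φ u` does on `M`. -/
def fusF {ω : G →* Γ} {b : InvIdem O ω} {ι : P →* G} (i : fixedSub b ι) :
    Subgroup (MulAut P × Γ) where
  carrier := {x | x ∈ autP ω ι ∧ ∃ f : modAi i ≃ₗ[AlgA b] modAi i,
    (∀ u m, f (rightAi i u m) = rightAi i (x.1 u) (f m)) ∧
    ∀ y m, m ∈ compAi i y ↔ f m ∈ compAi i (y * x.2⁻¹)}
  one_mem' := ⟨Subgroup.one_mem _, LinearEquiv.refl _ _, fun _ _ => rfl, fun y m => by simp⟩
  mul_mem' := by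
    rintro x y ⟨hx, f, hf1, hf2⟩ ⟨hy, g, hg1, hg2⟩
    refine ⟨Subgroup.mul_mem _ hx hy, g.trans f, fun u m => ?_, fun z m => ?_⟩
    · change f (g (rightAi i u m)) = rightAi i (x.1 (y.1 u)) (f (g m))
      rw [hg1, hf1]
    · rw [hg2, hf2, Prod.snd_mul, mul_inv_rev, ← mul_assoc]
      exact Iff.rfl
  inv_mem' := by
    rintro x ⟨hx, f, hf1, hf2⟩
    refine ⟨Subgroup.inv_mem _ hx, f.symm, fun u m => ?_, fun z m => ?_⟩
    · rw [LinearEquiv.symm_apply_eq, hf1, LinearEquiv.apply_symm_apply, Prod.fst_inv,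
        MulAut.apply_inv_self]
    · rw [hf2 (z * x⁻¹.2⁻¹) (f.symm m), LinearEquiv.apply_symm_apply, Prod.snd_inv, inv_inv, mul_inv_cancel_right]

/-- The group `P ⋊ F`, where `F` acts on `P` through its first component. -/
abbrev sdF {ω : G →* Γ} {b : InvIdem O ω} {ι : P →* G} (i : fixedSub b ι) :=
  P ⋊[(MonoidHom.fst (MulAut P) Γ).comp (fusF i).subtype] (fusF i)

/-- The crossed product `C = O P * F`, that is, the group algebra of `P ⋊ F`. -/
abbrev algC {ω : G →* Γ} {b : InvIdem O ω} {ι : P →* G} (i : fixedSub b ι) :=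
  MonoidAlgebra O (sdF i)

/-- The relations `m u ⊗ c = m ⊗ u c`, for `u ∈ P`. -/
def relM {ω : G →* Γ} {b : InvIdem O ω} {ι : P →* G} (i : fixedSub b ι) :
    Submodule (AlgA b) (modAi i ⊗[O] algC i) :=
  Submodule.span (AlgA b) {t | ∃ (m : modAi i) (u : P) (c : algC i),
    t = rightAi i u m ⊗ₜ[O] c
      - m ⊗ₜ[O] (MonoidAlgebra.of O (sdF i) (SemidirectProduct.inl u) * c)}

/-- The `(A, C)`-bimodule `A i ⊗_{O P} C`. -/
abbrev bimM {ω : G →* Γ} {b : InvIdem O ω} {ι : P →* G} (i : fixedSub b ι) :=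
  (modAi i ⊗[O] algC i) ⧸ relM i

/-- The element `m ⊗ c` of `A i ⊗_{O P} C`. -/
def tmulM {ω : G →* Γ} {b : InvIdem O ω} {ι : P →* G} (i : fixedSub b ι) (m : modAi i)
    (c : algC i) : bimM i :=
  (relM i).mkQ (m ⊗ₜ[O] c)

/-- The right action of `c ∈ C` on `A i ⊗_{O P} C`. -/
def rightM {ω : G →* Γ} {b : InvIdem O ω} {ι : P →* G} (i : fixedSub b ι) (c : algC i) :
    bimM i →ₗ[AlgA b] bimM i :=
  (relM i).mapQ (relM i)
    (TensorProduct.AlgebraTensorModule.map LinearMap.id (LinearMap.mulRight O c)) (by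
      refine Submodule.span_le.mpr ?_
      rintro _ ⟨m, u, d, rfl⟩
      refine Submodule.subset_span ⟨m, u, d * c, ?_⟩
      simp [mul_assoc])

/-- The component of degree `g ∈ Γ` of `A i ⊗_{O P} C`, where `m ⊗ u (φ, ḡ)`, for `m` homogeneous of
degree `y`, has degree `y ū ḡ`. -/
def compMΓ {ω : G →* Γ} {b : InvIdem O ω} {ι : P →* G} (i : fixedSub b ι) (g : Γ) :
    Submodule O (bimM i) :=
  Submodule.span O {t | ∃ (y : Γ) (m : modAi i) (s : sdF i), m ∈ compAi i y ∧
    y * ω (ι s.left) * (s.right : MulAut P × Γ).2 = g ∧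
    t = tmulM i m (MonoidAlgebra.of O (sdF i) s)}

/-- The component of degree `x ∈ F` of `A i ⊗_{O P} C` for the grading induced by that of `C`. -/
def compMF {ω : G →* Γ} {b : InvIdem O ω} {ι : P →* G} (i : fixedSub b ι) (x : MulAut P × Γ) :
    Submodule O (bimM i) :=
  Submodule.span O {t | ∃ (m : modAi i) (s : sdF i), (s.right : MulAut P × Γ) = x ∧
    t = tmulM i m (MonoidAlgebra.of O (sdF i) s)}

/-- The algebra of endomorphisms of the `(A, C)`-bimodule `A i ⊗_{O P} C` that preserve the
`Γ`-grading. -/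
def endM {ω : G →* Γ} {b : InvIdem O ω} {ι : P →* G} (i : fixedSub b ι) :
    Subalgebra O (Module.End (AlgA b) (bimM i)) where
  carrier := {f | (∀ c m, f (rightM i c m) = rightM i c (f m)) ∧
    ∀ g, ∀ m ∈ compMΓ i g, f m ∈ compMΓ i g}
  mul_mem' := by
    rintro f g ⟨hf, hf'⟩ ⟨hg, hg'⟩
    refine ⟨fun c m => ?_, fun y m hm => hf' y _ (hg' y m hm)⟩
    rw [Module.End.mul_apply, Module.End.mul_apply, hg, hf]
  add_mem' := by
    rintro f g ⟨hf, hf'⟩ ⟨hg, hg'⟩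
    refine ⟨fun c m => ?_, fun y m hm => Submodule.add_mem _ (hf' y m hm) (hg' y m hm)⟩
    rw [LinearMap.add_apply, LinearMap.add_apply, hf, hg, map_add]
  algebraMap_mem' := by
    intro r
    refine ⟨fun c m => ?_, fun y m hm => Submodule.smul_mem _ r hm⟩
    rw [Module.algebraMap_end_apply, Module.algebraMap_end_apply]
    exact (map_smul ((rightM i c).restrictScalars O) r m).symm

/-- The algebra `ℱ = End_{A-Gr ⊗ Cᵒᵖ}(A i ⊗_{O P} C)ᵒᵖ`. Because of the opposite multiplication, an
endomorphism `f` of the right `C`-module `M = A i ⊗_{O P} C` has degree `x` if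
`f (M_y) ⊆ M_{x⁻¹ y}` for all `y`. -/
def calF {ω : G →* Γ} {b : InvIdem O ω} {ι : P →* G} (i : fixedSub b ι) :
    GradedAlg O (MulAut P × Γ) where
  carrier := (endM i)ᵐᵒᵖ
  comp x :=
    { carrier := {f | ∀ y, ∀ m ∈ compMF i y, f.unop.1 m ∈ compMF i (x⁻¹ * y)}
      add_mem' := by
        intro f g hf hg y m hm
        rw [MulOpposite.unop_add, Subalgebra.coe_add, LinearMap.add_apply]
        exact Submodule.add_mem _ (hf y m hm) (hg y m hm)
      zero_mem' := fun y m hm => Submodule.zero_mem _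
      smul_mem' := by
        intro c f hf y m hm
        rw [MulOpposite.unop_smul, Subalgebra.coe_smul, LinearMap.smul_apply]
        exact Submodule.smul_mem _ c (hf y m hm) }
  one_mem := fun y m hm => by rw [inv_one, one_mul]; exact hm
  mul_mem := by
    intro x x' f g hf hg y m hm
    rw [mul_inv_rev, mul_assoc]
    exact hg _ _ (hf y m hm)

/-- `ℱ̄ = ℱ / J_gr(ℱ)`. -/
def calFbar {ω : G →* Γ} {b : InvIdem O ω} {ι : P →* G} (i : fixedSub b ι) :
    GradedAlg O (MulAut P × Γ) :=
  (calF i).residual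

/-! ### The canonical isomorphisms -/

/-- The generator `i` of `B^P i`. -/
def genBPi {ω : G →* Γ} {b : InvIdem O ω} {ι : P →* G} (i : fixedSub b ι) : modBPi i :=
  ⟨toBP i i, Ideal.subset_span rfl⟩

/-- The generator of `V_γ`. -/
def genVγ {ω : G →* Γ} {b : InvIdem O ω} {ι : P →* G} (i : fixedSub b ι) : modVγ i :=
  ⟨toBPγ i i, Ideal.subset_span rfl⟩

/-- The generator of `V_γ`, regarded as a module over `B(P) b_γ / m^*`. -/
def genVm [IsLocalRing O] {ω : G →* Γ} {b : InvIdem O ω} {ι : P →* G}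
    {hι : Function.Injective ι} {i : fixedSub b ι} {c : (algBofP hι i).carrier}
    (hc : IsPointBlock hι i c) : modVm hc :=
  ⟨toBPm hc i, Ideal.subset_span rfl⟩

/-- The generator `i` of `A i`. -/
def genAi {ω : G →* Γ} {b : InvIdem O ω} {ι : P →* G} (i : fixedSub b ι) : modAi i :=
  ⟨iA i, Ideal.subset_span rfl⟩

/-- `f ∈ ℰ` maps `1 ⊗ i` to `(β ⊗ n) ⊗ i`. (Each homogeneous `f` satisfies this for some `β` and
`n`, and `f` is determined by `β` and `n`. The same holds for the next two relations.) -/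
def RepE {ω : G →* Γ} {b : InvIdem O ω} {ι : P →* G} (i : fixedSub b ι) (β : fixedSub b ι)
    (n : normP i) (f : (calE i).carrier) : Prop :=
  (MulOpposite.unop f : Module.End (algBP i).Crossed ((algBP i).Ind (modBPi i)))
    ((algBP i).ind 1 1 (genBPi i)) = (algBP i).ind (toBP i β) n (genBPi i)

/-- `f ∈ ℰ̄` maps the generator of `B(P_γ) * E ⊗ V_γ` to the class of `(β ⊗ n) ⊗ i`. -/
def RepEbar {ω : G →* Γ} {b : InvIdem O ω} {ι : P →* G} (i : fixedSub b ι) (β : fixedSub b ι)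
    (n : normP i) (f : (calEbar i).carrier) : Prop :=
  (MulOpposite.unop f : Module.End (algBPγ i).Crossed ((algBPγ i).Ind (modVγ i)))
    ((algBPγ i).ind 1 1 (genVγ i)) = (algBPγ i).ind (toBPγ i β) n (genVγ i)

/-- `f ∈ ℰ̄(P)` maps the generator of `(B(P) b_γ / m^*) * E ⊗ V_γ` to the class of `(β ⊗ n) ⊗ i`. -/
def RepEbarP [IsLocalRing O] {ω : G →* Γ} {b : InvIdem O ω} {ι : P →* G}
    {hι : Function.Injective ι} {i : fixedSub b ι} {c : (algBofP hι i).carrier}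
    (hc : IsPointBlock hι i c) (β : fixedSub b ι) (n : normP i) (f : (calEbarP hc).carrier) :
    Prop :=
  (MulOpposite.unop f : Module.End (algBPm hc).Crossed ((algBPm hc).Ind (modVm hc)))
    ((algBPm hc).ind 1 1 (genVm hc)) = (algBPm hc).ind (toBPm hc β) n (genVm hc)

/-- `f ∈ ℱ` maps `i ⊗ 1` to `β n i ⊗ x⁻¹`, where `x ∈ F` is induced by `n`. -/
def RepF {ω : G →* Γ} {b : InvIdem O ω} {ι : P →* G} (i : fixedSub b ι) (β : fixedSub b ι)
    (n : normP i) (f : (calF i).carrier) : Prop :=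
  ∃ x : fusF i, degN i n x ∧
    (MulOpposite.unop f : endM i).1 (tmulM i (genAi i) 1)
      = tmulM i ((toA b β.1 * grpA b n) • genAi i)
          (MonoidAlgebra.of O (sdF i) (SemidirectProduct.inr x⁻¹))

/-- The reduction `ℰ → ℰ / J_gr(ℰ) ≃ ℰ̄`, on homogeneous elements: `f'` is the endomorphism induced
by `f` through the projective cover `B^P i → V_γ`. -/
def Reduces {ω : G →* Γ} {b : InvIdem O ω} {ι : P →* G} (i : fixedSub b ι)
    (f : (calE i).carrier) (f' : (calEbar i).carrier) : Prop :=
  ∃ β n, RepE i β n f ∧ RepEbar i β n f'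

/-- The graph of the canonical isomorphism `Ψ : ℰ → ℱ`, on homogeneous elements: if `f` maps `i` to
`(β ⊗ n) ⊗ i`, then `Ψ f` is given by right multiplication by `β n i`. -/
def Psi {ω : G →* Γ} {b : InvIdem O ω} {ι : P →* G} (i : fixedSub b ι)
    (f : (calE i).carrier) (f' : (calF i).carrier) : Prop :=
  ∃ β n, RepE i β n f ∧ RepF i β n f'

/-- `θ : ℰ̄ → ℱ̄` is the canonical isomorphism, induced by `Ψ : ℰ → ℱ`. -/
def IsCanonicalEF {ω : G →* Γ} {b : InvIdem O ω} {ι : P →* G} (i : fixedSub b ι)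
    (θ : GradedAlg.Iso (calEbar i) (calFbar i)) : Prop :=
  ∀ f f' f'', Reduces i f f' → Psi i f f'' → θ.toAlgEquiv f' = (calF i).toResidual f''

/-- `η : ℰ̄ → ℰ̄(P)` is the canonical isomorphism, induced by the isomorphism
`B(P_γ) ≃ B(P) b_γ / m^*` coming from the Brauer map. -/
def IsCanonicalEP [IsLocalRing O] {ω : G →* Γ} {b : InvIdem O ω} {ι : P →* G}
    {hι : Function.Injective ι} {i : fixedSub b ι} {c : (algBofP hι i).carrier}
    (hc : IsPointBlock hι i c) (η : GradedAlg.Iso (calEbar i) (calEbarP hc)) : Prop :=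
  ∀ f f' β n, RepEbar i β n f → RepEbarP hc β n f' → η.toAlgEquiv f = f'

end Extension
/-! ### Fibre products and product points -/

section Fibre

universe u v v' v'' vP
variable {O : Type u} [CommRing O] {G : Type v} [Group G] {G' : Type v'} [Group G']
  {Γ : Type v''} [Group Γ] {P : Type vP} [Group P]

/-- The group `G̈ = {(g, g') | ω g = ω' g'}`. -/
def fibre (ω : G →* Γ) (ω' : G' →* Γ) : Subgroup (G × G') where
  carrier := {x | ω x.1 = ω' x.2}
  one_mem' := by simp
  mul_mem' := by
    intro x y hx hy
    change ω (x.1 * y.1) = ω' (x.2 * y.2)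
    rw [map_mul, map_mul, hx, hy]
  inv_mem' := by
    intro x hx
    change ω x.1⁻¹ = ω' x.2⁻¹
    rw [map_inv, map_inv, hx]

/-- The homomorphism `G̈ → Γ`, with kernel `H × H'`. -/
def fibreHom (ω : G →* Γ) (ω' : G' →* Γ) : fibre ω ω' →* Γ :=
  (ω.comp (MonoidHom.fst G G')).comp (fibre ω ω').subtype

/-- The inclusion `H → H × H'`. -/
def kerInl (ω : G →* Γ) (ω' : G' →* Γ) : ω.ker →* (fibreHom ω ω').ker where
  toFun h := ⟨⟨(h, 1), by change ω h = ω' 1; rw [map_one]; exact h.2⟩, h.2⟩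
  map_one' := rfl
  map_mul' h k := Subtype.ext (Subtype.ext (Prod.ext rfl (mul_one 1).symm))

/-- The inclusion `H' → H × H'`. -/
def kerInr (ω : G →* Γ) (ω' : G' →* Γ) : ω'.ker →* (fibreHom ω ω').ker where
  toFun h := ⟨⟨(1, h), by change ω 1 = ω' h; rw [map_one]; exact h.2.symm⟩, map_one ω⟩
  map_one' := rfl
  map_mul' h k := Subtype.ext (Subtype.ext (Prod.ext (mul_one 1).symm rfl))

/-- The element `a ⊗ a'` of `O H ⊗ O H' = O (H × H')`. -/
def tens (ω : G →* Γ) (ω' : G' →* Γ) (a : MonoidAlgebra O ω.ker) (a' : MonoidAlgebra O ω'.ker) :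
    MonoidAlgebra O (fibreHom ω ω').ker :=
  MonoidAlgebra.mapDomainAlgHom O O (kerInl ω ω') a *
    MonoidAlgebra.mapDomainAlgHom O O (kerInr ω ω') a'

theorem tens_comm (ω : G →* Γ) (ω' : G' →* Γ) (a : MonoidAlgebra O ω.ker)
    (a' : MonoidAlgebra O ω'.ker) :
    MonoidAlgebra.mapDomainAlgHom O O (kerInr ω ω') a' *
      MonoidAlgebra.mapDomainAlgHom O O (kerInl ω ω') a = tens ω ω' a a' := by
  unfold tens
  induction a using MonoidAlgebra.induction_on with
  | of h =>
    induction a' using MonoidAlgebra.induction_on with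
    | of h' =>
      have e : kerInr ω ω' h' * kerInl ω ω' h = kerInl ω ω' h * kerInr ω ω' h' :=
        Subtype.ext (Subtype.ext (Prod.ext ((one_mul _).trans (mul_one _).symm)
          ((mul_one _).trans (one_mul _).symm)))
      simp [MonoidAlgebra.single_mul_single, e]
    | add x y hx hy => rw [map_add, add_mul, hx, hy, mul_add]
    | smul r x hx => rw [map_smul, smul_mul_assoc, hx, mul_smul_comm]
  | add x y hx hy => rw [map_add, mul_add, hx, hy, add_mul]
  | smul r x hx => rw [map_smul, mul_smul_comm, hx, smul_mul_assoc]

theorem tens_mul (ω : G →* Γ) (ω' : G' →* Γ) (a c : MonoidAlgebra O ω.ker)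
    (a' c' : MonoidAlgebra O ω'.ker) :
    tens ω ω' a a' * tens ω ω' c c' = tens ω ω' (a * c) (a' * c') := by
  have h := tens_comm ω ω' c a'
  unfold tens at h ⊢
  rw [map_mul, map_mul, mul_assoc, mul_assoc, ← mul_assoc _ _ (MonoidAlgebra.mapDomainAlgHom O O
    (kerInr ω ω') c'), h, mul_assoc]

theorem tens_conj (ω : G →* Γ) (ω' : G' →* Γ) (g : fibre ω ω') (a : MonoidAlgebra O ω.ker)
    (a' : MonoidAlgebra O ω'.ker) :
    MonoidAlgebra.domCongr O O (MulAut.conjNormal g) (tens ω ω' a a')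
      = tens ω ω' (MonoidAlgebra.domCongr O O (MulAut.conjNormal (g : G × G').1) a)
        (MonoidAlgebra.domCongr O O (MulAut.conjNormal (g : G × G').2) a') := by
  unfold tens
  rw [map_mul]
  congr 1
  · induction a using MonoidAlgebra.induction_on with
    | of h =>
      have e : MulAut.conjNormal g (kerInl ω ω' h)
          = kerInl ω ω' (MulAut.conjNormal (g : G × G').1 h) := by
        refine Subtype.ext (Subtype.ext (Prod.ext ?_ ?_))
        · rw [MulAut.conjNormal_apply]
          change (g : G × G').1 * (h : G) * (g : G × G').1⁻¹ = _
          exact (MulAut.conjNormal_apply _ _).symm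
        · rw [MulAut.conjNormal_apply]
          change (g : G × G').2 * 1 * (g : G × G').2⁻¹ = 1
          rw [mul_one, mul_inv_cancel]
      simp [e]
    | add x y hx hy => rw [map_add, map_add, hx, hy, map_add, map_add]
    | smul r x hx => rw [map_smul, map_smul, hx, map_smul, map_smul]
  · induction a' using MonoidAlgebra.induction_on with
    | of h =>
      have e : MulAut.conjNormal g (kerInr ω ω' h)
          = kerInr ω ω' (MulAut.conjNormal (g : G × G').2 h) := by
        refine Subtype.ext (Subtype.ext (Prod.ext ?_ ?_))
        · rw [MulAut.conjNormal_apply]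
          change (g : G × G').1 * 1 * (g : G × G').1⁻¹ = 1
          rw [mul_one, mul_inv_cancel]
        · rw [MulAut.conjNormal_apply]
          change (g : G × G').2 * (h : G') * (g : G × G').2⁻¹ = _
          exact (MulAut.conjNormal_apply _ _).symm
      simp [e]
    | add x y hx hy => rw [map_add, map_add, hx, hy, map_add, map_add]
    | smul r x hx => rw [map_smul, map_smul, hx, map_smul, map_smul]

theorem conj_fixed_central {ω : G →* Γ} (x : MonoidAlgebra O ω.ker)
    (hx : ∀ g : G, MonoidAlgebra.domCongr O O (MulAut.conjNormal g) x = x)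
    (y : MonoidAlgebra O ω.ker) : x * y = y * x := by
  induction y using MonoidAlgebra.induction_on with
  | of h =>
    have e := (kerAlg O ω).str_mul h x
    have e2 : MonoidAlgebra.of O ω.ker h * x
        = MonoidAlgebra.domCongr O O (MulAut.conjNormal (h : G)) x * MonoidAlgebra.of O ω.ker h := e
    rw [e2, hx]
  | add y z hy hz => rw [mul_add, hy, hz, add_mul]
  | smul r y hy => rw [mul_smul_comm, hy, smul_mul_assoc]

/-- The idempotent `b ⊗ b'` of `O (H × H')`. -/
def prodIdem {ω : G →* Γ} {ω' : G' →* Γ} (b : InvIdem O ω) (b' : InvIdem O ω') :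
    InvIdem O (fibreHom ω ω') where
  val := tens ω ω' b.val b'.val
  idem := by
    change _ * _ = _
    rw [tens_mul, b.idem.eq, b'.idem.eq]
  central := conj_fixed_central _ fun g => by rw [tens_conj, b.inv, b'.inv]
  inv := fun g => by rw [tens_conj, b.inv, b'.inv]

/-- The diagonal homomorphism `P → G̈`. -/
def diagP {ω : G →* Γ} {ω' : G' →* Γ} (ι : P →* G) (ι' : P →* G')
    (h : ∀ u, ω (ι u) = ω' (ι' u)) : P →* fibre ω ω' :=
  (ι.prod ι').codRestrict (fibre ω ω') h

theorem diagP_injective {ω : G →* Γ} {ω' : G' →* Γ} {ι : P →* G} {ι' : P →* G'}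
    (h : ∀ u, ω (ι u) = ω' (ι' u)) (hι : Function.Injective ι) :
    Function.Injective (diagP ι ι' h) := by
  intro u v huv
  exact hι (congrArg (fun t : fibre ω ω' => (t : G × G').1) huv)

/-- The point `γ''` of `P` on `B ⊗ B'` containing `i''` is the product `γ × γ'` of the points
containing `i` and `i'`: `Br_P(γ) ⊗ Br_P(γ') ⊆ Br_P(γ'')`. -/
def IsProductPoint [IsLocalRing O] {ω : G →* Γ} {ω' : G' →* Γ} {b : InvIdem O ω}
    {b' : InvIdem O ω'} {ι : P →* G} {ι' : P →* G'} (h : ∀ u, ω (ι u) = ω' (ι' u))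
    (hι : Function.Injective ι) (i : fixedSub b ι) (i' : fixedSub b' ι')
    (i'' : fixedSub (prodIdem b b') (diagP ι ι' h)) : Prop :=
  ∀ j ∈ conjClass i, ∀ j' ∈ conjClass i', ∃ w : fixedSub (prodIdem b b') (diagP ι ι' h),
    valB (prodIdem b b') w.1 = tens ω ω' (valB b j.1) (valB b' j'.1) ∧
    ∃ j'' ∈ conjClass i'', brP (diagP_injective h hι) i'' w = brP (diagP_injective h hι) i'' j''

end Fibre

end BlockExt

end

/-!
Each of the graded algebras `ℰ`, `ℰ̄`, `ℰ̄(P)` and `ℱ` is a corner of a crossed product: it is spanned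
by symbols `e r n e`, where `r` runs through `B^P` or one of its quotients and `n` through the
stabilizer `N_G(P_γ)`. This is the structure `Pres`. A homomorphism of coefficient algebras that
respects the action of the normalizer, the structural map and the idempotent induces a homomorphism
of the graded algebras (`Pres.hom`), and an isomorphism if it is bijective (`Pres.iso`). Thus the
theorem is about coefficient algebras and normalizers.

For the fusions, an isomorphism of `A i` with a twist of itself is right multiplication by some
`a ∈ A`, with inverse `a'`, and `i = a' a` is a sum over `P`-orbits of elements of `G`. Since `i` is
not in the kernel of the Brauer map, some orbit is a fixed point with a contribution invertible in
the local ring `i B^P i`. That fixed point is an element of `N_G(P)`, and it stabilizes `γ` because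
equivalent local idempotents are conjugate (`exists_degHom_eq`, with the converse
`degHom_mem_fusF`). Hence `F ≃ E`, and `ℱ` gets the presentation `presF` over `B^P`. The map `ℱ → ℰ̄` induced by
`B^P → B(P_γ)` has the graded radical as its kernel, because an element of the local ring `i B^P i`
outside the maximal ideal is invertible (`mem_gradedRadical_calF_iff`); this gives `θ`. The
isomorphism `B(P_γ) ≃ B(P) b_γ / m^*` (`equivBPm`) gives `η`.

For the product, send `(c, c') ∈ C_H(P) × C_{H'}(P)` to the tensor product of its images, and
the other elements of `H × H'` to `0`. The linear extension is a homomorphism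
`(B ⊗ B')^P → B(P_γ) ⊗ B'(P_γ')` (`prodHom`), since the terms of a product that are not fixed by `P`
come in orbits of length divisible by `p` (`groupLin_mul`). Its kernel is the maximal ideal
attached to `γ''`. As `k` is not assumed to be algebraically closed, `B(P_γ) ⊗ B'(P_γ')` has to be
shown to be simple, and this holds because `γ''` is a point: `B(P_γ)` is spanned by the image of
the finite ring `𝔽_p C_H(P)` and is therefore separable (`isSepAlg_algBPγ`), so the ideals of the
tensor product are generated by central idempotents, and the image of the local idempotent `i''` is
conjugate to `ī ⊗ ī'`, which no central idempotent can split (`ker_eq_maxIdealOf`). The result is an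
equivariant isomorphism `B''(P_γ'') ≃ B(P_γ) ⊗ B'(P_γ')` (`prodEquiv`).

Pairs in `N_G(P_γ) × N_{G'}(P_γ')` that lie in the fibre product and induce the same automorphism of
`P` stabilize `γ''` (`IsProductPoint.mem_normP`), whence `K ≤ F''`. Conversely the stabilizer of
`γ''` over `K` projects to those of `γ` and `γ'`, so that `prodEquiv` induces the isomorphism `β`
(`nonempty_isoEbar`). The isomorphisms `α` and `δ` are obtained by transport of `β` along `θ` and
`η`, which makes both squares commute.
-/

open scoped TensorProduct

noncomputable section

namespace BlockExt

/-! ### Local idempotents in finite algebras over a complete local ring -/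

section LocalIdem

/-- `x` is invertible in the corner `e R e`. -/
def CornerUnit {R : Type*} [Ring R] (e x : R) : Prop :=
  ∃ y, e * y = y ∧ y * e = y ∧ x * y = e ∧ y * x = e

/-- An idempotent `e` for which the corner `e R e` is a local ring. -/
structure IsLocalIdem {R : Type*} [Ring R] (e : R) : Prop where
  idem : IsIdempotentElem e
  ne_zero : e ≠ 0
  dichotomy : ∀ x, e * x = x → x * e = x → CornerUnit e x ∨ CornerUnit e (e - x)

theorem isAdicComplete_of_finite {O : Type*} [CommRing O] [IsNoetherianRing O]
    (I : Ideal O) [IsAdicComplete I O] (M : Type*) [AddCommGroup M] [Module O M]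
    [Module.Finite O M] : IsAdicComplete I M := by
  have hH : IsHausdorff I M := IsHausdorff.of_le_jacobson _ _ (IsAdicComplete.le_jacobson_bot I)
  have hP : IsPrecomplete I M := by
    rw [← AdicCompletion.of_surjective_iff]
    intro y
    obtain ⟨z, rfl⟩ := AdicCompletion.ofTensorProduct_surjective_of_finite I M y
    induction z with
    | zero => exact ⟨0, by simp⟩
    | add a b ha hb =>
      obtain ⟨x, hx⟩ := ha
      obtain ⟨y, hy⟩ := hb
      exact ⟨x + y, by rw [map_add, map_add, hx, hy]⟩
    | tmul r m =>
      obtain ⟨s, rfl⟩ := AdicCompletion.of_surjective I O r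
      refine ⟨s • m, ?_⟩
      rw [AdicCompletion.ofTensorProduct_tmul]
      ext n
      simp only [map_smul, AdicCompletion.smul_eval, AdicCompletion.of_apply]
      rfl
  exact { toIsHausdorff := hH, toIsPrecomplete := hP }

variable {O : Type*} [CommRing O] [IsNoetherianRing O] [IsLocalRing O]
  [IsAdicComplete (IsLocalRing.maximalIdeal O) O]

omit [IsNoetherianRing O] [IsAdicComplete (IsLocalRing.maximalIdeal O) O] in
theorem isArtinianRing_quotient_map {S : Type*} [CommRing S] [Algebra O S] [Module.Finite O S] :
    IsArtinianRing (S ⧸ (IsLocalRing.maximalIdeal O).map (algebraMap O S)) := by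
  let _ : Algebra (O ⧸ IsLocalRing.maximalIdeal O)
    (S ⧸ (IsLocalRing.maximalIdeal O).map (algebraMap O S)) :=
      Ideal.Quotient.algebraQuotientOfLEComap Ideal.le_comap_map
  have : IsScalarTower O (O ⧸ IsLocalRing.maximalIdeal O)
      (S ⧸ (IsLocalRing.maximalIdeal O).map (algebraMap O S)) :=
    IsScalarTower.of_algebraMap_eq fun r => rfl
  have hfin : Module.Finite (O ⧸ IsLocalRing.maximalIdeal O)
      (S ⧸ (IsLocalRing.maximalIdeal O).map (algebraMap O S)) :=
    Module.Finite.of_restrictScalars_finite O _ _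
  have hart0 : IsArtinianRing (O ⧸ IsLocalRing.maximalIdeal O) :=
    inferInstanceAs (IsArtinianRing (IsLocalRing.ResidueField O))
  exact IsArtinianRing.of_finite (O ⧸ IsLocalRing.maximalIdeal O) _

open Polynomial in
/-- Idempotents lift along a Henselian pair, by Hensel's lemma for `X ^ 2 - X`. -/
theorem exists_idem_lift {S : Type*} [CommRing S] (I : Ideal S) [hen : HenselianRing S I]
    (a : S ⧸ I) (ha : IsIdempotentElem a) :
    ∃ e : S, IsIdempotentElem e ∧ Ideal.Quotient.mk I e = a := by
  obtain ⟨e0, rfl⟩ := Ideal.Quotient.mk_surjective a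
  have hmem : e0 * e0 - e0 ∈ I := by
    rw [← Ideal.Quotient.eq, map_mul]
    exact ha
  have hmon : (X ^ 2 - X : S[X]).Monic := by
    rcases subsingleton_or_nontrivial S with hS | hS
    · exact Subsingleton.elim _ _
    · refine (monic_X_pow 2).sub_of_left ?_
      rw [degree_X_pow, degree_X]
      exact_mod_cast one_lt_two
  have hunit : IsUnit (Ideal.Quotient.mk I ((derivative (X ^ 2 - X : S[X])).eval e0)) := by
    have : Ideal.Quotient.mk I ((derivative (X ^ 2 - X : S[X])).eval e0)
        = 2 * Ideal.Quotient.mk I e0 - 1 := by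
      rw [derivative_sub, derivative_X_pow, derivative_X]
      simp [map_ofNat]
    rw [this]
    refine IsUnit.of_mul_eq_one (2 * Ideal.Quotient.mk I e0 - 1) ?_
    have := ha.eq
    linear_combination 4 * this
  obtain ⟨e, he, hee⟩ := hen.is_henselian (X ^ 2 - X) hmon e0 (by
    simpa [pow_two] using hmem) hunit
  refine ⟨e, ?_, Ideal.Quotient.eq.mpr hee⟩
  have := he.eq_zero
  simp only [eval_sub, eval_pow, eval_X] at this
  change e * e = e
  linear_combination this

theorem exists_pow_idem {S : Type*} [CommRing S] [IsArtinianRing S] (a : S) :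
    ∃ y : S, ∃ n : ℕ, a ^ n * (a * y) = a ^ n ∧ IsIdempotentElem (a ^ n * y ^ n) ∧
      a ^ n * (a ^ n * y ^ n) = a ^ n := by
  obtain ⟨n, y, hy⟩ := IsArtinian.exists_pow_succ_smul_dvd a (1 : S)
  simp only [smul_eq_mul, mul_one, Nat.succ_eq_add_one] at hy
  have h1 : ∀ k, a ^ (n + k) * y ^ k = a ^ n := by
    intro k
    induction k with
    | zero => simp
    | succ k ih =>
      calc a ^ (n + (k + 1)) * y ^ (k + 1) = (a ^ (n + 1) * y) * (a ^ k * y ^ k) := by ring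
        _ = a ^ (n + k) * y ^ k := by rw [hy]; ring
        _ = _ := ih
  refine ⟨y, n, by rw [← hy]; linear_combination (a * y) * hy, ?_, by
    rw [← mul_assoc, ← pow_add, h1]⟩
  change a ^ n * y ^ n * (a ^ n * y ^ n) = _
  calc _ = (a ^ (n + n) * y ^ n) * y ^ n := by ring
    _ = _ := by rw [h1]

/-- A finite commutative algebra over a complete local ring without nontrivial idempotents is
local. -/
theorem isUnit_or_isUnit_one_sub {S : Type*} [CommRing S] [Algebra O S] [Module.Finite O S]
    (h : ∀ e : S, IsIdempotentElem e → e = 0 ∨ e = 1) (x : S) : IsUnit x ∨ IsUnit (1 - x) := by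
  have hcI : IsAdicComplete ((IsLocalRing.maximalIdeal O).map (algebraMap O S)) S :=
    (IsAdicComplete.map_algebraMap_iff (IsLocalRing.maximalIdeal O) S).mpr
      (isAdicComplete_of_finite _ S)
  have hart := isArtinianRing_quotient_map (O := O) (S := S)
  generalize (IsLocalRing.maximalIdeal O).map (algebraMap O S) = I at hcI hart
  have hen : HenselianRing S I := inferInstance
  have hloc : IsLocalHom (Ideal.Quotient.mk I) := isLocalHom_of_le_jacobson_bot I hen.jac
  obtain ⟨y, n, h1, h2, h3⟩ := exists_pow_idem (Ideal.Quotient.mk I x)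
  obtain ⟨e, he, heq⟩ := exists_idem_lift I _ h2
  rcases h e he with h0 | h0
  · right
    apply hloc.map_nonunit
    rw [h0, map_zero] at heq
    rw [← heq, mul_zero] at h3
    rw [map_sub, map_one]
    exact IsNilpotent.isUnit_one_sub ⟨n, h3.symm⟩
  · left
    apply hloc.map_nonunit
    rw [h0, map_one] at heq
    have h4 : IsUnit ((Ideal.Quotient.mk I x) ^ n) := IsUnit.of_mul_eq_one _ heq.symm
    exact IsUnit.of_mul_eq_one y (h4.mul_left_cancel (by rw [h1, mul_one]))

/-- A ring that is a finite algebra over a complete local ring and has no nontrivial idempotents is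
local. -/
theorem isUnit_or_isUnit_one_sub_of_ring {S : Type*} [Ring S] [Algebra O S] [Module.Finite O S]
    (h : ∀ e : S, IsIdempotentElem e → e = 0 ∨ e = 1) (x : S) : IsUnit x ∨ IsUnit (1 - x) := by
  let f := Polynomial.aeval (R := O) x
  let Q := Polynomial O ⧸ RingHom.ker f
  let g : Q →ₐ[O] S := Ideal.kerLiftAlg f
  have hg : Function.Injective g := Ideal.kerLiftAlg_injective f
  have : Module.Finite O Q := Module.Finite.of_injective g.toLinearMap hg
  have hx : g (Ideal.Quotient.mk _ Polynomial.X) = x := by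
    change Polynomial.aeval x Polynomial.X = x
    simp
  have hQ : ∀ e : Q, IsIdempotentElem e → e = 0 ∨ e = 1 := by
    intro e he
    rcases h (g e) (he.map g) with h1 | h1
    · exact Or.inl (hg (h1.trans (map_zero g).symm))
    · exact Or.inr (hg (h1.trans (map_one g).symm))
  rcases isUnit_or_isUnit_one_sub (O := O) hQ (Ideal.Quotient.mk _ Polynomial.X) with h1 | h1
  · left
    rw [← hx]
    exact h1.map g
  · right
    have := h1.map g
    rwa [map_sub, map_one, hx] at this

theorem finite_corner {O : Type*} [CommRing O] [IsNoetherianRing O] {R : Type*} [Ring R]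
    [Algebra O R] [Module.Finite O R] {e : R}
    (he : IsIdempotentElem e) : Module.Finite O he.Corner :=
  Module.Finite.of_injective
    ({ toFun := cornerIncl he, map_add' := fun _ _ => rfl, map_smul' := fun _ _ => rfl } :
      he.Corner →ₗ[O] R) Subtype.val_injective

theorem IsPrimitiveIdem.isLocalIdem (O : Type*) [CommRing O] [IsNoetherianRing O] [IsLocalRing O]
    [IsAdicComplete (IsLocalRing.maximalIdeal O) O] {R : Type*} [Ring R] [Algebra O R]
    [Module.Finite O R] {e : R} (he : IsPrimitiveIdem e) : IsLocalIdem e := by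
  obtain ⟨hi, h0, hp⟩ := he
  refine ⟨hi, h0, fun x h1 h2 => ?_⟩
  have := finite_corner (O := O) hi
  have key : ∀ z : hi.Corner, IsUnit z → CornerUnit e (cornerIncl hi z) := by
    rintro _ ⟨u, rfl⟩
    refine ⟨cornerIncl hi (↑u⁻¹ : hi.Corner), corner_left _ _, corner_right _ _, ?_, ?_⟩
    · exact congrArg (cornerIncl hi) u.mul_inv
    · exact congrArg (cornerIncl hi) u.inv_mul
  have hS : ∀ f : hi.Corner, IsIdempotentElem f → f = 0 ∨ f = 1 := by
    intro f hf
    rcases hp (cornerIncl hi f) (hf.map (cornerIncl hi)) (corner_left _ _) (corner_right _ _) with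
      h | h
    · exact Or.inl (corner_ext hi h)
    · exact Or.inr (corner_ext hi h)
  exact (isUnit_or_isUnit_one_sub_of_ring (O := O) hS (toCorner hi x h1 h2)).imp (key _) (key _)

end LocalIdem

/-! ### Conjugacy of local idempotents -/

section Conj

variable {R : Type*} [Ring R]

theorem conjClass_refl (e : R) : e ∈ conjClass e := ⟨1, by simp⟩

theorem conjClass_symm {e f : R} (h : f ∈ conjClass e) : e ∈ conjClass f := by
  obtain ⟨a, rfl⟩ := h
  exact ⟨a⁻¹, by simp [mul_assoc]⟩

theorem conjClass_trans {e f g : R} (h : f ∈ conjClass e) (h' : g ∈ conjClass f) :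
    g ∈ conjClass e := by
  obtain ⟨a, rfl⟩ := h
  obtain ⟨c, rfl⟩ := h'
  exact ⟨c * a, by simp [mul_assoc]⟩

theorem mem_conjClass_of_inverse {e f u v : R} (h1 : u * v = 1) (h2 : v * u = 1)
    (h : u * e = f * u) : f ∈ conjClass e := by
  refine ⟨⟨u, v, h1, h2⟩, ?_⟩
  change f = u * e * v
  rw [h, mul_assoc, h1, mul_one]

/-- If `e ↦ f` and `f ↦ e` induce mutually inverse isomorphisms between `R e` and `R f`, then `e`
and `f` are conjugate. -/
theorem conj_of_corner_inverse {e f c : R} (he : IsIdempotentElem e) (hf : IsIdempotentElem f)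
    (h2 : c * e = c) (h3 : e * f * c = e) (h4 : f * c * f = f) :
    f ∈ conjClass e := by
  have he' := he.eq
  have hf' := hf.eq
  have a1 : f * c * e = f * c := by rw [mul_assoc, h2]
  have a2 : f * (f * c) = f * c := by rw [← mul_assoc, hf']
  have a3 : e * (f * c) = e := by rw [← mul_assoc, h3]
  have a4 : f * c * (f * c) = f * c := by rw [← mul_assoc, h4]
  have hff : f * (1 - f) = 0 := by rw [mul_sub, mul_one, hf', sub_self]
  refine mem_conjClass_of_inverse (u := f * c + (1 - f) * (1 - e)) (v := e * f + 1 - f * c)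
    ?_ ?_ ?_
  · have b1 : f * c * (e * f) = f := by rw [← mul_assoc, a1, h4]
    have b2 : (1 - f) * (1 - e) * (e * f) = 0 := by
      have : (1 - e) * (e * f) = 0 := by rw [sub_mul, one_mul, ← mul_assoc, he', sub_self]
      rw [mul_assoc, this, mul_zero]
    have b3 : (1 - f) * (1 - e) * (1 - f * c) = 1 - f := by
      have : (1 - e) * (1 - f * c) = 1 - f * c := by
        rw [sub_mul, one_mul, mul_sub, mul_one, a3, sub_self, sub_zero]
      rw [mul_assoc, this, sub_mul, one_mul, mul_sub, mul_one, a2]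
      abel
    rw [add_sub_assoc, mul_add, add_mul, add_mul, b1, b2, b3, mul_sub, mul_one, a4]
    abel
  · have b1 : e * f * (f * c) = e := by rw [mul_assoc, a2, a3]
    have b2 : e * f * ((1 - f) * (1 - e)) = 0 := by
      rw [← mul_assoc, mul_assoc e f, hff, mul_zero, zero_mul]
    have b3 : (1 - f * c) * ((1 - f) * (1 - e)) = 1 - e := by
      have : (1 - f * c) * (1 - f) = 1 - f * c := by
        rw [sub_mul, one_mul, mul_sub, mul_one, h4]; abel
      rw [← mul_assoc, this, mul_sub, mul_one, sub_mul, one_mul, a1]; abel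
    have b4 : (1 - f * c) * (f * c) = 0 := by rw [sub_mul, one_mul, a4, sub_self]
    rw [add_sub_assoc, add_mul, mul_add, mul_add, b1, b2, b3, b4]
    abel
  · rw [add_mul, mul_add, a1, a2, mul_assoc, sub_mul 1 e e, one_mul, he', sub_self, mul_zero,
      ← mul_assoc, hff, zero_mul]

/-- Orthogonal equivalent idempotents are conjugate. -/
theorem conj_of_orthogonal {e f a b : R} (he : IsIdempotentElem e) (hf : IsIdempotentElem f)
    (hef : e * f = 0) (hfe : f * e = 0) (h1 : e * a = a) (h2 : a * f = a) (h3 : f * b = b)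
    (h4 : b * e = b) (h5 : a * b = e) (h6 : b * a = f) : f ∈ conjClass e := by
  have he' := he.eq
  have hf' := hf.eq
  have k1 : a * a = 0 := by
    calc a * a = a * f * (e * a) := by rw [h1, h2]
      _ = a * (f * e) * a := by noncomm_ring
      _ = 0 := by rw [hfe, mul_zero, zero_mul]
  have k2 : b * b = 0 := by
    calc b * b = b * e * (f * b) := by rw [h3, h4]
      _ = b * (e * f) * b := by noncomm_ring
      _ = 0 := by rw [hef, mul_zero, zero_mul]
  have k3 : a * e = 0 := by rw [← h2, mul_assoc, hfe, mul_zero]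
  have k4 : f * a = 0 := by rw [← h1, ← mul_assoc, hfe, zero_mul]
  have k5 : b * f = 0 := by rw [← h4, mul_assoc, hef, mul_zero]
  have k6 : e * b = 0 := by rw [← h3, ← mul_assoc, hef, zero_mul]
  have hu : (a + b + 1 - e - f) * (a + b + 1 - e - f) = 1 := by
    have : (a + b + 1 - e - f) * (a + b + 1 - e - f) = a * a + a * b + a - a * e - a * f
        + (b * a + b * b + b - b * e - b * f) + (a + b + 1 - e - f)
        - (e * a + e * b + e - e * e - e * f) - (f * a + f * b + f - f * e - f * f) := by
      noncomm_ring
    rw [this, k1, k2, k3, k4, k5, k6, h1, h2, h3, h4, h5, h6, hef, hfe, he', hf']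
    abel
  refine mem_conjClass_of_inverse hu hu ?_
  have l1 : (a + b + 1 - e - f) * e = b := by
    have : (a + b + 1 - e - f) * e = a * e + b * e + e - e * e - f * e := by noncomm_ring
    rw [this, k3, h4, he', hfe]; abel
  have l2 : f * (a + b + 1 - e - f) = b := by
    have : f * (a + b + 1 - e - f) = f * a + f * b + f - f * e - f * f := by noncomm_ring
    rw [this, k4, h3, hf', hfe]; abel
  rw [l1, l2]

theorem IsLocalIdem.eq_zero_or_eq {e f : R} (he : IsLocalIdem e) (hf : IsIdempotentElem f)
    (h1 : e * f = f) (h2 : f * e = f) : f = 0 ∨ f = e := by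
  have key : ∀ g : R, IsIdempotentElem g → g * e = g → CornerUnit e g → g = e := by
    rintro g hg h ⟨y, -, -, hy, -⟩
    calc g = g * e := h.symm
      _ = g * (g * y) := by rw [hy]
      _ = e := by rw [← mul_assoc, hg.eq, hy]
  rcases he.dichotomy f h1 h2 with h | h
  · exact Or.inr (key f hf h2 h)
  · left
    have hg : IsIdempotentElem (e - f) := by
      change (e - f) * (e - f) = _
      rw [mul_sub, sub_mul, sub_mul, he.idem.eq, h1, h2, hf.eq]; abel
    have := key _ hg (by rw [sub_mul, he.idem.eq, h2]) h
    simpa using this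

/-- One-sided inverses in a local corner are two-sided. -/
theorem IsLocalIdem.cornerUnit_of_mul_eq {e x y : R} (he : IsLocalIdem e) (hx : e * x = x)
    (hx' : x * e = x) (hy : e * y = y) (hy' : y * e = y) (h : x * y = e) : CornerUnit e x := by
  refine ⟨y, hy, hy', h, ?_⟩
  have hi : IsIdempotentElem (y * x) := by
    change y * x * (y * x) = y * x
    rw [mul_assoc, ← mul_assoc x, h, hx]
  rcases he.eq_zero_or_eq hi (by rw [← mul_assoc, hy]) (by rw [mul_assoc, hx']) with h0 | h0
  · refine absurd ?_ he.ne_zero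
    calc e = x * y * (x * y) := by rw [h, he.idem.eq]
      _ = x * (y * x) * y := by noncomm_ring
      _ = 0 := by rw [h0, mul_zero, zero_mul]
  · exact h0

theorem IsLocalIdem.cornerUnit_of_mul_eq' {e x y : R} (he : IsLocalIdem e) (hx : e * x = x)
    (hx' : x * e = x) (hy : e * y = y) (hy' : y * e = y) (h : y * x = e) : CornerUnit e x := by
  obtain ⟨z, hz, hz', h1, h2⟩ := he.cornerUnit_of_mul_eq hy hy' hx hx' h
  refine ⟨y, hy, hy', ?_, h⟩
  have : z = x := by
    calc z = e * z := hz.symm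
      _ = z * y * z := by rw [h2]
      _ = z * (y * x) := by rw [mul_assoc, h1, h]
      _ = x := by rw [← mul_assoc, h2, hx]
  rw [← this, h2]

theorem IsLocalIdem.conj_of_cornerUnit {e f : R} (he : IsLocalIdem e) (hf : IsLocalIdem f)
    (h : CornerUnit e (e * f * e)) : f ∈ conjClass e := by
  obtain ⟨c, h1, h2, h3, h4⟩ := h
  have h3' : e * f * c = e := by rw [mul_assoc (e * f), h1] at h3; exact h3
  have hi : IsIdempotentElem (f * c * f) := by
    change f * c * f * (f * c * f) = _
    calc f * c * f * (f * c * f) = f * c * (f * f) * (c * f) := by noncomm_ring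
      _ = f * c * e * f * (c * f) := by rw [hf.idem.eq, mul_assoc f c e, h2]
      _ = f * c * (e * f * c) * f := by noncomm_ring
      _ = f * c * f := by rw [h3', mul_assoc f c e, h2]
  rcases hf.eq_zero_or_eq hi (by rw [← mul_assoc, ← mul_assoc, hf.idem.eq])
    (by rw [mul_assoc, hf.idem.eq]) with h0 | h0
  · refine absurd ?_ he.ne_zero
    calc e = e * f * c * (e * f * c) := by rw [h3', he.idem.eq]
      _ = e * f * (c * e) * f * c := by noncomm_ring
      _ = e * (f * c * f) * c := by rw [h2]; noncomm_ring
      _ = 0 := by rw [h0, mul_zero, zero_mul]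
  · exact conj_of_corner_inverse he.idem hf.idem h2 h3' h0

/-- Equivalent local idempotents are conjugate. -/
theorem IsLocalIdem.conj_of_equiv {e f a b : R} (he : IsLocalIdem e) (hf : IsLocalIdem f)
    (hab : a * b = e) (hba : b * a = f) : f ∈ conjClass e := by
  have hee := he.idem.eq
  have hff := hf.idem.eq
  rcases he.dichotomy (e * f * e) (by rw [← mul_assoc, ← mul_assoc, hee])
    (by rw [mul_assoc, hee]) with h | ⟨c, h1, h2, h3, h4⟩
  · exact he.conj_of_cornerUnit hf h
  · -- `e'' = h c h` with `h = 1 - f` is conjugate to `e` and orthogonal to `f`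
    set h := 1 - f with hh
    have hhh : h * h = h := by rw [hh, mul_sub, mul_one, sub_mul, one_mul, hff]; abel
    have hfh : f * h = 0 := by rw [hh, mul_sub, mul_one, hff, sub_self]
    have hhf : h * f = 0 := by rw [hh, sub_mul, one_mul, hff, sub_self]
    have e1 : e - e * f * e = e * h * e := by
      rw [hh, mul_sub, mul_one, sub_mul, hee]
    rw [e1] at h3 h4
    have h3' : e * h * c = e := by rw [mul_assoc (e * h), h1] at h3; exact h3
    have h4' : c * h * e = e := by rw [← mul_assoc, ← mul_assoc, h2] at h4; exact h4
    have hchc : c * h * c = c := by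
      calc c * h * c = c * h * e * c := by rw [mul_assoc (c * h), h1]
        _ = c := by rw [h4', h1]
    have hg : IsIdempotentElem (h * c * h) := by
      change h * c * h * (h * c * h) = _
      calc h * c * h * (h * c * h) = h * c * (h * h) * c * h := by noncomm_ring
        _ = h * (c * h * c) * h := by rw [hhh]; noncomm_ring
        _ = _ := by rw [hchc]
    have c1 : h * c * h ∈ conjClass e := by
      refine conj_of_corner_inverse he.idem hg h2 ?_ ?_
      · calc e * (h * c * h) * c = e * h * (c * h * c) := by noncomm_ring
          _ = e := by rw [hchc, h3']
      · calc h * c * h * c * (h * c * h) = h * (c * h * c) * h * c * h := by noncomm_ring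
          _ = h * c * h * c * h := by rw [hchc]
          _ = h * (c * h * c) * h := by noncomm_ring
          _ = _ := by rw [hchc]
    have c2 : f ∈ conjClass (h * c * h) := by
      have ea : e * a * f = e * a := by rw [mul_assoc, ← hba, ← mul_assoc a, hab, ← mul_assoc, hee]
      have eb : f * b * e = b * e := by rw [← hba, mul_assoc b, hab, mul_assoc, hee]
      have hbea : b * e * (e * a) = f := by
        calc b * e * (e * a) = b * (e * e) * a := by noncomm_ring
          _ = (b * a) * (b * a) := by rw [hee, ← hab]; noncomm_ring
          _ = f := by rw [hba, hff]
      have heab : e * a * (b * e) = e := by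
        calc e * a * (b * e) = e * (a * b) * e := by noncomm_ring
          _ = e := by rw [hab, hee, hee]
      refine conj_of_orthogonal (a := h * c * (e * a)) (b := b * e * h) hg hf.idem ?_ ?_ ?_ ?_ ?_
        ?_ ?_ ?_
      · rw [mul_assoc, hhf, mul_zero]
      · rw [← mul_assoc, ← mul_assoc, hfh, zero_mul, zero_mul]
      · calc h * c * h * (h * c * (e * a)) = h * c * (h * h) * c * (e * a) := by noncomm_ring
          _ = h * (c * h * c) * (e * a) := by rw [hhh]; noncomm_ring
          _ = _ := by rw [hchc]
      · rw [mul_assoc, ea]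
      · rw [← mul_assoc, ← mul_assoc, eb]
      · calc b * e * h * (h * c * h) = b * (e * (h * h) * c) * h := by noncomm_ring
          _ = b * e * h := by rw [hhh, h3']
      · calc h * c * (e * a) * (b * e * h) = h * c * (e * a * (b * e)) * h := by noncomm_ring
          _ = h * c * h := by rw [heab, mul_assoc h c, h2]
      · calc b * e * h * (h * c * (e * a)) = b * (e * (h * h) * c) * (e * a) := by noncomm_ring
          _ = f := by rw [hhh, h3', hbea]
    exact conjClass_trans c1 c2

end Conj

/-! ### The maximal ideal attached to a local idempotent -/

section MaxIdeal

variable {R : Type*} [Ring R]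

theorem mem_of_cornerUnit {e x : R} (h : CornerUnit e x) {I : TwoSidedIdeal R} (hx : x ∈ I) :
    e ∈ I := by
  obtain ⟨y, -, -, hy, -⟩ := h
  rw [← hy]
  exact I.mul_mem_right _ _ hx

theorem qmk_eq_zero_iff (I : TwoSidedIdeal R) (x : R) : InteriorAlgebra.qmk I x = 0 ↔ x ∈ I := by
  rw [TwoSidedIdeal.mem_iff]
  exact (I.ringCon.eq (a := x) (b := 0))

theorem qmk_eq_iff (I : TwoSidedIdeal R) (x y : R) :
    InteriorAlgebra.qmk I x = InteriorAlgebra.qmk I y ↔ x - y ∈ I := by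
  rw [← TwoSidedIdeal.rel_iff]
  exact I.ringCon.eq

theorem IsLocalIdem.cornerUnit_or_of_add {e x y : R} (he : IsLocalIdem e) (hx : e * x = x)
    (hx' : x * e = x) (hy : e * y = y) (hy' : y * e = y) (h : CornerUnit e (x + y)) :
    CornerUnit e x ∨ CornerUnit e y := by
  obtain ⟨z, hz, hz', h1, -⟩ := h
  have h2 : e - x * z = y * z := by rw [← h1, add_mul]; abel
  rcases he.dichotomy (x * z) (by rw [← mul_assoc, hx]) (by rw [mul_assoc, hz']) with
    ⟨w, hw, hw', h3, -⟩ | h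
  · left
    exact he.cornerUnit_of_mul_eq hx hx' (y := z * w) (by rw [← mul_assoc, hz])
      (by rw [mul_assoc, hw']) (by rw [← mul_assoc, h3])
  · right
    rw [h2] at h
    obtain ⟨w, hw, hw', h3, -⟩ := h
    exact he.cornerUnit_of_mul_eq hy hy' (y := z * w) (by rw [← mul_assoc, hz])
      (by rw [mul_assoc, hw']) (by rw [← mul_assoc, h3])

theorem CornerUnit.neg {e x : R} (h : CornerUnit e x) : CornerUnit e (-x) := by
  obtain ⟨y, h1, h2, h3, h4⟩ := h
  exact ⟨-y, by rw [mul_neg, h1], by rw [neg_mul, h2], by rw [neg_mul_neg, h3],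
    by rw [neg_mul_neg, h4]⟩

/-- The greatest two-sided ideal that does not contain the local idempotent `e`. -/
def greatestAvoiding {e : R} (he : IsLocalIdem e) : TwoSidedIdeal R :=
  TwoSidedIdeal.mk' {x | ∀ r s, ¬ CornerUnit e (e * r * x * s * e)}
    (by
      rintro r s ⟨y, -, -, h, -⟩
      rw [mul_zero, zero_mul, zero_mul, zero_mul] at h
      exact he.ne_zero h.symm)
    (by
      intro x y hx hy r s h
      rw [mul_add, add_mul, add_mul] at h
      have hl : ∀ t, e * (e * r * t * s * e) = e * r * t * s * e := fun t => by
        rw [← mul_assoc, ← mul_assoc, ← mul_assoc, ← mul_assoc, he.idem.eq]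
      have hr : ∀ t, e * r * t * s * e * e = e * r * t * s * e := fun t => by
        rw [mul_assoc, he.idem.eq]
      rcases he.cornerUnit_or_of_add (hl x) (hr x) (hl y) (hr y) h with h | h
      · exact hx r s h
      · exact hy r s h)
    (by
      intro x hx r s h
      apply hx r s
      have := h.neg
      simpa using this)
    (by
      intro x y hy r s h
      refine hy (r * x) s ?_
      have e1 : e * (r * x) * y * s * e = e * r * (x * y) * s * e := by noncomm_ring
      rwa [e1])
    (by
      intro x y hx r s h
      refine hx r (y * s) ?_
      have e1 : e * r * x * (y * s) * e = e * r * (x * y) * s * e := by noncomm_ring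
      rwa [e1])

theorem mem_greatestAvoiding {e : R} (he : IsLocalIdem e) (x : R) :
    x ∈ greatestAvoiding he ↔ ∀ r s, ¬ CornerUnit e (e * r * x * s * e) := by
  unfold greatestAvoiding
  rw [TwoSidedIdeal.mem_mk']
  rfl

theorem not_mem_greatestAvoiding {e : R} (he : IsLocalIdem e) : e ∉ greatestAvoiding he := by
  rw [mem_greatestAvoiding]
  intro h
  refine h 1 1 ⟨e, he.idem, he.idem, ?_, ?_⟩ <;> simp [he.idem.eq]

theorem le_greatestAvoiding {e : R} (he : IsLocalIdem e) {I : TwoSidedIdeal R} (h : e ∉ I) :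
    I ≤ greatestAvoiding he := by
  intro x hx
  rw [mem_greatestAvoiding]
  intro r s hu
  exact h (mem_of_cornerUnit hu
    (I.mul_mem_right _ _ (I.mul_mem_right _ _ (I.mul_mem_left _ _ hx))))

/-- Every ideal properly containing the greatest ideal avoiding `e` is the unit ideal: the quotient
`Q` has the faithful simple left ideal `Q e`, of which `Q` embeds into a finite power since `R` is
a finite algebra. Hence `Q` is a semisimple ring in which `e` meets every nonzero ideal. -/
theorem isCoatom_greatestAvoiding (O : Type*) [CommRing O] [Algebra O R] [Module.Finite O R]
    {e : R} (he : IsLocalIdem e) : IsCoatom (greatestAvoiding he) := by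
  set J := greatestAvoiding he with hJ
  let Q := J.ringCon.Quotient
  let q : R → Q := InteriorAlgebra.qmk J
  have hq0 : ∀ x, q x = 0 ↔ x ∈ J := qmk_eq_zero_iff J
  have hqm : ∀ x y, q (x * y) = q x * q y := fun _ _ => rfl
  have hqs : Function.Surjective q := InteriorAlgebra.qmk_surj J
  let S : Submodule Q Q := Ideal.span {q e}
  have hS : ∀ z, z ∈ S ↔ ∃ r, z = q (r * e) := by
    intro z
    rw [Ideal.mem_span_singleton']
    constructor
    · rintro ⟨a, rfl⟩
      obtain ⟨r, rfl⟩ := hqs a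
      exact ⟨r, rfl⟩
    · rintro ⟨r, rfl⟩
      exact ⟨q r, rfl⟩
  have hsimple : IsSimpleModule Q S := by
    rw [isSimpleModule_iff_isAtom]
    refine ⟨?_, ?_⟩
    · intro hbot
      have : q e ∈ S := (hS _).mpr ⟨1, by rw [one_mul]⟩
      rw [hbot, Submodule.mem_bot, hq0] at this
      exact not_mem_greatestAvoiding he this
    · intro L hL
      by_contra hne
      obtain ⟨z, hz, hz0⟩ := L.ne_bot_iff.mp hne
      obtain ⟨r, rfl⟩ := (hS z).mp (hL.le hz)
      rw [Ne, hq0, hJ, mem_greatestAvoiding] at hz0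
      push Not at hz0
      obtain ⟨a, s, hu⟩ := hz0
      -- a unit of the corner of the form `e a r e s e` has `e a r e` as a unit
      have h1 : CornerUnit e (e * a * (r * e)) := by
        obtain ⟨y, hy, hy', h1, h2⟩ := hu
        refine he.cornerUnit_of_mul_eq (y := e * s * e * y) ?_ ?_ ?_ ?_ ?_
        · rw [mul_assoc e a, ← mul_assoc e e, he.idem.eq]
        · rw [mul_assoc, mul_assoc r, he.idem.eq]
        · rw [← mul_assoc, ← mul_assoc, ← mul_assoc, he.idem.eq]
        · rw [mul_assoc, hy']
        · have : e * a * (r * e) * (e * s * e * y) = e * a * (r * (e * e)) * s * e * y := by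
            noncomm_ring
          rw [this, he.idem.eq, h1]
      obtain ⟨y, hy, hy', h1, h2⟩ := h1
      have h3 : q e ∈ L := by
        rw [← h2]
        have h4 : q (y * (e * a * (r * e))) = q (y * (e * a)) • q (r * e) := by
          rw [smul_eq_mul, ← hqm]
          congr 1
          noncomm_ring
        rw [h4]
        exact L.smul_mem _ hz
      exact absurd (Ideal.span_le.mpr (Set.singleton_subset_iff.mpr h3)) hL.not_ge
  have hss : IsSemisimpleRing Q := by
    obtain ⟨n, s, hs⟩ := Module.Finite.exists_fin (R := O) (M := R)
    let f : Q →ₗ[Q] (Fin n → S) := LinearMap.pi fun j =>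
      (LinearMap.toSpanSingleton Q S ⟨q (s j * e), (hS _).mpr ⟨_, rfl⟩⟩)
    refine IsSemisimpleModule.of_injective f ?_
    rw [← LinearMap.ker_eq_bot, Submodule.eq_bot_iff]
    intro x hx
    obtain ⟨r, rfl⟩ := hqs x
    have h1 : ∀ j, q (r * (s j * e)) = 0 := by
      intro j
      have := congrArg Subtype.val (congrFun (LinearMap.mem_ker.mp hx) j)
      exact this
    have h2 : ∀ t, r * (t * e) ∈ J := by
      intro t
      have ht : t ∈ Submodule.span O (Set.range s) := by rw [hs]; trivial
      induction ht using Submodule.span_induction with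
      | mem x hx => obtain ⟨j, rfl⟩ := hx; exact (hq0 _).mp (h1 j)
      | zero => rw [zero_mul, mul_zero]; exact J.zero_mem
      | add x y _ _ hx hy => rw [add_mul, mul_add]; exact J.add_mem hx hy
      | smul a x _ hx =>
        rw [smul_mul_assoc, mul_smul_comm, Algebra.smul_def]
        exact J.mul_mem_left _ _ hx
    rw [hq0, hJ, mem_greatestAvoiding]
    intro a t hu
    refine not_mem_greatestAvoiding he (mem_of_cornerUnit hu ?_)
    have : e * a * r * t * e = e * a * (r * (t * e)) := by noncomm_ring
    rw [this]
    exact J.mul_mem_left _ _ (h2 t)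
  refine ⟨fun h => not_mem_greatestAvoiding he (by rw [← hJ, h]; trivial), fun I hI => ?_⟩
  have heI : e ∈ I := by
    by_contra h
    exact absurd (le_greatestAvoiding he h) hI.not_ge
  -- the image of `I` in `Q` as a left ideal
  let L : Submodule Q Q :=
    { carrier := {z | ∃ x ∈ I, z = q x}
      add_mem' := by
        rintro _ _ ⟨x, hx, rfl⟩ ⟨y, hy, rfl⟩
        exact ⟨x + y, I.add_mem hx hy, rfl⟩
      zero_mem' := ⟨0, I.zero_mem, rfl⟩
      smul_mem' := by
        rintro c _ ⟨x, hx, rfl⟩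
        obtain ⟨c, rfl⟩ := hqs c
        exact ⟨c * x, I.mul_mem_left _ _ hx, rfl⟩ }
  obtain ⟨L', hL'⟩ := exists_isCompl L
  obtain ⟨a, ha, l, hl, hal⟩ := Submodule.mem_sup.mp
    (show (1 : Q) ∈ L ⊔ L' by rw [hL'.sup_eq_top]; trivial)
  obtain ⟨x, hx, rfl⟩ := ha
  obtain ⟨y, rfl⟩ := hqs l
  have hy : y ∈ J := by
    rw [hJ, mem_greatestAvoiding]
    intro r s hu
    have h1 : e * r * y ∈ J := by
      rw [← hq0]
      have h2 : q (e * r * y) ∈ L := ⟨_, I.mul_mem_right _ _ (I.mul_mem_right _ _ heI), rfl⟩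
      have h3 : q (e * r * y) ∈ L' := L'.smul_mem (q (e * r)) hl
      have := Submodule.mem_inf.mpr ⟨h2, h3⟩
      rwa [hL'.inf_eq_bot] at this
    exact not_mem_greatestAvoiding he (mem_of_cornerUnit hu
      (J.mul_mem_right _ _ (J.mul_mem_right _ _ h1)))
  have h1 : (1 : R) - x ∈ J := by
    rw [← qmk_eq_iff]
    change q 1 = q x
    rw [(hq0 y).mpr hy, add_zero] at hal
    exact hal.symm
  have h2 : (1 : R) ∈ I := by
    have := I.add_mem (hI.le h1) hx
    rwa [sub_add_cancel] at this
  rw [eq_top_iff]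
  intro z _
  have := I.mul_mem_left z _ h2
  rwa [mul_one] at this

theorem maxIdealOf_eq (O : Type*) [CommRing O] [Algebra O R] [Module.Finite O R]
    {e : R} (he : IsLocalIdem e) : maxIdealOf e = greatestAvoiding he := by
  refine le_antisymm (sSup_le fun I hI => le_greatestAvoiding he hI.2) ?_
  exact le_sSup ⟨isCoatom_greatestAvoiding O he, not_mem_greatestAvoiding he⟩

theorem not_mem_maxIdealOf (O : Type*) [CommRing O] [Algebra O R] [Module.Finite O R]
    {e : R} (he : IsLocalIdem e) : e ∉ maxIdealOf e := by
  rw [maxIdealOf_eq O he]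
  exact not_mem_greatestAvoiding he

theorem le_maxIdealOf (O : Type*) [CommRing O] [Algebra O R] [Module.Finite O R]
    {e : R} (he : IsLocalIdem e) {I : TwoSidedIdeal R} (h : e ∉ I) : I ≤ maxIdealOf e := by
  rw [maxIdealOf_eq O he]
  exact le_greatestAvoiding he h

theorem isCoatom_maxIdealOf (O : Type*) [CommRing O] [Algebra O R] [Module.Finite O R]
    {e : R} (he : IsLocalIdem e) : IsCoatom (maxIdealOf e) := by
  rw [maxIdealOf_eq O he]
  exact isCoatom_greatestAvoiding O he

theorem cornerUnit_of_not_mem_maxIdealOf (O : Type*) [CommRing O] [Algebra O R]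
    [Module.Finite O R] {e x : R} (he : IsLocalIdem e) (h1 : e * x = x) (h2 : x * e = x)
    (h : x ∉ maxIdealOf e) : CornerUnit e x := by
  rw [maxIdealOf_eq O he, mem_greatestAvoiding] at h
  push Not at h
  obtain ⟨r, s, hu⟩ := h
  have e1 : e * r * x * s * e = e * r * e * (x * (e * s * e)) := by
    calc e * r * x * s * e = e * r * (e * x * e) * s * e := by rw [h1, h2]
      _ = _ := by noncomm_ring
  rw [e1] at hu
  obtain ⟨y, hy, hy', h3, h4⟩ := hu
  have hee := he.idem.eq
  have h5 : CornerUnit e (x * (e * s * e)) := by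
    refine he.cornerUnit_of_mul_eq' (y := y * (e * r * e)) ?_ ?_ ?_ ?_ ?_
    · rw [← mul_assoc, h1]
    · rw [mul_assoc, mul_assoc, hee]
    · rw [← mul_assoc, hy]
    · rw [mul_assoc, mul_assoc, hee]
    · rw [mul_assoc, h4]
  obtain ⟨z, hz, hz', h6, -⟩ := h5
  exact he.cornerUnit_of_mul_eq h1 h2 (y := e * s * e * z)
    (by rw [← mul_assoc, ← mul_assoc, ← mul_assoc, hee]) (by rw [mul_assoc, hz'])
    (by rw [← mul_assoc, h6])

/-- Local idempotents that are congruent modulo an ideal not containing them are conjugate. -/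
theorem IsLocalIdem.conj_of_sub_mem {e f : R} (he : IsLocalIdem e) (hf : IsLocalIdem f)
    {I : TwoSidedIdeal R} (heI : e ∉ I) (h : e - f ∈ I) : f ∈ conjClass e := by
  refine he.conj_of_cornerUnit hf ?_
  have hee := he.idem.eq
  rcases he.dichotomy (e * f * e) (by rw [← mul_assoc, ← mul_assoc, hee])
    (by rw [mul_assoc, hee]) with hu | hu
  · exact hu
  · refine absurd (mem_of_cornerUnit hu ?_) heI
    have : e - e * f * e = e * (e - f) * e := by rw [mul_sub, sub_mul, hee, hee]
    rw [this]
    exact I.mul_mem_right _ _ (I.mul_mem_left _ _ h)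

end MaxIdeal

/-! ### Separable algebras -/

section Separable

/-- An `O`-algebra `R` with a separability element `∑ x_i ⊗ y_i`: one has `∑ x_i y_i = 1` and
`∑ s x_i ⊗ y_i = ∑ x_i ⊗ y_i s` for all `s`. -/
def IsSepAlg (O R : Type*) [CommRing O] [Ring R] [Algebra O R] : Prop :=
  ∃ (κ : Type) (_ : Fintype κ) (x y : κ → R), ∑ j, x j * y j = 1 ∧
    ∀ s, ∑ j, (s * x j) ⊗ₜ[O] (y j) = ∑ j, (x j) ⊗ₜ[O] (y j * s)

theorem sum_bilin_of_sep {O R V : Type*} [CommRing O] [Ring R] [Algebra O R] [AddCommGroup V]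
    [Module O V] {κ : Type} [Fintype κ] {x y : κ → R} {s : R}
    (h : ∑ j, (s * x j) ⊗ₜ[O] (y j) = ∑ j, (x j) ⊗ₜ[O] (y j * s))
    (B : R →ₗ[O] R →ₗ[O] V) : ∑ j, B (s * x j) (y j) = ∑ j, B (x j) (y j * s) := by
  have := congrArg (TensorProduct.lift B) h
  simpa using this

theorem isSepAlg_int_of_field (D : Type*) [Field D] [Finite D] : IsSepAlg ℤ D := by
  obtain ⟨p, hp⟩ := CharP.exists D
  have hpp : Fact p.Prime := ⟨CharP.char_is_prime D p⟩
  let _ : Algebra (ZMod p) D := ZMod.algebra D p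
  have h1 : Algebra.FormallyUnramified (ZMod p) D :=
    Algebra.FormallyUnramified.of_isSeparable (ZMod p) D
  have h2 : Algebra.FormallyUnramified ℤ (ZMod p) :=
    Algebra.FormallyUnramified.of_surjective (Algebra.ofId ℤ (ZMod p)) (ZMod.intCast_surjective)
  have h3 : Algebra.FormallyUnramified ℤ D := Algebra.FormallyUnramified.comp ℤ (ZMod p) D
  have h4 : Module.Finite ℤ D := Module.Finite.of_finite
  obtain ⟨t, ht, ht'⟩ := Algebra.FormallyUnramified.iff_exists_tensorProduct.mp h3
  obtain ⟨n, x, y, rfl⟩ := TensorProduct.exists_sum_tmul_eq t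
  refine ⟨Fin n, inferInstance, x, y, by simpa using ht', fun s => ?_⟩
  have := ht s
  rw [sub_mul, sub_eq_zero, Finset.mul_sum, Finset.mul_sum] at this
  simp only [Algebra.TensorProduct.tmul_mul_tmul, one_mul] at this
  rw [← this]
  exact Finset.sum_congr rfl fun j _ => by rw [mul_comm]

theorem IsSepAlg.of_ringEquiv {R S : Type*} [Ring R] [Ring S] (e : R ≃+* S)
    (h : IsSepAlg ℤ R) : IsSepAlg ℤ S := by
  obtain ⟨κ, _, x, y, h1, h2⟩ := h
  refine ⟨κ, inferInstance, fun j => e (x j), fun j => e (y j), ?_, fun s => ?_⟩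
  · rw [← map_one e, ← h1, map_sum]
    exact Finset.sum_congr rfl fun j _ => (map_mul e _ _).symm
  · obtain ⟨s, rfl⟩ := e.surjective s
    have := congrArg (TensorProduct.map e.toAddMonoidHom.toIntLinearMap
      e.toAddMonoidHom.toIntLinearMap) (h2 s)
    simpa using this

theorem IsSepAlg.matrix {D : Type*} [Ring D] (h : IsSepAlg ℤ D) (d : ℕ) [NeZero d] :
    IsSepAlg ℤ (Matrix (Fin d) (Fin d) D) := by
  obtain ⟨κ, _, x, y, h1, h2⟩ := h
  refine ⟨Fin d × κ, inferInstance, fun j => Matrix.single j.1 0 (x j.2),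
    fun j => Matrix.single 0 j.1 (y j.2), ?_, fun s => ?_⟩
  · rw [Fintype.sum_prod_type]
    simp only [Matrix.single_mul_single_same]
    have : ∀ a : Fin d, ∑ k, Matrix.single a a (x k * y k) = Matrix.single a a 1 := by
      intro a
      rw [← h1]
      exact (map_sum (Matrix.singleAddMonoidHom (α := D) a a) _ _).symm
    simp only [this]
    exact Matrix.sum_single_one
  · induction s using Matrix.induction_on' with
    | h_zero => simp
    | h_add p q hp hq =>
      simp only [add_mul, TensorProduct.add_tmul, mul_add, TensorProduct.tmul_add,
        Finset.sum_add_distrib]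
      rw [hp, hq]
    | h_std_basis a c r =>
      have hB := sum_bilin_of_sep (h2 r) (TensorProduct.mk ℤ (Matrix (Fin d) (Fin d) D)
        (Matrix (Fin d) (Fin d) D) |>.compl₁₂
          (Matrix.singleAddMonoidHom (α := D) a 0).toIntLinearMap
          (Matrix.singleAddMonoidHom (α := D) 0 c).toIntLinearMap)
      rw [Fintype.sum_prod_type, Fintype.sum_prod_type]
      rw [Finset.sum_eq_single c, Finset.sum_eq_single a]
      · simpa using hB
      · intro z _ hz
        simp [Matrix.single_mul_single_of_ne _ _ _ _ hz]
      · simp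
      · intro z _ hz
        simp [Matrix.single_mul_single_of_ne _ _ _ _ hz.symm]
      · simp

theorem IsSepAlg.pi {n : ℕ} {R : Fin n → Type*} [∀ i, Ring (R i)]
    (h : ∀ i, IsSepAlg ℤ (R i)) : IsSepAlg ℤ (∀ i, R i) := by
  choose κ hκ x y h1 h2 using h
  refine ⟨Σ i, κ i, inferInstance, fun j => Pi.single j.1 (x j.1 j.2),
    fun j => Pi.single j.1 (y j.1 j.2), ?_, fun s => ?_⟩
  · rw [Fintype.sum_sigma]
    have : ∀ i, ∑ k, (Pi.single i (x i k) * Pi.single i (y i k) : ∀ i, R i) = Pi.single i 1 := by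
      intro i
      simp only [← Pi.single_mul]
      rw [← h1 i]
      exact (map_sum (AddMonoidHom.single R i) _ _).symm
    simp only [this]
    exact Finset.univ_sum_single (1 : ∀ i, R i)
  · rw [Fintype.sum_sigma, Fintype.sum_sigma]
    refine Finset.sum_congr rfl fun i _ => ?_
    have hB := sum_bilin_of_sep (h2 i (s i)) ((TensorProduct.mk ℤ (∀ i, R i) (∀ i, R i)).compl₁₂
          (AddMonoidHom.single R i).toIntLinearMap (AddMonoidHom.single R i).toIntLinearMap)
    have e1 : ∀ k, s * Pi.single i (x i k) = Pi.single i (s i * x i k) := by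
      intro k; ext j
      by_cases hj : j = i
      · subst hj; simp
      · simp [hj]
    have e2 : ∀ k, Pi.single i (y i k) * s = Pi.single i (y i k * s i) := by
      intro k; ext j
      by_cases hj : j = i
      · subst hj; simp
      · simp [hj]
    simp only [e1, e2]
    simpa using hB

/-- Finite semisimple rings are separable, by the theorems of Wedderburn. -/
theorem isSepAlg_int_of_finite (S : Type*) [Ring S] [Finite S] [IsSemisimpleRing S] :
    IsSepAlg ℤ S := by
  obtain ⟨n, D, d, _, hd, ⟨e⟩⟩ := IsSemisimpleRing.exists_ringEquiv_pi_matrix_divisionRing S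
  refine IsSepAlg.of_ringEquiv e.symm (IsSepAlg.pi fun i => ?_)
  have hfin : Finite (D i) := by
    have : Function.Surjective fun s : S => e s i 0 0 := by
      intro a
      refine ⟨e.symm (Pi.single i (Matrix.single 0 0 a)), by simp⟩
    exact Finite.of_surjective _ this
  have h1 : IsSepAlg ℤ (D i) := @isSepAlg_int_of_field (D i) (littleWedderburn (D i)) hfin
  exact h1.matrix (d i)

theorem IsSepAlg.of_span {S : Type*} [Ring S] (h : IsSepAlg ℤ S) {O R : Type*} [CommRing O]
    [Ring R] [Algebra O R] (g : S →+* R) (hg : Submodule.span O (Set.range g) = ⊤) :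
    IsSepAlg O R := by
  obtain ⟨κ, _, x, y, h1, h2⟩ := h
  refine ⟨κ, inferInstance, fun j => g (x j), fun j => g (y j), ?_, fun s => ?_⟩
  · rw [← map_one g, ← h1, map_sum]
    exact Finset.sum_congr rfl fun j _ => (map_mul g _ _).symm
  · have hs : s ∈ Submodule.span O (Set.range g) := by rw [hg]; trivial
    induction hs using Submodule.span_induction with
    | mem s hs =>
      obtain ⟨s, rfl⟩ := hs
      let B : S →ₗ[ℤ] S →ₗ[ℤ] R ⊗[O] R := LinearMap.mk₂ ℤ (fun a b => g a ⊗ₜ[O] g b)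
        (fun a b c => by rw [map_add, TensorProduct.add_tmul])
        (fun c a b => by
          rw [map_zsmul, ← Int.cast_smul_eq_zsmul O, TensorProduct.smul_tmul',
            Int.cast_smul_eq_zsmul])
        (fun a b c => by rw [map_add, TensorProduct.tmul_add])
        (fun c a b => by
          rw [map_zsmul, ← Int.cast_smul_eq_zsmul O, TensorProduct.tmul_smul,
            Int.cast_smul_eq_zsmul])
      have := sum_bilin_of_sep (h2 s) B
      simpa [B] using this
    | zero => simp
    | add a b _ _ ha hb =>
      simp only [add_mul, TensorProduct.add_tmul, mul_add, TensorProduct.tmul_add,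
        Finset.sum_add_distrib]
      rw [ha, hb]
    | smul r a _ ha =>
      simp only [smul_mul_assoc, mul_smul_comm, TensorProduct.tmul_smul, ← TensorProduct.smul_tmul',
        ← Finset.smul_sum]
      rw [ha]

theorem IsSepAlg.tensorProduct {O R R' : Type*} [CommRing O] [Ring R] [Ring R'] [Algebra O R]
    [Algebra O R'] (h : IsSepAlg O R) (h' : IsSepAlg O R') : IsSepAlg O (R ⊗[O] R') := by
  obtain ⟨κ, _, x, y, h1, h2⟩ := h
  obtain ⟨κ', _, x', y', h1', h2'⟩ := h'
  refine ⟨κ × κ', inferInstance, fun j => x j.1 ⊗ₜ x' j.2, fun j => y j.1 ⊗ₜ y' j.2, ?_,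
    fun s => ?_⟩
  · simp only [Algebra.TensorProduct.tmul_mul_tmul]
    rw [Fintype.sum_prod_type]
    simp only [← TensorProduct.tmul_sum, ← TensorProduct.sum_tmul]
    rw [h1, h1']
    rfl
  · induction s with
    | zero => simp
    | add a b ha hb =>
      simp only [add_mul, TensorProduct.add_tmul, mul_add, TensorProduct.tmul_add,
        Finset.sum_add_distrib]
      rw [ha, hb]
    | tmul a b =>
      simp only [Algebra.TensorProduct.tmul_mul_tmul]
      have e1 : ∀ j', ∑ j, ((a * x j) ⊗ₜ[O] (b * x' j')) ⊗ₜ[O] ((y j) ⊗ₜ[O] (y' j'))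
          = ∑ j, ((x j) ⊗ₜ[O] (b * x' j')) ⊗ₜ[O] ((y j * a) ⊗ₜ[O] (y' j')) := fun j' =>
        sum_bilin_of_sep (h2 a) ((TensorProduct.mk O (R ⊗[O] R') (R ⊗[O] R')).compl₁₂
          ((TensorProduct.mk O R R').flip (b * x' j')) ((TensorProduct.mk O R R').flip (y' j')))
      have e2 : ∀ j, ∑ j', ((x j) ⊗ₜ[O] (b * x' j')) ⊗ₜ[O] ((y j * a) ⊗ₜ[O] (y' j'))
          = ∑ j', ((x j) ⊗ₜ[O] (x' j')) ⊗ₜ[O] ((y j * a) ⊗ₜ[O] (y' j' * b)) := fun j =>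
        sum_bilin_of_sep (h2' b) ((TensorProduct.mk O (R ⊗[O] R') (R ⊗[O] R')).compl₁₂
          (TensorProduct.mk O R R' (x j)) (TensorProduct.mk O R R' (y j * a)))
      rw [Fintype.sum_prod_type_right, Fintype.sum_prod_type]
      simp only [e1]
      rw [Finset.sum_comm]
      simp only [e2]

/-- The submodules of a module annihilated by the maximal ideal of a local ring have complements. -/
theorem exists_projection {O V : Type*} [CommRing O] [IsLocalRing O] [AddCommGroup V] [Module O V]
    (hV : ∀ r ∈ IsLocalRing.maximalIdeal O, ∀ v : V, r • v = 0) (W : Submodule O V) :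
    ∃ π : V →ₗ[O] V, (∀ v, π v ∈ W) ∧ ∀ v ∈ W, π v = v := by
  have hT : Module.IsTorsionBySet O V (IsLocalRing.maximalIdeal O : Set O) :=
    fun v r => hV r r.2 v
  have hss : IsSemisimpleModule O V := by
    let _ := hT.module
    have : IsSemisimpleRing (O ⧸ IsLocalRing.maximalIdeal O) :=
      inferInstanceAs (IsSemisimpleRing (IsLocalRing.ResidueField O))
    have : IsSemisimpleModule (O ⧸ IsLocalRing.maximalIdeal O) V := inferInstance
    exact hT.isSemisimpleModule_iff.mp this
  obtain ⟨W', hW'⟩ := exists_isCompl W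
  refine ⟨W.subtype ∘ₗ W.projectionOnto W' hW', fun v => Subtype.coe_prop _, fun v hv => ?_⟩
  have := Submodule.projectionOnto_apply_left hW' ⟨v, hv⟩
  exact congrArg Subtype.val this

/-- Two-sided ideals of a separable algebra over a field have an identity element. -/
theorem IsSepAlg.exists_identity {O T : Type*} [CommRing O] [IsLocalRing O] [Ring T] [Algebra O T]
    (h : IsSepAlg O T) (hT : ∀ r ∈ IsLocalRing.maximalIdeal O, ∀ v : T, r • v = 0)
    (I : TwoSidedIdeal T) : ∃ z ∈ I, (∀ x ∈ I, z * x = x) ∧ ∀ x, z * x = x * z := by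
  obtain ⟨κ, _, x, y, h1, h2⟩ := h
  let W : Submodule O T :=
    { carrier := I
      add_mem' := I.add_mem
      zero_mem' := I.zero_mem
      smul_mem' := by
        intro c v hv
        rw [Algebra.smul_def]
        exact I.mul_mem_left _ _ hv }
  obtain ⟨π, hπ, hπ'⟩ := exists_projection hT W
  have hsum : ∀ f : κ → T, (∀ j, f j ∈ I) → ∑ j, f j ∈ I := fun f hf => sum_mem fun j _ => hf j
  set u := ∑ j, x j * π (y j) with hu
  set v := ∑ j, π (x j) * y j with hv
  have huI : u ∈ I := hsum _ fun j => I.mul_mem_left _ _ (hπ _)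
  have hvI : v ∈ I := hsum _ fun j => I.mul_mem_right _ _ (hπ _)
  have hu1 : ∀ s ∈ I, s * u = s := by
    intro s hs
    have e1 := sum_bilin_of_sep (h2 s) ((LinearMap.mul O T).compl₁₂ LinearMap.id π)
    have e2 : s * u = ∑ j, s * x j * π (y j) := by
      rw [hu, Finset.mul_sum]
      exact Finset.sum_congr rfl fun j _ => (mul_assoc _ _ _).symm
    rw [e2]
    refine e1.trans ?_
    have e3 : ∀ j, (LinearMap.mul O T).compl₁₂ LinearMap.id π (x j) (y j * s) = x j * y j * s := by
      intro j
      change x j * π (y j * s) = _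
      rw [hπ' _ (I.mul_mem_left _ _ hs), mul_assoc]
    simp only [e3]
    rw [← Finset.sum_mul, h1, one_mul]
  have hv1 : ∀ s ∈ I, v * s = s := by
    intro s hs
    have e1 := sum_bilin_of_sep (h2 s) ((LinearMap.mul O T).compl₁₂ π LinearMap.id)
    have e2 : v * s = ∑ j, π (x j) * (y j * s) := by
      rw [hv, Finset.sum_mul]
      exact Finset.sum_congr rfl fun j _ => mul_assoc _ _ _
    rw [e2]
    refine e1.symm.trans ?_
    have e3 : ∀ j, (LinearMap.mul O T).compl₁₂ π LinearMap.id (s * x j) (y j) = s * (x j * y j) := by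
      intro j
      change π (s * x j) * y j = _
      rw [hπ' _ (I.mul_mem_right _ _ hs), mul_assoc]
    simp only [e3]
    rw [← Finset.mul_sum, h1, mul_one]
  have huv : u = v := (hv1 u huI).symm.trans (hu1 v hvI)
  refine ⟨u, huI, fun s hs => by rw [huv, hv1 s hs], fun s => ?_⟩
  calc u * s = u * s * u := (hu1 _ (I.mul_mem_right _ _ huI)).symm
    _ = u * (s * u) := mul_assoc _ _ _
    _ = s * u := by rw [huv]; exact hv1 _ (I.mul_mem_left _ _ hvI)

end Separable

/-! ### Presentations of graded algebras -/

section Pres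

universe u w w' v v' wR wR'

variable {O : Type u} [CommRing O] {N : Type v} [Group N] {Θ : Type v'} [Group Θ]

/-- A presentation of the `Θ`-graded algebra `X` as the corner `e (R * d(N)) e` of a crossed product
of `R` with the image of `d : N → Θ`. The element `el n r` stands for `e r n e`, the kernel of `d`
is identified with elements of `R` through `str`, and `co n` is the coefficient in `R` of the
component of degree `d n` with respect to the basis element `n`. -/
structure Pres (d : N →* Θ) {R : Type wR} [Ring R] [Algebra O R] (act : N →* (R ≃ₐ[O] R))
    (str : d.ker → R) (e : R) (X : GradedAlg.{w} O Θ) where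
  el : N → R →ₗ[O] X.carrier
  co : N → X.carrier →ₗ[O] R
  el_one : el 1 1 = 1
  el_mul : ∀ n m r s, el n r * el m s = el (n * m) (r * act n (e * s))
  el_str : ∀ (z : d.ker) n r, el (z * n) r = el n (r * str z)
  el_compress : ∀ n r, el n (e * r * act n e) = el n r
  co_same : ∀ n r, co n (el n r) = e * r * act n e
  co_ne : ∀ n m r, d n ≠ d m → co m (el n r) = 0
  el_mem : ∀ n r, el n r ∈ X.comp (d n)
  comp_le : ∀ x a, a ∈ X.comp x → a = 0 ∨ ∃ n r, d n = x ∧ a = el n r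
  span : ∀ a, a ∈ Submodule.span O {a | ∃ n r, a = el n r}

namespace Pres

variable {d : N →* Θ} {R : Type wR} [Ring R] [Algebra O R] {act : N →* (R ≃ₐ[O] R)}
  {str : d.ker → R} {e : R} {X : GradedAlg.{w} O Θ}
  {R' : Type wR'} [Ring R'] [Algebra O R'] {act' : N →* (R' ≃ₐ[O] R')}
  {str' : d.ker → R'} {e' : R'} {Y : GradedAlg.{w'} O Θ}

theorem mul_inv_mem_ker {n m : N} (h : d n = d m) : n * m⁻¹ ∈ d.ker := by
  rw [MonoidHom.mem_ker, MonoidHom.map_mul, h, MonoidHom.map_inv, mul_inv_cancel]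

theorem el_eq_of_deg_eq (p : Pres d act str e X) {n m : N} (h : d n = d m) (r : R) :
    p.el n r = p.el m (r * str ⟨n * m⁻¹, mul_inv_mem_ker h⟩) := by
  rw [← p.el_str]
  simp

theorem co_of_deg_eq (p : Pres d act str e X) {n m : N} (h : d n = d m) (r : R) :
    p.co m (p.el n r) = e * (r * str ⟨n * m⁻¹, mul_inv_mem_ker h⟩) * act m e := by
  rw [p.el_eq_of_deg_eq h, p.co_same]

theorem induction (p : Pres d act str e X) {P : X.carrier → Prop} (a : X.carrier)
    (h0 : P 0) (hadd : ∀ a b, P a → P b → P (a + b)) (hmap : ∀ n r, P (p.el n r)) : P a := by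
  induction p.span a using Submodule.span_induction with
  | mem x hx => obtain ⟨n, r, rfl⟩ := hx; exact hmap n r
  | zero => exact h0
  | add x y _ _ hx hy => exact hadd x y hx hy
  | smul c x hx hP =>
    have : ∀ x ∈ Submodule.span O {a | ∃ n r, a = p.el n r}, ∀ c : O, P (c • x) := by
      intro x hx
      induction hx using Submodule.span_induction with
      | mem x hx => obtain ⟨n, r, rfl⟩ := hx; intro c; rw [← map_smul]; exact hmap _ _
      | zero => intro c; rw [smul_zero]; exact h0
      | add x y _ _ hx hy => intro c; rw [smul_add]; exact hadd _ _ (hx c) (hy c)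
      | smul c x _ hx => intro c'; rw [smul_smul]; exact hx _
    exact this x hx c

theorem linearMap_ext (p : Pres d act str e X) {M : Type*} [AddCommGroup M] [Module O M]
    {f g : X.carrier →ₗ[O] M} (h : ∀ n r, f (p.el n r) = g (p.el n r)) (a : X.carrier) :
    f a = g a := by
  induction a using p.induction with
  | h0 => rw [map_zero, map_zero]
  | hadd a b ha hb => rw [map_add, map_add, ha, hb]
  | hmap n r => exact h n r

/-- A set-theoretic section of `d`. -/
def sec (d : N →* Θ) (x : d.range) : N := Function.surjInv d.rangeRestrict_surjective x

theorem deg_sec (x : d.range) : d (sec d x) = x :=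
  congrArg Subtype.val (Function.surjInv_eq d.rangeRestrict_surjective x)

variable [Finite N]

instance finite_range : Finite d.range :=
  Finite.of_surjective _ d.rangeRestrict_surjective

/-- The linear map between algebras with presentations that is induced by an equivariant map of the
coefficient algebras. -/
def linHom (p : Pres d act str e X) (p' : Pres d act' str' e' Y) (σ : R →ₐ[O] R') :
    X.carrier →ₗ[O] Y.carrier :=
  letI : Fintype d.range := Fintype.ofFinite _
  ∑ x : d.range, p'.el (sec d x) ∘ₗ σ.toLinearMap ∘ₗ p.co (sec d x)

theorem linHom_el (p : Pres d act str e X) (p' : Pres d act' str' e' Y) (σ : R →ₐ[O] R')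
    (hact : ∀ n r, σ (act n r) = act' n (σ r)) (hstr : ∀ z, σ (str z) = str' z) (he : σ e = e')
    (n : N) (r : R) : p.linHom p' σ (p.el n r) = p'.el n (σ r) := by
  let _ : Fintype d.range := Fintype.ofFinite _
  unfold linHom
  rw [LinearMap.sum_apply, Finset.sum_eq_single (d.rangeRestrict n)]
  · have h : d n = d (sec d (d.rangeRestrict n)) := (deg_sec (d.rangeRestrict n)).symm
    change p'.el _ (σ (p.co _ (p.el n r))) = _
    rw [p.co_of_deg_eq h, map_mul σ, map_mul σ, hact, he, p'.el_compress,
      map_mul σ, hstr, ← p'.el_eq_of_deg_eq h]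
  · intro x _ hx
    change p'.el _ (σ (p.co _ (p.el n r))) = 0
    rw [p.co_ne _ _ _ fun h => hx (Subtype.ext ((h.trans (deg_sec x)).symm)), map_zero, map_zero]
  · intro h
    exact absurd (Finset.mem_univ _) h

/-- The homomorphism between algebras with presentations that is induced by an equivariant
homomorphism of the coefficient algebras. -/
def hom (p : Pres d act str e X) (p' : Pres d act' str' e' Y) (σ : R →ₐ[O] R')
    (hact : ∀ n r, σ (act n r) = act' n (σ r)) (hstr : ∀ z, σ (str z) = str' z) (he : σ e = e') :
    X.carrier →ₐ[O] Y.carrier :=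
  AlgHom.ofLinearMap (p.linHom p' σ)
    (by rw [← p.el_one, p.linHom_el p' σ hact hstr he, map_one σ, p'.el_one])
    (by
      intro a b
      induction a using p.induction with
      | h0 => rw [zero_mul, map_zero, zero_mul]
      | hadd a c ha hc => rw [add_mul, map_add, ha, hc, map_add, add_mul]
      | hmap n r =>
        induction b using p.induction with
        | h0 => rw [mul_zero, map_zero, mul_zero]
        | hadd a c ha hc => rw [mul_add, map_add, ha, hc, map_add, mul_add]
        | hmap m s =>
          rw [p.el_mul, p.linHom_el p' σ hact hstr he, p.linHom_el p' σ hact hstr he,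
            p.linHom_el p' σ hact hstr he, p'.el_mul, map_mul σ, hact, map_mul σ, he])

theorem hom_el (p : Pres d act str e X) (p' : Pres d act' str' e' Y) (σ : R →ₐ[O] R')
    (hact : ∀ n r, σ (act n r) = act' n (σ r)) (hstr : ∀ z, σ (str z) = str' z) (he : σ e = e')
    (n : N) (r : R) : p.hom p' σ hact hstr he (p.el n r) = p'.el n (σ r) :=
  p.linHom_el p' σ hact hstr he n r

theorem hom_map_comp (p : Pres d act str e X) (p' : Pres d act' str' e' Y) (σ : R →ₐ[O] R')
    (hact : ∀ n r, σ (act n r) = act' n (σ r)) (hstr : ∀ z, σ (str z) = str' z) (he : σ e = e')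
    (hσ : Function.Surjective σ) (x : Θ) :
    (X.comp x).map (p.hom p' σ hact hstr he).toLinearMap = Y.comp x := by
  apply le_antisymm
  · rintro _ ⟨a, ha, rfl⟩
    rcases p.comp_le x a ha with rfl | ⟨n, r, rfl, rfl⟩
    · rw [map_zero]; exact zero_mem _
    · change p.hom p' σ hact hstr he _ ∈ _
      rw [p.hom_el]
      exact p'.el_mem _ _
  · intro a ha
    rcases p'.comp_le x a ha with rfl | ⟨n, r, rfl, rfl⟩
    · exact zero_mem _
    · obtain ⟨r, rfl⟩ := hσ r
      exact ⟨p.el n r, p.el_mem n r, p.hom_el p' σ hact hstr he n r⟩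

theorem hom_surjective (p : Pres d act str e X) (p' : Pres d act' str' e' Y) (σ : R →ₐ[O] R')
    (hact : ∀ n r, σ (act n r) = act' n (σ r)) (hstr : ∀ z, σ (str z) = str' z) (he : σ e = e')
    (hσ : Function.Surjective σ) : Function.Surjective (p.hom p' σ hact hstr he) := by
  intro a
  induction a using p'.induction with
  | h0 => exact ⟨0, map_zero _⟩
  | hadd a b ha hb =>
    obtain ⟨a, rfl⟩ := ha
    obtain ⟨b, rfl⟩ := hb
    exact ⟨a + b, map_add _ _ _⟩
  | hmap n r =>
    obtain ⟨r, rfl⟩ := hσ r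
    exact ⟨p.el n r, p.hom_el p' σ hact hstr he n r⟩

/-- The isomorphism between algebras with presentations that is induced by an equivariant
isomorphism of the coefficient algebras. -/
def iso (p : Pres d act str e X) (p' : Pres d act' str' e' Y) (σ : R ≃ₐ[O] R')
    (hact : ∀ n r, σ (act n r) = act' n (σ r)) (hstr : ∀ z, σ (str z) = str' z) (he : σ e = e') :
    GradedAlg.Iso X Y where
  toAlgEquiv := AlgEquiv.ofBijective (p.hom p' (σ : R →ₐ[O] R') hact hstr he) (by
    refine ⟨Function.LeftInverse.injective (g := p'.linHom p (σ.symm : R' →ₐ[O] R)) fun a => ?_,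
      p.hom_surjective p' (σ : R →ₐ[O] R') hact hstr he σ.surjective⟩
    refine p.linearMap_ext (f := p'.linHom p (σ.symm : R' →ₐ[O] R) ∘ₗ
      (p.hom p' (σ : R →ₐ[O] R') hact hstr he).toLinearMap) (g := LinearMap.id) (fun n r => ?_) a
    change p'.linHom p (σ.symm : R' →ₐ[O] R) (p.hom p' (σ : R →ₐ[O] R') hact hstr he (p.el n r))
      = p.el n r
    refine (congrArg (p'.linHom p (σ.symm : R' →ₐ[O] R))
      (p.hom_el p' (σ : R →ₐ[O] R') hact hstr he n r)).trans ?_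
    rw [p'.linHom_el p (σ.symm : R' →ₐ[O] R)]
    · exact congrArg _ (σ.symm_apply_apply r)
    · exact fun n r => (σ.symm_apply_eq).mpr (by
        rw [hact]; exact congrArg _ (σ.apply_symm_apply r).symm)
    · exact fun z => (σ.symm_apply_eq).mpr (hstr z).symm
    · exact (σ.symm_apply_eq).mpr he.symm)
  map_comp := p.hom_map_comp p' (σ : R →ₐ[O] R') hact hstr he σ.surjective

theorem iso_el (p : Pres d act str e X) (p' : Pres d act' str' e' Y) (σ : R ≃ₐ[O] R')
    (hact : ∀ n r, σ (act n r) = act' n (σ r)) (hstr : ∀ z, σ (str z) = str' z) (he : σ e = e')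
    (n : N) (r : R) : (p.iso p' σ hact hstr he).toAlgEquiv (p.el n r) = p'.el n (σ r) :=
  p.hom_el p' (σ : R →ₐ[O] R') hact hstr he n r

theorem co_hom (p : Pres d act str e X) (p' : Pres d act' str' e' Y) (σ : R →ₐ[O] R')
    (hact : ∀ n r, σ (act n r) = act' n (σ r)) (hstr : ∀ z, σ (str z) = str' z) (he : σ e = e')
    (n : N) (a : X.carrier) : p'.co n (p.hom p' σ hact hstr he a) = σ (p.co n a) := by
  refine p.linearMap_ext (f := p'.co n ∘ₗ (p.hom p' σ hact hstr he).toLinearMap)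
    (g := σ.toLinearMap ∘ₗ p.co n) (fun m r => ?_) a
  change p'.co n (p.hom p' σ hact hstr he (p.el m r)) = σ (p.co n (p.el m r))
  rw [p.hom_el]
  by_cases h : d m = d n
  · rw [p'.co_of_deg_eq h, p.co_of_deg_eq h, map_mul σ, map_mul σ, map_mul σ, hact, hstr, he]
  · rw [p'.co_ne _ _ _ h, p.co_ne _ _ _ h, map_zero]

theorem linHom_self (p : Pres d act str e X) (a : X.carrier) :
    p.linHom p (AlgHom.id O R) a = a :=
  p.linearMap_ext (g := LinearMap.id)
    (fun n r => p.linHom_el p (AlgHom.id O R) (fun _ _ => rfl) (fun _ => rfl) rfl n r) a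

theorem eq_sum (p : Pres d act str e X) (a : X.carrier) :
    letI : Fintype d.range := Fintype.ofFinite _
    a = ∑ x : d.range, p.el (sec d x) (p.co (sec d x) a) := by
  conv_lhs => rw [← p.linHom_self a]
  unfold linHom
  rw [LinearMap.sum_apply]
  rfl

end Pres
end Pres

/-! ### Graded radicals and graded isomorphisms -/

namespace GradedAlg

universe w w' w'' u v
variable {O : Type u} [CommRing O] {Θ : Type v} [Group Θ] {X : GradedAlg.{w} O Θ}
  {Y : GradedAlg.{w'} O Θ} {W : GradedAlg.{w''} O Θ}

/-- The inverse of a graded isomorphism. -/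
def Iso.symm (e : Iso X Y) : Iso Y X where
  toAlgEquiv := e.toAlgEquiv.symm
  map_comp x := by
    refine Submodule.ext fun a => ?_
    constructor
    · rintro ⟨b, hb, rfl⟩
      refine (e.mem_iff x _).mp ?_
      change e.toAlgEquiv (e.toAlgEquiv.symm b) ∈ _
      rwa [AlgEquiv.apply_symm_apply]
    · exact fun ha => ⟨e.toAlgEquiv a, (e.mem_iff x a).mpr ha, e.toAlgEquiv.symm_apply_apply a⟩

/-- The composition of graded isomorphisms. -/
def Iso.trans (e : Iso X Y) (f : Iso Y W) : Iso X W where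
  toAlgEquiv := e.toAlgEquiv.trans f.toAlgEquiv
  map_comp x := by
    rw [← f.map_comp x, ← e.map_comp x, ← Submodule.map_comp]
    rfl

/-- If the homogeneous elements that are not killed by `f` are left invertible, then the kernel of
`f` is the only maximal graded left ideal. -/
theorem mem_gradedRadical_iff [Nontrivial Y.carrier] (f : X.carrier →ₐ[O] Y.carrier)
    (hdec : ∀ a, f a = 0 → a ∈ AddSubgroup.closure {h | f h = 0 ∧ ∃ x, h ∈ X.comp x})
    (hinv : ∀ x a, a ∈ X.comp x → f a ≠ 0 → ∃ b, b * a = 1) (a : X.carrier) :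
    a ∈ X.gradedRadical ↔ f a = 0 := by
  have hle : ∀ J, X.IsGradedLeftIdeal J → J ≠ ⊤ → J ≤ RingHom.ker f := by
    intro J hJ hne a ha
    have h1 : AddSubgroup.closure {h | h ∈ J ∧ ∃ x, h ∈ X.comp x}
        ≤ (RingHom.ker f).toAddSubgroup := by
      rw [AddSubgroup.closure_le]
      rintro c ⟨hc, x, hx⟩
      by_contra hfc
      obtain ⟨d, hd⟩ := hinv x c hx hfc
      exact hne ((Ideal.eq_top_iff_one J).mpr (hd ▸ J.mul_mem_left d hc))
    exact h1 (hJ a ha)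
  have hker : X.IsGradedLeftIdeal (RingHom.ker f) := fun a ha => hdec a ha
  have htop : RingHom.ker f ≠ ⊤ := RingHom.ker_ne_top f
  have hmax : X.IsMaximalGradedLeftIdeal (RingHom.ker f) :=
    ⟨hker, htop, fun J hJ hlt => by
      by_contra hne
      exact absurd (hle J hJ hne) hlt.not_ge⟩
  have huniq : ∀ I, X.IsMaximalGradedLeftIdeal I → I = RingHom.ker f := by
    intro I hI
    by_contra hne
    exact htop (hI.2.2 _ hker (lt_of_le_of_ne (hle I hI.1 hI.2.1) hne))
  have hset : {a | ∀ I, X.IsMaximalGradedLeftIdeal I → a ∈ I}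
      = (TwoSidedIdeal.ker f : Set X.carrier) := by
    ext a
    refine ⟨fun h => (TwoSidedIdeal.mem_ker _).mpr (h _ hmax), fun h I hI => ?_⟩
    rw [huniq I hI]
    exact (TwoSidedIdeal.mem_ker _).mp h
  unfold gradedRadical
  rw [hset, ← TwoSidedIdeal.mem_ker f]
  constructor
  · exact fun h => TwoSidedIdeal.span_le.mpr le_rfl h
  · exact fun h => TwoSidedIdeal.subset_span h

/-- The homomorphism induced on the quotient by the graded radical. -/
def residualLift (f : X.carrier →ₐ[O] Y.carrier) (h : ∀ a, a ∈ X.gradedRadical ↔ f a = 0) :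
    X.residual.carrier →ₐ[O] Y.carrier :=
  X.gradedRadical.ringCon.liftₐ f (by
    intro a b hab
    have h2 : X.gradedRadical.ringCon a b := hab
    rw [TwoSidedIdeal.rel_iff, h, map_sub, sub_eq_zero] at h2
    exact h2)

theorem residualLift_toResidual (f : X.carrier →ₐ[O] Y.carrier)
    (h : ∀ a, a ∈ X.gradedRadical ↔ f a = 0) (a : X.carrier) :
    residualLift f h (X.toResidual a) = f a := rfl

theorem toResidual_surjective : Function.Surjective X.toResidual :=
  X.gradedRadical.ringCon.mk'_surjective

/-- A surjective graded homomorphism whose kernel is the graded radical identifies its target with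
the quotient by the graded radical. -/
def residualIso (f : X.carrier →ₐ[O] Y.carrier) (h : ∀ a, a ∈ X.gradedRadical ↔ f a = 0)
    (hf : Function.Surjective f) (hcomp : ∀ x, (X.comp x).map f.toLinearMap = Y.comp x) :
    Iso X.residual Y where
  toAlgEquiv := AlgEquiv.ofBijective (residualLift f h) (by
    constructor
    · rw [injective_iff_map_eq_zero]
      intro a ha
      obtain ⟨a, rfl⟩ := toResidual_surjective a
      rw [residualLift_toResidual, ← h] at ha
      exact (qmk_eq_zero_iff _ _).mpr ha
    · intro b
      obtain ⟨a, rfl⟩ := hf b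
      exact ⟨X.toResidual a, rfl⟩)
  map_comp x := by
    rw [← hcomp x]
    refine Submodule.ext fun b => ?_
    constructor
    · rintro ⟨_, ⟨a, ha, rfl⟩, rfl⟩
      exact ⟨a, ha, rfl⟩
    · rintro ⟨a, ha, rfl⟩
      exact ⟨X.toResidual a, ⟨a, ha, rfl⟩, rfl⟩

end GradedAlg

/-! ### Conjugation, truncation and diagonal tensor products of presentations -/

namespace Pres

universe u w w' v v' v₁ v₂ wR wR'

variable {O : Type u} [CommRing O] {N : Type v} [Group N] {Θ : Type v'} [Group Θ]
  {d : N →* Θ} {R : Type wR} [Ring R] [Algebra O R] {act : N →* (R ≃ₐ[O] R)}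
  {str : d.ker → R} {e : R} {X : GradedAlg.{w} O Θ}

theorem exists_of_mem (p : Pres d act str e X) {x : Θ} {a : X.carrier} (ha : a ∈ X.comp x) {n : N}
    (hn : d n = x) : ∃ r, a = p.el n r := by
  rcases p.comp_le x a ha with rfl | ⟨m, r, hm, rfl⟩
  · exact ⟨0, (map_zero _).symm⟩
  · exact ⟨_, p.el_eq_of_deg_eq (hm.trans hn.symm) r⟩

theorem exists_deg_of_ne_zero (p : Pres d act str e X) {x : Θ} {a : X.carrier}
    (ha : a ∈ X.comp x) (h : a ≠ 0) : ∃ n, d n = x := by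
  rcases p.comp_le x a ha with h0 | ⟨m, r, hm, _⟩
  · exact absurd h0 h
  · exact ⟨m, hm⟩

/-- A presentation at `e` gives one at the conjugate `a e a⁻¹`. -/
def conj (p : Pres d act str e X) (hstr : ∀ (z : d.ker) x, str z * x = act z x * str z) (a : Rˣ) :
    Pres d act str (a * e * (↑a⁻¹ : R)) X where
  el n := p.el n ∘ₗ LinearMap.mulLeft O (↑a⁻¹ : R) ∘ₗ LinearMap.mulRight O (act n a)
  co n := LinearMap.mulLeft O (a : R) ∘ₗ LinearMap.mulRight O (act n (↑a⁻¹ : R)) ∘ₗ p.co n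
  el_one := by
    change p.el 1 (↑a⁻¹ * (1 * act 1 a)) = 1
    rw [map_one act, one_mul, AlgEquiv.one_apply, Units.inv_mul, p.el_one]
  el_mul n m r s := by
    change p.el n (↑a⁻¹ * (r * act n a)) * p.el m (↑a⁻¹ * (s * act m a))
      = p.el (n * m) (↑a⁻¹ * (r * act n (a * e * ↑a⁻¹ * s) * act (n * m) a))
    rw [p.el_mul, map_mul act, AlgEquiv.mul_apply]
    congr 1
    simp only [map_mul, mul_assoc]
  el_str z n r := by
    change p.el (z * n) (↑a⁻¹ * (r * act (z * n) a)) = p.el n (↑a⁻¹ * (r * str z * act n a))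
    rw [p.el_str, map_mul act, AlgEquiv.mul_apply]
    congr 1
    simp only [mul_assoc]
    rw [hstr]
  el_compress n r := by
    change p.el n (↑a⁻¹ * (a * e * ↑a⁻¹ * r * act n (a * e * ↑a⁻¹) * act n a))
      = p.el n (↑a⁻¹ * (r * act n a))
    rw [← p.el_compress n (↑a⁻¹ * (r * act n a))]
    congr 1
    have h : act n (↑a⁻¹ : R) * act n (a : R) = 1 := by rw [← map_mul, Units.inv_mul, map_one]
    simp only [map_mul, mul_assoc]
    rw [h, mul_one, Units.inv_mul_cancel_left]
  co_same n r := by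
    change a * (p.co n (p.el n (↑a⁻¹ * (r * act n a))) * act n (↑a⁻¹ : R)) = _
    rw [p.co_same]
    simp only [map_mul, mul_assoc]
  co_ne n m r h := by
    change a * (p.co m (p.el n _) * act m (↑a⁻¹ : R)) = _
    rw [p.co_ne n m _ h, zero_mul, mul_zero]
  el_mem n r := p.el_mem n _
  comp_le x c hc := by
    rcases p.comp_le x c hc with h | ⟨n, r, hn, rfl⟩
    · exact Or.inl h
    · refine Or.inr ⟨n, a * r * act n (↑a⁻¹ : R), hn, ?_⟩
      change _ = p.el n (↑a⁻¹ * (a * r * act n (↑a⁻¹ : R) * act n (a : R)))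
      rw [mul_assoc (a * r), ← map_mul, Units.inv_mul, map_one, mul_one,
        Units.inv_mul_cancel_left]
  span c := by
    refine Submodule.span_mono ?_ (p.span c)
    rintro _ ⟨n, r, rfl⟩
    refine ⟨n, a * r * act n (↑a⁻¹ : R), ?_⟩
    change _ = p.el n (↑a⁻¹ * (a * r * act n (↑a⁻¹ : R) * act n (a : R)))
    rw [mul_assoc (a * r), ← map_mul, Units.inv_mul, map_one, mul_one,
      Units.inv_mul_cancel_left]

theorem mem_truncSub (K : Subgroup Θ) {x : Θ} (hx : x ∈ K) {a : X.carrier} (ha : a ∈ X.comp x) :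
    a ∈ X.truncSub K :=
  Submodule.mem_iSup_of_mem (p := fun x : K => X.comp x) ⟨x, hx⟩ ha

/-- The presentation of `X_K` that is induced by one of `X`. -/
def trunc (p : Pres d act str e X) (K : Subgroup Θ) :
    Pres (d.subgroupComap K) (act.comp (K.comap d).subtype)
      (fun z => str ⟨z.1.1, congrArg Subtype.val z.2⟩) e (X.trunc K) where
  el n :=
    { toFun := fun r => ⟨p.el n r, mem_truncSub K n.2 (p.el_mem n r)⟩
      map_add' := fun r s => Subtype.ext (map_add (p.el n) r s)
      map_smul' := fun c r => Subtype.ext (map_smul (p.el n) c r) }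
  co n := p.co n ∘ₗ (X.truncSub K).val.toLinearMap
  el_one := Subtype.ext p.el_one
  el_mul n m r s := Subtype.ext (p.el_mul n m r s)
  el_str z n r := Subtype.ext (p.el_str ⟨z.1.1, congrArg Subtype.val z.2⟩ n r)
  el_compress n r := Subtype.ext (p.el_compress n r)
  co_same n r := p.co_same n r
  co_ne n m r h := p.co_ne n m r fun h' => h (Subtype.ext h')
  el_mem n r := p.el_mem n r
  comp_le x a ha := by
    rcases p.comp_le x a.1 ha with h | ⟨n, r, hn, h⟩
    · exact Or.inl (Subtype.ext h)
    · exact Or.inr ⟨⟨n, by rw [Subgroup.mem_comap, hn]; exact x.2⟩, r, Subtype.ext hn,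
        Subtype.ext h⟩
  span a := by
    obtain ⟨a, ha⟩ := a
    refine Submodule.iSup_induction' (fun x : K => X.comp x)
      (motive := fun a h => (⟨a, h⟩ : X.truncSub K) ∈ Submodule.span O _) ?_ ?_ ?_ ha
    · intro x a hax
      rcases p.comp_le x a hax with h | ⟨n, r, hn, h⟩
      · subst h
        exact zero_mem _
      · refine Submodule.subset_span ⟨⟨n, by rw [Subgroup.mem_comap, hn]; exact x.2⟩, r, ?_⟩
        exact Subtype.ext h
    · exact zero_mem _
    · intro a c ha hc h1 h2
      exact add_mem h1 h2

variable {N₁ : Type v₁} [Group N₁] {N₂ : Type v₂} [Group N₂] {d₁ : N₁ →* Θ} {d₂ : N₂ →* Θ}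
  {R' : Type wR'} [Ring R'] [Algebra O R'] {act₁ : N₁ →* (R ≃ₐ[O] R)} {act₂ : N₂ →* (R' ≃ₐ[O] R')}
  {str₁ : d₁.ker → R} {str₂ : d₂.ker → R'} {e' : R'} {Y : GradedAlg.{w'} O Θ}

/-- The action of `N` on `R ⊗ R'` through actions of two quotients of `N` on `R` and `R'`. -/
def tensorAct (act₁ : N₁ →* (R ≃ₐ[O] R)) (act₂ : N₂ →* (R' ≃ₐ[O] R')) (π₁ : N →* N₁)
    (π₂ : N →* N₂) : N →* (R ⊗[O] R' ≃ₐ[O] R ⊗[O] R') where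
  toFun n := Algebra.TensorProduct.congr (act₁ (π₁ n)) (act₂ (π₂ n))
  map_one' := by
    rw [map_one, map_one, map_one, map_one]
    exact Algebra.TensorProduct.congr_refl
  map_mul' n m := by
    rw [map_mul, map_mul, map_mul, map_mul]
    refine AlgEquiv.ext fun t => ?_
    induction t using TensorProduct.induction_on with
    | zero => rw [map_zero, map_zero]
    | tmul r s => rfl
    | add s t hs ht => rw [map_add, map_add, hs, ht]

theorem tensorAct_tmul (act₁ : N₁ →* (R ≃ₐ[O] R)) (act₂ : N₂ →* (R' ≃ₐ[O] R')) (π₁ : N →* N₁)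
    (π₂ : N →* N₂) (n : N) (r : R) (s : R') :
    tensorAct act₁ act₂ π₁ π₂ n (r ⊗ₜ[O] s) = act₁ (π₁ n) r ⊗ₜ[O] act₂ (π₂ n) s := rfl

theorem tmul_mem_diagSub {x : Θ} {a : X.carrier} {c : Y.carrier} (ha : a ∈ X.comp x)
    (hc : c ∈ Y.comp x) : a ⊗ₜ[O] c ∈ GradedAlg.diagComp X Y x :=
  Submodule.apply_mem_map₂ _ ha hc

theorem map_mem_diagComp (p : Pres d₁ act₁ str₁ e X) (q : Pres d₂ act₂ str₂ e' Y) {x : Θ} {n : N₁}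
    {m : N₂} (hn : d₁ n = x) (hm : d₂ m = x) (t : R ⊗[O] R') :
    TensorProduct.map (p.el n) (q.el m) t ∈ GradedAlg.diagComp X Y x := by
  induction t using TensorProduct.induction_on with
  | zero => rw [map_zero]; exact zero_mem _
  | tmul r s => exact tmul_mem_diagSub (hn ▸ p.el_mem n r) (hm ▸ q.el_mem m s)
  | add s t hs ht => rw [map_add]; exact add_mem hs ht

theorem eq_of_mem_diagComp (p : Pres d₁ act₁ str₁ e X) (q : Pres d₂ act₂ str₂ e' Y) (π₁ : N →* N₁)
    (π₂ : N →* N₂) (h₁ : ∀ n, d₁ (π₁ n) = d n) (h₂ : ∀ n, d₂ (π₂ n) = d n)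
    (hs : ∀ n m, d₁ n = d₂ m → ∃ l, d l = d₁ n) {x : Θ} {a : X.carrier ⊗[O] Y.carrier}
    (ha : a ∈ GradedAlg.diagComp X Y x) :
    a = 0 ∨ ∃ l t, d l = x ∧ a = TensorProduct.map (p.el (π₁ l)) (q.el (π₂ l)) t := by
  by_cases hx : ∃ l, d l = x
  · obtain ⟨l, rfl⟩ := hx
    right
    have hle : GradedAlg.diagComp X Y (d l)
        ≤ LinearMap.range (TensorProduct.map (p.el (π₁ l)) (q.el (π₂ l))) := by
      refine Submodule.map₂_le.mpr fun c hc c' hc' => ?_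
      obtain ⟨r, rfl⟩ := p.exists_of_mem hc (h₁ l)
      obtain ⟨r', rfl⟩ := q.exists_of_mem hc' (h₂ l)
      exact ⟨r ⊗ₜ r', rfl⟩
    obtain ⟨t, rfl⟩ := hle ha
    exact ⟨l, t, rfl, rfl⟩
  · left
    have hle : GradedAlg.diagComp X Y x ≤ ⊥ := by
      refine Submodule.map₂_le.mpr fun c hc c' hc' => ?_
      rw [Submodule.mem_bot]
      by_cases h0 : c = 0
      · rw [h0, map_zero, LinearMap.zero_apply]
      by_cases h0' : c' = 0
      · rw [h0', map_zero]
      obtain ⟨n, hn⟩ := p.exists_deg_of_ne_zero hc h0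
      obtain ⟨m, hm⟩ := q.exists_deg_of_ne_zero hc' h0'
      obtain ⟨l, hl⟩ := hs n m (hn.trans hm.symm)
      exact absurd ⟨l, hl.trans hn⟩ hx
    exact (Submodule.mem_bot O).mp (hle ha)

/-- The presentation of `Δ(X ⊗ Y)` that is induced by presentations of `X` and `Y`. -/
def diag (p : Pres d₁ act₁ str₁ e X) (q : Pres d₂ act₂ str₂ e' Y) (π₁ : N →* N₁) (π₂ : N →* N₂)
    (h₁ : ∀ n, d₁ (π₁ n) = d n) (h₂ : ∀ n, d₂ (π₂ n) = d n)
    (hs : ∀ n m, d₁ n = d₂ m → ∃ l, d l = d₁ n) :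
    Pres d (tensorAct act₁ act₂ π₁ π₂)
      (fun z => str₁ ⟨π₁ z, (h₁ z).trans z.2⟩ ⊗ₜ[O] str₂ ⟨π₂ z, (h₂ z).trans z.2⟩)
      (e ⊗ₜ[O] e') (GradedAlg.diag X Y) where
  el n :=
    { toFun := fun t => ⟨TensorProduct.map (p.el (π₁ n)) (q.el (π₂ n)) t,
        Submodule.mem_iSup_of_mem (p := fun x => GradedAlg.diagComp X Y x) (d n)
          (map_mem_diagComp p q (h₁ n) (h₂ n) t)⟩
      map_add' := fun s t => Subtype.ext (map_add _ s t)
      map_smul' := fun c t => Subtype.ext (map_smul _ c t) }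
  co n := TensorProduct.map (p.co (π₁ n)) (q.co (π₂ n)) ∘ₗ
    (GradedAlg.diagSub X Y).val.toLinearMap
  el_one := Subtype.ext (by
    change p.el (π₁ 1) 1 ⊗ₜ[O] q.el (π₂ 1) 1 = 1
    rw [map_one π₁, map_one π₂, p.el_one, q.el_one]
    rfl)
  el_mul n m s t := Subtype.ext (by
    change TensorProduct.map (p.el (π₁ n)) (q.el (π₂ n)) s *
      TensorProduct.map (p.el (π₁ m)) (q.el (π₂ m)) t
      = TensorProduct.map (p.el (π₁ (n * m))) (q.el (π₂ (n * m)))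
        (s * tensorAct act₁ act₂ π₁ π₂ n (e ⊗ₜ[O] e' * t))
    induction s using TensorProduct.induction_on with
    | zero => rw [map_zero, zero_mul, zero_mul, map_zero]
    | add s s' hs hs' => rw [map_add, add_mul, hs, hs', add_mul, map_add]
    | tmul r r' =>
      induction t using TensorProduct.induction_on with
      | zero => rw [map_zero, mul_zero, mul_zero, map_zero, mul_zero, map_zero]
      | add s s' hs hs' => rw [map_add, mul_add, hs, hs', mul_add, map_add, mul_add, map_add]
      | tmul s s' =>
        rw [Algebra.TensorProduct.tmul_mul_tmul, tensorAct_tmul,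
          Algebra.TensorProduct.tmul_mul_tmul, TensorProduct.map_tmul, TensorProduct.map_tmul,
          TensorProduct.map_tmul, Algebra.TensorProduct.tmul_mul_tmul, p.el_mul, q.el_mul,
          map_mul π₁, map_mul π₂])
  el_str z n t := Subtype.ext (by
    change TensorProduct.map (p.el (π₁ (z * n))) (q.el (π₂ (z * n))) t
      = TensorProduct.map (p.el (π₁ n)) (q.el (π₂ n)) (t * _)
    induction t using TensorProduct.induction_on with
    | zero => rw [map_zero, zero_mul, map_zero]
    | add s s' hs hs' => rw [map_add, hs, hs', add_mul, map_add]
    | tmul r r' =>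
      rw [Algebra.TensorProduct.tmul_mul_tmul, TensorProduct.map_tmul, TensorProduct.map_tmul,
        map_mul π₁, map_mul π₂]
      exact congrArg₂ _ (p.el_str ⟨π₁ z, _⟩ _ _) (q.el_str ⟨π₂ z, _⟩ _ _))
  el_compress n t := Subtype.ext (by
    change TensorProduct.map (p.el (π₁ n)) (q.el (π₂ n)) (_ * t * _)
      = TensorProduct.map (p.el (π₁ n)) (q.el (π₂ n)) t
    rw [tensorAct_tmul]
    induction t using TensorProduct.induction_on with
    | zero => rw [mul_zero, zero_mul, map_zero]
    | add s s' hs hs' => rw [mul_add, add_mul, map_add, hs, hs', map_add]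
    | tmul r r' =>
      rw [Algebra.TensorProduct.tmul_mul_tmul, Algebra.TensorProduct.tmul_mul_tmul,
        TensorProduct.map_tmul, TensorProduct.map_tmul, p.el_compress, q.el_compress])
  co_same n t := by
    change TensorProduct.map (p.co (π₁ n)) (q.co (π₂ n))
      (TensorProduct.map (p.el (π₁ n)) (q.el (π₂ n)) t) = _
    rw [tensorAct_tmul]
    induction t using TensorProduct.induction_on with
    | zero => rw [mul_zero, zero_mul, map_zero, map_zero]
    | add s s' hs hs' => rw [mul_add, add_mul, map_add, map_add, hs, hs']
    | tmul r r' =>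
      rw [Algebra.TensorProduct.tmul_mul_tmul, Algebra.TensorProduct.tmul_mul_tmul,
        TensorProduct.map_tmul, TensorProduct.map_tmul, p.co_same, q.co_same]
  co_ne n m t h := by
    change TensorProduct.map (p.co (π₁ m)) (q.co (π₂ m))
      (TensorProduct.map (p.el (π₁ n)) (q.el (π₂ n)) t) = 0
    have h' : d₁ (π₁ n) ≠ d₁ (π₁ m) := by rwa [h₁, h₁]
    induction t using TensorProduct.induction_on with
    | zero => rw [map_zero, map_zero]
    | add s s' hs hs' => rw [map_add, map_add, hs, hs', add_zero]
    | tmul r r' =>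
      rw [TensorProduct.map_tmul, TensorProduct.map_tmul, p.co_ne _ _ _ h', TensorProduct.zero_tmul]
  el_mem n t := map_mem_diagComp p q (h₁ n) (h₂ n) t
  comp_le x a ha := by
    rcases eq_of_mem_diagComp p q π₁ π₂ h₁ h₂ hs ha with h | ⟨l, t, hl, h⟩
    · exact Or.inl (Subtype.ext h)
    · exact Or.inr ⟨l, t, hl, Subtype.ext h⟩
  span a := by
    obtain ⟨a, ha⟩ := a
    refine Submodule.iSup_induction' (fun x => GradedAlg.diagComp X Y x)
      (motive := fun a h => (⟨a, h⟩ : GradedAlg.diagSub X Y) ∈ Submodule.span O _) ?_ ?_ ?_ ha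
    · intro x a hax
      rcases eq_of_mem_diagComp p q π₁ π₂ h₁ h₂ hs hax with h | ⟨l, t, hl, h⟩
      · subst h
        exact zero_mem _
      · exact Submodule.subset_span ⟨l, t, Subtype.ext h⟩
    · exact zero_mem _
    · intro a c ha hc h1 h2
      exact add_mem h1 h2

variable [Finite N] {R₂ : Type wR'} [Ring R₂] [Algebra O R₂] {actN : N →* (R₂ ≃ₐ[O] R₂)}
  {strN : d.ker → R₂} {eN : R₂}

/-- If the homogeneous elements outside the kernel of the map induced by `σ` are left invertible,
then that kernel is the graded radical. -/
theorem mem_gradedRadical_iff [Nontrivial Y.carrier] (p : Pres d act str e X)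
    (q : Pres d actN strN eN Y) (σ : R →ₐ[O] R₂)
    (hact : ∀ n r, σ (act n r) = actN n (σ r)) (hstr : ∀ z, σ (str z) = strN z) (he : σ e = eN)
    (hinv : ∀ n r, q.el n (σ r) ≠ 0 → ∃ b, b * p.el n r = 1) (a : X.carrier) :
    a ∈ X.gradedRadical ↔ p.hom q σ hact hstr he a = 0 := by
  refine GradedAlg.mem_gradedRadical_iff _ (fun a ha => ?_) (fun x a hax ha => ?_) a
  · rw [p.eq_sum a]
    refine AddSubgroup.sum_mem _ fun x _ => AddSubgroup.subset_closure ⟨?_, _, p.el_mem _ _⟩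
    rw [p.hom_el, ← p.co_hom q σ hact hstr he, ha, map_zero, map_zero]
  · rcases p.comp_le x a hax with rfl | ⟨n, r, rfl, rfl⟩
    · exact absurd (map_zero _) ha
    · rw [p.hom_el] at ha
      exact hinv n r ha

end Pres

/-! ### Crossed products and their graded endomorphism algebras -/

namespace InteriorAlgebra

universe w u v v'
variable {O : Type u} [CommRing O] {N : Type v} [Group N] {Z : Subgroup N}
  (R : InteriorAlgebra.{w} O N Z)

theorem cr_mul (r s : R.carrier) (n m : N) :
    R.cr r n * R.cr s m = R.cr (r * R.act n s) (n * m) := by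
  change qmk _ (SkewMonoidAlgebra.single n r * SkewMonoidAlgebra.single m s) = _
  rw [SkewMonoidAlgebra.single_mul_single]
  rfl

theorem cr_one : R.cr 1 1 = 1 := rfl

theorem cr_add (r s : R.carrier) (n : N) : R.cr (r + s) n = R.cr r n + R.cr s n := by
  change qmk _ (SkewMonoidAlgebra.single n (r + s)) = _
  rw [SkewMonoidAlgebra.single_add]
  rfl

theorem cr_smul (c : O) (r : R.carrier) (n : N) : R.cr (c • r) n = c • R.cr r n := by
  change qmk _ (SkewMonoidAlgebra.single n (c • r)) = _
  rw [← SkewMonoidAlgebra.smul_single]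
  rfl

theorem cr_str (z : Z) : R.cr 1 z = R.cr (R.str z) 1 :=
  (qmk_eq_iff _ _ _).mpr (TwoSidedIdeal.subset_span ⟨z, rfl⟩)

theorem cr_mul_left (r : R.carrier) (z : Z) (n : N) :
    R.cr r (z * n) = R.cr (r * R.str z) n := by
  have h1 : R.cr r (z * n) = R.cr r 1 * R.cr 1 z * R.cr 1 n := by
    rw [cr_mul, cr_mul, map_one, map_one, mul_one, mul_one, one_mul]
  rw [h1, cr_str, cr_mul, cr_mul, map_one R.act, map_one, mul_one, AlgEquiv.one_apply, one_mul,
    one_mul]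

theorem crossed_induction {P : R.Crossed → Prop} (c : R.Crossed) (zero : P 0)
    (add : ∀ a b, P a → P b → P (a + b)) (cr : ∀ r n, P (R.cr r n)) : P c := by
  obtain ⟨t, rfl⟩ := qmk_surj _ c
  induction t using SkewMonoidAlgebra.induction_on with
  | zero => exact zero
  | single n r => exact cr r n
  | add s t hs ht => exact add _ _ hs ht

open scoped Classical in
/-- The coefficient of `n` with respect to the basis element `m`: the element `str (n m⁻¹)` if
`n` and `m` lie in the same coset of `Z`, and `0` otherwise. -/
def cosetCoeff (m n : N) : R.carrier :=
  if h : n * m⁻¹ ∈ Z then R.str ⟨n * m⁻¹, h⟩ else 0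

theorem cosetCoeff_of_mem {m n : N} (h : n * m⁻¹ ∈ Z) :
    R.cosetCoeff m n = R.str ⟨n * m⁻¹, h⟩ := dif_pos h

theorem cosetCoeff_of_notMem {m n : N} (h : n * m⁻¹ ∉ Z) : R.cosetCoeff m n = 0 := dif_neg h

theorem cosetCoeff_self (n : N) : R.cosetCoeff n n = 1 := by
  have h : n * n⁻¹ ∈ Z := by rw [mul_inv_cancel]; exact Z.one_mem
  rw [R.cosetCoeff_of_mem h]
  have : (⟨n * n⁻¹, h⟩ : Z) = 1 := Subtype.ext (mul_inv_cancel n)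
  rw [this, map_one]

theorem cosetCoeff_mul_left [hZ : Z.Normal] (m n k : N) :
    R.cosetCoeff m (k * n) = R.act k (R.cosetCoeff (k⁻¹ * m) n) := by
  have e : k * n * m⁻¹ = k * (n * (k⁻¹ * m)⁻¹) * k⁻¹ := by group
  by_cases h : n * (k⁻¹ * m)⁻¹ ∈ Z
  · have h' : k * n * m⁻¹ ∈ Z := by rw [e]; exact hZ.conj_mem _ h _
    rw [R.cosetCoeff_of_mem h, R.cosetCoeff_of_mem h']
    exact (R.act_str k _ _ e).symm
  · have h' : k * n * m⁻¹ ∉ Z := fun h' => h (by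
      have := hZ.conj_mem _ h' k⁻¹
      rwa [e, show k⁻¹ * (k * (n * (k⁻¹ * m)⁻¹) * k⁻¹) * k⁻¹⁻¹ = n * (k⁻¹ * m)⁻¹ by group] at this)
    rw [R.cosetCoeff_of_notMem h, R.cosetCoeff_of_notMem h', map_zero]

theorem cosetCoeff_mul_right (m n k : N) :
    R.cosetCoeff m (n * k) = R.cosetCoeff (m * k⁻¹) n := by
  have e : n * k * m⁻¹ = n * (m * k⁻¹)⁻¹ := by group
  by_cases h : n * (m * k⁻¹)⁻¹ ∈ Z
  · have h' : n * k * m⁻¹ ∈ Z := by rwa [e]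
    rw [R.cosetCoeff_of_mem h, R.cosetCoeff_of_mem h']
    exact congrArg R.str (Subtype.ext e)
  · have h' : n * k * m⁻¹ ∉ Z := by rwa [e]
    rw [R.cosetCoeff_of_notMem h, R.cosetCoeff_of_notMem h']

theorem act_mul_cosetCoeff (m n : N) (x : R.carrier) :
    R.act n x * R.cosetCoeff m n = R.cosetCoeff m n * R.act m x := by
  by_cases h : n * m⁻¹ ∈ Z
  · rw [R.cosetCoeff_of_mem h, R.str_mul ⟨_, h⟩ (R.act m x), ← AlgEquiv.mul_apply, ← map_mul,
      inv_mul_cancel_right]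
  · rw [R.cosetCoeff_of_notMem h, mul_zero, zero_mul]

/-- The coefficient of an element of the skew group algebra with respect to the basis element `m`
of the crossed product. -/
def skewCoeff (m : N) : SkewMonoidAlgebra R.carrier N →+ R.carrier :=
  SkewMonoidAlgebra.liftNC (AddMonoidHom.id R.carrier) (R.cosetCoeff m)

theorem skewCoeff_single (m n : N) (r : R.carrier) :
    R.skewCoeff m (SkewMonoidAlgebra.single n r) = r * R.cosetCoeff m n :=
  SkewMonoidAlgebra.liftNC_single _ _ _ _

theorem skewCoeff_smul (m : N) (c : O) (t : SkewMonoidAlgebra R.carrier N) :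
    R.skewCoeff m (c • t) = c • R.skewCoeff m t := by
  induction t using SkewMonoidAlgebra.induction_on with
  | zero => rw [smul_zero, map_zero, smul_zero]
  | single n r =>
    rw [SkewMonoidAlgebra.smul_single, skewCoeff_single, skewCoeff_single, smul_mul_assoc]
  | add s t hs ht => rw [smul_add, map_add, hs, ht, map_add, smul_add]

theorem skewCoeff_single_mul [Z.Normal] (m k : N) (r : R.carrier)
    (t : SkewMonoidAlgebra R.carrier N) :
    R.skewCoeff m (SkewMonoidAlgebra.single k r * t)
      = r * R.act k (R.skewCoeff (k⁻¹ * m) t) := by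
  induction t using SkewMonoidAlgebra.induction_on with
  | zero => rw [mul_zero, map_zero, map_zero, map_zero, mul_zero]
  | single n s =>
    rw [SkewMonoidAlgebra.single_mul_single, skewCoeff_single, skewCoeff_single,
      cosetCoeff_mul_left, map_mul, mul_assoc]
    rfl
  | add s t hs ht => rw [mul_add, map_add, hs, ht, map_add, map_add, mul_add]

theorem skewCoeff_mul_single (m k : N) (r : R.carrier) (t : SkewMonoidAlgebra R.carrier N) :
    R.skewCoeff m (t * SkewMonoidAlgebra.single k r)
      = R.skewCoeff (m * k⁻¹) t * R.act (m * k⁻¹) r := by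
  induction t using SkewMonoidAlgebra.induction_on with
  | zero => rw [zero_mul, map_zero, map_zero, zero_mul]
  | single n s =>
    rw [SkewMonoidAlgebra.single_mul_single, skewCoeff_single, skewCoeff_single,
      cosetCoeff_mul_right, mul_assoc, mul_assoc, ← act_mul_cosetCoeff]
    rfl
  | add s t hs ht => rw [add_mul, map_add, hs, ht, map_add, add_mul]

theorem skewCoeff_eq_zero [Z.Normal] (m : N) {t : SkewMonoidAlgebra R.carrier N}
    (ht : t ∈ R.crossedRel) : R.skewCoeff m t = 0 := by
  let I : TwoSidedIdeal (SkewMonoidAlgebra R.carrier N) :=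
    TwoSidedIdeal.mk' {t | ∀ m, R.skewCoeff m t = 0} (fun m => map_zero _)
      (fun hx hy m => by rw [map_add, hx, hy, add_zero])
      (fun hx m => by rw [map_neg, hx, neg_zero])
      (by
        intro x y hy
        induction x using SkewMonoidAlgebra.induction_on with
        | zero => intro m; rw [zero_mul, map_zero]
        | single n r => intro m; rw [skewCoeff_single_mul, hy, map_zero, mul_zero]
        | add s t hs ht => intro m; rw [add_mul, map_add, hs, ht, add_zero])
      (by
        intro x y hx
        induction y using SkewMonoidAlgebra.induction_on with
        | zero => intro m; rw [mul_zero, map_zero]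
        | single n r => intro m; rw [skewCoeff_mul_single, hx, zero_mul]
        | add s t hs ht => intro m; rw [mul_add, map_add, hs, ht, add_zero])
  have hI : ∀ t, t ∈ I ↔ ∀ m, R.skewCoeff m t = 0 := fun t => TwoSidedIdeal.mem_mk' ..
  have hle : R.crossedRel ≤ I := by
    refine TwoSidedIdeal.span_le.mpr ?_
    rintro _ ⟨z, rfl⟩
    refine (hI _).mpr fun m => ?_
    rw [map_sub, skewCoeff_single, skewCoeff_single, one_mul, sub_eq_zero]
    by_cases h : (1 : N) * m⁻¹ ∈ Z
    · have h' : (z : N) * m⁻¹ ∈ Z := by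
        rw [← one_mul m⁻¹]; exact Z.mul_mem z.2 h
      rw [R.cosetCoeff_of_mem h, R.cosetCoeff_of_mem h', ← map_mul]
      exact congrArg R.str (Subtype.ext (congrArg ((z : N) * ·) (one_mul m⁻¹).symm))
    · have h' : (z : N) * m⁻¹ ∉ Z := fun h' => h (by
        rw [one_mul]; exact (Z.mul_mem_cancel_left z.2).mp h')
      rw [R.cosetCoeff_of_notMem h, R.cosetCoeff_of_notMem h', mul_zero]
  exact (hI t).mp (hle ht) m

/-- The coefficient of an element of the crossed product with respect to the basis element `m`. -/
def crossedCoeff [Z.Normal] (m : N) : R.Crossed →ₗ[O] R.carrier :=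
  have key : ∀ s t : SkewMonoidAlgebra R.carrier N, qmk R.crossedRel s = qmk R.crossedRel t →
      R.skewCoeff m s = R.skewCoeff m t := fun s t h => by
    rw [← sub_eq_zero, ← map_sub]
    exact R.skewCoeff_eq_zero m ((qmk_eq_iff _ _ _).mp h)
  have inv : ∀ c, qmk R.crossedRel (Function.surjInv (qmk_surj R.crossedRel) c) = c :=
    Function.surjInv_eq (qmk_surj R.crossedRel)
  { toFun := fun c => R.skewCoeff m (Function.surjInv (qmk_surj R.crossedRel) c)
    map_add' := fun a b => by
      rw [← map_add]
      exact key _ _ ((inv _).trans (congrArg₂ (· + ·) (inv a) (inv b)).symm)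
    map_smul' := fun r a => by
      rw [RingHom.id_apply, ← skewCoeff_smul]
      exact key _ _ ((inv _).trans (congrArg (r • ·) (inv a)).symm) }

theorem crossedCoeff_cr [Z.Normal] (m n : N) (r : R.carrier) :
    R.crossedCoeff m (R.cr r n) = r * R.cosetCoeff m n := by
  rw [← skewCoeff_single]
  change R.skewCoeff m (Function.surjInv (qmk_surj R.crossedRel) _) = _
  rw [← sub_eq_zero, ← map_sub]
  apply R.skewCoeff_eq_zero
  rw [← qmk_eq_iff]
  exact Function.surjInv_eq (qmk_surj R.crossedRel) _

/-! #### The induced module of a principal left ideal -/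

variable {R} (e : R.carrier)

/-- The generator `1 ⊗ e` of the module induced by `R e`. -/
def indGen : R.Ind (Ideal.span {e}) := R.ind 1 1 ⟨e, Ideal.subset_span rfl⟩

/-- The map `c ⊗ v ↦ c v` from the induced module of `R e` to the crossed product. -/
def indToCrossed : R.Ind (Ideal.span {e}) →ₗ[R.Crossed] R.Crossed :=
  (R.indRel (Ideal.span {e})).liftQ
    (TensorProduct.AlgebraTensorModule.lift
      { toFun := fun c =>
          { toFun := fun v => c * R.cr v.1 1
            map_add' := fun v w => by
              rw [Submodule.coe_add, cr_add, mul_add]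
            map_smul' := fun r v => by
              rw [RingHom.id_apply, Submodule.coe_smul_of_tower, cr_smul, mul_smul_comm] }
        map_add' := fun c c' => LinearMap.ext fun v => add_mul c c' _
        map_smul' := fun c c' => LinearMap.ext fun v => mul_assoc c c' _ }) (by
    rw [indRel, Submodule.span_le]
    rintro _ ⟨x, r, v, rfl⟩
    refine LinearMap.mem_ker.mpr ?_
    rw [map_sub, sub_eq_zero]
    change x * R.cr r 1 * R.cr v.1 1 = x * R.cr (r * v.1) 1
    rw [mul_assoc, cr_mul, map_one, mul_one]
    rfl)

theorem indToCrossed_mk (c : R.Crossed) (v : Ideal.span {e}) :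
    indToCrossed e ((R.indRel (Ideal.span {e})).mkQ (c ⊗ₜ[O] v)) = c * R.cr v.1 1 := rfl

theorem indToCrossed_ind (r : R.carrier) (n : N) (v : Ideal.span {e}) :
    indToCrossed e (R.ind r n v) = R.cr (r * R.act n v.1) n := by
  change R.cr r n * R.cr v.1 1 = _
  rw [cr_mul, mul_one]

theorem indToCrossed_gen : indToCrossed e (indGen e) = R.cr e 1 := by
  unfold indGen
  rw [indToCrossed_ind, map_one, one_mul]
  rfl

variable {e}

theorem span_mul_right (he : IsIdempotentElem e) (v : Ideal.span {e}) : v.1 * e = v.1 := by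
  obtain ⟨a, ha⟩ := Ideal.mem_span_singleton'.mp v.2
  rw [← ha, mul_assoc, he.eq]

theorem smul_indGen_mk (c : R.Crossed) :
    c • indGen e = (R.indRel (Ideal.span {e})).mkQ
      (c ⊗ₜ[O] (⟨e, Ideal.subset_span rfl⟩ : Ideal.span {e})) := by
  unfold indGen ind
  rw [← map_smul, TensorProduct.smul_tmul', smul_eq_mul, cr_one, mul_one]

theorem indToCrossed_smul_gen (he : IsIdempotentElem e) (m : R.Ind (Ideal.span {e})) :
    indToCrossed e m • indGen e = m := by
  obtain ⟨t, rfl⟩ := (R.indRel (Ideal.span {e})).mkQ_surjective m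
  induction t using TensorProduct.induction_on with
  | zero => rw [map_zero, map_zero]; exact zero_smul R.Crossed (indGen e)
  | add s t hs ht =>
    rw [map_add, map_add]
    exact (add_smul _ _ _).trans (by rw [hs, ht])
  | tmul c v =>
    rw [indToCrossed_mk, smul_indGen_mk]
    refine (Submodule.Quotient.eq _).mpr ?_
    have hv : (v : R.carrier) • (⟨e, Ideal.subset_span rfl⟩ : Ideal.span {e}) = v :=
      Subtype.ext (span_mul_right he v)
    have h := Submodule.subset_span (R := R.Crossed) (s := {t | ∃ (x : R.Crossed) (r : R.carrier)
      (v : Ideal.span {e}), t = (x * R.cr r 1) ⊗ₜ[O] v - x ⊗ₜ[O] (r • v)})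
      ⟨c, v.1, ⟨e, Ideal.subset_span rfl⟩, rfl⟩
    rw [hv] at h
    exact h

theorem ind_eq_smul (he : IsIdempotentElem e) (r : R.carrier) (n : N) (v : Ideal.span {e}) :
    R.ind r n v = R.cr (r * R.act n v.1) n • indGen e := by
  rw [← indToCrossed_ind, indToCrossed_smul_gen he]

variable {Θ : Type v'} [Group Θ] {deg : N → Θ → Prop}

/-- The element of the crossed product that corresponds to an endomorphism of the induced module. -/
def symbol (f : (R.cliffordAlg (Ideal.span {e}) deg).carrier) : R.Crossed :=
  indToCrossed e ((MulOpposite.unop f : Module.End R.Crossed (R.Ind (Ideal.span {e}))) (indGen e))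

theorem apply_gen (he : IsIdempotentElem e) (f : (R.cliffordAlg (Ideal.span {e}) deg).carrier) :
    (MulOpposite.unop f : Module.End R.Crossed (R.Ind (Ideal.span {e}))) (indGen e)
      = symbol f • indGen e :=
  (indToCrossed_smul_gen he _).symm

theorem apply_eq (he : IsIdempotentElem e) (f : (R.cliffordAlg (Ideal.span {e}) deg).carrier)
    (m : R.Ind (Ideal.span {e})) :
    (MulOpposite.unop f : Module.End R.Crossed (R.Ind (Ideal.span {e}))) m
      = (indToCrossed e m * symbol f) • indGen e := by
  conv_lhs => rw [← indToCrossed_smul_gen he m]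
  rw [map_smul, apply_gen he]
  exact smul_smul (indToCrossed e m) (symbol f) (indGen e)

theorem symbol_injective (he : IsIdempotentElem e) :
    Function.Injective (symbol : (R.cliffordAlg (Ideal.span {e}) deg).carrier → R.Crossed) := by
  intro f g h
  refine MulOpposite.unop_injective (LinearMap.ext fun m => ?_)
  refine (apply_eq he f m).trans (Eq.trans ?_ (apply_eq he g m).symm)
  rw [h]

theorem symbol_mul (he : IsIdempotentElem e)
    (f g : (R.cliffordAlg (Ideal.span {e}) deg).carrier) :
    symbol (f * g) = symbol f * symbol g := by
  change indToCrossed e ((MulOpposite.unop g : Module.End R.Crossed (R.Ind (Ideal.span {e})))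
    ((MulOpposite.unop f : Module.End R.Crossed (R.Ind (Ideal.span {e}))) (indGen e))) = _
  rw [apply_gen he, map_smul, map_smul]
  rfl

theorem symbol_one : symbol (1 : (R.cliffordAlg (Ideal.span {e}) deg).carrier) = R.cr e 1 :=
  indToCrossed_gen e

/-- The symbol, as a linear map. -/
def symbolLin : (R.cliffordAlg (Ideal.span {e}) deg).carrier →ₗ[O] R.Crossed where
  toFun := symbol
  map_add' f g := map_add (indToCrossed e)
    ((MulOpposite.unop f : Module.End R.Crossed (R.Ind (Ideal.span {e}))) (indGen e))
    ((MulOpposite.unop g : Module.End R.Crossed (R.Ind (Ideal.span {e}))) (indGen e))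
  map_smul' c f := map_smul ((indToCrossed e).restrictScalars O) c
    ((MulOpposite.unop f : Module.End R.Crossed (R.Ind (Ideal.span {e}))) (indGen e))

theorem symbol_compress (he : IsIdempotentElem e)
    (f : (R.cliffordAlg (Ideal.span {e}) deg).carrier) :
    R.cr e 1 * symbol f * R.cr e 1 = symbol f := by
  rw [← symbol_one (deg := deg), ← symbol_mul he, ← symbol_mul he, one_mul, mul_one]

variable (R e deg) in
/-- The endomorphism of the induced module given by right multiplication by `c`. -/
def rightMul (c : R.Crossed) : (R.cliffordAlg (Ideal.span {e}) deg).carrier :=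
  MulOpposite.op ((LinearMap.toSpanSingleton R.Crossed (R.Ind (Ideal.span {e})) (indGen e)).comp
    ((LinearMap.toSpanSingleton R.Crossed R.Crossed c).comp (indToCrossed e)))

theorem symbol_rightMul (c : R.Crossed) :
    symbol (rightMul R e deg c) = R.cr e 1 * c * R.cr e 1 := by
  change indToCrossed e ((indToCrossed e (indGen e) * c) • indGen e) = _
  rw [map_smul, indToCrossed_gen, smul_eq_mul]

theorem rightMul_symbol (he : IsIdempotentElem e)
    (f : (R.cliffordAlg (Ideal.span {e}) deg).carrier) : rightMul R e deg (symbol f) = f :=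
  symbol_injective he (by rw [symbol_rightMul, symbol_compress he])

variable (R e deg) in
/-- Right multiplication by elements of the crossed product, as a linear map. -/
def rightMulLin (he : IsIdempotentElem e) :
    R.Crossed →ₗ[O] (R.cliffordAlg (Ideal.span {e}) deg).carrier where
  toFun := rightMul R e deg
  map_add' c c' := symbol_injective he (by
    rw [symbol_rightMul]
    refine Eq.trans ?_ (map_add symbolLin (rightMul R e deg c) (rightMul R e deg c')).symm
    change _ = symbol (rightMul R e deg c) + symbol (rightMul R e deg c')
    rw [symbol_rightMul, symbol_rightMul, mul_add, add_mul])
  map_smul' r c := symbol_injective he (by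
    rw [symbol_rightMul]
    refine Eq.trans ?_ (map_smul symbolLin r (rightMul R e deg c)).symm
    change _ = r • symbol (rightMul R e deg c)
    rw [symbol_rightMul, mul_smul_comm, smul_mul_assoc])

/-- The coefficients of an element of the crossed product, as a linear map. -/
def crLin (n : N) : R.carrier →ₗ[O] R.Crossed where
  toFun r := R.cr r n
  map_add' r s := R.cr_add r s n
  map_smul' c r := R.cr_smul c r n

theorem cr_compress (r : R.carrier) (n : N) :
    R.cr e 1 * R.cr r n * R.cr e 1 = R.cr (e * r * R.act n e) n := by
  rw [cr_mul, cr_mul, map_one R.act, one_mul, mul_one]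
  rfl

theorem cr_idem (he : IsIdempotentElem e) : R.cr e 1 * R.cr e 1 = R.cr e 1 := by
  rw [cr_mul, map_one R.act, mul_one, AlgEquiv.one_apply, he.eq]

theorem cr_of_deg_eq {d : N →* Θ} (hZ : ∀ n, n ∈ Z ↔ d n = 1) {n m : N} (h : d n = d m)
    (r : R.carrier) : ∃ s, R.cr r n = R.cr s m := by
  have hz : n * m⁻¹ ∈ Z := by rw [hZ, map_mul, h, map_inv, mul_inv_cancel]
  refine ⟨r * R.str ⟨n * m⁻¹, hz⟩, ?_⟩
  rw [← cr_mul_left]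
  simp

/-- The graded endomorphism algebra of the module induced by `R e` is the corner of the crossed
product at `e`. -/
def cliffordPres (he : IsIdempotentElem e) (d : N →* Θ) (hZ : ∀ n, n ∈ Z ↔ d n = 1)
    (hdeg : ∀ n x, deg n x ↔ d n = x) :
    Pres d R.act (fun z => R.str ⟨z.1, (hZ z.1).mpr z.2⟩) e
      (R.cliffordAlg (Ideal.span {e}) deg) :=
  have hn : Z.Normal := by
    have : Z = d.ker := Subgroup.ext hZ
    rw [this]
    infer_instance
  { el := fun n => rightMulLin R e deg he ∘ₗ crLin n
    co := fun n => R.crossedCoeff n ∘ₗ symbolLin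
    el_one := symbol_injective he (by
      change symbol (rightMul R e deg (R.cr 1 1)) = _
      rw [symbol_rightMul, symbol_one, cr_one, mul_one, cr_idem he])
    el_mul := fun n m r s => symbol_injective he (by
      change symbol (rightMul R e deg (R.cr r n) * rightMul R e deg (R.cr s m))
        = symbol (rightMul R e deg (R.cr _ _))
      rw [symbol_mul he, symbol_rightMul, symbol_rightMul, symbol_rightMul, cr_compress,
        cr_compress, cr_compress, cr_mul]
      congr 1
      rw [map_mul R.act, AlgEquiv.mul_apply]
      simp only [map_mul, mul_assoc]
      rw [← mul_assoc (R.act n e) (R.act n e), ← map_mul (R.act n), he.eq])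
    el_str := fun z n r => congrArg (rightMul R e deg)
      (R.cr_mul_left r ⟨z.1, (hZ z.1).mpr z.2⟩ n)
    el_compress := fun n r => symbol_injective he (by
      change symbol (rightMul R e deg (R.cr _ n)) = symbol (rightMul R e deg (R.cr r n))
      rw [symbol_rightMul, symbol_rightMul, ← cr_compress, ← mul_assoc, ← mul_assoc, cr_idem he,
        mul_assoc, cr_idem he])
    co_same := fun n r => by
      change R.crossedCoeff n (symbol (rightMul R e deg (R.cr r n))) = _
      rw [symbol_rightMul, cr_compress, crossedCoeff_cr, cosetCoeff_self, mul_one]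
    co_ne := fun n m r h => by
      change R.crossedCoeff m (symbol (rightMul R e deg (R.cr r n))) = _
      have hnm : n * m⁻¹ ∉ Z := fun h' => h (by
        rwa [hZ, map_mul, map_inv, mul_inv_eq_one] at h')
      rw [symbol_rightMul, cr_compress, crossedCoeff_cr, R.cosetCoeff_of_notMem hnm, mul_zero]
    el_mem := fun n r => by
      intro y m hm
      induction hm using Submodule.span_induction with
      | mem m hm =>
        obtain ⟨s, k, v, hk, rfl⟩ := hm
        refine Submodule.subset_span ⟨s * R.act k v.1 * R.act k r, k * n,
          ⟨e, Ideal.subset_span rfl⟩, ?_, ?_⟩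
        · rw [hdeg] at hk ⊢
          rw [map_mul, hk]
        · change (indToCrossed e (R.ind s k v) * R.cr r n) • indGen e = _
          rw [ind_eq_smul he (s * R.act k v.1 * R.act k r), indToCrossed_ind, cr_mul,
            ← indToCrossed_smul_gen he (R.cr _ (k * n) • indGen e), map_smul, indToCrossed_gen,
            smul_eq_mul, cr_mul, mul_one]
      | zero => rw [map_zero]; exact zero_mem _
      | add a c _ _ ha hc => rw [map_add]; exact add_mem ha hc
      | smul c a _ ha =>
        have := Submodule.smul_mem _ c ha
        rwa [← LinearMap.map_smul_of_tower] at this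
    comp_le := fun x f hf => by
      have h1 : indGen e ∈ R.indComp (Ideal.span {e}) deg 1 :=
        Submodule.subset_span ⟨1, 1, _, (hdeg 1 1).mpr (map_one d), rfl⟩
      have h2 := hf 1 _ h1
      rw [one_mul] at h2
      by_cases hx : ∃ n, d n = x
      · obtain ⟨n, rfl⟩ := hx
        right
        have h3 : R.indComp (Ideal.span {e}) deg (d n) ≤
            (LinearMap.range (crLin (R := R) n)).comap ((indToCrossed e).restrictScalars O) := by
          refine Submodule.span_le.mpr ?_
          rintro _ ⟨r, m, v, hm, rfl⟩
          obtain ⟨s, hs⟩ := cr_of_deg_eq hZ ((hdeg _ _).mp hm) (r * R.act m v.1)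
          exact ⟨s, hs.symm.trans (indToCrossed_ind e r m v).symm⟩
        obtain ⟨r, hr⟩ := h3 h2
        refine ⟨n, r, rfl, ?_⟩
        rw [← rightMul_symbol he f]
        exact congrArg (rightMul R e deg) hr.symm
      · left
        have h3 : R.indComp (Ideal.span {e}) deg x ≤ ⊥ := by
          refine Submodule.span_le.mpr ?_
          rintro _ ⟨r, m, v, hm, rfl⟩
          exact absurd ⟨m, (hdeg _ _).mp hm⟩ hx
        refine symbol_injective he ((congrArg (indToCrossed e) ((Submodule.mem_bot O).mp (h3 h2))).trans ?_)
        rw [map_zero]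
        exact (map_zero (symbolLin (R := R) (e := e) (deg := deg))).symm
    span := fun f => by
      rw [← rightMul_symbol he f]
      generalize symbol f = c
      change rightMulLin R e deg he c ∈ _
      induction c using R.crossed_induction with
      | zero => rw [map_zero]; exact zero_mem _
      | add a b ha hb => rw [map_add]; exact add_mem ha hb
      | cr r n => exact Submodule.subset_span ⟨n, r, rfl⟩ }

theorem eq_el_of_apply_gen (he : IsIdempotentElem e) (d : N →* Θ) (hZ : ∀ n, n ∈ Z ↔ d n = 1)
    (hdeg : ∀ n x, deg n x ↔ d n = x) {f : (R.cliffordAlg (Ideal.span {e}) deg).carrier}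
    {r : R.carrier} {n : N}
    (h : (MulOpposite.unop f : Module.End R.Crossed (R.Ind (Ideal.span {e}))) (indGen e)
      = R.ind r n ⟨e, Ideal.subset_span rfl⟩) :
    f = (cliffordPres he d hZ hdeg).el n r := by
  rw [← rightMul_symbol he f, ← rightMul_symbol he ((cliffordPres he d hZ hdeg).el n r)]
  congr 1
  rw [← symbol_compress he f]
  change R.cr e 1 * indToCrossed e _ * _ = symbol (rightMul R e deg (R.cr r n))
  rw [symbol_rightMul, h, indToCrossed_ind, cr_compress, cr_compress, mul_assoc, mul_assoc,
    mul_assoc, ← map_mul, he.eq]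

end InteriorAlgebra

/-! ### The algebra `A` as a crossed product over `B` -/

section AlgebraA

universe u v v' vP
variable {O : Type u} [CommRing O] {G : Type v} [Group G] {Γ : Type v'} [Group Γ]
  {P : Type vP} [Group P] {ω : G →* Γ} (b : InvIdem O ω)

theorem valA_injective : Function.Injective (valA b) := Subtype.val_injective

theorem valB_injective : Function.Injective (valB b) := Subtype.val_injective

theorem inclG_injective (ω : G →* Γ) : Function.Injective (inclG O ω) :=
  MonoidAlgebra.mapDomain_injective Subtype.val_injective

/-- The inclusion `B → A` as an algebra homomorphism. -/
def toAHom : (algB b).carrier →ₐ[O] AlgA b where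
  toFun := toA b
  map_one' := rfl
  map_mul' x y := valA_injective b (map_mul (inclG O ω) (valB b x) (valB b y))
  map_zero' := valA_injective b (map_zero (inclG O ω))
  map_add' x y := valA_injective b (map_add (inclG O ω) (valB b x) (valB b y))
  commutes' r := valA_injective b (map_smul (inclG O ω) r b.val)

theorem toA_mul (x y : (algB b).carrier) : toA b (x * y) = toA b x * toA b y :=
  map_mul (toAHom b) x y

theorem toA_one : toA b 1 = 1 := rfl

theorem toA_injective : Function.Injective (toA b) := fun _ _ h =>
  valB_injective b (inclG_injective ω (congrArg (valA b) h))

theorem grpA_one : grpA b 1 = 1 :=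
  valA_injective b (by
    change inclG O ω b.val * MonoidAlgebra.of O G 1 = inclG O ω b.val
    rw [map_one, mul_one])

theorem grpA_mul (g h : G) : grpA b (g * h) = grpA b g * grpA b h :=
  valA_injective b (by
    change inclG O ω b.val * MonoidAlgebra.of O G (g * h)
      = inclG O ω b.val * MonoidAlgebra.of O G g * (inclG O ω b.val * MonoidAlgebra.of O G h)
    rw [mul_assoc, ← mul_assoc (MonoidAlgebra.of O G g), ← centralG, ← mul_assoc, ← mul_assoc,
      (idemG b).eq, map_mul, mul_assoc])

theorem grpA_mul_toA (g : G) (x : (algB b).carrier) :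
    grpA b g * toA b x = toA b ((algB b).act g x) * grpA b g :=
  valA_injective b (by
    change inclG O ω b.val * MonoidAlgebra.of O G g * inclG O ω (valB b x)
      = inclG O ω (MonoidAlgebra.domCongr O O (MulAut.conjNormal g) (valB b x))
        * (inclG O ω b.val * MonoidAlgebra.of O G g)
    rw [mul_assoc, ← inclG_act, ← mul_assoc, ← mul_assoc, ← map_mul, ← map_mul, b.central])

theorem toA_str (h : ω.ker) : toA b ((algB b).str h) = grpA b h :=
  valA_injective b (by
    change inclG O ω (b.val * MonoidAlgebra.of O ω.ker h) = _
    rw [map_mul]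
    change _ = inclG O ω b.val * MonoidAlgebra.of O G h
    congr 1
    simp [inclG])

theorem grpA_inv_mul (g : G) : grpA b g⁻¹ * grpA b g = 1 := by
  rw [← grpA_mul, inv_mul_cancel, grpA_one]

theorem grpA_mul_inv (g : G) : grpA b g * grpA b g⁻¹ = 1 := by
  rw [← grpA_mul, mul_inv_cancel, grpA_one]

/-- The elements of `O G` that are supported on the fibre of `ω` above `x`. -/
def fibreSub (ω : G →* Γ) (x : Γ) : Submodule O (MonoidAlgebra O G) where
  carrier := {a | ∀ g, a.coeff g ≠ 0 → ω g = x}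
  add_mem' := by
    intro a c ha hc g hg
    by_cases h : a.coeff g = 0
    · refine hc g fun h' => hg ?_
      rw [MonoidAlgebra.coeff_add, Finsupp.add_apply, h, h', add_zero]
    · exact ha g h
  zero_mem' g hg := absurd rfl hg
  smul_mem' := by
    intro r a ha g hg
    refine ha g fun h => hg ?_
    rw [MonoidAlgebra.coeff_smul, Finsupp.smul_apply, h, smul_zero]

theorem of_mem_fibreSub (g : G) : MonoidAlgebra.of O G g ∈ fibreSub (O := O) ω (ω g) := by
  intro k hk
  rw [MonoidAlgebra.of_apply, MonoidAlgebra.coeff_single] at hk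
  by_contra h
  refine hk (Finsupp.single_eq_of_ne fun h' => h ?_)
  rw [h']

theorem inclG_mem_fibreSub (x : MonoidAlgebra O ω.ker) : inclG O ω x ∈ fibreSub ω 1 := by
  induction x using MonoidAlgebra.induction_on with
  | of h =>
    have e : inclG O ω (MonoidAlgebra.of O ω.ker h) = MonoidAlgebra.of O G h := by simp [inclG]
    rw [e]
    have := of_mem_fibreSub (O := O) (ω := ω) (h : G)
    rwa [show ω (h : G) = 1 from h.2] at this
  | add x y hx hy => rw [map_add]; exact add_mem hx hy
  | smul r x hx => rw [map_smul]; exact Submodule.smul_mem _ r hx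

variable [Finite G]

theorem eq_sum_coeff {H : Type*} [Group H] [Fintype H] (a : MonoidAlgebra O H) :
    a = ∑ g, a.coeff g • MonoidAlgebra.of O H g := by
  induction a using MonoidAlgebra.induction_on with
  | of h =>
    rw [Finset.sum_eq_single h]
    · rw [MonoidAlgebra.of_apply, MonoidAlgebra.coeff_single, Finsupp.single_eq_same, one_smul]
    · intro g _ hg
      rw [MonoidAlgebra.of_apply, MonoidAlgebra.coeff_single, Finsupp.single_eq_of_ne hg, zero_smul]
    · exact fun h' => absurd (Finset.mem_univ _) h'
  | add x y hx hy =>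
    conv_lhs => rw [hx, hy]
    rw [← Finset.sum_add_distrib]
    exact Finset.sum_congr rfl fun g _ => by
      rw [MonoidAlgebra.coeff_add, Finsupp.add_apply, add_smul]
  | smul r x hx =>
    conv_lhs => rw [hx]
    rw [Finset.smul_sum]
    exact Finset.sum_congr rfl fun g _ => by
      rw [MonoidAlgebra.coeff_smul, Finsupp.smul_apply, smul_smul, smul_eq_mul]

theorem fibreSub_le_span (x : Γ) :
    fibreSub (O := O) ω x ≤ Submodule.span O {t | ∃ g, ω g = x ∧ t = MonoidAlgebra.of O G g} := by
  have := Fintype.ofFinite G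
  intro a ha
  rw [eq_sum_coeff a]
  refine Submodule.sum_mem _ fun g _ => ?_
  by_cases h : a.coeff g = 0
  · rw [h, zero_smul]; exact zero_mem _
  · exact Submodule.smul_mem _ _ (Submodule.subset_span ⟨g, ha g h, rfl⟩)

theorem fibreSub_mul {x y : Γ} {a c : MonoidAlgebra O G} (ha : a ∈ fibreSub ω x)
    (hc : c ∈ fibreSub ω y) : a * c ∈ fibreSub ω (x * y) := by
  have h : fibreSub (O := O) ω x * fibreSub ω y ≤ fibreSub ω (x * y) := by
    refine (mul_le_mul' (fibreSub_le_span x) (fibreSub_le_span y)).trans ?_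
    rw [Submodule.span_mul_span, Submodule.span_le]
    rintro _ ⟨_, ⟨g, rfl, rfl⟩, _, ⟨k, rfl, rfl⟩, rfl⟩
    change MonoidAlgebra.of O G g * MonoidAlgebra.of O G k ∈ _
    rw [← map_mul, ← map_mul]
    exact of_mem_fibreSub _
  exact h (Submodule.mul_mem_mul ha hc)

variable {b}

theorem compA_mul {x y : Γ} {a c : AlgA b} (ha : a ∈ compA b x) (hc : c ∈ compA b y) :
    a * c ∈ compA b (x * y) :=
  fibreSub_mul ha hc

omit [Finite G] in
theorem toA_mem_compA (x : (algB b).carrier) : toA b x ∈ compA b 1 :=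
  inclG_mem_fibreSub (valB b x)

theorem grpA_mem_compA (g : G) : grpA b g ∈ compA b (ω g) := by
  have := fibreSub_mul (inclG_mem_fibreSub (O := O) b.val) (of_mem_fibreSub (ω := ω) g)
  rwa [one_mul] at this

omit [Finite G] in
theorem eq_sum_grpA [Fintype G] (a : AlgA b) : a = ∑ g, (valA b a).coeff g • grpA b g := by
  apply valA_injective b
  have h1 : valA b (∑ g, (valA b a).coeff g • grpA b g)
      = ∑ g, (valA b a).coeff g • (inclG O ω b.val * MonoidAlgebra.of O G g) :=
    map_sum (valA b) _ _
  have h2 : inclG O ω b.val * valA b a = valA b a := corner_left (idemG b) a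
  rw [h1, ← h2]
  conv_lhs => rw [eq_sum_coeff (valA b a), Finset.mul_sum]
  refine Finset.sum_congr rfl fun g _ => ?_
  rw [mul_smul_comm, h2]

theorem exists_toA {a : AlgA b} (ha : a ∈ compA b 1) : ∃ x, toA b x = a := by
  have := Fintype.ofFinite G
  change a ∈ LinearMap.range (toAHom b).toLinearMap
  rw [eq_sum_grpA a]
  refine Submodule.sum_mem _ fun g _ => ?_
  by_cases h : (valA b a).coeff g = 0
  · rw [h, zero_smul]; exact zero_mem _
  · exact Submodule.smul_mem _ _ ⟨(algB b).str ⟨g, ha g h⟩, toA_str b _⟩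

theorem exists_toA_mul_grpA {a : AlgA b} {g : G} (ha : a ∈ compA b (ω g)) :
    ∃ x, a = toA b x * grpA b g := by
  have h := compA_mul ha (grpA_mem_compA (b := b) g⁻¹)
  rw [← map_mul, mul_inv_cancel, map_one] at h
  obtain ⟨x, hx⟩ := exists_toA h
  exact ⟨x, by rw [hx, mul_assoc, grpA_inv_mul, mul_one]⟩

end AlgebraA

/-! ### The degree homomorphism on the normalizer of a point -/

section Degree

universe u v v' vP
variable {O : Type u} [CommRing O] {G : Type v} [Group G] {Γ : Type v'} [Group Γ]
  {P : Type vP} [Group P] {ω : G →* Γ} {b : InvIdem O ω} {ι : P →* G}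

/-- The automorphism of `P` that is induced by an element of `N_G(P)`. -/
def conjP (hι : Function.Injective ι) :
    (Subgroup.normalizer (ι.range : Set G) : Subgroup G) →* MulAut P :=
  (MulAut.congr (MonoidHom.ofInjective hι).symm).toMonoidHom.comp ι.range.normalizerMonoidHom

theorem conjP_apply (hι : Function.Injective ι)
    (n : (Subgroup.normalizer (ι.range : Set G) : Subgroup G)) (u : P) :
    ι (conjP hι n u) = n * ι u * (n : G)⁻¹ := by
  have h : MonoidHom.ofInjective hι ((MonoidHom.ofInjective hι).symm
      (ι.range.normalizerMonoidHom n (MonoidHom.ofInjective hι u)))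
      = ι.range.normalizerMonoidHom n (MonoidHom.ofInjective hι u) :=
    MulEquiv.apply_symm_apply _ _
  exact congrArg Subtype.val h

/-- The homomorphism `N_G(P_γ) → Aut(P) × Γ` with kernel `C_H(P)`. -/
def degHom (hι : Function.Injective ι) (i : fixedSub b ι) : normP i →* MulAut P × Γ :=
  ((conjP hι).comp (Subgroup.inclusion inf_le_left)).prod (ω.comp (normP i).subtype)

theorem degHom_fst (hι : Function.Injective ι) (i : fixedSub b ι) (n : normP i) (u : P) :
    ι ((degHom hι i n).1 u) = n * ι u * (n : G)⁻¹ :=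
  conjP_apply hι _ u

theorem induces_unique (hι : Function.Injective ι) {n : G} {x y : MulAut P × Γ}
    (hx : Induces ω ι n x) (hy : Induces ω ι n y) : x = y := by
  refine Prod.ext (MulEquiv.ext fun u => hι ?_) (hx.2.trans hy.2.symm)
  rw [hx.1, hy.1]

theorem degN_iff (hι : Function.Injective ι) (i : fixedSub b ι) (n : normP i) (x : MulAut P × Γ) :
    degN i n x ↔ degHom hι i n = x := by
  have h : Induces ω ι n (degHom hι i n) := ⟨degHom_fst hι i n, rfl⟩
  exact ⟨fun hx => induces_unique hι h hx, fun hx => hx ▸ h⟩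

theorem mem_centP_iff (hι : Function.Injective ι) (i : fixedSub b ι) (n : normP i) :
    n ∈ centP i ↔ degHom hι i n = 1 := by
  rw [← degN_iff hι]
  constructor
  · rintro ⟨h1, h2⟩
    exact ⟨fun u => by rw [h2 u, mul_inv_cancel_right]; rfl, h1.symm⟩
  · rintro ⟨h1, h2⟩
    refine ⟨h2.symm, fun u => ?_⟩
    have := h1 u
    rw [eq_mul_inv_iff_mul_eq] at this
    exact this.symm

/-- The structure maps of the presentations below: `C_H(P)` is the kernel of `degHom`. -/
def kerToCent (hι : Function.Injective ι) (i : fixedSub b ι) (z : (degHom hι i).ker) : centP i :=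
  ⟨z.1, (mem_centP_iff hι i z.1).mpr z.2⟩

/-- `ℰ` as a corner of the crossed product over `B^P`. -/
def presE (hι : Function.Injective ι) {i : fixedSub b ι} (hi : IsIdempotentElem (toBP i i)) :
    Pres (degHom hι i) (algBP i).act (fun z => (algBP i).str (kerToCent hι i z)) (toBP i i)
      (calE i) :=
  InteriorAlgebra.cliffordPres hi (degHom hι i) (mem_centP_iff hι i) (degN_iff hι i)

/-- `ℰ̄` as a corner of the crossed product over `B(P_γ)`. -/
def presEbar (hι : Function.Injective ι) {i : fixedSub b ι} (hi : IsIdempotentElem (toBPγ i i)) :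
    Pres (degHom hι i) (algBPγ i).act (fun z => (algBPγ i).str (kerToCent hι i z)) (toBPγ i i)
      (calEbar i) :=
  InteriorAlgebra.cliffordPres hi (degHom hι i) (mem_centP_iff hι i) (degN_iff hι i)

/-- `ℰ̄(P)` as a corner of the crossed product over `B(P) b_γ / m^*`. -/
def presEbarP [IsLocalRing O] {hι : Function.Injective ι} {i : fixedSub b ι}
    {c : (algBofP hι i).carrier} (hc : IsPointBlock hι i c) (hi : IsIdempotentElem (toBPm hc i)) :
    Pres (degHom hι i) (algBPm hc).act (fun z => (algBPm hc).str (kerToCent hι i z)) (toBPm hc i)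
      (calEbarP hc) :=
  InteriorAlgebra.cliffordPres hi (degHom hι i) (mem_centP_iff hι i) (degN_iff hι i)

theorem RepE.eq_el (hι : Function.Injective ι) {i : fixedSub b ι}
    (hi : IsIdempotentElem (toBP i i)) {β : fixedSub b ι} {n : normP i} {f : (calE i).carrier}
    (h : RepE i β n f) : f = (presE hι hi).el n (toBP i β) :=
  InteriorAlgebra.eq_el_of_apply_gen hi (degHom hι i) (mem_centP_iff hι i) (degN_iff hι i) h

theorem RepEbar.eq_el (hι : Function.Injective ι) {i : fixedSub b ι}
    (hi : IsIdempotentElem (toBPγ i i)) {β : fixedSub b ι} {n : normP i} {f : (calEbar i).carrier}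
    (h : RepEbar i β n f) : f = (presEbar hι hi).el n (toBPγ i β) :=
  InteriorAlgebra.eq_el_of_apply_gen hi (degHom hι i) (mem_centP_iff hι i) (degN_iff hι i) h

theorem RepEbarP.eq_el [IsLocalRing O] {hι : Function.Injective ι} {i : fixedSub b ι}
    {c : (algBofP hι i).carrier} {hc : IsPointBlock hι i c} (hi : IsIdempotentElem (toBPm hc i))
    {β : fixedSub b ι} {n : normP i} {f : (calEbarP hc).carrier} (h : RepEbarP hc β n f) :
    f = (presEbarP hc hi).el n (toBPm hc β) :=
  InteriorAlgebra.eq_el_of_apply_gen hi (degHom hι i) (mem_centP_iff hι i) (degN_iff hι i) h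

end Degree

/-! ### Sums over orbits and the Brauer map -/

section Orbit

universe u v v' vP vS
variable {O : Type u} [CommRing O] {G : Type v} [Group G] {Γ : Type v'} [Group Γ]
  {P : Type vP} [Group P] {ω : G →* Γ} {b : InvIdem O ω} {ι : P →* G}

/-- The kernel of the Brauer map, as a set of elements of `B`. -/
def brauerVal [IsLocalRing O] (b : InvIdem O ω) (ι : P →* G) : AddSubmonoid (algB b).carrier where
  carrier := {y | ∃ z ∈ brauerKer b ι, z.1 = y}
  zero_mem' := ⟨0, zero_mem _, rfl⟩
  add_mem' := by
    rintro _ _ ⟨y, hy, rfl⟩ ⟨z, hz, rfl⟩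
    exact ⟨y + z, add_mem hy hz, rfl⟩

theorem mem_brauerKer_iff [IsLocalRing O] (x : fixedSub b ι) :
    x ∈ brauerKer b ι ↔ x.1 ∈ brauerVal b ι := by
  constructor
  · exact fun h => ⟨x, h, rfl⟩
  · rintro ⟨z, hz, h⟩
    rwa [← Subtype.ext h]

variable {S : Type vS} [MulAction P S]

/-- The sum of an equivariant family over an orbit is a relative trace. -/
theorem isRelTrace_orbit [Finite P] {F : S → (algB b).carrier}
    (hF : ∀ u s, F (u • s) = (algB b).act (ι u) (F s)) (s₀ : S) (A : Finset S)
    (hA : ∀ s, s ∈ A ↔ s ∈ MulAction.orbit P s₀) :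
    IsRelTrace b ι (MulAction.stabilizer P s₀) (∑ s ∈ A, F s) := by
  classical
  have := Fintype.ofFinite (P ⧸ MulAction.stabilizer P s₀)
  have hT : ∀ t, t ∈ (Finset.univ : Finset (P ⧸ MulAction.stabilizer P s₀)).image Quotient.out
      ↔ ∃ q : P ⧸ MulAction.stabilizer P s₀, Quotient.out q = t := fun t => by
    rw [Finset.mem_image]
    exact ⟨fun ⟨q, _, h⟩ => ⟨q, h⟩, fun ⟨q, h⟩ => ⟨q, Finset.mem_univ _, h⟩⟩
  refine ⟨F s₀, Finset.univ.image (Quotient.out : P ⧸ MulAction.stabilizer P s₀ → P),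
    fun u hu => ?_, fun u => ?_, ?_⟩
  · rw [← hF, MulAction.mem_stabilizer_iff.mp hu]
  · refine ⟨(u : P ⧸ MulAction.stabilizer P s₀).out, ⟨(hT _).mpr ⟨_, rfl⟩, ?_⟩, ?_⟩
    · rw [← QuotientGroup.eq]
      exact Quotient.out_eq' _
    · rintro t ⟨ht, htu⟩
      obtain ⟨q, rfl⟩ := (hT t).mp ht
      rw [← QuotientGroup.eq] at htu
      have : q = u := (Quotient.out_eq' q).symm.trans htu
      rw [this]
  · symm
    refine Finset.sum_bij (fun t _ => t • s₀) (fun t _ => (hA _).mpr ⟨t, rfl⟩) ?_ ?_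
      (fun t _ => (hF t s₀).symm)
    · intro t ht t' ht' h
      obtain ⟨q, rfl⟩ := (hT t).mp ht
      obtain ⟨q', rfl⟩ := (hT t').mp ht'
      have h2 : (q.out : P ⧸ MulAction.stabilizer P s₀) = q'.out := by
        rw [QuotientGroup.eq, MulAction.mem_stabilizer_iff, mul_smul]
        exact inv_smul_eq_iff.mpr h.symm
      have h3 : q = q' := (Quotient.out_eq' q).symm.trans (h2.trans (Quotient.out_eq' q'))
      rw [h3]
    · intro s hs
      obtain ⟨u, rfl⟩ := (hA s).mp hs
      refine ⟨(u : P ⧸ MulAction.stabilizer P s₀).out, (hT _).mpr ⟨_, rfl⟩, ?_⟩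
      have h : ((u : P ⧸ MulAction.stabilizer P s₀).out : P ⧸ MulAction.stabilizer P s₀) = u :=
        Quotient.out_eq' _
      rw [QuotientGroup.eq, MulAction.mem_stabilizer_iff, mul_smul] at h
      exact (inv_smul_eq_iff.mp h).symm

/-- The sum of an equivariant family that vanishes on fixed points is killed by the Brauer map. -/
theorem sum_mem_brauerVal [IsLocalRing O] [Finite P] [Fintype S] {F : S → (algB b).carrier}
    (hF : ∀ u s, F (u • s) = (algB b).act (ι u) (F s))
    (h0 : ∀ s, (∀ u : P, u • s = s) → F s = 0) : ∑ s, F s ∈ brauerVal b ι := by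
  classical
  rw [← Finset.sum_fiberwise Finset.univ
    (fun s => (Quotient.mk (MulAction.orbitRel P S) s)) F]
  refine AddSubmonoid.sum_mem _ fun q _ => ?_
  obtain ⟨s₀, rfl⟩ := Quotient.exists_rep q
  have hA : ∀ s, s ∈ (Finset.univ.filter fun s => Quotient.mk (MulAction.orbitRel P S) s
      = Quotient.mk (MulAction.orbitRel P S) s₀) ↔ s ∈ MulAction.orbit P s₀ := fun s => by
    rw [Finset.mem_filter, Quotient.eq]
    exact ⟨fun h => h.2, fun h => ⟨Finset.mem_univ _, h⟩⟩
  by_cases h : MulAction.stabilizer P s₀ = ⊤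
  · rw [Finset.sum_eq_zero]
    · exact zero_mem _
    · intro s hs
      have hfix : ∀ u : P, u • s₀ = s₀ := fun u => by
        rw [← MulAction.mem_stabilizer_iff, h]; trivial
      obtain ⟨u, rfl⟩ := (hA s).mp hs
      change F (u • s₀) = 0
      rw [hfix]
      exact h0 _ hfix
  · have htr := isRelTrace_orbit (b := b) hF s₀ _ hA
    suffices hfix : (∑ s with Quotient.mk (MulAction.orbitRel P S) s
        = Quotient.mk (MulAction.orbitRel P S) s₀, F s) ∈ fixedSub b ι from
      ⟨⟨_, hfix⟩, TwoSidedIdeal.subset_span (Or.inl ⟨_, h, htr⟩), rfl⟩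
    intro u
    rw [map_sum]
    refine Finset.sum_bij (fun s _ => u • s) (fun s hs => ?_) (fun s _ t _ hst => ?_)
      (fun s hs => ?_) (fun s _ => (hF u s).symm)
    · rw [hA] at hs ⊢
      exact MulAction.mem_orbit_of_mem_orbit _ hs
    · exact MulAction.injective u hst
    · refine ⟨u⁻¹ • s, ?_, smul_inv_smul u s⟩
      rw [hA] at hs ⊢
      exact MulAction.mem_orbit_of_mem_orbit _ hs

end Orbit

/-! ### Fusions are induced by the normalizer of the point -/

section Fusion

theorem IsLocalIdem.map {R S : Type*} [Ring R] [Ring S] (f : R →+* S)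
    (hf : Function.Surjective f) {e : R} (he : IsLocalIdem e) (h0 : f e ≠ 0) :
    IsLocalIdem (f e) := by
  have hcu : ∀ x, CornerUnit e x → CornerUnit (f e) (f x) := by
    rintro x ⟨y, h1, h2, h3, h4⟩
    exact ⟨f y, by rw [← map_mul, h1], by rw [← map_mul, h2], by rw [← map_mul, h3],
      by rw [← map_mul, h4]⟩
  refine ⟨he.idem.map f, h0, fun x h1 h2 => ?_⟩
  obtain ⟨x, rfl⟩ := hf x
  have e1 : f (e * x * e) = f x := by rw [map_mul, map_mul, h1, h2]
  have h := he.dichotomy (e * x * e) (by rw [← mul_assoc, ← mul_assoc, he.idem.eq])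
    (by rw [mul_assoc, he.idem.eq])
  rw [← e1, ← map_sub]
  exact h.imp (hcu _) (hcu _)

theorem IsLocalIdem.map_equiv {R S : Type*} [Ring R] [Ring S] (s : R ≃+* S) {e : R}
    (he : IsLocalIdem e) : IsLocalIdem (s e) :=
  IsLocalIdem.map (s : R →+* S) s.surjective he fun h =>
    he.ne_zero ((map_eq_zero_iff s s.injective).mp h)

universe u v v' vP
variable {O : Type u} [CommRing O] {G : Type v} [Group G] {Γ : Type v'} [Group Γ]
  {P : Type vP} [Group P] {ω : G →* Γ} {b : InvIdem O ω} {ι : P →* G}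

/-- The action of `N_G(P)` on `B^P`. -/
def actNorm (b : InvIdem O ω) (ι : P →* G) :
    (Subgroup.normalizer (ι.range : Set G) : Subgroup G) →* (fixedSub b ι ≃ₐ[O] fixedSub b ι) :=
  restrictAct (algB b) (fixedSub b ι) _ (fun _ hn x hx => act_mem_fixedSub hn x hx)

theorem image_act_pointSet (i : fixedSub b ι)
    (n : (Subgroup.normalizer (ι.range : Set G) : Subgroup G)) :
    (algB b).act n '' pointSet i = pointSet (actNorm b ι n i) := by
  unfold pointSet
  rw [Set.image_image]
  apply Set.Subset.antisymm
  · rintro _ ⟨j, hj, rfl⟩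
    exact ⟨actNorm b ι n j, conjClass_map (actNorm b ι n : fixedSub b ι →+* fixedSub b ι) hj, rfl⟩
  · rintro _ ⟨j, hj, rfl⟩
    have h := conjClass_map ((actNorm b ι n).symm : fixedSub b ι →+* fixedSub b ι) hj
    refine ⟨(actNorm b ι n).symm j, ?_, ?_⟩
    · have e : ((actNorm b ι n).symm : fixedSub b ι →+* fixedSub b ι) (actNorm b ι n i) = i :=
        (actNorm b ι n).symm_apply_apply i
      rwa [e] at h
    · exact congrArg Subtype.val ((actNorm b ι n).apply_symm_apply j)

theorem pointSet_eq_iff (i j : fixedSub b ι) : pointSet j = pointSet i ↔ j ∈ conjClass i := by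
  constructor
  · intro h
    have hj : j.1 ∈ pointSet j := ⟨j, conjClass_refl j, rfl⟩
    rw [h] at hj
    obtain ⟨k, hk, hkj⟩ := hj
    rwa [← Subtype.ext hkj]
  · intro h
    refine congrArg (Set.image Subtype.val) (Set.ext fun k => ?_)
    exact ⟨fun hk => conjClass_trans h hk, fun hk => conjClass_trans (conjClass_symm h) hk⟩

theorem mem_normP_iff (i : fixedSub b ι)
    (n : (Subgroup.normalizer (ι.range : Set G) : Subgroup G)) :
    (n : G) ∈ normP i ↔ actNorm b ι n i ∈ conjClass i := by
  rw [← pointSet_eq_iff, ← image_act_pointSet]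
  exact ⟨fun h => h.2, fun h => ⟨n.2, h⟩⟩

/-- The elements of `C_H(P)` stabilize all points of `P` on `B`, so that `N_G(P_γ)` contains every
element of `G` that induces the same pair as one of its elements. -/
theorem mem_normP_of_induces (hι : Function.Injective ι) (i : fixedSub b ι) (n : normP i) {m : G}
    (hm : Induces ω ι m (degHom hι i n)) : m ∈ normP i := by
  have hn : Induces ω ι n (degHom hι i n) := ⟨degHom_fst hι i n, rfl⟩
  have h1 : ω ((n : G)⁻¹ * m) = 1 := by
    rw [map_mul, map_inv, ← hm.2, ← hn.2, inv_mul_cancel]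
  have h2 : ∀ u, (n : G)⁻¹ * m * ι u = ι u * ((n : G)⁻¹ * m) := by
    intro u
    have h3 : m * ι u * m⁻¹ = n * ι u * (n : G)⁻¹ := (hm.1 u).symm.trans (hn.1 u)
    rw [mul_inv_eq_iff_eq_mul] at h3
    rw [mul_assoc, h3]
    group
  have hz : ((n : G)⁻¹ * m) ∈ Subgroup.normalizer (ι.range : Set G) := by
    intro x
    have h4 : ∀ x ∈ ι.range, ∀ c : G, (∀ u, c * ι u = ι u * c) → c * x * c⁻¹ ∈ ι.range := by
      rintro _ ⟨u, rfl⟩ c hc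
      rw [hc, mul_inv_cancel_right]
      exact ⟨u, rfl⟩
    refine ⟨fun hx => h4 x hx _ h2, fun hx => ?_⟩
    have h5 := h4 _ hx ((n : G)⁻¹ * m)⁻¹ (fun u => by
      rw [inv_mul_eq_iff_eq_mul, ← mul_assoc, h2, mul_inv_cancel_right])
    have e : ((n : G)⁻¹ * m)⁻¹ * ((n : G)⁻¹ * m * x * ((n : G)⁻¹ * m)⁻¹) * ((n : G)⁻¹ * m)⁻¹⁻¹ = x := by
      group
    rwa [e] at h5
  have hzP : ((n : G)⁻¹ * m) ∈ normP i := by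
    refine (mem_normP_iff i ⟨_, hz⟩).mpr ?_
    have hs : (algB b).str ⟨_, h1⟩ ∈ fixedSub b ι := fun u =>
      (algB b).act_str (ι u) _ _ (by
        change (n : G)⁻¹ * m = ι u * ((n : G)⁻¹ * m) * (ι u)⁻¹
        rw [← h2, mul_inv_cancel_right])
    have hs' : (algB b).str ⟨_, h1⟩⁻¹ ∈ fixedSub b ι := fun u =>
      (algB b).act_str (ι u) _ _ (by
        change ((n : G)⁻¹ * m)⁻¹ = ι u * ((n : G)⁻¹ * m)⁻¹ * (ι u)⁻¹
        rw [eq_mul_inv_iff_mul_eq, inv_mul_eq_iff_eq_mul, ← mul_assoc, h2, mul_inv_cancel_right])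
    refine mem_conjClass_of_inverse (u := (⟨_, hs⟩ : fixedSub b ι)) (v := ⟨_, hs'⟩) ?_ ?_ ?_
    · refine Subtype.ext ?_
      change (algB b).str _ * (algB b).str _ = 1
      rw [← map_mul, mul_inv_cancel, map_one]
    · refine Subtype.ext ?_
      change (algB b).str _ * (algB b).str _ = 1
      rw [← map_mul, inv_mul_cancel, map_one]
    · exact Subtype.ext ((algB b).str_mul ⟨_, h1⟩ i.1)
  have := (normP i).mul_mem n.2 hzP
  rwa [mul_inv_cancel_left] at this

theorem toA_comm_grpA (x : fixedSub b ι) (u : P) :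
    toA b x.1 * grpA b (ι u) = grpA b (ι u) * toA b x.1 := by
  rw [grpA_mul_toA, x.2 u]

theorem act_mem_conjClass (i : fixedSub b ι) (n : normP i) :
    (algBP i).act n (toBP i i) ∈ conjClass (toBP i i) := by
  have h := act_inv_mem_conjClass i n⁻¹
  rw [map_inv] at h
  exact h

variable [Finite G]

/-- If the unit `w` of `B^P` conjugates `i` to its image under `n`, then right multiplication by
`n⁻¹ w` is an isomorphism of `A i` with its twist. -/
theorem degHom_mem_fusF (hι : Function.Injective ι) (i : fixedSub b ι) (n : normP i) :
    degHom hι i n ∈ fusF i := by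
  refine ⟨fun u => ?_, ?_⟩
  · rw [degHom_fst, map_mul, map_mul, map_inv]
    rfl
  obtain ⟨w, hw⟩ := (mem_normP_iff i ⟨n, n.2.1⟩).mp n.2
  set t : AlgA b := grpA b (n : G)⁻¹ * toA b w.1.1 with ht
  set t' : AlgA b := toA b (↑w⁻¹ : fixedSub b ι).1 * grpA b (n : G) with ht'
  have hw1 : toA b w.1.1 * toA b (↑w⁻¹ : fixedSub b ι).1 = 1 := by
    rw [← toA_mul, ← toA_one]
    exact congrArg (toA b) (congrArg Subtype.val (w.mul_inv))
  have hw2 : toA b (↑w⁻¹ : fixedSub b ι).1 * toA b w.1.1 = 1 := by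
    rw [← toA_mul, ← toA_one]
    exact congrArg (toA b) (congrArg Subtype.val (w.inv_mul))
  have h1 : t * t' = 1 := by
    rw [ht, ht', mul_assoc, ← mul_assoc (toA b _), hw1, one_mul, grpA_inv_mul]
  have h2 : t' * t = 1 := by
    rw [ht, ht', mul_assoc, ← mul_assoc (grpA b _), grpA_mul_inv, one_mul, hw2]
  have hni : toA b ((algB b).act n i.1) * toA b w.1.1
      = toA b w.1.1 * iA i := by
    rw [iA, ← toA_mul, ← toA_mul]
    refine congrArg (toA b) (congrArg Subtype.val (?_ : actNorm b ι ⟨n, n.2.1⟩ i * ↑w = ↑w * i))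
    rw [hw, mul_assoc, w.inv_mul, mul_one]
  have h3 : iA i * t = t * iA i := by
    have h4 : grpA b (n : G)⁻¹ * toA b ((algB b).act n i.1) = iA i * grpA b (n : G)⁻¹ := by
      rw [grpA_mul_toA, ← AlgEquiv.mul_apply, ← map_mul, inv_mul_cancel, map_one]
      rfl
    rw [ht, ← mul_assoc, ← h4, mul_assoc, hni, mul_assoc]
  have h3' : iA i * t' = t' * iA i := by
    calc iA i * t' = t' * t * iA i * t' := by rw [h2, one_mul]
      _ = t' * (t * iA i) * t' := by rw [mul_assoc t' t]
      _ = t' * (iA i * (t * t')) := by rw [← h3, mul_assoc, mul_assoc (iA i)]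
      _ = t' * iA i := by rw [h1, mul_one]
  have hmem : ∀ s : AlgA b, iA i * s = s * iA i → ∀ m ∈ Ideal.span {iA i},
      m * s ∈ Ideal.span {iA i} := by
    intro s hs m hm
    obtain ⟨a, rfl⟩ := Ideal.mem_span_singleton'.mp hm
    exact Ideal.mem_span_singleton'.mpr ⟨a * s, by rw [mul_assoc, mul_assoc, hs]⟩
  have hdt : t ∈ compA b (degHom hι i n).2⁻¹ := by
    have := compA_mul (grpA_mem_compA (b := b) (n : G)⁻¹) (toA_mem_compA w.1.1)
    rwa [map_inv, mul_one] at this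
  have hdt' : t' ∈ compA b (degHom hι i n).2 := by
    have := compA_mul (toA_mem_compA (↑w⁻¹ : fixedSub b ι).1)
      (grpA_mem_compA (b := b) (n : G))
    rwa [one_mul] at this
  have hut : ∀ u, grpA b (ι u) * t = t * grpA b (ι ((degHom hι i n).1 u)) := by
    intro u
    rw [ht, mul_assoc, toA_comm_grpA, ← mul_assoc, ← mul_assoc, ← grpA_mul, ← grpA_mul, degHom_fst]
    congr 2
    group
  refine ⟨LinearEquiv.ofLinearMap
    { toFun := fun m => ⟨m.1 * t, hmem t h3 m.1 m.2⟩
      map_add' := fun m m' => Subtype.ext (add_mul m.1 m'.1 t)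
      map_smul' := fun a m => Subtype.ext (mul_assoc a m.1 t) }
    { toFun := fun m => ⟨m.1 * t', hmem t' h3' m.1 m.2⟩
      map_add' := fun m m' => Subtype.ext (add_mul m.1 m'.1 t')
      map_smul' := fun a m => Subtype.ext (mul_assoc a m.1 t') }
    (LinearMap.ext fun m => Subtype.ext (by
      change m.1 * t' * t = m.1
      rw [mul_assoc, h2, mul_one]))
    (LinearMap.ext fun m => Subtype.ext (by
      change m.1 * t * t' = m.1
      rw [mul_assoc, h1, mul_one])), fun u m => Subtype.ext ?_, fun y m => ⟨fun hm => ?_, fun hm => ?_⟩⟩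
  · change m.1 * grpA b (ι u) * t = m.1 * t * grpA b (ι _)
    rw [mul_assoc m.1, hut]
    exact (mul_assoc m.1 t _).symm
  · exact compA_mul (show m.1 ∈ compA b y from hm) hdt
  · have h5 := compA_mul (show m.1 * t ∈ compA b _ from hm) hdt'
    rw [mul_assoc m.1, h1, mul_one, inv_mul_cancel_right] at h5
    exact h5

omit [Finite G] in
theorem coeff_of_mul (g h : G) (a : MonoidAlgebra O G) :
    (MonoidAlgebra.of O G g * a).coeff (g * h) = a.coeff h := by
  rw [MonoidAlgebra.of_apply, MonoidAlgebra.coeff_single_mul_eq_mul_coeff (m₂ := h), one_mul]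
  exact fun m _ => mul_right_inj g

omit [Finite G] in
theorem coeff_mul_of (g h : G) (a : MonoidAlgebra O G) :
    (a * MonoidAlgebra.of O G g).coeff (h * g) = a.coeff h := by
  rw [MonoidAlgebra.of_apply, MonoidAlgebra.coeff_mul_single_eq_coeff_mul (m₂ := h), mul_one]
  exact fun m _ => mul_left_inj g

omit [Finite G] in
theorem valA_grpA_mul (g : G) (a : AlgA b) :
    valA b (grpA b g * a) = MonoidAlgebra.of O G g * valA b a := by
  rw [map_mul]
  change inclG O ω b.val * MonoidAlgebra.of O G g * valA b a = _
  rw [centralG, mul_assoc]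
  congr 1
  exact corner_left (idemG b) a

omit [Finite G] in
theorem valA_mul_grpA (g : G) (a : AlgA b) :
    valA b (a * grpA b g) = valA b a * MonoidAlgebra.of O G g := by
  rw [map_mul]
  change valA b a * (inclG O ω b.val * MonoidAlgebra.of O G g) = _
  rw [← mul_assoc]
  congr 1
  exact corner_right (idemG b) a

variable [IsNoetherianRing O] [IsLocalRing O] [IsAdicComplete (IsLocalRing.maximalIdeal O) O]

omit [IsLocalRing O] [IsAdicComplete (IsLocalRing.maximalIdeal O) O] in
theorem finite_fixedSub (b : InvIdem O ω) (ι : P →* G) : Module.Finite O (fixedSub b ι) := by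
  have h1 : @Module.Finite O (MonoidAlgebra O ω.ker) _ _ Algebra.toModule :=
    Module.Finite.equiv (MonoidAlgebra.coeffLinearEquiv O).symm
  have h2 : Module.Finite O (algB b).carrier := @finite_corner O _ _ _ _ _ h1 _ b.idem
  exact inferInstanceAs (Module.Finite O (Subalgebra.toSubmodule (fixedSub b ι)))

theorem IsLocalPoint.isLocalIdem {i : fixedSub b ι} (hi : IsLocalPoint i) : IsLocalIdem i := by
  have := finite_fixedSub b ι
  exact hi.1.isLocalIdem O

omit [Finite G] [IsNoetherianRing O] [IsLocalRing O]
  [IsAdicComplete (IsLocalRing.maximalIdeal O) O] in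
theorem modAi_mul_iA {i : fixedSub b ι} (hi : IsIdempotentElem i) (m : modAi i) :
    m.1 * iA i = m.1 := by
  obtain ⟨a, ha⟩ := Ideal.mem_span_singleton'.mp m.2
  have h : iA i * iA i = iA i := by
    rw [iA, ← toA_mul]
    exact congrArg (toA b) (congrArg Subtype.val hi.eq)
  rw [← ha, mul_assoc, h]

/-- Each fusion is induced by an element of the normalizer of the point: if the isomorphism is the
right multiplication by `a` with inverse `a'`, then `i = a' a` is a sum over `P`-orbits of elements
of `G`, and since `i` is not killed by the Brauer map, a fixed point occurs in the support of
`a'`. -/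
theorem exists_degHom_eq [Finite P] (hι : Function.Injective ι) {i : fixedSub b ι}
    (hi : IsLocalPoint i) {x : MulAut P × Γ} (hx : x ∈ fusF i) : ∃ n, degHom hι i n = x := by
  have := Fintype.ofFinite G
  obtain ⟨hxa, f, hf1, hf2⟩ := hx
  have hid : IsIdempotentElem i := hi.1.1
  set a : AlgA b := (f (genAi i)).1 with ha
  set a' : AlgA b := (f.symm (genAi i)).1 with ha'
  have hgen : ∀ m : modAi i, m = m.1 • genAi i := fun m => Subtype.ext (modAi_mul_iA hid m).symm
  have hf : ∀ m, (f m).1 = m.1 * a := fun m => by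
    conv_lhs => rw [hgen m, map_smul]
    rfl
  have hfs : ∀ m, (f.symm m).1 = m.1 * a' := fun m => by
    conv_lhs => rw [hgen m, map_smul]
    rfl
  have h1 : a' * a = iA i := by
    rw [ha', ← hf, LinearEquiv.apply_symm_apply]; rfl
  have h2 : a * a' = iA i := by
    rw [ha, ← hfs, LinearEquiv.symm_apply_apply]; rfl
  have ha1 : a * iA i = a := modAi_mul_iA hid _
  have ha2 : iA i * a = a := (hf (genAi i)).symm
  have ha1' : a' * iA i = a' := modAi_mul_iA hid _
  have ha2' : iA i * a' = a' := (hfs (genAi i)).symm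
  have hu : ∀ u, grpA b (ι u) * a = a * grpA b (ι (x.1 u)) := fun u => by
    have h := congrArg Subtype.val (hf1 u (genAi i))
    rw [hf] at h
    have h' : iA i * grpA b (ι u) * a = a * grpA b (ι (x.1 u)) := h
    rwa [iA_comm, mul_assoc, ha2] at h'
  have hu' : ∀ u, grpA b (ι (x.1 u)) * a' = a' * grpA b (ι u) := fun u => by
    calc grpA b (ι (x.1 u)) * a' = grpA b (ι (x.1 u)) * iA i * a' := by rw [mul_assoc, ha2']
      _ = a' * (a * grpA b (ι (x.1 u))) * a' := by rw [← iA_comm, ← h1, mul_assoc a']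
      _ = a' * (grpA b (ι u) * iA i) := by rw [← hu, mul_assoc a', mul_assoc (grpA b _), h2]
      _ = a' * grpA b (ι u) := by rw [← iA_comm, ← mul_assoc, ha1']
  have hda : a ∈ compA b x.2⁻¹ := by
    have h : genAi i ∈ compAi i 1 := toA_mem_compA i.1
    have := (hf2 1 _).mp h
    rwa [one_mul] at this
  have hda' : a' ∈ compA b x.2 := by
    refine (hf2 x.2 (f.symm (genAi i))).mpr ?_
    rw [LinearEquiv.apply_symm_apply, mul_inv_cancel]
    exact toA_mem_compA i.1
  have hF : ∀ g, ∃ β : (algB b).carrier,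
      toA b β = (valA b a').coeff g • (grpA b g * a) := by
    intro g
    by_cases h : (valA b a').coeff g = 0
    · exact ⟨0, by rw [h, zero_smul]; exact map_zero (toAHom b)⟩
    · have hg : ω g = x.2 := hda' g h
      have := compA_mul (grpA_mem_compA (b := b) g) hda
      rw [hg, mul_inv_cancel] at this
      exact exists_toA (Submodule.smul_mem _ _ this)
  choose F hFa using hF
  have hsum : ∑ g, F g = i.1 := by
    apply toA_injective b
    have e : toA b (∑ g, F g) = ∑ g, toA b (F g) := map_sum (toAHom b) _ _
    rw [e]
    change _ = iA i
    rw [← h1]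
    conv_rhs => rw [eq_sum_grpA a', Finset.sum_mul]
    exact Finset.sum_congr rfl fun g _ => by rw [hFa, smul_mul_assoc]
  -- `P` acts on `G` by `u • g = u g φ⁻¹(u)⁻¹`, and the fixed points induce `φ`.
  let _ : MulAction P G :=
    { smul := fun u g => ι u * g * (ι (x.1⁻¹ u))⁻¹
      one_smul := fun g => by
        change ι 1 * g * (ι (x.1⁻¹ 1))⁻¹ = g
        simp
      mul_smul := fun u v g => by
        change ι (u * v) * g * (ι (x.1⁻¹ (u * v)))⁻¹
          = ι u * (ι v * g * (ι (x.1⁻¹ v))⁻¹) * (ι (x.1⁻¹ u))⁻¹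
        rw [map_mul, map_mul, map_mul]
        group }
  have hsmul : ∀ (u : P) (g : G), u • g = ι u * g * (ι (x.1⁻¹ u))⁻¹ := fun _ _ => rfl
  have hcoeff : ∀ (u : P) (g : G), (valA b a').coeff (u • g) = (valA b a').coeff g := by
    intro u g
    have h := hu' (x.1⁻¹ u)
    rw [MulAut.apply_inv_self] at h
    have h3 : (valA b (grpA b (ι u) * a')).coeff (ι u * g)
        = (valA b (a' * grpA b (ι (x.1⁻¹ u)))).coeff (ι u * g) := by rw [h]
    rw [valA_grpA_mul, valA_mul_grpA, coeff_of_mul] at h3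
    rw [h3, ← coeff_mul_of (ι (x.1⁻¹ u)) (u • g), hsmul, inv_mul_cancel_right]
  have hFact : ∀ (u : P) (g : G), F (u • g) = (algB b).act (ι u) (F g) := by
    intro u g
    apply toA_injective b
    have h3 : grpA b (ι (x.1⁻¹ u))⁻¹ * a = a * grpA b (ι u)⁻¹ := by
      have := hu (x.1⁻¹ u⁻¹)
      rwa [MulAut.apply_inv_self, map_inv (x.1⁻¹ : MulAut P), map_inv, map_inv] at this
    have h4 : toA b ((algB b).act (ι u) (F g)) = grpA b (ι u) * toA b (F g) * grpA b (ι u)⁻¹ := by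
      rw [grpA_mul_toA, mul_assoc, grpA_mul_inv, mul_one]
    rw [h4, hFa, hFa, hcoeff, hsmul, grpA_mul, grpA_mul, mul_assoc, h3, mul_smul_comm,
      smul_mul_assoc, mul_assoc, mul_assoc, mul_assoc]
  obtain ⟨g, hfix, hFg⟩ : ∃ g : G, (∀ u : P, u • g = g) ∧ F g ≠ 0 := by
    by_contra hno
    push Not at hno
    have := sum_mem_brauerVal hFact hno
    rw [hsum, ← mem_brauerKer_iff] at this
    exact hi.2 this
  have hgω : ω g = x.2 := by
    refine hda' g fun h => hFg ?_
    apply toA_injective b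
    rw [hFa, h, zero_smul]
    exact (map_zero (toAHom b)).symm
  have hind : Induces ω ι g x := by
    refine ⟨fun u => ?_, hgω.symm⟩
    have := hfix (x.1 u)
    rw [hsmul, MulAut.inv_apply_self, mul_inv_eq_iff_eq_mul] at this
    rw [← this, mul_inv_cancel_right]
  have hnorm : g ∈ Subgroup.normalizer (ι.range : Set G) := by
    intro y
    constructor
    · rintro ⟨u, rfl⟩
      exact ⟨x.1 u, hind.1 u⟩
    · rintro ⟨v, hv⟩
      refine ⟨x.1⁻¹ v, ?_⟩
      have := hind.1 (x.1⁻¹ v)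
      rw [MulAut.apply_inv_self, hv] at this
      exact (mul_left_cancel (mul_right_cancel this)).symm
  obtain ⟨β, hβ⟩ := exists_toA_mul_grpA (g := g) (hgω ▸ hda')
  obtain ⟨β', hβ'⟩ : ∃ β', a = grpA b g⁻¹ * toA b β' := by
    have h := compA_mul (grpA_mem_compA (b := b) g) hda
    rw [hgω, mul_inv_cancel] at h
    obtain ⟨y, hy⟩ := exists_toA h
    exact ⟨y, by rw [hy, ← mul_assoc, grpA_inv_mul, one_mul]⟩
  have hβf : β ∈ fixedSub b ι := by
    intro u
    apply toA_injective b
    have h3 := hu' (x.1⁻¹ u)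
    rw [MulAut.apply_inv_self] at h3
    have h4 : grpA b g * grpA b (ι (x.1⁻¹ u)) = grpA b (ι u) * grpA b g := by
      rw [← grpA_mul, ← grpA_mul]
      have := hind.1 (x.1⁻¹ u)
      rw [MulAut.apply_inv_self] at this
      rw [this, inv_mul_cancel_right]
    rw [hβ, mul_assoc, h4, ← mul_assoc, ← mul_assoc, grpA_mul_toA] at h3
    have h5 := congrArg (· * (grpA b g⁻¹ * grpA b (ι u)⁻¹)) h3
    simp only [mul_assoc] at h5
    rw [← mul_assoc (grpA b g) (grpA b g⁻¹), grpA_mul_inv, one_mul, grpA_mul_inv, mul_one,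
      mul_one] at h5
    exact h5
  have hβf' : β' ∈ fixedSub b ι := by
    intro u
    apply toA_injective b
    have h3 := hu (x.1⁻¹ u)
    rw [MulAut.apply_inv_self] at h3
    have h4 : grpA b (ι (x.1⁻¹ u)) * grpA b g⁻¹ = grpA b g⁻¹ * grpA b (ι u) := by
      rw [← grpA_mul, ← grpA_mul]
      have := hind.1 (x.1⁻¹ u)
      rw [MulAut.apply_inv_self] at this
      rw [this]
      congr 1
      group
    rw [hβ', ← mul_assoc, h4, mul_assoc, mul_assoc, grpA_mul_toA] at h3
    have h5 := congrArg (fun t => grpA b g * t * grpA b (ι u)⁻¹) h3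
    simp only [← mul_assoc] at h5
    rw [grpA_mul_inv, one_mul, one_mul, mul_assoc, grpA_mul_inv, mul_one, mul_assoc,
      grpA_mul_inv, mul_one] at h5
    exact h5
  have hloc := hi.isLocalIdem
  have e1 : (⟨β, hβf⟩ * ⟨β', hβf'⟩ : fixedSub b ι) = i := by
    refine Subtype.ext (toA_injective b ?_)
    change toA b (β * β') = iA i
    rw [← h1, hβ, hβ', toA_mul, mul_assoc, ← mul_assoc (grpA b g), grpA_mul_inv, one_mul]
  have e2 : (⟨β', hβf'⟩ * ⟨β, hβf⟩ : fixedSub b ι) = actNorm b ι ⟨g, hnorm⟩ i := by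
    refine Subtype.ext (toA_injective b ?_)
    change toA b (β' * β) = toA b ((algB b).act g i.1)
    have h3 : grpA b g * (a * a') * grpA b g⁻¹ = toA b (β' * β) := by
      rw [hβ, hβ', toA_mul]
      simp only [← mul_assoc]
      rw [grpA_mul_inv, one_mul, mul_assoc, grpA_mul_inv, mul_one]
    rw [← h3, h2, iA, grpA_mul_toA, mul_assoc, grpA_mul_inv, mul_one]
  have hn : g ∈ normP i := (mem_normP_iff i ⟨g, hnorm⟩).mpr
    (hloc.conj_of_equiv (show IsLocalIdem (actNorm b ι ⟨g, hnorm⟩ i) from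
      hloc.map_equiv (actNorm b ι ⟨g, hnorm⟩).toRingEquiv) e1 e2)
  exact ⟨⟨g, hn⟩, (degN_iff hι i ⟨g, hn⟩ x).mp hind⟩

end Fusion

/-! ### The algebra `ℱ` as a corner of a crossed product -/

section AlgebraF

universe u v v' vP
variable {O : Type u} [CommRing O] {G : Type v} [Group G] {Γ : Type v'} [Group Γ]
  {P : Type vP} [Group P] {ω : G →* Γ} {b : InvIdem O ω} {ι : P →* G} (i : fixedSub b ι)

/-- The element of `C` that is given by `x ∈ F`. -/
def inrC (x : fusF i) : algC i := MonoidAlgebra.of O (sdF i) (SemidirectProduct.inr x)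

/-- The element of `C` that is given by `u ∈ P`. -/
def inlC (u : P) : algC i := MonoidAlgebra.of O (sdF i) (SemidirectProduct.inl u)

theorem inrC_one : inrC i 1 = 1 := by
  unfold inrC
  rw [map_one, map_one]

theorem inrC_mul (x y : fusF i) : inrC i (x * y) = inrC i x * inrC i y := by
  unfold inrC
  rw [map_mul, map_mul]

theorem inrC_mul_inlC (x : fusF i) (u : P) :
    inrC i x * inlC i u = inlC i (x.1.1 u) * inrC i x := by
  unfold inrC inlC
  rw [← map_mul, ← map_mul]
  congr 1
  ext <;> simp

theorem of_eq_inlC_mul (s : sdF i) :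
    MonoidAlgebra.of O (sdF i) s = inlC i s.left * inrC i s.right := by
  unfold inrC inlC
  rw [← map_mul, SemidirectProduct.inl_left_mul_inr_right]

theorem tmulM_rightAi (u : P) (m : modAi i) (c : algC i) :
    tmulM i (rightAi i u m) c = tmulM i m (inlC i u * c) :=
  (Submodule.Quotient.eq _).mpr (Submodule.subset_span ⟨m, u, c, rfl⟩)

theorem tmulM_add_left (m m' : modAi i) (c : algC i) :
    tmulM i (m + m') c = tmulM i m c + tmulM i m' c := by
  unfold tmulM
  rw [TensorProduct.add_tmul, map_add]

theorem tmulM_smul_left (a : AlgA b) (m : modAi i) (c : algC i) :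
    tmulM i (a • m) c = a • tmulM i m c := rfl

theorem tmulM_zero_left (c : algC i) : tmulM i 0 c = 0 := by
  unfold tmulM
  rw [TensorProduct.zero_tmul, map_zero]

theorem tmulM_add_right (m : modAi i) (c c' : algC i) :
    tmulM i m (c + c') = tmulM i m c + tmulM i m c' := by
  unfold tmulM
  rw [TensorProduct.tmul_add, map_add]

theorem rightM_tmulM (m : modAi i) (c d : algC i) :
    rightM i d (tmulM i m c) = tmulM i m (c * d) := rfl

theorem bimM_induction {p : bimM i → Prop} (t : bimM i) (zero : p 0)
    (add : ∀ s t, p s → p t → p (s + t)) (tmul : ∀ m c, p (tmulM i m c)) : p t := by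
  obtain ⟨t, rfl⟩ := (relM i).mkQ_surjective t
  induction t using TensorProduct.induction_on with
  | zero => rw [map_zero]; exact zero
  | tmul m c => exact tmul m c
  | add s t hs ht => rw [map_add]; exact add _ _ hs ht

theorem bimM_induction_of {p : bimM i → Prop} (t : bimM i) (zero : p 0)
    (add : ∀ s t, p s → p t → p (s + t)) (tmul : ∀ m x, p (tmulM i m (inrC i x))) : p t := by
  refine bimM_induction i t zero add fun m c => ?_
  induction c using MonoidAlgebra.induction_on generalizing m with
  | of s =>
    rw [of_eq_inlC_mul, ← tmulM_rightAi]
    exact tmul _ _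
  | add x y hx hy =>
    rw [tmulM_add_right]
    exact add _ _ (hx m) (hy m)
  | smul r x hx =>
    have h : tmulM i m (r • x) = tmulM i (r • m) x := by
      unfold tmulM
      rw [TensorProduct.smul_tmul]
    rw [h]
    exact hx _

open scoped Classical in
/-- The right operators on `A i` whose matrix coefficients give the coordinate at `y`. -/
def coordEnd (y : fusF i) : algC i →ₗ[O] (modAi i →ₗ[AlgA b] modAi i) :=
  Finsupp.linearCombination O (fun s : sdF i => if s.right = y then rightAi i s.left else 0) ∘ₗ
    (MonoidAlgebra.coeffLinearEquiv O).toLinearMap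

open scoped Classical in
theorem coordEnd_of (y : fusF i) (s : sdF i) :
    coordEnd i y (MonoidAlgebra.of O (sdF i) s) = if s.right = y then rightAi i s.left else 0 := by
  change Finsupp.linearCombination O _ (MonoidAlgebra.of O (sdF i) s).coeff = _
  rw [MonoidAlgebra.of_apply, MonoidAlgebra.coeff_single, Finsupp.linearCombination_single,
    one_smul]

theorem rightAi_mul (u v : P) (m : modAi i) :
    rightAi i (u * v) m = rightAi i v (rightAi i u m) := Subtype.ext (by
  change m.1 * grpA b (ι (u * v)) = m.1 * grpA b (ι u) * grpA b (ι v)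
  rw [map_mul, grpA_mul, mul_assoc])

theorem coordEnd_inlC_mul (y : fusF i) (u : P) (c : algC i) (m : modAi i) :
    coordEnd i y (inlC i u * c) m = coordEnd i y c (rightAi i u m) := by
  induction c using MonoidAlgebra.induction_on with
  | of s =>
    have e : inlC i u * MonoidAlgebra.of O (sdF i) s
        = MonoidAlgebra.of O (sdF i) (SemidirectProduct.inl u * s) := (map_mul _ _ _).symm
    rw [e, coordEnd_of, coordEnd_of]
    have h1 : (SemidirectProduct.inl u * s).right = s.right := by simp
    have h2 : (SemidirectProduct.inl u * s).left = u * s.left := by simp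
    rw [h1, h2]
    split_ifs
    · exact rightAi_mul i u s.left m
    · rfl
  | add x z hx hz => rw [mul_add, map_add, map_add, LinearMap.add_apply, hx, hz]; rfl
  | smul r x hx => rw [mul_smul_comm, map_smul, map_smul, LinearMap.smul_apply, hx]; rfl

/-- The coordinate at `y ∈ F` of an element of `A i ⊗_{O P} C = ⨁_y A i ⊗ y`. -/
def coordM (y : fusF i) : bimM i →ₗ[AlgA b] modAi i :=
  (relM i).liftQ (TensorProduct.AlgebraTensorModule.lift
    { toFun := fun m =>
        { toFun := fun c => coordEnd i y c m
          map_add' := fun c c' => by rw [map_add]; rfl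
          map_smul' := fun r c => by rw [map_smul]; rfl }
      map_add' := fun m m' => LinearMap.ext fun c => map_add (coordEnd i y c) m m'
      map_smul' := fun a m => LinearMap.ext fun c => map_smul (coordEnd i y c) a m }) (by
    rw [relM, Submodule.span_le]
    rintro _ ⟨m, u, c, rfl⟩
    refine LinearMap.mem_ker.mpr ?_
    rw [map_sub, sub_eq_zero]
    exact (coordEnd_inlC_mul i y u c m).symm)

theorem coordM_tmulM (y : fusF i) (m : modAi i) (c : algC i) :
    coordM i y (tmulM i m c) = coordEnd i y c m := rfl

theorem rightAi_one (m : modAi i) : rightAi i 1 m = m := Subtype.ext (by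
  change m.1 * grpA b (ι 1) = m.1
  rw [map_one, grpA_one, mul_one])

theorem coordM_same (y : fusF i) (m : modAi i) : coordM i y (tmulM i m (inrC i y)) = m := by
  classical
  rw [coordM_tmulM, inrC, coordEnd_of, if_pos (SemidirectProduct.right_inr y),
    SemidirectProduct.left_inr, rightAi_one]

theorem coordM_ne {x y : fusF i} (h : x ≠ y) (m : modAi i) :
    coordM i y (tmulM i m (inrC i x)) = 0 := by
  classical
  rw [coordM_tmulM, inrC, coordEnd_of, if_neg (by rwa [SemidirectProduct.right_inr])]
  rfl

theorem eq_sum_coordM [Fintype (fusF i)] (t : bimM i) :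
    t = ∑ y, tmulM i (coordM i y t) (inrC i y) := by
  induction t using bimM_induction_of with
  | zero =>
    exact (Finset.sum_eq_zero fun y _ => by rw [map_zero, tmulM_zero_left]).symm
  | add s t hs ht =>
    conv_lhs => rw [hs, ht]
    rw [← Finset.sum_add_distrib]
    exact Finset.sum_congr rfl fun y _ => by rw [map_add, tmulM_add_left]
  | tmul m x =>
    rw [Finset.sum_eq_single x, coordM_same]
    · intro y _ hy
      rw [coordM_ne i hy.symm, tmulM_zero_left]
    · exact fun h => absurd (Finset.mem_univ _) h

theorem coordM_rightM_inlC (y : fusF i) (u : P) (t : bimM i) :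
    coordM i y (rightM i (inlC i u) t) = rightAi i (y.1.1 u) (coordM i y t) := by
  induction t using bimM_induction_of with
  | zero => rw [map_zero, map_zero, map_zero]
  | add s t hs ht => rw [map_add, map_add, hs, ht, map_add, map_add]
  | tmul m x =>
    rw [rightM_tmulM, inrC_mul_inlC, ← tmulM_rightAi]
    by_cases h : x = y
    · subst h
      rw [coordM_same, coordM_same]
    · rw [coordM_ne i h, coordM_ne i h, map_zero]

theorem rightAi_mem_compAi [Finite G] {y : Γ} {m : modAi i} (hm : m ∈ compAi i y) (u : P) :
    rightAi i u m ∈ compAi i (y * ω (ι u)) :=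
  compA_mul (show m.1 ∈ compA b y from hm) (grpA_mem_compA (b := b) (ι u))

theorem coordM_mem_compAi [Finite G] {g : Γ} {t : bimM i} (ht : t ∈ compMΓ i g) (x : fusF i) :
    coordM i x t ∈ compAi i (g * x.1.2⁻¹) := by
  induction ht using Submodule.span_induction with
  | mem t ht =>
    obtain ⟨y, m, s, hm, rfl, rfl⟩ := ht
    rw [of_eq_inlC_mul, ← tmulM_rightAi]
    by_cases h : s.right = x
    · subst h
      rw [coordM_same, mul_inv_cancel_right]
      exact rightAi_mem_compAi i hm _
    · rw [coordM_ne i h]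
      exact zero_mem _
  | zero => rw [map_zero]; exact zero_mem _
  | add a c _ _ ha hc => rw [map_add]; exact add_mem ha hc
  | smul r a _ ha =>
    have e : coordM i x (r • a) = r • coordM i x a := map_smul ((coordM i x).restrictScalars O) r a
    rw [e]
    exact Submodule.smul_mem _ r ha

/-- The generator `i ⊗ 1` of the bimodule `A i ⊗_{O P} C`. -/
def genM : bimM i := tmulM i (genAi i) 1

variable {i}

theorem modAi_eq_smul (hi : IsIdempotentElem i) (m : modAi i) : m = m.1 • genAi i :=
  Subtype.ext (modAi_mul_iA hi m).symm

theorem tmulM_eq (hi : IsIdempotentElem i) (m : modAi i) (c : algC i) :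
    tmulM i m c = m.1 • rightM i c (genM i) := by
  rw [genM, rightM_tmulM, one_mul, ← tmulM_smul_left, ← modAi_eq_smul hi]

/-- Elements of `ℱ` are determined by the image of the generator. -/
theorem calF_ext (hi : IsIdempotentElem i) {f g : (calF i).carrier}
    (h : (MulOpposite.unop f : endM i).1 (genM i) = (MulOpposite.unop g : endM i).1 (genM i)) :
    f = g := by
  refine MulOpposite.unop_injective (Subtype.ext (LinearMap.ext fun t => ?_))
  induction t using bimM_induction with
  | zero => exact (map_zero _).trans (map_zero _).symm
  | add s t hs ht => exact (map_add _ s t).trans ((congrArg₂ _ hs ht).trans (map_add _ s t).symm)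
  | tmul m c =>
    rw [tmulM_eq hi, map_smul, map_smul]
    exact congrArg (m.1 • ·) (((MulOpposite.unop f : endM i).2.1 c _).trans
      ((congrArg (rightM i c) h).trans ((MulOpposite.unop g : endM i).2.1 c _).symm))

end AlgebraF

/-! ### The presentation of `ℱ` -/

section PresentationF

universe u v v' vP
variable {O : Type u} [CommRing O] {G : Type v} [Group G] {Γ : Type v'} [Group Γ]
  {P : Type vP} [Group P] {ω : G →* Γ} {b : InvIdem O ω} {ι : P →* G} (i : fixedSub b ι)

/-- The endomorphism of the left `A`-module `A i` that is the right multiplication by `a i`. -/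
def rightMulAi (a : AlgA b) : modAi i →ₗ[AlgA b] modAi i where
  toFun m := ⟨m.1 * (a * iA i), Ideal.mem_span_singleton'.mpr ⟨m.1 * a, mul_assoc _ _ _⟩⟩
  map_add' m m' := Subtype.ext (add_mul m.1 m'.1 _)
  map_smul' c m := Subtype.ext (mul_assoc c m.1 _)

theorem tmulM_mem_compMF {x : MulAut P × Γ} {t : bimM i} (ht : t ∈ compMF i x) :
    (∀ hx : x ∈ fusF i, t = tmulM i (coordM i ⟨x, hx⟩ t) (inrC i ⟨x, hx⟩)) ∧
      (x ∉ fusF i → t = 0) := by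
  induction ht using Submodule.span_induction with
  | mem t ht =>
    obtain ⟨m, s, rfl, rfl⟩ := ht
    refine ⟨fun hx => ?_, fun hx => absurd s.right.2 hx⟩
    rw [of_eq_inlC_mul, ← tmulM_rightAi]
    change _ = tmulM i (coordM i s.right _) (inrC i s.right)
    rw [coordM_same]
  | zero => exact ⟨fun hx => by rw [map_zero, tmulM_zero_left], fun _ => rfl⟩
  | add a c _ _ ha hc =>
    refine ⟨fun hx => ?_, fun hx => by rw [ha.2 hx, hc.2 hx, add_zero]⟩
    conv_lhs => rw [ha.1 hx, hc.1 hx]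
    rw [map_add, tmulM_add_left]
  | smul r a _ ha =>
    refine ⟨fun hx => ?_, fun hx => by rw [ha.2 hx]; exact smul_zero r⟩
    have e : coordM i ⟨x, hx⟩ (r • a) = r • coordM i ⟨x, hx⟩ a :=
      map_smul ((coordM i ⟨x, hx⟩).restrictScalars O) r a
    conv_lhs => rw [ha.1 hx]
    rw [e]
    rfl

/-- The image of the generator under an element of `ℱ`. -/
def evM : (calF i).carrier →ₗ[O] bimM i where
  toFun f := (MulOpposite.unop f : endM i).1 (genM i)
  map_add' _ _ := rfl
  map_smul' _ _ := rfl

theorem genM_mem_compMF : genM i ∈ compMF i 1 :=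
  Submodule.subset_span ⟨genAi i, 1, rfl, by rw [map_one]; rfl⟩

theorem genM_mem_compMΓ : genM i ∈ compMΓ i 1 :=
  Submodule.subset_span ⟨1, genAi i, 1, toA_mem_compA i.1, by simp, by rw [map_one]; rfl⟩

theorem rightM_inlC_genM (u : P) : rightM i (inlC i u) (genM i) = grpA b (ι u) • genM i := by
  rw [genM, rightM_tmulM, one_mul, ← tmulM_smul_left]
  conv_lhs => rw [← mul_one (inlC i u), ← tmulM_rightAi]
  refine congrArg (fun m => tmulM i m 1) (Subtype.ext ?_)
  exact iA_comm i u

variable [Finite G] (hι : Function.Injective ι)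

/-- The element of `F` that is induced by an element of the normalizer of the point. -/
def degF (n : normP i) : fusF i := ⟨degHom hι i n, degHom_mem_fusF hι i n⟩

theorem degF_mul (n m : normP i) : degF i hι (n * m) = degF i hι n * degF i hι m :=
  Subtype.ext (map_mul _ n m)

theorem grpA_mul_grpA_inv (n : normP i) (u : P) :
    grpA b (ι u) * grpA b (n : G) = grpA b (n : G) * grpA b (ι ((degF i hι n)⁻¹.1.1 u)) := by
  rw [← grpA_mul, ← grpA_mul]
  congr 1
  have h := degHom_fst hι i n ((degF i hι n)⁻¹.1.1 u)
  have e : (degHom hι i n).1 ((degF i hι n)⁻¹.1.1 u) = u :=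
    MulAut.apply_inv_self P (degHom hι i n).1 u
  rw [e, eq_mul_inv_iff_mul_eq] at h
  exact h

theorem rightMulAi_rightAi (n : normP i) (β : fixedSub b ι) (u : P) (m : modAi i) :
    rightMulAi i (toA b β.1 * grpA b (n : G)) (rightAi i u m)
      = rightAi i ((degF i hι n)⁻¹.1.1 u) (rightMulAi i (toA b β.1 * grpA b (n : G)) m) := by
  refine Subtype.ext ?_
  change m.1 * grpA b (ι u) * (toA b β.1 * grpA b (n : G) * iA i)
    = m.1 * (toA b β.1 * grpA b (n : G) * iA i) * grpA b (ι _)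
  rw [mul_assoc m.1, mul_assoc m.1, mul_assoc (_ * _) (iA i), iA_comm, ← mul_assoc (grpA b (ι u)),
    ← mul_assoc (grpA b (ι u)), ← toA_comm_grpA, mul_assoc (toA b β.1), grpA_mul_grpA_inv i hι]
  simp only [mul_assoc]

/-- The `A`-linear map `m ⊗ c ↦ m β n i ⊗ x⁻¹ c` before the passage to the quotient, where `n`
induces `x ∈ F`. -/
def elFunTensor (n : normP i) (β : fixedSub b ι) :
    modAi i ⊗[O] algC i →ₗ[AlgA b] modAi i ⊗[O] algC i :=
  TensorProduct.AlgebraTensorModule.map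
    (rightMulAi i (toA b β.1 * grpA b (n : G))) (LinearMap.mulLeft O (inrC i (degF i hι n)⁻¹))

theorem elFunTensor_tmul (n : normP i) (β : fixedSub b ι) (m : modAi i) (c : algC i) :
    elFunTensor i hι n β (m ⊗ₜ[O] c)
      = rightMulAi i (toA b β.1 * grpA b (n : G)) m ⊗ₜ[O] (inrC i (degF i hι n)⁻¹ * c) := rfl

theorem elFunTensor_rel (n : normP i) (β : fixedSub b ι) (m : modAi i) (u : P) (c : algC i) :
    elFunTensor i hι n β (rightAi i u m ⊗ₜ[O] c - m ⊗ₜ[O] (inlC i u * c)) ∈ relM i := by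
  have h : inrC i (degF i hι n)⁻¹ * (inlC i u * c)
      = inlC i ((degF i hι n)⁻¹.1.1 u) * (inrC i (degF i hι n)⁻¹ * c) := by
    rw [← mul_assoc, inrC_mul_inlC, mul_assoc]
  rw [map_sub, elFunTensor_tmul, elFunTensor_tmul, rightMulAi_rightAi i hι, h]
  exact Submodule.subset_span ⟨_, _, _, rfl⟩

theorem relM_le_comap (n : normP i) (β : fixedSub b ι) :
    relM i ≤ (relM i).comap (elFunTensor i hι n β) := by
  refine Submodule.span_le.mpr fun t ht => SetLike.mem_coe.mpr (Submodule.mem_comap.mpr ?_)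
  obtain ⟨m, u, c, ht⟩ := ht
  rw [ht]
  exact elFunTensor_rel i hι n β m u c

/-- The `A`-linear map `m ⊗ c ↦ m β n i ⊗ x⁻¹ c`, where `n` induces `x ∈ F`. -/
def elFun (n : normP i) (β : fixedSub b ι) : bimM i →ₗ[AlgA b] bimM i :=
  (relM i).mapQ (relM i) (elFunTensor i hι n β) (relM_le_comap i hι n β)

theorem elFun_tmulM (n : normP i) (β : fixedSub b ι) (m : modAi i) (c : algC i) :
    elFun i hι n β (tmulM i m c)
      = tmulM i (rightMulAi i (toA b β.1 * grpA b (n : G)) m) (inrC i (degF i hι n)⁻¹ * c) := rfl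

omit [Finite G] in
theorem inrC_mul_of (x : fusF i) (s : sdF i) :
    inrC i x * MonoidAlgebra.of O (sdF i) s
      = MonoidAlgebra.of O (sdF i) (SemidirectProduct.inr x * s) := (map_mul _ _ _).symm

theorem elFun_mem (n : normP i) (β : fixedSub b ι) : elFun i hι n β ∈ endM i := by
  refine ⟨fun c t => ?_, fun g t ht => ?_⟩
  · induction t using bimM_induction with
    | zero => simp only [map_zero]
    | add s t hs ht => simp only [map_add, hs, ht]
    | tmul m d =>
      rw [rightM_tmulM, elFun_tmulM, elFun_tmulM, rightM_tmulM, mul_assoc]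
  · induction ht using Submodule.span_induction with
    | mem t ht =>
      obtain ⟨y, m, s, hm, rfl, rfl⟩ := ht
      refine Submodule.subset_span ⟨y * ω n, rightMulAi i (toA b β.1 * grpA b (n : G)) m,
        SemidirectProduct.inr (degF i hι n)⁻¹ * s, ?_, ?_, ?_⟩
      · have h1 := compA_mul (compA_mul (toA_mem_compA (b := b) β.1)
          (grpA_mem_compA (b := b) (n : G))) (toA_mem_compA i.1)
        rw [one_mul, mul_one] at h1
        exact compA_mul (show m.1 ∈ compA b y from hm) h1
      · have h1 : (SemidirectProduct.inr (degF i hι n)⁻¹ * s).left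
            = (degF i hι n)⁻¹.1.1 s.left := by simp
        have h2 : (SemidirectProduct.inr (degF i hι n)⁻¹ * s).right
            = (degF i hι n)⁻¹ * s.right := by simp
        rw [h1, h2]
        have h3 : ω n * ω (ι ((degF i hι n)⁻¹.1.1 s.left)) = ω (ι s.left) * ω n := by
          have h := degHom_fst hι i n ((degF i hι n)⁻¹.1.1 s.left)
          have e : (degHom hι i n).1 ((degF i hι n)⁻¹.1.1 s.left) = s.left :=
            MulAut.apply_inv_self P (degHom hι i n).1 _
          rw [e, eq_mul_inv_iff_mul_eq] at h
          rw [← map_mul, ← map_mul, h]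
        change y * ω n * ω (ι _) * ((ω n)⁻¹ * (s.right : MulAut P × Γ).2) = _
        rw [mul_assoc y, h3, mul_assoc, mul_assoc (ω (ι s.left)), mul_inv_cancel_left, mul_assoc]
      · rw [elFun_tmulM, inrC_mul_of]
    | zero => rw [map_zero]; exact zero_mem _
    | add a c _ _ ha hc => rw [map_add]; exact add_mem ha hc
    | smul r a _ ha =>
      have e : elFun i hι n β (r • a) = r • elFun i hι n β a :=
        map_smul ((elFun i hι n β).restrictScalars O) r a
      rw [e]
      exact Submodule.smul_mem _ r ha

variable {i}

/-- The coefficient `β n i` of the image of the generator. -/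
def coefAi (n : normP i) (β : fixedSub b ι) : modAi i :=
  rightMulAi i (toA b β.1 * grpA b (n : G)) (genAi i)

omit [Finite G] in
theorem coefAi_val (n : normP i) (β : fixedSub b ι) :
    (coefAi n β).1 = iA i * (toA b β.1 * grpA b (n : G) * iA i) := rfl

theorem elFun_genM (n : normP i) (β : fixedSub b ι) :
    elFun i hι n β (genM i) = tmulM i (coefAi n β) (inrC i (degF i hι n)⁻¹) := by
  rw [genM, elFun_tmulM, mul_one]
  rfl

omit [Finite G] in
theorem coefAi_add (n : normP i) (β β' : fixedSub b ι) :
    coefAi n (β + β') = coefAi n β + coefAi n β' := Subtype.ext (by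
  have h : toA b (β + β').1 = toA b β.1 + toA b β'.1 := map_add (toAHom b) β.1 β'.1
  change (coefAi n (β + β')).1 = (coefAi n β).1 + (coefAi n β').1
  rw [coefAi_val, h, add_mul, add_mul, mul_add]
  rfl)

omit [Finite G] in
theorem coefAi_smul (n : normP i) (r : O) (β : fixedSub b ι) :
    coefAi n (r • β) = r • coefAi n β := Subtype.ext (by
  have h : toA b (r • β).1 = r • toA b β.1 := map_smul (toAHom b) r β.1
  change (coefAi n (r • β)).1 = r • (coefAi n β).1
  rw [coefAi_val, h, smul_mul_assoc, smul_mul_assoc, mul_smul_comm]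
  rfl)

theorem elFun_add_genM (n : normP i) (β β' : fixedSub b ι) :
    elFun i hι n (β + β') (genM i) = elFun i hι n β (genM i) + elFun i hι n β' (genM i) := by
  rw [elFun_genM, elFun_genM, elFun_genM, coefAi_add, tmulM_add_left]

theorem elFun_smul_genM (n : normP i) (r : O) (β : fixedSub b ι) :
    elFun i hι n (r • β) (genM i) = r • elFun i hι n β (genM i) := by
  rw [elFun_genM, elFun_genM, coefAi_smul]
  rfl

/-- The element of `ℱ` of degree `x` with `i ⊗ 1 ↦ i β n i ⊗ x⁻¹`, where `n` induces `x`. -/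
def elF (hi : IsIdempotentElem i) (n : normP i) : fixedSub b ι →ₗ[O] (calF i).carrier where
  toFun β := MulOpposite.op ⟨elFun i hι n β, elFun_mem i hι n β⟩
  map_add' β β' := calF_ext hi (elFun_add_genM hι n β β')
  map_smul' r β := calF_ext hi (elFun_smul_genM hι n r β)

theorem elF_genM (hi : IsIdempotentElem i) (n : normP i) (β : fixedSub b ι) :
    evM i (elF hι hi n β)
      = tmulM i (coefAi n β) (inrC i (degF i hι n)⁻¹) :=
  elFun_genM hι n β

omit [Finite G] in
theorem coordM_genM_fixed (f : (calF i).carrier) (y : fusF i) (u : P) :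
    grpA b (ι u) * (coordM i y (evM i f)).1
      = (coordM i y (evM i f)).1 * grpA b (ι (y.1.1 u)) := by
  have h : grpA b (ι u) • coordM i y (evM i f)
      = rightAi i (y.1.1 u) (coordM i y (evM i f)) := by
    have h1 : rightM i (inlC i u) (evM i f) = grpA b (ι u) • evM i f :=
      ((MulOpposite.unop f : endM i).2.1 (inlC i u) (genM i)).symm.trans
        ((congrArg (MulOpposite.unop f : endM i).1 (rightM_inlC_genM i u)).trans (map_smul _ _ _))
    rw [← coordM_rightM_inlC, h1, map_smul]
  exact congrArg Subtype.val h

theorem exists_coF (n : normP i) (f : (calF i).carrier) :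
    ∃ β : fixedSub b ι, toA b β.1
      = (coordM i (degF i hι n)⁻¹ (evM i f)).1
        * grpA b (n : G)⁻¹ := by
  set m := coordM i (degF i hι n)⁻¹ (evM i f) with hm
  have h1 : m ∈ compAi i (1 * (degF i hι n)⁻¹.1.2⁻¹) :=
    coordM_mem_compAi i ((MulOpposite.unop f : endM i).2.2 1 _ (genM_mem_compMΓ i)) _
  have h2 : m.1 * grpA b (n : G)⁻¹ ∈ compA b 1 := by
    have h := compA_mul (show m.1 ∈ compA b _ from h1) (grpA_mem_compA (b := b) (n : G)⁻¹)
    have e : (degF i hι n)⁻¹.1.2⁻¹ = ω n := inv_inv _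
    rwa [e, one_mul, ← map_mul, mul_inv_cancel, map_one] at h
  obtain ⟨β, hβ⟩ := exists_toA h2
  refine ⟨⟨β, fun u => toA_injective b ?_⟩, hβ⟩
  have h3 : grpA b (ι u) * toA b β = toA b β * grpA b (ι u) := by
    have h4 : grpA b (ι ((degF i hι n)⁻¹.1.1 u)) * grpA b (n : G)⁻¹
        = grpA b (n : G)⁻¹ * grpA b (ι u) := by
      have h5 := congrArg (fun t => grpA b (n : G)⁻¹ * t * grpA b (n : G)⁻¹)
        (grpA_mul_grpA_inv i hι n u)
      beta_reduce at h5
      rw [mul_assoc, mul_assoc (grpA b (ι u)), grpA_mul_inv, mul_one, ← mul_assoc (grpA b (n : G)⁻¹),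
        grpA_inv_mul, one_mul] at h5
      exact h5.symm
    rw [hβ, ← mul_assoc, coordM_genM_fixed, mul_assoc, h4, mul_assoc]
  rw [grpA_mul_toA] at h3
  have h6 := congrArg (· * grpA b (ι u)⁻¹) h3
  beta_reduce at h6
  rwa [mul_assoc, mul_assoc, grpA_mul_inv, mul_one, mul_one] at h6

/-- The inclusion `B^P → A`. -/
def toAFix (b : InvIdem O ω) (ι : P →* G) : fixedSub b ι →ₗ[O] AlgA b :=
  (toAHom b).toLinearMap ∘ₗ (fixedSub b ι).val.toLinearMap

omit [Finite G] in
theorem toAFix_injective : Function.Injective (toAFix b ι) := fun _ _ h =>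
  Subtype.ext (toA_injective b h)

/-- The coefficient of an element of `ℱ` with respect to `n`, as an element of `A`. -/
def coFA (n : normP i) : (calF i).carrier →ₗ[O] AlgA b :=
  LinearMap.mulRight O (grpA b (n : G)⁻¹) ∘ₗ (Ideal.span {iA i}).subtype.restrictScalars O ∘ₗ
    (coordM i (degF i hι n)⁻¹).restrictScalars O ∘ₗ evM i

/-- The coefficient of an element of `ℱ` with respect to `n`. -/
def coF (n : normP i) : (calF i).carrier →ₗ[O] fixedSub b ι :=
  (LinearEquiv.ofInjective (toAFix b ι) toAFix_injective).symm.toLinearMap ∘ₗ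
    (coFA hι n).codRestrict (LinearMap.range (toAFix b ι)) (fun f => exists_coF hι n f)

theorem toA_coF (n : normP i) (f : (calF i).carrier) :
    toA b (coF hι n f).1
      = (coordM i (degF i hι n)⁻¹ (evM i f)).1 * grpA b (n : G)⁻¹ :=
  congrArg Subtype.val ((LinearEquiv.ofInjective (toAFix b ι) toAFix_injective).apply_symm_apply
    ((coFA hι n).codRestrict (LinearMap.range (toAFix b ι)) (fun f => exists_coF hι n f) f))

omit [Finite G] in
theorem iA_smul_genM (hi : IsIdempotentElem i) : iA i • genM i = genM i := by
  rw [genM, ← tmulM_smul_left]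
  refine congrArg (fun m => tmulM i m 1) (Subtype.ext ?_)
  exact modAi_mul_iA hi (genAi i)

omit [Finite G] in
theorem coefAi_eq (hi : IsIdempotentElem i) {n : normP i} {β : fixedSub b ι} {m : modAi i}
    (h1 : toA b β.1 = m.1 * grpA b (n : G)⁻¹) (h2 : iA i • m = m) : coefAi n β = m := by
  refine Subtype.ext ?_
  rw [coefAi_val, h1, mul_assoc m.1, grpA_inv_mul, mul_one, modAi_mul_iA hi]
  exact congrArg Subtype.val h2

theorem coefAi_coF (hi : IsIdempotentElem i) (n : normP i) (f : (calF i).carrier) :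
    coefAi n (coF hι n f) = coordM i (degF i hι n)⁻¹ (evM i f) := by
  refine coefAi_eq hi (toA_coF hι n f) ?_
  rw [← map_smul]
  exact congrArg _ ((map_smul (MulOpposite.unop f : endM i).1 _ _).symm.trans
    (congrArg (MulOpposite.unop f : endM i).1 (iA_smul_genM hi)))

/-- The component of degree `x` of an element of `ℱ`, where `n` induces `x`. -/
theorem elF_coF_genM (hi : IsIdempotentElem i) (n : normP i) (f : (calF i).carrier) :
    evM i (elF hι hi n (coF hι n f))
      = tmulM i (coordM i (degF i hι n)⁻¹ (evM i f)) (inrC i (degF i hι n)⁻¹) :=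
  (elF_genM hι hi n _).trans (congrArg (fun m => tmulM i m _) (coefAi_coF hι hi n f))

omit [Finite G] in
theorem evM_injective (hi : IsIdempotentElem i) {f g : (calF i).carrier}
    (h : evM i f = evM i g) : f = g := calF_ext hi h

omit [Finite G] in
theorem grpA_mul_iA_mul_toA (n : normP i) (s : fixedSub b ι) :
    grpA b (n : G) * (iA i * toA b s.1)
      = toA b (actNorm b ι ⟨n, n.2.1⟩ (i * s)).1 * grpA b (n : G) := by
  have h : iA i * toA b s.1 = toA b (i * s : fixedSub b ι).1 := (toA_mul b i.1 s.1).symm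
  rw [h, grpA_mul_toA]
  rfl

omit [Finite G] in
theorem coefAi_mul (n m : normP i) (r s : fixedSub b ι) :
    rightMulAi i (toA b s.1 * grpA b (m : G)) (coefAi n r)
      = coefAi (n * m) (r * (actNorm b ι ⟨n, n.2.1⟩ (i * s))) := by
  set t := actNorm b ι ⟨n, n.2.1⟩ (i * s) with ht
  have h1 : toA b (r * t).1 = toA b r.1 * toA b t.1 := toA_mul b r.1 t.1
  have h2 : grpA b ((n * m : normP i) : G) = grpA b (n : G) * grpA b (m : G) :=
    grpA_mul b (n : G) (m : G)
  refine Subtype.ext ?_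
  rw [coefAi_val, h1, h2]
  calc iA i * (toA b r.1 * grpA b (n : G) * iA i) * (toA b s.1 * grpA b (m : G) * iA i)
      = iA i * toA b r.1 * (grpA b (n : G) * (iA i * toA b s.1)) * grpA b (m : G) * iA i := by
        simp only [mul_assoc]
    _ = _ := by rw [grpA_mul_iA_mul_toA, ← ht]; simp only [mul_assoc]

omit [Finite G] in
theorem coefAi_str (z n : normP i) (r s : fixedSub b ι) (hs : toA b s.1 = grpA b (z : G)) :
    coefAi (z * n) r = coefAi n (r * s) := by
  have h1 : toA b (r * s).1 = toA b r.1 * toA b s.1 := toA_mul b r.1 s.1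
  have h2 : grpA b ((z * n : normP i) : G) = grpA b (z : G) * grpA b (n : G) :=
    grpA_mul b (z : G) (n : G)
  refine Subtype.ext ?_
  rw [coefAi_val, coefAi_val, h1, h2, hs]
  simp only [mul_assoc]

omit [Finite G] in
theorem coefAi_compress (hi : IsIdempotentElem i) (n : normP i) (r : fixedSub b ι) :
    coefAi n (i * r * actNorm b ι ⟨n, n.2.1⟩ i) = coefAi n r := by
  set t := actNorm b ι ⟨n, n.2.1⟩ i with ht
  have h1 : toA b (i * r * t).1 = iA i * toA b r.1 * toA b t.1 :=
    (toA_mul b (i * r).1 t.1).trans (congrArg (· * toA b t.1) (toA_mul b i.1 r.1))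
  have h : iA i * iA i = iA i := modAi_mul_iA hi (genAi i)
  have h2 : toA b t.1 * grpA b (n : G) = grpA b (n : G) * iA i := by
    rw [iA, grpA_mul_toA]
    rfl
  refine Subtype.ext ?_
  rw [coefAi_val, coefAi_val, h1]
  calc iA i * (iA i * toA b r.1 * toA b t.1 * grpA b (n : G) * iA i)
      = (iA i * iA i) * (toA b r.1 * (toA b t.1 * grpA b (n : G)) * iA i) := by
        simp only [mul_assoc]
    _ = _ := by rw [h2]; simp only [mul_assoc, h]

omit [Finite G] in
theorem coefAi_mul_grpA_inv (n : normP i) (r : fixedSub b ι) :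
    (coefAi n r).1 * grpA b (n : G)⁻¹
      = toA b (i * r * actNorm b ι ⟨n, n.2.1⟩ i : fixedSub b ι).1 := by
  rw [coefAi_val]
  change _ = toA b (i.1 * r.1 * (algB b).act n i.1)
  have h2 : grpA b (n : G) * iA i * grpA b (n : G)⁻¹ = toA b ((algB b).act n i.1) := by
    rw [iA, grpA_mul_toA, mul_assoc, grpA_mul_inv, mul_one]
  rw [toA_mul, toA_mul, ← h2]
  simp only [mul_assoc]
  rfl

theorem elF_mul (hi : IsIdempotentElem i) (n m : normP i) (r s : fixedSub b ι) :
    elF hι hi n r * elF hι hi m s = elF hι hi (n * m) (r * actNorm b ι ⟨n, n.2.1⟩ (i * s)) := by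
  refine evM_injective hi ?_
  have h1 : evM i (elF hι hi n r * elF hι hi m s)
      = elFun i hι m s (evM i (elF hι hi n r)) := rfl
  rw [h1, elF_genM, elF_genM, elFun_tmulM, ← inrC_mul, ← mul_inv_rev, ← degF_mul]
  exact congrArg (fun t => tmulM i t _) (coefAi_mul n m r s)

theorem elF_one (hi : IsIdempotentElem i) : elF hι hi 1 1 = 1 := by
  refine evM_injective hi ?_
  rw [elF_genM]
  have h1 : degF i hι 1 = 1 := Subtype.ext (map_one _)
  rw [h1, inv_one, inrC_one]
  refine congrArg (fun m => tmulM i m 1) (Subtype.ext ?_)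
  change iA i * (toA b 1 * grpA b 1 * iA i) = iA i
  rw [toA_one, grpA_one, one_mul, one_mul]
  exact modAi_mul_iA hi (genAi i)

theorem elF_str (hi : IsIdempotentElem i) (z n : normP i) (hz : degHom hι i z = 1)
    (r s : fixedSub b ι) (hs : toA b s.1 = grpA b (z : G)) :
    elF hι hi (z * n) r = elF hι hi n (r * s) := by
  refine evM_injective hi ?_
  have h : degF i hι (z * n) = degF i hι n := by
    rw [degF_mul, show degF i hι z = 1 from Subtype.ext hz, one_mul]
  rw [elF_genM, elF_genM, h, coefAi_str z n r s hs]

theorem elF_compress (hi : IsIdempotentElem i) (n : normP i) (r : fixedSub b ι) :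
    elF hι hi n (i * r * actNorm b ι ⟨n, n.2.1⟩ i) = elF hι hi n r :=
  evM_injective hi (by rw [elF_genM, elF_genM, coefAi_compress hi])

theorem elF_mem (hi : IsIdempotentElem i) (n : normP i) (r : fixedSub b ι) :
    elF hι hi n r ∈ (calF i).comp (degHom hι i n) := by
  intro y t ht
  change elFun i hι n r t ∈ _
  induction ht using Submodule.span_induction with
  | mem t ht =>
    obtain ⟨m, s, rfl, rfl⟩ := ht
    rw [elFun_tmulM, inrC_mul_of]
    refine Submodule.subset_span ⟨_, _, ?_, rfl⟩
    simp [degF]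
  | zero => rw [map_zero]; exact zero_mem _
  | add a c _ _ ha hc => rw [map_add]; exact add_mem ha hc
  | smul c a _ ha =>
    have e : elFun i hι n r (c • a) = c • elFun i hι n r a :=
      map_smul ((elFun i hι n r).restrictScalars O) c a
    rw [e]
    exact Submodule.smul_mem _ c ha

theorem coF_elF_same (hi : IsIdempotentElem i) (n : normP i) (r : fixedSub b ι) :
    coF hι n (elF hι hi n r) = i * r * actNorm b ι ⟨n, n.2.1⟩ i := by
  refine toAFix_injective ((toA_coF hι n _).trans ?_)
  rw [elF_genM, coordM_same]
  exact coefAi_mul_grpA_inv n r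

theorem coF_elF_ne (hi : IsIdempotentElem i) {n m : normP i} (h : degHom hι i n ≠ degHom hι i m)
    (r : fixedSub b ι) : coF hι m (elF hι hi n r) = 0 := by
  refine toAFix_injective ((toA_coF hι m _).trans ?_)
  rw [elF_genM, coordM_ne]
  · exact (zero_mul _).trans (map_zero (toAFix b ι)).symm
  · exact fun h' => h (congrArg Subtype.val (inv_injective h'))

theorem elF_coF (hi : IsIdempotentElem i) (n : normP i) {f : (calF i).carrier}
    (hf : f ∈ (calF i).comp (degHom hι i n)) : f = elF hι hi n (coF hι n f) := by
  refine evM_injective hi ?_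
  rw [elF_coF_genM]
  have h := hf 1 _ (genM_mem_compMF i)
  rw [mul_one] at h
  exact (tmulM_mem_compMF i h).1 (degF i hι n)⁻¹.2

variable (hsurj : ∀ x ∈ fusF i, ∃ n, degHom hι i n = x)

include hsurj in
theorem eq_zero_or_elF (hi : IsIdempotentElem i) (x : MulAut P × Γ) (f : (calF i).carrier)
    (hf : f ∈ (calF i).comp x) : f = 0 ∨ ∃ n r, degHom hι i n = x ∧ f = elF hι hi n r := by
  by_cases hx : x ∈ fusF i
  · obtain ⟨n, rfl⟩ := hsurj x hx
    exact Or.inr ⟨n, _, rfl, elF_coF hι hi n hf⟩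
  · have h := hf 1 _ (genM_mem_compMF i)
    rw [mul_one] at h
    refine Or.inl (evM_injective hi ?_)
    rw [map_zero]
    exact (tmulM_mem_compMF i h).2 fun hx' => hx (inv_inv x ▸ (fusF i).inv_mem hx')

include hsurj in
theorem mem_span_elF (hi : IsIdempotentElem i) (f : (calF i).carrier) :
    f ∈ Submodule.span O {a | ∃ n r, a = elF hι hi n r} := by
  have hfin : Finite (fusF i) := Finite.of_surjective (degF i hι) fun x => by
    obtain ⟨n, hn⟩ := hsurj x x.2
    exact ⟨n, Subtype.ext hn⟩
  have := Fintype.ofFinite (fusF i)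
  have hn : ∀ y : fusF i, ∃ n, (degF i hι n)⁻¹ = y := fun y => by
    obtain ⟨n, hn⟩ := hsurj _ y⁻¹.2
    exact ⟨n, inv_eq_iff_eq_inv.mpr (Subtype.ext hn)⟩
  choose n hn using hn
  have h : f = ∑ y, elF hι hi (n y) (coF hι (n y) f) := by
    refine evM_injective hi ?_
    rw [map_sum]
    conv_lhs => rw [eq_sum_coordM i (evM i f)]
    refine Finset.sum_congr rfl fun y _ => ?_
    rw [elF_coF_genM, hn]
  rw [h]
  exact Submodule.sum_mem _ fun y _ => Submodule.subset_span ⟨_, _, rfl⟩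

/-- `ℱ` as a corner of the crossed product over `B^P`. -/
def presF (hi : IsIdempotentElem i) :
    Pres (degHom hι i) (algBP i).act (fun z => (algBP i).str (kerToCent hι i z)) (toBP i i)
      (calF i) where
  el := elF hι hi
  co := coF hι
  el_one := elF_one hι hi
  el_mul := elF_mul hι hi
  el_str z n r := elF_str hι hi z.1 n z.2 r _
    (toA_str b ⟨((z : normP i) : G), (kerToCent hι i z).2.1⟩)
  el_compress := elF_compress hι hi
  co_same := coF_elF_same hι hi
  co_ne _ _ r h := coF_elF_ne hι hi h r
  el_mem := elF_mem hι hi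
  comp_le := eq_zero_or_elF hι hsurj hi
  span := mem_span_elF hι hsurj hi

theorem RepF.eq_el (hi : IsIdempotentElem i) {β : fixedSub b ι} {n : normP i}
    {f : (calF i).carrier} (h : RepF i β n f) : f = (presF hι hsurj hi).el n (toBP i β) := by
  obtain ⟨x, hx, hf⟩ := h
  have hxn : degF i hι n = x := Subtype.ext ((degN_iff hι i n x).mp hx)
  refine evM_injective hi ?_
  have h1 : evM i f = iA i • evM i f :=
    (congrArg (MulOpposite.unop f : endM i).1 (iA_smul_genM hi)).symm.trans (map_smul _ _ _)
  have h2 : evM i f = tmulM i ((toA b β.1 * grpA b n) • genAi i) (inrC i x⁻¹) := hf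
  refine h1.trans (Eq.trans ?_ (elF_genM hι hi n (toBP i β)).symm)
  rw [h2, hxn]
  rfl

end PresentationF

/-! ### The canonical isomorphism `ℰ̄ ≃ ℱ̄` -/

section CanonicalEF

namespace Pres

universe u w v v' wR
variable {O : Type u} [CommRing O] {N : Type v} [Group N] {Θ : Type v'} [Group Θ]
  {d : N →* Θ} {R : Type wR} [Ring R] [Algebra O R] {act : N →* (R ≃ₐ[O] R)} {str : d.ker → R}
  {e : R} {X : GradedAlg.{w} O Θ}

/-- A homogeneous element is left invertible if its coefficient, transported to the corner `e R e`
by means of an element that conjugates `e` to its translate, is invertible there. -/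
theorem exists_left_inverse (p : Pres d act str e X) (he : IsIdempotentElem e) {n : N} {w : Rˣ}
    (hw : act n e = w * e * (↑w⁻¹ : R)) {r : R} (h : CornerUnit e (e * r * w * e)) :
    ∃ b, b * p.el n r = 1 := by
  obtain ⟨v, hv1, hv2, -, hv⟩ := h
  refine ⟨p.el n⁻¹ ((act n).symm (w * v)), ?_⟩
  have hinv : act n⁻¹ = (act n).symm := by rw [map_inv]; rfl
  have hww : (↑w⁻¹ : R) * w = 1 := w.inv_mul
  have h3 : e * ((act n).symm (w * v) * (act n).symm (e * r)) * e = e := by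
    apply (act n).injective
    rw [map_mul, map_mul, map_mul, AlgEquiv.apply_symm_apply, AlgEquiv.apply_symm_apply, hw]
    calc w * e * (↑w⁻¹ : R) * (w * v * (e * r)) * (w * e * (↑w⁻¹ : R))
        = w * (e * ((↑w⁻¹ : R) * w) * v) * (e * r * w * e) * (↑w⁻¹ : R) := by
          simp only [mul_assoc]
      _ = w * (v * (e * r * w * e)) * (↑w⁻¹ : R) := by
          rw [hww, mul_one, hv1, mul_assoc (w : R)]
      _ = _ := by rw [hv]
  rw [p.el_mul, hinv, inv_mul_cancel, ← p.el_compress 1, map_one]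
  change p.el 1 (e * ((act n).symm (w * v) * (act n).symm (e * r)) * e) = 1
  rw [h3, ← p.el_one, ← p.el_compress 1 1, map_one, mul_one]
  change p.el 1 e = p.el 1 (e * e)
  rw [he.eq]

end Pres

universe u v v' vP
variable {O : Type u} [CommRing O] {G : Type v} [Group G] {Γ : Type v'} [Group Γ]
  {P : Type vP} [Group P] {ω : G →* Γ} {b : InvIdem O ω} {ι : P →* G} {i : fixedSub b ι}

/-- The canonical map `B^P → B(P_γ)` as an algebra homomorphism. -/
def toBPγHom (i : fixedSub b ι) : (algBP i).carrier →ₐ[O] (algBPγ i).carrier :=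
  (maxIdealOf (toBP i i)).ringCon.mkₐ (α := O)

theorem toBPγHom_surjective (i : fixedSub b ι) : Function.Surjective (toBPγHom i) :=
  InteriorAlgebra.qmk_surj _

theorem toBPγHom_eq_zero_iff (x : (algBP i).carrier) :
    toBPγHom i x = 0 ↔ x ∈ maxIdealOf (toBP i i) := qmk_eq_zero_iff _ x

variable [Finite G] [IsNoetherianRing O] [IsLocalRing O]
  [IsAdicComplete (IsLocalRing.maximalIdeal O) O]

omit [IsLocalRing O] [IsAdicComplete (IsLocalRing.maximalIdeal O) O] in
theorem finite_algBP (i : fixedSub b ι) : Module.Finite O (algBP i).carrier :=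
  finite_fixedSub b ι

theorem IsLocalPoint.toBPγ_ne_zero (hi : IsLocalPoint i) : toBPγ i i ≠ 0 := by
  have := finite_algBP i
  intro h
  exact not_mem_maxIdealOf O (show IsLocalIdem (toBP i i) from hi.isLocalIdem)
    ((toBPγHom_eq_zero_iff (toBP i i)).mp h)

omit [Finite G] [IsNoetherianRing O] [IsAdicComplete (IsLocalRing.maximalIdeal O) O] in
theorem IsLocalPoint.idem_toBP (hi : IsLocalPoint i) : IsIdempotentElem (toBP i i) := hi.1.1

omit [Finite G] [IsNoetherianRing O] [IsAdicComplete (IsLocalRing.maximalIdeal O) O] in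
theorem IsLocalPoint.idem_toBPγ (hi : IsLocalPoint i) : IsIdempotentElem (toBPγ i i) :=
  hi.idem_toBP.map (toBPγHom i)

theorem nontrivial_calEbar (hι : Function.Injective ι) (hi : IsLocalPoint i) :
    Nontrivial (calEbar i).carrier := by
  refine ⟨1, 0, fun h => hi.toBPγ_ne_zero ?_⟩
  have h1 := (presEbar hι hi.idem_toBPγ).co_same 1 1
  rw [(presEbar hι hi.idem_toBPγ).el_one, h, map_zero, map_one, mul_one] at h1
  exact hi.idem_toBPγ.symm.trans h1.symm

variable (hι : Function.Injective ι) (hi : IsLocalPoint i)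

include hι hi in
theorem exists_degHom_eq_of_mem_fusF : ∀ x ∈ fusF i, ∃ n, degHom hι i n = x := by
  have : Finite P := Finite.of_injective ι hι
  exact fun x hx => exists_degHom_eq hι hi hx

/-- The canonical homomorphism `ℱ → ℰ̄`. -/
def toEbarHom : (calF i).carrier →ₐ[O] (calEbar i).carrier :=
  (presF hι (exists_degHom_eq_of_mem_fusF hι hi) hi.idem_toBP).hom (presEbar hι hi.idem_toBPγ)
    (toBPγHom i) (fun _ _ => rfl) (fun _ => rfl) rfl

/-- The kernel of `ℱ → ℰ̄` is the graded radical: a homogeneous element with nonzero image is left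
invertible, because the corner of `B^P` at `i` is local. -/
theorem mem_gradedRadical_calF_iff (a : (calF i).carrier) :
    a ∈ (calF i).gradedRadical ↔ toEbarHom hι hi a = 0 := by
  have := nontrivial_calEbar hι hi
  have := finite_algBP i
  refine Pres.mem_gradedRadical_iff _ _ _ _ _ _ (fun n r hr => ?_) a
  obtain ⟨w, hw⟩ := act_mem_conjClass i n
  refine Pres.exists_left_inverse _ hi.idem_toBP hw ?_
  have hee : toBP i i * toBP i i = toBP i i := hi.idem_toBP
  refine cornerUnit_of_not_mem_maxIdealOf O
    (show IsLocalIdem (toBP i i) from hi.isLocalIdem) ?_ ?_ fun hm => hr ?_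
  · simp only [← mul_assoc, hee]
  · rw [mul_assoc, hee]
  · have h1 : toBPγ i i * toBPγHom i r * (algBPγ i).act n (toBPγ i i) = 0 := by
      change toBPγHom i (toBP i i * r * (algBP i).act n (toBP i i)) = 0
      rw [toBPγHom_eq_zero_iff, hw]
      have h2 := TwoSidedIdeal.mul_mem_right _ _ (↑w⁻¹ : (algBP i).carrier) hm
      simpa only [mul_assoc] using h2
    rw [← (presEbar hι hi.idem_toBPγ).el_compress, h1, map_zero]

/-- The canonical isomorphism `ℱ̄ ≃ ℰ̄`. -/
def isoFbarEbar : GradedAlg.Iso (calFbar i) (calEbar i) :=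
  GradedAlg.residualIso (toEbarHom hι hi) (mem_gradedRadical_calF_iff hι hi)
    (Pres.hom_surjective _ _ _ _ _ _ (toBPγHom_surjective i))
    (Pres.hom_map_comp _ _ _ _ _ _ (toBPγHom_surjective i))

theorem isCanonicalEF_symm : IsCanonicalEF i (isoFbarEbar hι hi).symm := by
  rintro f f' f'' ⟨β, n, hf, hf'⟩ ⟨β₁, n₁, hf₁, hf''⟩
  have hs := exists_degHom_eq_of_mem_fusF hι hi
  refine (AlgEquiv.symm_apply_eq _).mpr ?_
  have h1 : f'' = (presF hι hs hi.idem_toBP).el n (toBP i β) := by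
    have h2 := (RepE.eq_el hι hi.idem_toBP hf).symm.trans (RepE.eq_el hι hi.idem_toBP hf₁)
    have h3 : ∀ m r, (presE hι hi.idem_toBP).hom (presF hι hs hi.idem_toBP)
        (AlgHom.id O (algBP i).carrier) (fun _ _ => rfl) (fun _ => rfl) rfl
        ((presE hι hi.idem_toBP).el m r) = (presF hι hs hi.idem_toBP).el m r :=
      Pres.hom_el _ _ _ _ _ _
    exact (RepF.eq_el hι hs hi.idem_toBP hf'').trans
      ((h3 n₁ _).symm.trans ((congrArg _ h2.symm).trans (h3 n _)))
  rw [h1, RepEbar.eq_el hι hi.idem_toBPγ hf']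
  exact (Pres.hom_el (presF hι hs hi.idem_toBP) (presEbar hι hi.idem_toBPγ) (toBPγHom i)
    (fun _ _ => rfl) (fun _ => rfl) rfl n (toBP i β)).symm

end CanonicalEF

/-! ### The canonical isomorphism `ℰ̄ ≃ ℰ̄(P)` -/

section CanonicalEP

/-- The isomorphism `R / I ≃ T` that is induced by a surjective homomorphism with kernel `I`. -/
def quotientEquiv {O R T : Type*} [CommRing O] [Ring R] [Ring T] [Algebra O R] [Algebra O T]
    (I : TwoSidedIdeal R) (f : R →ₐ[O] T) (hf : Function.Surjective f)
    (hk : ∀ x, f x = 0 ↔ x ∈ I) : I.ringCon.Quotient ≃ₐ[O] T :=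
  AlgEquiv.ofBijective (I.ringCon.liftₐ f fun x y h => by
    have h1 : x - y ∈ I := (I.rel_iff x y).mp h
    rw [← hk, map_sub, sub_eq_zero] at h1
    exact h1) (by
    constructor
    · refine (injective_iff_map_eq_zero _).mpr fun x hx => ?_
      obtain ⟨x, rfl⟩ := InteriorAlgebra.qmk_surj I x
      exact (qmk_eq_zero_iff I x).mpr ((hk x).mp hx)
    · intro y
      obtain ⟨x, rfl⟩ := hf y
      exact ⟨InteriorAlgebra.qmk I x, rfl⟩)

universe u v v' vP
variable {O : Type u} [CommRing O] {G : Type v} [Group G] {Γ : Type v'} [Group Γ]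
  {P : Type vP} [Group P] {ω : G →* Γ} {b : InvIdem O ω} {ι : P →* G} {i : fixedSub b ι}
  [IsLocalRing O] {hι : Function.Injective ι} {c : (algBofP hι i).carrier}
  (hc : IsPointBlock hι i c)

/-- The Brauer map as an algebra homomorphism. -/
def brPHom (hι : Function.Injective ι) (i : fixedSub b ι) :
    (algBP i).carrier →ₐ[O] (algBofP hι i).carrier :=
  (brauerKer b ι : TwoSidedIdeal (algBP i).carrier).ringCon.mkₐ (α := O)

theorem brPHom_surjective (hι : Function.Injective ι) (i : fixedSub b ι) :
    Function.Surjective (brPHom hι i) := InteriorAlgebra.qmk_surj _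

/-- The canonical map `B^P → B(P) b_γ / m^*` as an algebra homomorphism. -/
def toBPmHom : (algBP i).carrier →ₐ[O] (algBPm hc).carrier :=
  AlgHom.ofLinearMap
    { toFun := toBPm hc
      map_add' := fun x y => by
        refine congrArg (InteriorAlgebra.qmk (mStar hc)) (corner_ext hc.idem ?_)
        change c * brPHom hι i (x + y) = c * brPHom hι i x + c * brPHom hι i y
        rw [map_add, mul_add]
      map_smul' := fun r x => by
        refine congrArg (InteriorAlgebra.qmk (mStar hc)) (corner_ext hc.idem ?_)
        change c * brPHom hι i (r • x) = r • (c * brPHom hι i x)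
        rw [map_smul, mul_smul_comm] }
    (by
      refine congrArg (InteriorAlgebra.qmk (mStar hc)) (corner_ext hc.idem ?_)
      change c * brPHom hι i 1 = c
      rw [map_one, mul_one])
    (fun x y => by
      refine congrArg (InteriorAlgebra.qmk (mStar hc)) (corner_ext hc.idem ?_)
      change c * brPHom hι i (x * y) = c * brPHom hι i x * (c * brPHom hι i y)
      rw [map_mul, mul_assoc c, ← mul_assoc (brPHom hι i x) c, ← hc.central (brPHom hι i x),
        mul_assoc c (brPHom hι i x), ← mul_assoc c c, hc.idem.eq])

theorem toBPmHom_surjective : Function.Surjective (toBPmHom hc) := by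
  intro y
  obtain ⟨y, rfl⟩ := InteriorAlgebra.qmk_surj _ y
  obtain ⟨x, hx⟩ := brPHom_surjective hι i (cornerIncl hc.idem y)
  refine ⟨x, congrArg (InteriorAlgebra.qmk (mStar hc)) (corner_ext hc.idem ?_)⟩
  change c * brPHom hι i x = cornerIncl hc.idem y
  rw [hx]
  exact corner_left hc.idem y

variable [Finite G] [IsNoetherianRing O] [IsAdicComplete (IsLocalRing.maximalIdeal O) O]

omit [IsAdicComplete (IsLocalRing.maximalIdeal O) O] in
theorem finite_algBofP (hι : Function.Injective ι) (i : fixedSub b ι) :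
    Module.Finite O (algBofP hι i).carrier := by
  have := finite_fixedSub b ι
  have : Module.Finite O (algBP i).carrier := this
  exact Module.Finite.of_surjective (brPHom hι i).toLinearMap (brPHom_surjective hι i)

/-- The kernel of the map to `B(P) b_γ / m^*` is the maximal ideal of `B^P` attached to `γ`. -/
theorem toBPmHom_eq_zero_iff (hi : IsLocalPoint i) (x : (algBP i).carrier) :
    toBPmHom hc x = 0 ↔ x ∈ maxIdealOf (toBP i i) := by
  have := finite_algBP i
  have := finite_algBofP hι i
  have hloc : IsLocalIdem (toBP i i) := hi.isLocalIdem
  have hbloc : IsLocalIdem (brP hι i i) :=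
    hloc.map (brPHom hι i : (algBP i).carrier →+* (algBofP hι i).carrier)
      (brPHom_surjective hι i) hc.br_ne_zero
  set M := maxIdealOf (brP hι i i) with hM
  have h1 : toBPmHom hc x = 0 ↔ c * brPHom hι i x ∈ M :=
    (qmk_eq_zero_iff _ _).trans (TwoSidedIdeal.mem_comap (cornerIncl hc.idem))
  have h2 : (1 - c) ∈ M := by
    have h3 : brP hι i i ∉ TwoSidedIdeal.span {1 - c} := by
      have h4 : TwoSidedIdeal.span {1 - c} ≤ TwoSidedIdeal.mk' {x | c * x = 0} (mul_zero c)
          (fun {x y} hx hy => by rw [Set.mem_ofPred_eq, mul_add, hx, hy, add_zero])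
          (fun {x} hx => by rw [Set.mem_ofPred_eq, mul_neg, hx, neg_zero])
          (fun {x y} hy => by
            rw [Set.mem_ofPred_eq, ← mul_assoc, hc.central, mul_assoc, hy, mul_zero])
          (fun {x y} hx => by rw [Set.mem_ofPred_eq, ← mul_assoc, hx, zero_mul]) := by
        rw [TwoSidedIdeal.span_le]
        rintro _ rfl
        rw [SetLike.mem_coe, TwoSidedIdeal.mem_mk']
        rw [Set.mem_ofPred_eq, mul_sub, mul_one, hc.idem.eq, sub_self]
      intro h5
      have h6 := h4 h5
      rw [TwoSidedIdeal.mem_mk', Set.mem_ofPred_eq, hc.mul_br] at h6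
      exact hc.br_ne_zero h6
    exact le_maxIdealOf O hbloc h3 (TwoSidedIdeal.subset_span rfl)
  have h3 : c * brPHom hι i x ∈ M ↔ brPHom hι i x ∈ M := by
    refine ⟨fun h => ?_, fun h => M.mul_mem_left _ _ h⟩
    have h4 := add_mem h (M.mul_mem_right _ (brPHom hι i x) h2)
    rwa [← add_mul, add_sub_cancel, one_mul] at h4
  rw [h1, h3]
  constructor
  · intro h
    refine le_maxIdealOf O hloc (I := TwoSidedIdeal.comap (brPHom hι i) M) ?_
      ((TwoSidedIdeal.mem_comap _).mpr h)
    exact fun h4 => not_mem_maxIdealOf O hbloc ((TwoSidedIdeal.mem_comap _).mp h4)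
  · intro h
    have hle : (brauerKer b ι : TwoSidedIdeal (algBP i).carrier) ≤ maxIdealOf (toBP i i) :=
      le_maxIdealOf O hloc hi.2
    let φ : (algBofP hι i).carrier →+* (algBPγ i).carrier :=
      RingCon.lift (brauerKer b ι : TwoSidedIdeal (algBP i).carrier).ringCon
        (toBPγHom i : (algBP i).carrier →+* (algBPγ i).carrier) (by
          intro y z hyz
          rw [TwoSidedIdeal.rel_iff] at hyz
          exact (qmk_eq_iff _ _ _).mpr (hle hyz))
    have hφ : ∀ y, φ (brPHom hι i y) = toBPγHom i y := fun _ => rfl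
    refine le_maxIdealOf O hbloc (I := TwoSidedIdeal.ker φ) ?_ ?_
    · rw [TwoSidedIdeal.mem_ker]
      exact hi.toBPγ_ne_zero
    · rw [TwoSidedIdeal.mem_ker, hφ, toBPγHom_eq_zero_iff]
      exact h

/-- The canonical isomorphism `B(P_γ) ≃ B(P) b_γ / m^*`. -/
def equivBPm (hi : IsLocalPoint i) : (algBPγ i).carrier ≃ₐ[O] (algBPm hc).carrier :=
  quotientEquiv (maxIdealOf (toBP i i)) (toBPmHom hc) (toBPmHom_surjective hc)
    (toBPmHom_eq_zero_iff hc hi)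

theorem equivBPm_act (hi : IsLocalPoint i) (n : normP i) (x : (algBPγ i).carrier) :
    equivBPm hc hi ((algBPγ i).act n x) = (algBPm hc).act n (equivBPm hc hi x) := by
  obtain ⟨x, rfl⟩ := toBPγHom_surjective i x
  refine congrArg (InteriorAlgebra.qmk (mStar hc)) (corner_ext hc.idem ?_)
  change c * (algBofP hι i).act n (brPHom hι i x) = (algBofP hι i).act n (c * brPHom hι i x)
  rw [map_mul, hc.inv]

omit [Finite G] [IsNoetherianRing O] [IsAdicComplete (IsLocalRing.maximalIdeal O) O] in
theorem IsLocalPoint.idem_toBPm (hi : IsLocalPoint i) : IsIdempotentElem (toBPm hc i) :=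
  hi.idem_toBP.map (toBPmHom hc)

/-- The canonical isomorphism `ℰ̄ ≃ ℰ̄(P)`. -/
def isoEbarEbarP (hi : IsLocalPoint i) : GradedAlg.Iso (calEbar i) (calEbarP hc) :=
  (presEbar hι hi.idem_toBPγ).iso (presEbarP hc (hi.idem_toBPm hc)) (equivBPm hc hi)
    (equivBPm_act hc hi) (fun _ => rfl) rfl

theorem isCanonicalEP (hi : IsLocalPoint i) : IsCanonicalEP hc (isoEbarEbarP hc hi) := by
  intro f f' β n hf hf'
  rw [RepEbar.eq_el hι hi.idem_toBPγ hf, RepEbarP.eq_el (hi.idem_toBPm hc) hf']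
  exact Pres.iso_el _ _ _ _ _ _ n (toBPγ i β)

end CanonicalEP

/-! ### Counting fixed points -/

section FixedPoints

/-- A sum of an invariant family over a set with an action of a `p`-group, with values in a group
of exponent `p`, vanishes if the family vanishes at the fixed points. -/
theorem sum_eq_zero_of_invariant {p : ℕ} {P S M : Type*} [Group P] [Finite P]
    (hP : IsPGroup p P) [Fact p.Prime] [MulAction P S] [Fintype S] [AddCommGroup M]
    (hM : ∀ m : M, p • m = 0) {F : S → M} (hF : ∀ (u : P) s, F (u • s) = F s)
    (h0 : ∀ s, (∀ u : P, u • s = s) → F s = 0) : ∑ s, F s = 0 := by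
  classical
  rw [← Finset.sum_fiberwise Finset.univ
    (fun s => (Quotient.mk (MulAction.orbitRel P S) s)) F]
  refine Finset.sum_eq_zero fun q _ => ?_
  obtain ⟨s₀, rfl⟩ := Quotient.exists_rep q
  have hA : ∀ s, s ∈ (Finset.univ.filter fun s => Quotient.mk (MulAction.orbitRel P S) s
      = Quotient.mk (MulAction.orbitRel P S) s₀) ↔ s ∈ MulAction.orbit P s₀ := fun s => by
    rw [Finset.mem_filter, Quotient.eq]
    exact ⟨fun h => h.2, fun h => ⟨Finset.mem_univ _, h⟩⟩
  have hconst : ∀ s ∈ (Finset.univ.filter fun s => Quotient.mk (MulAction.orbitRel P S) s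
      = Quotient.mk (MulAction.orbitRel P S) s₀), F s = F s₀ := fun s hs => by
    obtain ⟨u, rfl⟩ := (hA s).mp hs
    exact hF u s₀
  rw [Finset.sum_congr rfl hconst, Finset.sum_const]
  by_cases hfix : ∀ u : P, u • s₀ = s₀
  · rw [h0 _ hfix, smul_zero]
  · obtain ⟨n, hn⟩ := hP.card_orbit s₀
    have hcard : (Finset.univ.filter fun s => Quotient.mk (MulAction.orbitRel P S) s
        = Quotient.mk (MulAction.orbitRel P S) s₀).card = Nat.card (MulAction.orbit P s₀) := by
      rw [← Nat.card_eq_finsetCard]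
      exact Nat.card_congr (Equiv.subtypeEquivRight hA)
    rw [hcard, hn]
    rcases n with _ | n
    · exfalso
      rw [pow_zero, Nat.card_eq_one_iff_unique] at hn
      obtain ⟨hs, -⟩ := hn
      refine hfix fun u => ?_
      exact congrArg Subtype.val (hs.elim ⟨u • s₀, ⟨u, rfl⟩⟩ ⟨s₀, MulAction.mem_orbit_self s₀⟩)
    · rw [pow_succ, mul_smul, hM, smul_zero]

variable {O H T : Type*} [CommRing O] [Group H] [Ring T] [Algebra O T]

/-- The linear extension to the group algebra of a function on the group. -/
def groupLin (O : Type*) [CommRing O] {T : Type*} [AddCommGroup T] [Module O T] (ψ : H → T) :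
    MonoidAlgebra O H →ₗ[O] T :=
  Finsupp.linearCombination O ψ ∘ₗ (MonoidAlgebra.coeffLinearEquiv O).toLinearMap

theorem groupLin_of (ψ : H → T) (h : H) : groupLin O ψ (MonoidAlgebra.of O H h) = ψ h := by
  change Finsupp.linearCombination O ψ (MonoidAlgebra.of O H h).coeff = ψ h
  rw [MonoidAlgebra.of_apply, MonoidAlgebra.coeff_single, Finsupp.linearCombination_single,
    one_smul]

theorem groupLin_apply [Fintype H] (ψ : H → T) (a : MonoidAlgebra O H) :
    groupLin O ψ a = ∑ h, a.coeff h • ψ h := by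
  conv_lhs => rw [eq_sum_coeff a]
  rw [map_sum]
  exact Finset.sum_congr rfl fun h _ => by rw [map_smul, groupLin_of]

theorem coeff_of_fixed {σ : MulAut H} {a : MonoidAlgebra O H}
    (ha : MonoidAlgebra.domCongr O O σ a = a) (h : H) : a.coeff (σ h) = a.coeff h := by
  conv_lhs => rw [← ha]
  simp

/-- A function on a group that is invariant under a `p`-group of automorphisms and multiplicative
on its fixed points extends to a multiplicative function on the fixed elements of the group
algebra. -/
theorem groupLin_mul {p : ℕ} {P : Type*} [Group P] [Finite P] (hP : IsPGroup p P) [Fact p.Prime]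
    [Finite H] (hT : ∀ t : T, p • t = 0) (σ : P →* MulAut H) {ψ : H → T}
    (hinv : ∀ u h, ψ (σ u h) = ψ h)
    (hmul : ∀ h k, (∀ u, σ u h = h) → (∀ u, σ u k = k) → ψ (h * k) = ψ h * ψ k)
    {a c : MonoidAlgebra O H} (ha : ∀ u, MonoidAlgebra.domCongr O O (σ u) a = a)
    (hc : ∀ u, MonoidAlgebra.domCongr O O (σ u) c = c) :
    groupLin O ψ (a * c) = groupLin O ψ a * groupLin O ψ c := by
  have := Fintype.ofFinite H
  have h1 : groupLin O ψ (a * c) = ∑ x : H × H, (a.coeff x.1 * c.coeff x.2) • ψ (x.1 * x.2) := by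
    conv_lhs => rw [eq_sum_coeff a, eq_sum_coeff c]
    rw [Finset.sum_mul_sum, map_sum, Fintype.sum_prod_type]
    refine Finset.sum_congr rfl fun h _ => ?_
    rw [map_sum]
    refine Finset.sum_congr rfl fun k _ => ?_
    rw [smul_mul_smul_comm, ← map_mul, map_smul, groupLin_of]
  have h2 : groupLin O ψ a * groupLin O ψ c
      = ∑ x : H × H, (a.coeff x.1 * c.coeff x.2) • (ψ x.1 * ψ x.2) := by
    rw [groupLin_apply, groupLin_apply, Finset.sum_mul_sum, Fintype.sum_prod_type]
    exact Finset.sum_congr rfl fun h _ => Finset.sum_congr rfl fun k _ => smul_mul_smul_comm _ _ _ _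
  rw [h1, h2, ← sub_eq_zero, ← Finset.sum_sub_distrib]
  let _ : MulAction P (H × H) :=
    { smul := fun u x => (σ u x.1, σ u x.2)
      one_smul := fun x => by
        change (σ 1 x.1, σ 1 x.2) = x
        rw [map_one]
        rfl
      mul_smul := fun u v x => by
        change (σ (u * v) x.1, σ (u * v) x.2) = (σ u (σ v x.1), σ u (σ v x.2))
        rw [map_mul]
        rfl }
  have hsmul : ∀ (u : P) (x : H × H), u • x = (σ u x.1, σ u x.2) := fun _ _ => rfl
  refine sum_eq_zero_of_invariant hP hT (fun u x => ?_) fun x hx => ?_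
  · rw [hsmul, coeff_of_fixed (ha u), coeff_of_fixed (hc u), hinv, hinv, ← map_mul, hinv]
  · rw [hmul x.1 x.2 (fun u => congrArg Prod.fst (hx u)) fun u => congrArg Prod.snd (hx u),
      sub_self]

end FixedPoints

/-! ### The algebra `B(P_γ)` is spanned by the centralizer of `P` -/

section Centralizer

universe u v v' vP
variable {O : Type u} [CommRing O] {G : Type v} [Group G] {Γ : Type v'} [Group Γ]
  {P : Type vP} [Group P] {ω : G →* Γ} {b : InvIdem O ω} {ι : P →* G}

/-- The conjugation action of `P` on `H`. -/
def conjKer (ω : G →* Γ) (ι : P →* G) : P →* MulAut ω.ker := MulAut.conjNormal.comp ι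

theorem conjKer_eq_self_iff (u : P) (h : ω.ker) :
    conjKer ω ι u h = h ↔ ι u * h = h * ι u := by
  rw [← mul_inv_eq_iff_eq_mul, Subtype.ext_iff]
  change ((MulAut.conjNormal (ι u) h : ω.ker) : G) = h ↔ _
  rw [MulAut.conjNormal_apply]

theorem str_mem_fixedSub {h : ω.ker} (hh : ∀ u, conjKer ω ι u h = h) :
    (algB b).str h ∈ fixedSub b ι := fun u =>
  (algB b).act_str (ι u) h h
    (eq_mul_inv_iff_mul_eq.mpr ((conjKer_eq_self_iff u h).mp (hh u)).symm)

open scoped Classical in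
/-- The function on `H` that maps `c ∈ C_H(P)` to the image of `c b` in `B(P_γ)` and vanishes
outside `C_H(P)`. -/
def centVal (i : fixedSub b ι) (h : ω.ker) : (algBPγ i).carrier :=
  if hh : ∀ u, conjKer ω ι u h = h then toBPγ i ⟨(algB b).str h, str_mem_fixedSub hh⟩ else 0

theorem centVal_of_fixed (i : fixedSub b ι) {h : ω.ker} (hh : ∀ u, conjKer ω ι u h = h) :
    centVal i h = toBPγ i ⟨(algB b).str h, str_mem_fixedSub hh⟩ := dif_pos hh

theorem centVal_of_not_fixed (i : fixedSub b ι) {h : ω.ker} (hh : ¬ ∀ u, conjKer ω ι u h = h) :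
    centVal i h = 0 := dif_neg hh

theorem conjKer_fixed_conj (u : P) {h : ω.ker} :
    (∀ v, conjKer ω ι v (conjKer ω ι u h) = conjKer ω ι u h) ↔ ∀ v, conjKer ω ι v h = h := by
  constructor
  · intro hh
    have h1 : conjKer ω ι u h = h := by
      have := hh u⁻¹
      rwa [← MulAut.mul_apply, ← map_mul, inv_mul_cancel, map_one, MulAut.one_apply, eq_comm] at this
    rwa [h1] at hh
  · intro hh
    rwa [hh u]

theorem centVal_conj (i : fixedSub b ι) (u : P) (h : ω.ker) :
    centVal i (conjKer ω ι u h) = centVal i h := by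
  by_cases hh : ∀ v, conjKer ω ι v h = h
  · rw [hh u]
  · rw [centVal_of_not_fixed i hh, centVal_of_not_fixed i fun h' => hh ((conjKer_fixed_conj u).mp h')]

theorem centVal_mul (i : fixedSub b ι) {h k : ω.ker} (hh : ∀ u, conjKer ω ι u h = h)
    (hk : ∀ u, conjKer ω ι u k = k) : centVal i (h * k) = centVal i h * centVal i k := by
  have hhk : ∀ u, conjKer ω ι u (h * k) = h * k := fun u => by rw [map_mul, hh, hk]
  rw [centVal_of_fixed i hh, centVal_of_fixed i hk, centVal_of_fixed i hhk]
  have e : (⟨(algB b).str (h * k), str_mem_fixedSub hhk⟩ : fixedSub b ι)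
      = ⟨(algB b).str h, str_mem_fixedSub hh⟩ * ⟨(algB b).str k, str_mem_fixedSub hk⟩ :=
    Subtype.ext (map_mul _ h k)
  rw [e]
  exact map_mul (toBPγHom i) _ _

theorem eq_sum_str [Fintype ω.ker] (x : (algB b).carrier) :
    x = ∑ h, (valB b x).coeff h • (algB b).str h := by
  apply valB_injective b
  have h1 : valB b (∑ h, (valB b x).coeff h • (algB b).str h)
      = ∑ h, (valB b x).coeff h • (b.val * MonoidAlgebra.of O ω.ker h) :=
    map_sum (cornerIncl b.idem) _ _
  have h2 : b.val * valB b x = valB b x := corner_left b.idem x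
  rw [h1, ← h2]
  conv_lhs => rw [eq_sum_coeff (valB b x), Finset.mul_sum]
  exact Finset.sum_congr rfl fun h _ => by rw [mul_smul_comm, h2]

theorem domCongr_valB (x : fixedSub b ι) (u : P) :
    MonoidAlgebra.domCongr O O (conjKer ω ι u) (valB b x.1) = valB b x.1 :=
  congrArg (valB b) (x.2 u)

variable [Finite G] [IsNoetherianRing O] [IsLocalRing O]
  [IsAdicComplete (IsLocalRing.maximalIdeal O) O] {i : fixedSub b ι}

theorem brauerKer_le_maxIdealOf (hi : IsLocalPoint i) :
    (brauerKer b ι : TwoSidedIdeal (algBP i).carrier) ≤ maxIdealOf (toBP i i) := by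
  have := finite_algBP i
  exact le_maxIdealOf O (show IsLocalIdem (toBP i i) from hi.isLocalIdem) hi.2

/-- The image in `B(P_γ)` of an element of `B^P` is determined by its coefficients at the elements
of `C_H(P)`, because the rest is a sum of relative traces. -/
theorem groupLin_centVal [Finite P] (hi : IsLocalPoint i) (x : fixedSub b ι) :
    groupLin O (centVal i) (valB b x.1) = toBPγ i x := by
  classical
  have := Fintype.ofFinite ω.ker
  let F : ω.ker → (algB b).carrier := fun h =>
    if ∀ u, conjKer ω ι u h = h then 0 else (valB b x.1).coeff h • (algB b).str h
  let F' : ω.ker → fixedSub b ι := fun h =>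
    if hh : ∀ u, conjKer ω ι u h = h then
      (valB b x.1).coeff h • ⟨(algB b).str h, str_mem_fixedSub hh⟩ else 0
  have hsum : ∑ h, F h = (x - ∑ h, F' h).1 := by
    have h1 : (x - ∑ h, F' h).1 = x.1 - ∑ h, (F' h).1 := by
      rw [← AddSubmonoidClass.coe_finsetSum]
      rfl
    rw [h1, eq_sub_iff_add_eq, ← Finset.sum_add_distrib]
    conv_rhs => rw [eq_sum_str x.1]
    refine Finset.sum_congr rfl fun h _ => ?_
    by_cases hh : ∀ u, conjKer ω ι u h = h
    · have e1 : F h = 0 := if_pos hh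
      have e2 : F' h = (valB b x.1).coeff h • ⟨(algB b).str h, str_mem_fixedSub hh⟩ := dif_pos hh
      rw [e1, e2, zero_add]
      rfl
    · have e1 : F h = (valB b x.1).coeff h • (algB b).str h := if_neg hh
      have e2 : F' h = 0 := dif_neg hh
      rw [e1, e2]
      exact add_zero _
  let _ : MulAction P ω.ker := MulAction.compHom ω.ker (conjKer ω ι)
  have hmem : x - ∑ h, F' h ∈ brauerKer b ι := by
    rw [mem_brauerKer_iff, ← hsum]
    refine sum_mem_brauerVal (fun u h => ?_) fun h hh => if_pos hh
    change F (conjKer ω ι u h) = (algB b).act (ι u) (F h)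
    by_cases hh : ∀ u, conjKer ω ι u h = h
    · rw [hh u, show F h = 0 from if_pos hh, map_zero]
    · have hh' : ¬ ∀ v, conjKer ω ι v (conjKer ω ι u h) = conjKer ω ι u h := fun h' =>
        hh ((conjKer_fixed_conj u).mp h')
      rw [show F h = _ from if_neg hh, show F (conjKer ω ι u h) = _ from if_neg hh', map_smul,
        coeff_of_fixed (domCongr_valB x u)]
      congr 1
      refine ((algB b).act_str (ι u) h _ ?_).symm
      exact MulAut.conjNormal_apply _ _
  have h1 : toBPγHom i x = toBPγHom i (∑ h, F' h : fixedSub b ι) :=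
    (qmk_eq_iff _ _ _).mpr (brauerKer_le_maxIdealOf hi hmem)
  have h2 : toBPγHom i (∑ h, F' h : fixedSub b ι) = ∑ h, toBPγHom i (F' h) :=
    map_sum (toBPγHom i) _ _
  rw [groupLin_apply]
  refine Eq.trans ?_ (h2.symm.trans h1.symm)
  refine Finset.sum_congr rfl fun h _ => ?_
  by_cases hh : ∀ u, conjKer ω ι u h = h
  · rw [centVal_of_fixed i hh, show F' h = _ from dif_pos hh]
    exact (map_smul (toBPγHom i) _ _).symm
  · rw [centVal_of_not_fixed i hh, show F' h = _ from dif_neg hh, smul_zero]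
    exact (map_zero (toBPγHom i)).symm

end Centralizer

/-! ### Simple algebras spanned by a finite ring -/

section Simple

/-- The quotient by a maximal two-sided ideal is simple. -/
theorem isSimpleRing_quotient {R : Type*} [Ring R] {M : TwoSidedIdeal R} (hM : IsCoatom M) :
    IsSimpleRing M.ringCon.Quotient := by
  have h1 : (1 : M.ringCon.Quotient) ≠ 0 := fun h => hM.1 (by
    have h2 : (1 : R) ∈ M := (qmk_eq_zero_iff M 1).mp h
    refine top_le_iff.mp fun x _ => ?_
    have h3 := M.mul_mem_left x _ h2
    rwa [mul_one] at h3)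
  have : Nontrivial M.ringCon.Quotient := ⟨1, 0, h1⟩
  refine ⟨⟨fun I => ?_⟩⟩
  by_cases hI : ∀ x ∈ I, x = 0
  · exact Or.inl (eq_bot_iff.mpr fun x hx => (TwoSidedIdeal.mem_bot _).mpr (hI x hx))
  · push Not at hI
    obtain ⟨x, hx, hx0⟩ := hI
    obtain ⟨x, rfl⟩ := InteriorAlgebra.qmk_surj M x
    have hlt : M < TwoSidedIdeal.comap M.ringCon.mk' I := by
      refine lt_of_le_of_ne (fun y hy => (TwoSidedIdeal.mem_comap _).mpr ?_) fun h => ?_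
      · have : M.ringCon.mk' y = 0 := (qmk_eq_zero_iff M y).mpr hy
        rw [this]
        exact zero_mem I
      · refine hx0 ((qmk_eq_zero_iff M x).mpr ?_)
        rw [h]
        exact (TwoSidedIdeal.mem_comap _).mpr hx
    have htop := hM.2 _ hlt
    refine Or.inr (top_le_iff.mp fun y _ => ?_)
    obtain ⟨y, rfl⟩ := InteriorAlgebra.qmk_surj M y
    have hy : y ∈ TwoSidedIdeal.comap M.ringCon.mk' I := by rw [htop]; trivial
    exact (TwoSidedIdeal.mem_comap _).mp hy

/-- A nonzero ideal of a subring that spans a simple algebra contains `1` in its span, because the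
span is a two-sided ideal. -/
theorem one_mem_span_of_ideal {O R : Type*} [CommRing O] [Ring R] [Algebra O R] [IsSimpleRing R]
    (S : Subring R) (hS : Submodule.span O (S : Set R) = ⊤) (J : Ideal S) [J.IsTwoSided]
    (hJ : J ≠ ⊥) : (1 : R) ∈ Submodule.span O (Subtype.val '' (J : Set S)) := by
  set W := Submodule.span O (Subtype.val '' (J : Set S)) with hW
  have hl : ∀ r, ∀ x ∈ W, r * x ∈ W := by
    have h : (⊤ : Submodule O R) * W ≤ W := by
      rw [← hS, hW, Submodule.span_mul_span, Submodule.span_le]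
      rintro _ ⟨s, hs, _, ⟨x, hx, rfl⟩, rfl⟩
      exact Submodule.subset_span ⟨⟨s, hs⟩ * x, J.mul_mem_left _ hx, rfl⟩
    exact fun r x hx => h (Submodule.mul_mem_mul trivial hx)
  have hr : ∀ r, ∀ x ∈ W, x * r ∈ W := by
    have h : W * (⊤ : Submodule O R) ≤ W := by
      rw [← hS, hW, Submodule.span_mul_span, Submodule.span_le]
      rintro _ ⟨_, ⟨x, hx, rfl⟩, s, hs, rfl⟩
      exact Submodule.subset_span ⟨x * ⟨s, hs⟩, J.mul_mem_right _ hx, rfl⟩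
    exact fun r x hx => h (Submodule.mul_mem_mul hx trivial)
  obtain ⟨x, hx, hx0⟩ := Submodule.exists_mem_ne_zero_of_ne_bot hJ
  let I : TwoSidedIdeal R := TwoSidedIdeal.mk' W W.zero_mem W.add_mem W.neg_mem
    (fun {x y} hy => hl x y hy) (fun {x y} hx => hr y x hx)
  have hI : ∀ y, y ∈ I ↔ y ∈ W := fun y => TwoSidedIdeal.mem_mk' _ _ _ _ _ _ y
  refine (hI 1).mp (IsSimpleRing.one_mem_of_ne_zero_mem I (x := (x : R)) ?_
    ((hI _).mpr (Submodule.subset_span ⟨x, hx, rfl⟩)))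
  exact fun h => hx0 (Subtype.ext h)

/-- A finite ring that spans a simple algebra is semisimple, because the span of its nilpotent
radical is an ideal. -/
theorem isSemisimpleRing_of_span {O R : Type*} [CommRing O] [Ring R] [Algebra O R] [IsSimpleRing R]
    (S : Subring R) [Finite S] (hS : Submodule.span O (S : Set R) = ⊤) : IsSemisimpleRing S := by
  rw [IsArtinianRing.isSemisimpleRing_iff_jacobson]
  by_contra hJ
  have h1 := one_mem_span_of_ideal (O := O) S hS (Ring.jacobson S) hJ
  obtain ⟨n, hn⟩ := IsSemiprimaryRing.isNilpotent (R := S)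
  have h2 : ∀ m, (1 : R) ∈ Submodule.span O (Subtype.val '' (↑(Ring.jacobson S ^ m) : Set S)) := by
    intro m
    induction m with
    | zero => exact Submodule.subset_span ⟨1, by rw [Submodule.pow_zero, Ideal.one_eq_top]; trivial, rfl⟩
    | succ m ih =>
      have h3 := Submodule.mul_mem_mul h1 ih
      rw [one_mul, Submodule.span_mul_span] at h3
      refine Submodule.span_mono ?_ h3
      rintro _ ⟨_, ⟨x, hx, rfl⟩, _, ⟨y, hy, rfl⟩, rfl⟩
      refine ⟨x * y, ?_, rfl⟩
      rw [SetLike.mem_coe, Ideal.IsTwoSided.pow_succ]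
      exact Ideal.mul_mem_mul hx hy
  have h3 := h2 n
  rw [hn, show Subtype.val '' ((↑(0 : Ideal S)) : Set S) = ({0} : Set R) by simp,
    Submodule.span_zero_singleton, Submodule.mem_bot] at h3
  exact one_ne_zero h3

/-- A simple algebra that is spanned by a finite ring is separable over the base ring. -/
theorem isSepAlg_of_finite_span {O R A : Type*} [CommRing O] [Ring R] [Algebra O R] [IsSimpleRing R]
    [Ring A] [Finite A] (g : A →+* R) (hg : Submodule.span O (Set.range g) = ⊤) : IsSepAlg O R := by
  have : Finite g.range := Set.finite_range g
  have hS : Submodule.span O (g.range : Set R) = ⊤ := by rw [RingHom.coe_range, hg]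
  have := isSemisimpleRing_of_span g.range hS
  refine IsSepAlg.of_span (isSepAlg_int_of_finite g.range) g.range.subtype ?_
  rw [show Set.range g.range.subtype = (g.range : Set R) from Subtype.range_val]
  exact hS

/-- A central element of a tensor product of simple algebras that annihilates a pure tensor with
nonzero factors is zero. -/
theorem eq_zero_of_mul_tmul {O R R' : Type*} [CommRing O] [Ring R] [Ring R'] [Algebra O R]
    [Algebra O R'] [IsSimpleRing R] [IsSimpleRing R'] {z : R ⊗[O] R'} (hz : ∀ x, z * x = x * z)
    {x : R} {x' : R'} (hx : x ≠ 0) (hx' : x' ≠ 0) (h : z * x ⊗ₜ x' = 0) : z = 0 := by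
  have key : z * (1 : R) ⊗ₜ x' = 0 := by
    let I : TwoSidedIdeal R := TwoSidedIdeal.mk' {r | z * r ⊗ₜ[O] x' = 0}
      (by rw [Set.mem_ofPred_eq, TensorProduct.zero_tmul, mul_zero])
      (fun {a c} ha hc => by
        rw [Set.mem_ofPred_eq] at ha hc ⊢
        rw [TensorProduct.add_tmul, mul_add, ha, hc, add_zero])
      (fun {a} ha => by
        rw [Set.mem_ofPred_eq] at ha ⊢
        rw [TensorProduct.neg_tmul, mul_neg, ha, neg_zero])
      (fun {a c} hc => by
        rw [Set.mem_ofPred_eq] at hc ⊢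
        rw [← one_mul x', ← Algebra.TensorProduct.tmul_mul_tmul, ← mul_assoc, hz, mul_assoc, hc,
          mul_zero])
      (fun {a c} ha => by
        rw [Set.mem_ofPred_eq] at ha ⊢
        rw [← mul_one x', ← Algebra.TensorProduct.tmul_mul_tmul, ← mul_assoc, ha, zero_mul])
    have hI : ∀ r, r ∈ I ↔ z * r ⊗ₜ[O] x' = 0 := fun r => TwoSidedIdeal.mem_mk' _ _ _ _ _ _ r
    exact (hI 1).mp (IsSimpleRing.one_mem_of_ne_zero_mem I hx ((hI x).mpr h))
  let I : TwoSidedIdeal R' := TwoSidedIdeal.mk' {r | z * (1 : R) ⊗ₜ[O] r = 0}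
    (by rw [Set.mem_ofPred_eq, TensorProduct.tmul_zero, mul_zero])
    (fun {a c} ha hc => by
      rw [Set.mem_ofPred_eq] at ha hc ⊢
      rw [TensorProduct.tmul_add, mul_add, ha, hc, add_zero])
    (fun {a} ha => by
      rw [Set.mem_ofPred_eq] at ha ⊢
      rw [TensorProduct.tmul_neg, mul_neg, ha, neg_zero])
    (fun {a c} hc => by
      rw [Set.mem_ofPred_eq] at hc ⊢
      rw [← one_mul (1 : R), ← Algebra.TensorProduct.tmul_mul_tmul, ← mul_assoc, hz, mul_assoc, hc,
        mul_zero])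
    (fun {a c} ha => by
      rw [Set.mem_ofPred_eq] at ha ⊢
      rw [← mul_one (1 : R), ← Algebra.TensorProduct.tmul_mul_tmul, ← mul_assoc, ha, zero_mul])
  have hI : ∀ r, r ∈ I ↔ z * (1 : R) ⊗ₜ[O] r = 0 := fun r => TwoSidedIdeal.mem_mk' _ _ _ _ _ _ r
  have h1 : z * (1 : R) ⊗ₜ[O] (1 : R') = 0 :=
    (hI 1).mp (IsSimpleRing.one_mem_of_ne_zero_mem I hx' ((hI x').mpr key))
  rwa [← Algebra.TensorProduct.one_def, mul_one] at h1

/-- Modules annihilated by the maximal ideal are vector spaces over the residue field. -/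
theorem exists_functional {O V : Type*} [CommRing O] [IsLocalRing O] [AddCommGroup V] [Module O V]
    (hV : ∀ r ∈ IsLocalRing.maximalIdeal O, ∀ v : V, r • v = 0) {v : V} (hv : v ≠ 0) :
    ∃ f : V →ₗ[O] IsLocalRing.ResidueField O, f v ≠ 0 := by
  have hT : Module.IsTorsionBySet O V (IsLocalRing.maximalIdeal O : Set O) :=
    fun v r => hV r r.2 v
  let _ : Module (IsLocalRing.ResidueField O) V := hT.module
  by_contra h
  push Not at h
  refine hv ((Module.forall_dual_apply_eq_zero_iff (IsLocalRing.ResidueField O) v).mp fun f => ?_)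
  exact h
    { toFun := f
      map_add' := map_add f
      map_smul' := fun r w => by
        have h1 : r • w = IsLocalRing.residue O r • w := rfl
        rw [h1, map_smul]
        rfl }

theorem tmul_ne_zero {O V V' : Type*} [CommRing O] [IsLocalRing O] [AddCommGroup V] [Module O V]
    [AddCommGroup V'] [Module O V'] (hV : ∀ r ∈ IsLocalRing.maximalIdeal O, ∀ v : V, r • v = 0)
    (hV' : ∀ r ∈ IsLocalRing.maximalIdeal O, ∀ v : V', r • v = 0) {v : V} {v' : V'} (hv : v ≠ 0)
    (hv' : v' ≠ 0) : v ⊗ₜ[O] v' ≠ 0 := by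
  obtain ⟨f, hf⟩ := exists_functional hV hv
  obtain ⟨f', hf'⟩ := exists_functional hV' hv'
  intro h
  have h1 := congrArg (LinearMap.mul' O (IsLocalRing.ResidueField O) ∘ₗ TensorProduct.map f f') h
  rw [map_zero] at h1
  exact mul_ne_zero hf hf' h1

end Simple

/-! ### The homomorphism from `(B ⊗ B')^P` to `B(P_γ) ⊗ B'(P_γ')` -/

/-- The sizes of the sets of representatives in the definition of the relative traces are divisible
by `p`. -/
theorem dvd_card_of_representatives {p : ℕ} [Fact p.Prime] {P : Type*} [Group P] [Finite P]
    (hP : IsPGroup p P) {Q : Subgroup P} (hQ : Q ≠ ⊤) {T : Finset P}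
    (hT : ∀ u : P, ∃! t, t ∈ T ∧ t⁻¹ * u ∈ Q) : p ∣ T.card := by
  have hbij : Function.Bijective fun t : T => (QuotientGroup.mk (t : P) : P ⧸ Q) := by
    constructor
    · rintro ⟨t, ht⟩ ⟨s, hs⟩ hts
      refine Subtype.ext ((hT s).unique ⟨ht, QuotientGroup.eq.mp hts⟩ ⟨hs, ?_⟩)
      rw [inv_mul_cancel]
      exact Q.one_mem
    · intro q
      obtain ⟨u, rfl⟩ := QuotientGroup.mk_surjective q
      obtain ⟨t, ⟨ht, htu⟩, -⟩ := hT u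
      exact ⟨⟨t, ht⟩, QuotientGroup.eq.mpr htu⟩
  have hc : T.card = Q.index := by
    rw [← Nat.card_eq_finsetCard]
    exact Nat.card_eq_of_bijective _ hbij
  rw [hc]
  obtain ⟨n, hn⟩ := hP.index Q
  rcases n with _ | n
  · exact absurd (Subgroup.index_eq_one.mp hn) hQ
  · exact ⟨p ^ n, by rw [hn, pow_succ']⟩

section ProductHom

universe u v v₁ v' vP
variable {O : Type u} [CommRing O] {G : Type v} [Group G] {G' : Type v₁} [Group G'] {Γ : Type v'}
  [Group Γ] {P : Type vP} [Group P] {ω : G →* Γ} {ω' : G' →* Γ} {b : InvIdem O ω}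
  {b' : InvIdem O ω'} {ι : P →* G} {ι' : P →* G'}

/-- The projection `H × H' → H`. -/
def kerFst (ω : G →* Γ) (ω' : G' →* Γ) : (fibreHom ω ω').ker →* ω.ker :=
  (((MonoidHom.fst G G').comp (fibre ω ω').subtype).comp (fibreHom ω ω').ker.subtype).codRestrict
    ω.ker fun x => x.2

/-- The projection `H × H' → H'`. -/
def kerSnd (ω : G →* Γ) (ω' : G' →* Γ) : (fibreHom ω ω').ker →* ω'.ker :=
  (((MonoidHom.snd G G').comp (fibre ω ω').subtype).comp (fibreHom ω ω').ker.subtype).codRestrict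
    ω'.ker fun x => (show ω' x.1.1.2 = 1 from x.1.2.symm.trans x.2)

theorem kerFst_conj (l : fibre ω ω') (x : (fibreHom ω ω').ker) :
    kerFst ω ω' (MulAut.conjNormal l x) = MulAut.conjNormal (l : G × G').1 (kerFst ω ω' x) := by
  refine Subtype.ext ?_
  rw [MulAut.conjNormal_apply]
  change ((MulAut.conjNormal l x : (fibreHom ω ω').ker) : fibre ω ω').1.1 = _
  rw [MulAut.conjNormal_apply]
  rfl

theorem kerSnd_conj (l : fibre ω ω') (x : (fibreHom ω ω').ker) :
    kerSnd ω ω' (MulAut.conjNormal l x) = MulAut.conjNormal (l : G × G').2 (kerSnd ω ω' x) := by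
  refine Subtype.ext ?_
  rw [MulAut.conjNormal_apply]
  change ((MulAut.conjNormal l x : (fibreHom ω ω').ker) : fibre ω ω').1.2 = _
  rw [MulAut.conjNormal_apply]
  rfl

variable (h : ∀ u, ω (ι u) = ω' (ι' u))

theorem kerFst_fixed {x : (fibreHom ω ω').ker}
    (hx : ∀ u, conjKer (fibreHom ω ω') (diagP ι ι' h) u x = x) (u : P) :
    conjKer ω ι u (kerFst ω ω' x) = kerFst ω ω' x :=
  (kerFst_conj (diagP ι ι' h u) x).symm.trans (congrArg _ (hx u))

theorem kerSnd_fixed {x : (fibreHom ω ω').ker}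
    (hx : ∀ u, conjKer (fibreHom ω ω') (diagP ι ι' h) u x = x) (u : P) :
    conjKer ω' ι' u (kerSnd ω ω' x) = kerSnd ω ω' x :=
  (kerSnd_conj (diagP ι ι' h u) x).symm.trans (congrArg _ (hx u))

variable (i : fixedSub b ι) (i' : fixedSub b' ι')

/-- The function on `H × H'` that maps `(c, c') ∈ C_H(P) × C_{H'}(P)` to the tensor product of the
images of `c b` and `c' b'`, and vanishes outside `C_H(P) × C_{H'}(P)`. -/
def prodVal (x : (fibreHom ω ω').ker) : (algBPγ i).carrier ⊗[O] (algBPγ i').carrier :=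
  centVal i (kerFst ω ω' x) ⊗ₜ[O] centVal i' (kerSnd ω ω' x)

theorem prodVal_conj (u : P) (x : (fibreHom ω ω').ker) :
    prodVal i i' (conjKer (fibreHom ω ω') (diagP ι ι' h) u x) = prodVal i i' x := by
  unfold prodVal
  rw [show kerFst ω ω' (conjKer (fibreHom ω ω') (diagP ι ι' h) u x)
      = conjKer ω ι u (kerFst ω ω' x) from kerFst_conj (diagP ι ι' h u) x,
    show kerSnd ω ω' (conjKer (fibreHom ω ω') (diagP ι ι' h) u x)
      = conjKer ω' ι' u (kerSnd ω ω' x) from kerSnd_conj (diagP ι ι' h u) x,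
    centVal_conj, centVal_conj]

theorem prodVal_mul {x y : (fibreHom ω ω').ker}
    (hx : ∀ u, conjKer (fibreHom ω ω') (diagP ι ι' h) u x = x)
    (hy : ∀ u, conjKer (fibreHom ω ω') (diagP ι ι' h) u y = y) :
    prodVal i i' (x * y) = prodVal i i' x * prodVal i i' y := by
  unfold prodVal
  rw [map_mul, map_mul, centVal_mul i (kerFst_fixed h hx) (kerFst_fixed h hy),
    centVal_mul i' (kerSnd_fixed h hx) (kerSnd_fixed h hy), Algebra.TensorProduct.tmul_mul_tmul]

theorem groupLin_prodVal_tens (a : MonoidAlgebra O ω.ker) (a' : MonoidAlgebra O ω'.ker) :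
    groupLin O (prodVal i i') (tens ω ω' a a')
      = groupLin O (centVal i) a ⊗ₜ[O] groupLin O (centVal i') a' := by
  unfold tens
  induction a using MonoidAlgebra.induction_on with
  | of x =>
    induction a' using MonoidAlgebra.induction_on with
    | of y =>
      have e : MonoidAlgebra.mapDomainAlgHom O O (kerInl ω ω') (MonoidAlgebra.of O ω.ker x) *
          MonoidAlgebra.mapDomainAlgHom O O (kerInr ω ω') (MonoidAlgebra.of O ω'.ker y)
          = MonoidAlgebra.of O _ (kerInl ω ω' x * kerInr ω ω' y) := by
        simp [MonoidAlgebra.single_mul_single]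
      have e1 : kerFst ω ω' (kerInl ω ω' x * kerInr ω ω' y) = x := Subtype.ext (mul_one _)
      have e2 : kerSnd ω ω' (kerInl ω ω' x * kerInr ω ω' y) = y := Subtype.ext (one_mul _)
      rw [e, groupLin_of, groupLin_of, groupLin_of, prodVal, e1, e2]
    | add s t hs ht => rw [map_add, mul_add, map_add, hs, ht, map_add, TensorProduct.tmul_add]
    | smul r s hs => rw [map_smul, mul_smul_comm, map_smul, hs, map_smul, TensorProduct.tmul_smul]
  | add s t hs ht => rw [map_add, add_mul, map_add, hs, ht, map_add, TensorProduct.add_tmul]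
  | smul r s hs =>
    rw [map_smul, smul_mul_assoc, map_smul, hs, map_smul, TensorProduct.smul_tmul']

/-- The inclusion `B → O H` as a linear map. -/
def valBLin (b : InvIdem O ω) : (algB b).carrier →ₗ[O] MonoidAlgebra O ω.ker where
  toFun := valB b
  map_add' x y := map_add (cornerIncl b.idem) x y
  map_smul' _ _ := rfl

theorem conjNormal_fixed_iff {n : G} (hn : n ∈ Subgroup.normalizer (ι.range : Set G)) (x : ω.ker) :
    (∀ u, conjKer ω ι u (MulAut.conjNormal n x) = MulAut.conjNormal n x)
      ↔ ∀ u, conjKer ω ι u x = x := by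
  have key : ∀ n ∈ Subgroup.normalizer (ι.range : Set G), ∀ x : ω.ker,
      (∀ u, conjKer ω ι u x = x) →
      ∀ u, conjKer ω ι u (MulAut.conjNormal n x) = MulAut.conjNormal n x := by
    intro n hn x hx u
    have h2 := ((Subgroup.inv_mem _ hn) (ι u)).mp ⟨u, rfl⟩
    obtain ⟨v, hv⟩ := h2
    have e : ι u * n = n * ι v := by rw [hv]; group
    change MulAut.conjNormal (ι u) (MulAut.conjNormal n x) = _
    rw [← MulAut.mul_apply, ← map_mul, e, map_mul, MulAut.mul_apply]
    exact congrArg _ (hx v)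
  refine ⟨fun hx => ?_, key n hn x⟩
  have := key n⁻¹ (Subgroup.inv_mem _ hn) _ hx
  rwa [← MulAut.mul_apply, ← map_mul, inv_mul_cancel, map_one, MulAut.one_apply] at this

theorem centVal_act (n : normP i) (x : ω.ker) :
    centVal i (MulAut.conjNormal (n : G) x) = (algBPγ i).act n (centVal i x) := by
  by_cases hx : ∀ u, conjKer ω ι u x = x
  · rw [centVal_of_fixed i hx, centVal_of_fixed i ((conjNormal_fixed_iff n.2.1 x).mpr hx)]
    refine congrArg (InteriorAlgebra.qmk (maxIdealOf (toBP i i))) (Subtype.ext ?_)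
    exact ((algB b).act_str n x _ (MulAut.conjNormal_apply _ _)).symm
  · rw [centVal_of_not_fixed i hx,
      centVal_of_not_fixed i fun h' => hx ((conjNormal_fixed_iff n.2.1 x).mp h'), map_zero]

theorem groupLin_prodVal_conj {l : fibre ω ω'} {n : normP i} {n' : normP i'}
    (hn : (l : G × G').1 = n) (hn' : (l : G × G').2 = n')
    (a : MonoidAlgebra O (fibreHom ω ω').ker) :
    groupLin O (prodVal i i') (MonoidAlgebra.domCongr O O (MulAut.conjNormal l) a)
      = Algebra.TensorProduct.congr ((algBPγ i).act n) ((algBPγ i').act n')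
          (groupLin O (prodVal i i') a) := by
  induction a using MonoidAlgebra.induction_on with
  | of x =>
    have e : MonoidAlgebra.domCongr O O (MulAut.conjNormal l) (MonoidAlgebra.of O _ x)
        = MonoidAlgebra.of O (fibreHom ω ω').ker (MulAut.conjNormal l x) := by simp
    rw [e, groupLin_of, groupLin_of, prodVal, prodVal, kerFst_conj, kerSnd_conj, hn, hn',
      centVal_act, centVal_act]
    rfl
  | add s t hs ht => rw [map_add, map_add, hs, ht, map_add, map_add]
  | smul r s hs => rw [map_smul, map_smul, hs, map_smul, map_smul]

theorem groupLin_domCongr (u : P) (a : MonoidAlgebra O (fibreHom ω ω').ker) :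
    groupLin O (prodVal i i') (MonoidAlgebra.domCongr O O
      (conjKer (fibreHom ω ω') (diagP ι ι' h) u) a) = groupLin O (prodVal i i') a := by
  induction a using MonoidAlgebra.induction_on with
  | of x =>
    have e : MonoidAlgebra.domCongr O O (conjKer (fibreHom ω ω') (diagP ι ι' h) u)
        (MonoidAlgebra.of O _ x) = MonoidAlgebra.of O _
          (conjKer (fibreHom ω ω') (diagP ι ι' h) u x) := by simp
    rw [e, groupLin_of, groupLin_of, prodVal_conj]
  | add s t hs ht => rw [map_add, map_add, hs, ht, map_add]
  | smul r s hs => rw [map_smul, map_smul, hs, map_smul]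

/-- The element `x ⊗ x'` of `(B ⊗ B')^P`. -/
def tensFixed (x : fixedSub b ι) (x' : fixedSub b' ι') :
    fixedSub (prodIdem b b') (diagP ι ι' h) :=
  ⟨toCorner (prodIdem b b').idem (tens ω ω' (valB b x.1) (valB b' x'.1))
    ((tens_mul ω ω' _ _ _ _).trans (congrArg₂ _ (corner_left b.idem x.1) (corner_left b'.idem x'.1)))
    ((tens_mul ω ω' _ _ _ _).trans
      (congrArg₂ _ (corner_right b.idem x.1) (corner_right b'.idem x'.1))), fun u =>
    corner_ext (prodIdem b b').idem ((tens_conj ω ω' (diagP ι ι' h u) _ _).trans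
      (congrArg₂ _ (domCongr_valB x u) (domCongr_valB x' u)))⟩

theorem valB_tensFixed (x : fixedSub b ι) (x' : fixedSub b' ι') :
    valB (prodIdem b b') (tensFixed h x x').1 = tens ω ω' (valB b x.1) (valB b' x'.1) := rfl

variable {i i'} [Finite G] [Finite G'] [IsNoetherianRing O] [IsLocalRing O]
  [IsAdicComplete (IsLocalRing.maximalIdeal O) O]

omit [Finite G'] in
theorem smul_algBPγ_eq_zero (hi : IsLocalPoint i) {r : O} (hr : r ∈ IsLocalRing.maximalIdeal O)
    (x : (algBPγ i).carrier) : r • x = 0 := by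
  obtain ⟨x, rfl⟩ := toBPγHom_surjective i x
  rw [← map_smul, toBPγHom_eq_zero_iff]
  exact brauerKer_le_maxIdealOf hi (TwoSidedIdeal.subset_span (Or.inr ⟨r, hr, x, rfl⟩))

omit [Finite G'] in
theorem smul_tensor_eq_zero (hi : IsLocalPoint i) {r : O} (hr : r ∈ IsLocalRing.maximalIdeal O)
    (t : (algBPγ i).carrier ⊗[O] (algBPγ i').carrier) : r • t = 0 := by
  induction t using TensorProduct.induction_on with
  | zero => rw [smul_zero]
  | tmul x y => rw [TensorProduct.smul_tmul', smul_algBPγ_eq_zero hi hr, TensorProduct.zero_tmul]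
  | add s t hs ht => rw [smul_add, hs, ht, add_zero]

variable {p : ℕ} [Fact p.Prime] [CharP (IsLocalRing.ResidueField O) p]

omit [IsNoetherianRing O] [IsAdicComplete (IsLocalRing.maximalIdeal O) O] [Fact p.Prime]
  [Finite G] [Finite G'] in
theorem natCast_mem_maximalIdeal : (p : O) ∈ IsLocalRing.maximalIdeal O := by
  rw [← IsLocalRing.residue_eq_zero_iff, map_natCast, CharP.cast_eq_zero]

omit [Finite G'] [Fact p.Prime] in
theorem nsmul_algBPγ_eq_zero (hi : IsLocalPoint i) (x : (algBPγ i).carrier) : p • x = 0 := by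
  rw [← Nat.cast_smul_eq_nsmul O]
  exact smul_algBPγ_eq_zero hi natCast_mem_maximalIdeal x

omit [Finite G'] [Fact p.Prime] in
theorem nsmul_tensor_eq_zero (hi : IsLocalPoint i)
    (t : (algBPγ i).carrier ⊗[O] (algBPγ i').carrier) : p • t = 0 := by
  rw [← Nat.cast_smul_eq_nsmul O]
  exact smul_tensor_eq_zero hi natCast_mem_maximalIdeal t

variable [Finite P] (hP : IsPGroup p P) (hi : IsLocalPoint i) (hi' : IsLocalPoint i')

include hi hi' in
omit [Fact p.Prime] [CharP (IsLocalRing.ResidueField O) p] in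
theorem groupLin_prodVal_one : groupLin O (prodVal i i') (prodIdem b b').val = 1 := by
  change groupLin O (prodVal i i') (tens ω ω' (valB b (1 : fixedSub b ι).1)
    (valB b' (1 : fixedSub b' ι').1)) = 1
  rw [groupLin_prodVal_tens, groupLin_centVal hi, groupLin_centVal hi']
  rfl

/-- The homomorphism `(B ⊗ B')^P → B(P_γ) ⊗ B'(P_γ')`. It maps `x ⊗ x'`, for `x ∈ B^P` and
`x' ∈ B'^P`, to the tensor product of the images of `x` and `x'`. Because `(B ⊗ B')^P` is not
spanned by these elements, the map is defined by means of the coefficients at the elements of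
`C_H(P) × C_{H'}(P)`. -/
def prodHom : fixedSub (prodIdem b b') (diagP ι ι' h) →ₐ[O]
    (algBPγ i).carrier ⊗[O] (algBPγ i').carrier :=
  AlgHom.ofLinearMap (groupLin O (prodVal i i') ∘ₗ valBLin (prodIdem b b') ∘ₗ
      (fixedSub (prodIdem b b') (diagP ι ι' h)).val.toLinearMap)
    (groupLin_prodVal_one hi hi')
    (fun x y => groupLin_mul (ψ := prodVal i i') hP (nsmul_tensor_eq_zero hi)
      (conjKer (fibreHom ω ω') (diagP ι ι' h)) (prodVal_conj h i i')
      (fun _ _ => prodVal_mul h i i') (domCongr_valB x) (domCongr_valB y))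

theorem prodHom_apply (x : fixedSub (prodIdem b b') (diagP ι ι' h)) :
    prodHom h hP hi hi' x = groupLin O (prodVal i i') (valB (prodIdem b b') x.1) := rfl

theorem prodHom_of_valB_eq {w : fixedSub (prodIdem b b') (diagP ι ι' h)} {x : fixedSub b ι}
    {x' : fixedSub b' ι'} (hw : valB (prodIdem b b') w.1 = tens ω ω' (valB b x.1) (valB b' x'.1)) :
    prodHom h hP hi hi' w = toBPγ i x ⊗ₜ[O] toBPγ i' x' := by
  rw [prodHom_apply, hw, groupLin_prodVal_tens, groupLin_centVal hi, groupLin_centVal hi']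

theorem prodHom_surjective : Function.Surjective (prodHom h hP hi hi') := by
  intro t
  induction t using TensorProduct.induction_on with
  | zero => exact ⟨0, map_zero _⟩
  | tmul x y =>
    obtain ⟨x, rfl⟩ := toBPγHom_surjective i x
    obtain ⟨y, rfl⟩ := toBPγHom_surjective i' y
    exact ⟨tensFixed h x y, prodHom_of_valB_eq h hP hi hi' (valB_tensFixed h x y)⟩
  | add s t hs ht =>
    obtain ⟨x, rfl⟩ := hs
    obtain ⟨y, rfl⟩ := ht
    exact ⟨x + y, map_add _ _ _⟩

theorem prodHom_act {l : (Subgroup.normalizer ((diagP ι ι' h).range : Set (fibre ω ω')) :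
    Subgroup (fibre ω ω'))} {n : normP i} {n' : normP i'} (hn : (l : fibre ω ω').1.1 = n)
    (hn' : (l : fibre ω ω').1.2 = n') (x : fixedSub (prodIdem b b') (diagP ι ι' h)) :
    prodHom h hP hi hi' (actNorm (prodIdem b b') (diagP ι ι' h) l x)
      = Algebra.TensorProduct.congr ((algBPγ i).act n) ((algBPγ i').act n')
          (prodHom h hP hi hi' x) :=
  groupLin_prodVal_conj i i' hn hn' (valB (prodIdem b b') x.1)

theorem prodHom_str {z : (fibreHom ω ω').ker}
    (hz : ∀ u, conjKer (fibreHom ω ω') (diagP ι ι' h) u z = z) :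
    prodHom h hP hi hi' ⟨(algB (prodIdem b b')).str z, str_mem_fixedSub hz⟩
      = toBPγ i ⟨(algB b).str (kerFst ω ω' z), str_mem_fixedSub (kerFst_fixed h hz)⟩ ⊗ₜ[O]
        toBPγ i' ⟨(algB b').str (kerSnd ω ω' z), str_mem_fixedSub (kerSnd_fixed h hz)⟩ := by
  have hof : ∀ u, MonoidAlgebra.domCongr O O (conjKer (fibreHom ω ω') (diagP ι ι' h) u)
      (MonoidAlgebra.of O _ z) = MonoidAlgebra.of O _ z := fun u => by simp [hz u]
  have e2 := groupLin_mul (ψ := prodVal i i') hP (nsmul_tensor_eq_zero hi)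
    (conjKer (fibreHom ω ω') (diagP ι ι' h)) (prodVal_conj h i i')
    (fun _ _ => prodVal_mul h i i')
    (domCongr_valB (1 : fixedSub (prodIdem b b') (diagP ι ι' h))) hof
  have e3 : valB (prodIdem b b') (1 : fixedSub (prodIdem b b') (diagP ι ι' h)).1
      = (prodIdem b b').val := rfl
  rw [e3, groupLin_prodVal_one hi hi', one_mul, groupLin_of, prodVal,
    centVal_of_fixed i (kerFst_fixed h hz), centVal_of_fixed i' (kerSnd_fixed h hz)] at e2
  exact e2

theorem prodHom_eq_zero_of_mem_brauerKer {x : fixedSub (prodIdem b b') (diagP ι ι' h)}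
    (hx : x ∈ brauerKer (prodIdem b b') (diagP ι ι' h)) : prodHom h hP hi hi' x = 0 := by
  have hle : brauerKer (prodIdem b b') (diagP ι ι' h) ≤ TwoSidedIdeal.ker (prodHom h hP hi hi') := by
    refine TwoSidedIdeal.span_le.mpr ?_
    rintro y (⟨Q, hQ, x, T, -, hT, hy⟩ | ⟨r, hr, x, rfl⟩)
    · refine SetLike.mem_coe.mpr ((TwoSidedIdeal.mem_ker _).mpr ?_)
      have e : ∀ t, groupLin O (prodVal i i') (valBLin (prodIdem b b')
          ((algB (prodIdem b b')).act (diagP ι ι' h t) x))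
          = groupLin O (prodVal i i') (valBLin (prodIdem b b') x) := fun t =>
        groupLin_domCongr h i i' t (valB (prodIdem b b') x)
      change groupLin O (prodVal i i') (valBLin (prodIdem b b') y.1) = 0
      rw [hy, map_sum, map_sum, Finset.sum_congr rfl fun t _ => e t, Finset.sum_const]
      obtain ⟨m, hm⟩ := dvd_card_of_representatives hP hQ hT
      rw [hm, mul_smul, nsmul_tensor_eq_zero hi]
    · refine SetLike.mem_coe.mpr ((TwoSidedIdeal.mem_ker _).mpr ?_)
      rw [map_smul, smul_tensor_eq_zero hi hr]
  exact (TwoSidedIdeal.mem_ker _).mp (hle hx)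

end ProductHom

/-! ### The simple algebra of a product point -/

section ProductPoint

theorem maxIdealOf_eq_of_mem_conjClass {R : Type*} [Ring R] {e f : R} (h : f ∈ conjClass e) :
    maxIdealOf f = maxIdealOf e := by
  unfold maxIdealOf
  refine congrArg sSup (Set.ext fun I => ?_)
  exact and_congr_right fun _ => not_congr (conjClass_mem_iff h I)

theorem IsLocalIdem.of_mem_conjClass {R : Type*} [Ring R] {e f : R} (he : IsLocalIdem e)
    (h : f ∈ conjClass e) : IsLocalIdem f := by
  obtain ⟨a, rfl⟩ := h
  exact he.map_equiv (MulSemiringAction.toRingEquiv (ConjAct Rˣ) R (ConjAct.toConjAct a))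

/-- The ideals of a separable tensor product of simple algebras are generated by central
idempotents. Those that do not contain a local pure tensor annihilate it, and hence vanish. -/
theorem ker_eq_maxIdealOf {O R S S' : Type*} [CommRing O] [IsLocalRing O] [Ring R] [Algebra O R]
    [Module.Finite O R] [Ring S] [Algebra O S] [Ring S'] [Algebra O S'] [IsSimpleRing S]
    [IsSimpleRing S'] (hsep : IsSepAlg O (S ⊗[O] S'))
    (hT : ∀ r ∈ IsLocalRing.maximalIdeal O, ∀ t : S ⊗[O] S', r • t = 0)
    {f : R →ₐ[O] S ⊗[O] S'} (hf : Function.Surjective f) {e : R} (he : IsLocalIdem e) {s : S}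
    {s' : S'} (hs : s ≠ 0) (hs' : s' ≠ 0) (hss : s ⊗ₜ[O] s' ≠ 0) (hfe : f e = s ⊗ₜ[O] s') (x : R) :
    f x = 0 ↔ x ∈ maxIdealOf e := by
  have hle : TwoSidedIdeal.ker f ≤ maxIdealOf e :=
    le_maxIdealOf O he fun h => hss (hfe ▸ (TwoSidedIdeal.mem_ker _).mp h)
  refine ⟨fun h => hle ((TwoSidedIdeal.mem_ker _).mpr h), fun hx => ?_⟩
  let I : TwoSidedIdeal (S ⊗[O] S') := TwoSidedIdeal.mk' (f '' maxIdealOf e)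
    ⟨0, zero_mem _, map_zero f⟩
    (by rintro _ _ ⟨a, ha, rfl⟩ ⟨c, hc, rfl⟩; exact ⟨a + c, add_mem ha hc, map_add f _ _⟩)
    (by rintro _ ⟨a, ha, rfl⟩; exact ⟨-a, neg_mem ha, map_neg f _⟩)
    (by
      rintro t _ ⟨a, ha, rfl⟩
      obtain ⟨t, rfl⟩ := hf t
      exact ⟨t * a, TwoSidedIdeal.mul_mem_left _ _ _ ha, map_mul f _ _⟩)
    (by
      rintro _ t ⟨a, ha, rfl⟩
      obtain ⟨t, rfl⟩ := hf t
      exact ⟨a * t, TwoSidedIdeal.mul_mem_right _ _ _ ha, map_mul f _ _⟩)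
  have hI : ∀ y, y ∈ I ↔ ∃ a ∈ maxIdealOf e, f a = y := fun y =>
    TwoSidedIdeal.mem_mk' _ _ _ _ _ _ y
  obtain ⟨z, hzI, hz, hzc⟩ := hsep.exists_identity hT I
  have hfeI : f e ∉ I := fun h => by
    obtain ⟨a, ha, hae⟩ := (hI _).mp h
    have h1 : e - a ∈ maxIdealOf e := hle ((TwoSidedIdeal.mem_ker _).mpr (by
      rw [map_sub, hae, sub_self]))
    have h2 := add_mem h1 ha
    rw [sub_add_cancel] at h2
    exact not_mem_maxIdealOf O he h2
  have hloc : IsLocalIdem (f e) := IsLocalIdem.map (f : R →+* S ⊗[O] S') hf he (by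
    change f e ≠ 0
    rwa [hfe])
  have hzz : IsIdempotentElem z := hz z hzI
  have hz0 : z = 0 := by
    rcases hloc.eq_zero_or_eq (f := z * f e) (hzz.mul_of_commute (hzc _) hloc.idem)
      (by rw [← mul_assoc, ← hzc, mul_assoc, hloc.idem.eq])
      (by rw [mul_assoc, hloc.idem.eq]) with h0 | h0
    · rw [hfe] at h0
      exact eq_zero_of_mul_tmul hzc hs hs' h0
    · exact absurd (h0 ▸ I.mul_mem_right _ _ hzI) hfeI
  rw [← hz (f x) ((hI _).mpr ⟨x, hx, rfl⟩), hz0, zero_mul]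

universe u v v₁ v' vP
variable {O : Type u} [CommRing O] {G : Type v} [Group G] {G' : Type v₁} [Group G'] {Γ : Type v'}
  [Group Γ] {P : Type vP} [Group P] {ω : G →* Γ} {ω' : G' →* Γ} {b : InvIdem O ω}
  {b' : InvIdem O ω'} {ι : P →* G} {ι' : P →* G'} {i : fixedSub b ι} {i' : fixedSub b' ι'}

/-- `C_H(P)` as a subgroup of `H`. -/
def centKer (ω : G →* Γ) (ι : P →* G) : Subgroup ω.ker where
  carrier := {x | ∀ u, conjKer ω ι u x = x}
  one_mem' := fun u => map_one _
  mul_mem' := fun hx hy u => by rw [map_mul, hx u, hy u]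
  inv_mem' := fun hx u => by rw [map_inv, hx u]

/-- The structural map from `C_H(P)` to the multiplicative monoid of `B(P_γ)`. -/
def centHom (i : fixedSub b ι) : centKer ω ι →* (algBPγ i).carrier where
  toFun x := toBPγ i ⟨(algB b).str x, str_mem_fixedSub x.2⟩
  map_one' := congrArg (toBPγ i) (Subtype.ext (map_one (algB b).str))
  map_mul' x y := congrArg (toBPγ i) (Subtype.ext (map_mul (algB b).str x.1 y.1))

variable [Finite G] [IsNoetherianRing O] [IsLocalRing O]
  [IsAdicComplete (IsLocalRing.maximalIdeal O) O]

theorem isSimpleRing_algBPγ (hi : IsLocalPoint i) : IsSimpleRing (algBPγ i).carrier := by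
  have := finite_algBP i
  exact isSimpleRing_quotient (isCoatom_maxIdealOf O
    (show IsLocalIdem (toBP i i) from hi.isLocalIdem))

/-- `B(P_γ)` is separable, because it is spanned by a homomorphic image of the finite ring
`𝔽_p C_H(P)`. -/
theorem isSepAlg_algBPγ {p : ℕ} [Fact p.Prime] [CharP (IsLocalRing.ResidueField O) p] [Finite P]
    (hi : IsLocalPoint i) : IsSepAlg O (algBPγ i).carrier := by
  have := isSimpleRing_algBPγ hi
  have hchar : CharP (algBPγ i).carrier p :=
    (CharP.charP_iff_prime_eq_zero Fact.out).mpr (by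
      rw [← nsmul_one]
      exact nsmul_algBPγ_eq_zero hi 1)
  let _ : Algebra (ZMod p) (algBPγ i).carrier := ZMod.algebra _ p
  have : Finite (MonoidAlgebra (ZMod p) (centKer ω ι)) :=
    Finite.of_injective (fun a (x : centKer ω ι) => a.coeff x) fun a c h =>
      MonoidAlgebra.ext (Finsupp.ext fun x => congrFun h x)
  have := Fintype.ofFinite ω.ker
  refine isSepAlg_of_finite_span
    (MonoidAlgebra.lift (ZMod p) (algBPγ i).carrier (centKer ω ι) (centHom i) :
      MonoidAlgebra (ZMod p) (centKer ω ι) →ₐ[ZMod p] (algBPγ i).carrier).toRingHom ?_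
  refine top_le_iff.mp fun x _ => ?_
  obtain ⟨x, rfl⟩ := toBPγHom_surjective i x
  have hx : toBPγHom i x = ∑ y, (valB b x.1).coeff y • centVal i y :=
    (groupLin_centVal hi x).symm.trans (groupLin_apply _ _)
  rw [hx]
  refine Submodule.sum_mem _ fun y _ => Submodule.smul_mem _ _ ?_
  by_cases hy : ∀ u, conjKer ω ι u y = y
  · refine Submodule.subset_span ⟨MonoidAlgebra.of (ZMod p) _ ⟨y, hy⟩, ?_⟩
    rw [centVal_of_fixed i hy]
    exact MonoidAlgebra.lift_of (centHom i) ⟨y, hy⟩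
  · rw [centVal_of_not_fixed i hy]
    exact zero_mem _

variable {h : ∀ u, ω (ι u) = ω' (ι' u)} {hι : Function.Injective ι}
  {i'' : fixedSub (prodIdem b b') (diagP ι ι' h)} [Finite G'] {p : ℕ} [Fact p.Prime]
  [CharP (IsLocalRing.ResidueField O) p] [Finite P] (hP : IsPGroup p P)

/-- The point `γ''` contains a preimage of the tensor product of the images of `j ∈ γ` and
`j' ∈ γ'`. -/
theorem IsProductPoint.exists_prodHom_eq (hprod : IsProductPoint h hι i i' i'')
    (hi : IsLocalPoint i) (hi' : IsLocalPoint i') {j : fixedSub b ι} {j' : fixedSub b' ι'}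
    (hj : j ∈ conjClass i) (hj' : j' ∈ conjClass i') :
    ∃ j'' ∈ conjClass i'', prodHom h hP hi hi' j'' = toBPγ i j ⊗ₜ[O] toBPγ i' j' := by
  obtain ⟨w, hw, j'', hj'', hwj⟩ := hprod j hj j' hj'
  refine ⟨j'', hj'', ?_⟩
  rw [← prodHom_of_valB_eq h hP hi hi' hw, ← sub_eq_zero, ← map_sub]
  exact prodHom_eq_zero_of_mem_brauerKer h hP hi hi'
    ((qmk_eq_iff (brauerKer (prodIdem b b') (diagP ι ι' h)) j'' w).mp hwj.symm)

omit [Finite P] in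
theorem toBPγ_tmul_ne_zero (hi : IsLocalPoint i) (hi' : IsLocalPoint i') :
    toBPγ i i ⊗ₜ[O] toBPγ i' i' ≠ 0 :=
  tmul_ne_zero (fun _ hr x => smul_algBPγ_eq_zero hi hr x)
    (fun _ hr x => smul_algBPγ_eq_zero hi' hr x) hi.toBPγ_ne_zero hi'.toBPγ_ne_zero

theorem prodHom_eq_zero_iff (hprod : IsProductPoint h hι i i' i'') (hi : IsLocalPoint i)
    (hi' : IsLocalPoint i') (hi'' : IsLocalPoint i'')
    (x : fixedSub (prodIdem b b') (diagP ι ι' h)) :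
    prodHom h hP hi hi' x = 0 ↔ x ∈ maxIdealOf i'' := by
  have := finite_fixedSub (prodIdem b b') (diagP ι ι' h)
  have := isSimpleRing_algBPγ hi
  have := isSimpleRing_algBPγ hi'
  obtain ⟨j'', hj'', hj⟩ := hprod.exists_prodHom_eq hP hi hi' (conjClass_refl i)
    (conjClass_refl i')
  rw [← maxIdealOf_eq_of_mem_conjClass hj'']
  exact ker_eq_maxIdealOf
    (IsSepAlg.tensorProduct (isSepAlg_algBPγ (p := p) hi) (isSepAlg_algBPγ (p := p) hi'))
    (fun _ hr t => smul_tensor_eq_zero hi hr t) (prodHom_surjective h hP hi hi')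
    (hi''.isLocalIdem.of_mem_conjClass hj'') hi.toBPγ_ne_zero hi'.toBPγ_ne_zero
    (toBPγ_tmul_ne_zero hi hi') hj x

/-- The isomorphism `B''(P_γ'') ≃ B(P_γ) ⊗ B'(P_γ')`. -/
def prodEquiv (hprod : IsProductPoint h hι i i' i'') (hi : IsLocalPoint i)
    (hi' : IsLocalPoint i') (hi'' : IsLocalPoint i'') :
    (algBPγ i'').carrier ≃ₐ[O] (algBPγ i).carrier ⊗[O] (algBPγ i').carrier :=
  quotientEquiv (maxIdealOf i'') (prodHom h hP hi hi') (prodHom_surjective h hP hi hi')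
    (prodHom_eq_zero_iff hP hprod hi hi' hi'')

end ProductPoint

/-! ### The normalizer of a product point -/

section ProductNormalizer

universe u v v₁ v' vP
variable {O : Type u} [CommRing O] {G : Type v} [Group G] {G' : Type v₁} [Group G'] {Γ : Type v'}
  [Group Γ] {P : Type vP} [Group P] {ω : G →* Γ} {ω' : G' →* Γ} {b : InvIdem O ω}
  {b' : InvIdem O ω'} {ι : P →* G} {ι' : P →* G'} {i : fixedSub b ι} {i' : fixedSub b' ι'}

theorem Induces.mem_normalizer {n : G} {x : MulAut P × Γ} (hn : Induces ω ι n x) :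
    n ∈ Subgroup.normalizer (ι.range : Set G) := by
  intro y
  constructor
  · rintro ⟨u, rfl⟩
    exact ⟨x.1 u, hn.1 u⟩
  · rintro ⟨v, hv⟩
    refine ⟨x.1⁻¹ v, ?_⟩
    have h1 := hn.1 (x.1⁻¹ v)
    rw [MulAut.apply_inv_self, hv] at h1
    exact (mul_left_cancel (mul_right_cancel h1)).symm

theorem degHom_eq_iff (hι : Function.Injective ι) (i : fixedSub b ι) (n : normP i)
    (x : MulAut P × Γ) : degHom hι i n = x ↔ Induces ω ι n x :=
  (degN_iff hι i n x).symm

variable {h : ∀ u, ω (ι u) = ω' (ι' u)}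

theorem Induces.fst {l : fibre ω ω'} {x : MulAut P × Γ}
    (hl : Induces (fibreHom ω ω') (diagP ι ι' h) l x) : Induces ω ι l.1.1 x :=
  ⟨fun u => congrArg (fun t : fibre ω ω' => t.1.1) (hl.1 u), hl.2⟩

theorem Induces.snd {l : fibre ω ω'} {x : MulAut P × Γ}
    (hl : Induces (fibreHom ω ω') (diagP ι ι' h) l x) : Induces ω' ι' l.1.2 x :=
  ⟨fun u => congrArg (fun t : fibre ω ω' => t.1.2) (hl.1 u), hl.2.trans l.2⟩

theorem Induces.pair {l : fibre ω ω'} {x : MulAut P × Γ} (h1 : Induces ω ι l.1.1 x)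
    (h2 : Induces ω' ι' l.1.2 x) : Induces (fibreHom ω ω') (diagP ι ι' h) l x :=
  ⟨fun u => Subtype.ext (Prod.ext (h1.1 u) (h2.1 u)), h1.2⟩

variable [Finite G] [Finite G'] [Finite P] [IsNoetherianRing O] [IsLocalRing O]
  [IsAdicComplete (IsLocalRing.maximalIdeal O) O] {p : ℕ} [Fact p.Prime]
  [CharP (IsLocalRing.ResidueField O) p] {hι : Function.Injective ι}
  {i'' : fixedSub (prodIdem b b') (diagP ι ι' h)}

/-- The stabilizer of `γ''` contains the pairs of elements of the stabilizers of `γ` and `γ'`: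
such a pair maps `γ''` to a point that has an element in common with `γ''` modulo the maximal ideal
that does not contain it. -/
theorem IsProductPoint.mem_normP (hprod : IsProductPoint h hι i i' i'') (hP : IsPGroup p P)
    (hi : IsLocalPoint i) (hi' : IsLocalPoint i') (hi'' : IsLocalPoint i'') {l : fibre ω ω'}
    (hl : l ∈ Subgroup.normalizer ((diagP ι ι' h).range : Set (fibre ω ω')))
    (hl1 : l.1.1 ∈ normP i) (hl2 : l.1.2 ∈ normP i') : l ∈ normP i'' := by
  have := finite_fixedSub (prodIdem b b') (diagP ι ι' h)
  obtain ⟨j, hj, hj1⟩ := hprod.exists_prodHom_eq hP hi hi' (conjClass_refl i) (conjClass_refl i')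
  have ha : actNorm b ι ⟨l.1.1, hl1.1⟩ i ∈ conjClass i := (mem_normP_iff i _).mp hl1
  have ha' : actNorm b' ι' ⟨l.1.2, hl2.1⟩ i' ∈ conjClass i' := (mem_normP_iff i' _).mp hl2
  obtain ⟨k, hk, hk1⟩ := hprod.exists_prodHom_eq hP hi hi' ha ha'
  set s := actNorm (prodIdem b b') (diagP ι ι' h) ⟨l, hl⟩ with hs
  have hjk : prodHom h hP hi hi' (s j) = prodHom h hP hi hi' k := by
    have h1 := prodHom_act h hP hi hi' (l := ⟨l, hl⟩) (n := ⟨l.1.1, hl1⟩) (n' := ⟨l.1.2, hl2⟩)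
      rfl rfl j
    rw [hj1] at h1
    rw [hk1]
    exact h1
  have hmem : k - s j ∈ maxIdealOf i'' := by
    rw [← prodHom_eq_zero_iff hP hprod hi hi' hi'', map_sub, hjk, sub_self]
  have hloc := hi''.isLocalIdem.of_mem_conjClass hk
  have hsj : s j ∈ conjClass k := by
    refine hloc.conj_of_sub_mem
      ((hi''.isLocalIdem.of_mem_conjClass hj).map_equiv s.toRingEquiv) ?_ hmem
    rw [conjClass_mem_iff hk]
    exact not_mem_maxIdealOf O hi''.isLocalIdem
  have hsi : s j ∈ conjClass (s i'') := conjClass_map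
    (s : fixedSub (prodIdem b b') (diagP ι ι' h) →+* fixedSub (prodIdem b b') (diagP ι ι' h)) hj
  refine (mem_normP_iff i'' ⟨l, hl⟩).mpr ?_
  exact conjClass_trans hk (conjClass_trans hsj (conjClass_symm hsi))

variable {hι' : Function.Injective ι'} (hi : IsLocalPoint i) (hi' : IsLocalPoint i')

omit [Finite G'] [Finite P] [Finite G] [IsNoetherianRing O] [IsLocalRing O]
  [IsAdicComplete (IsLocalRing.maximalIdeal O) O] in
theorem exists_degHom_eq_pair (hprod : ∀ l : fibre ω ω',
    l ∈ Subgroup.normalizer ((diagP ι ι' h).range : Set (fibre ω ω')) → l.1.1 ∈ normP i →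
    l.1.2 ∈ normP i' → l ∈ normP i'') {n : normP i} {n' : normP i'}
    (hn : degHom hι i n = degHom hι' i' n') :
    ∃ l, degHom (diagP_injective h hι) i'' l = degHom hι i n := by
  have h1 := (degHom_eq_iff hι i n _).mp rfl
  have h2 := (degHom_eq_iff hι' i' n' _).mp hn.symm
  have hl : Induces (fibreHom ω ω') (diagP ι ι' h) ⟨(n, n'), h1.2.symm.trans h2.2⟩
    (degHom hι i n) := Induces.pair h1 h2
  exact ⟨⟨_, hprod _ hl.mem_normalizer n.2 n'.2⟩, (degHom_eq_iff _ _ _ _).mpr hl⟩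

end ProductNormalizer

/-! ### The isomorphism for the Clifford extensions -/

section ProductClifford

universe u v v₁ v' vP
variable {O : Type u} [CommRing O] {G : Type v} [Group G] {G' : Type v₁} [Group G'] {Γ : Type v'}
  [Group Γ] {P : Type vP} [Group P] {ω : G →* Γ} {ω' : G' →* Γ} {b : InvIdem O ω}
  {b' : InvIdem O ω'} {ι : P →* G} {ι' : P →* G'} {h : ∀ u, ω (ι u) = ω' (ι' u)}

section Projections

variable {hι : Function.Injective ι} {hι' : Function.Injective ι'} {i : fixedSub b ι}
  {i' : fixedSub b' ι'} (i'' : fixedSub (prodIdem b b') (diagP ι ι' h)) {K : Subgroup (MulAut P × Γ)}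

theorem induces_degHom (n : normP i) : Induces ω ι n (degHom hι i n) :=
  (degHom_eq_iff hι i n _).mp rfl

theorem fst_mem_normP (hK : ∀ x ∈ K, ∃ n, degHom hι i n = x)
    (l : K.comap (degHom (diagP_injective h hι) i'')) : l.1.1.1.1 ∈ normP i := by
  obtain ⟨n, hn⟩ := hK _ l.2
  refine mem_normP_of_induces hι i n ?_
  rw [hn]
  exact (induces_degHom l.1).fst

theorem snd_mem_normP (hK : ∀ x ∈ K, ∃ n, degHom hι' i' n = x)
    (l : K.comap (degHom (diagP_injective h hι) i'')) : l.1.1.1.2 ∈ normP i' := by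
  obtain ⟨n, hn⟩ := hK _ l.2
  refine mem_normP_of_induces hι' i' n ?_
  rw [hn]
  exact (induces_degHom l.1).snd

theorem degHom_fst_eq (hK : ∀ x ∈ K, ∃ n, degHom hι i n = x)
    (l : K.comap (degHom (diagP_injective h hι) i'')) :
    degHom hι i ⟨l.1.1.1.1, fst_mem_normP i'' hK l⟩ = degHom (diagP_injective h hι) i'' l.1 :=
  (degHom_eq_iff hι i _ _).mpr (induces_degHom l.1).fst

theorem degHom_snd_eq (hK : ∀ x ∈ K, ∃ n, degHom hι' i' n = x)
    (l : K.comap (degHom (diagP_injective h hι) i'')) :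
    degHom hι' i' ⟨l.1.1.1.2, snd_mem_normP (hι := hι) i'' hK l⟩ = degHom (diagP_injective h hι) i'' l.1 :=
  (degHom_eq_iff hι' i' _ _).mpr (induces_degHom l.1).snd

/-- The projection to `G` of the part of the stabilizer of `γ''` that lies above `K`. -/
def normFst (hK : ∀ x ∈ K, ∃ n, degHom hι i n = x) :
    K.comap (degHom (diagP_injective h hι) i'') →* K.comap (degHom hι i) where
  toFun l := ⟨⟨l.1.1.1.1, fst_mem_normP i'' hK l⟩, by
    rw [Subgroup.mem_comap, degHom_fst_eq i'' hK l]; exact l.2⟩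
  map_one' := rfl
  map_mul' _ _ := rfl

/-- The projection to `G'` of the part of the stabilizer of `γ''` that lies above `K`. -/
def normSnd (hK : ∀ x ∈ K, ∃ n, degHom hι' i' n = x) :
    K.comap (degHom (diagP_injective h hι) i'') →* K.comap (degHom hι' i') where
  toFun l := ⟨⟨l.1.1.1.2, snd_mem_normP (hι := hι) i'' hK l⟩, by
    rw [Subgroup.mem_comap, degHom_snd_eq (hι := hι) i'' hK l]; exact l.2⟩
  map_one' := rfl
  map_mul' _ _ := rfl

end Projections

variable [Finite G] [Finite G'] [IsNoetherianRing O] [IsLocalRing O]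
  [IsAdicComplete (IsLocalRing.maximalIdeal O) O] {p : ℕ} [Fact p.Prime]
  [CharP (IsLocalRing.ResidueField O) p] {hι : Function.Injective ι} {hι' : Function.Injective ι'}
  {i : fixedSub b ι} {i' : fixedSub b' ι'} {i'' : fixedSub (prodIdem b b') (diagP ι ι' h)}
  [Finite P] (hP : IsPGroup p P) (hprod : IsProductPoint h hι i i' i'')
  (hi : IsLocalPoint i) (hi' : IsLocalPoint i') (hi'' : IsLocalPoint i'')
  {K : Subgroup (MulAut P × Γ)}

include hP hprod hi hi' hi'' hι' in
theorem exists_degHom_prod (hK : ∀ x ∈ K, ∃ n, degHom hι i n = x)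
    (hK' : ∀ x ∈ K, ∃ n, degHom hι' i' n = x) :
    ∀ x ∈ K, ∃ l, degHom (diagP_injective h hι) i'' l = x := by
  intro x hx
  obtain ⟨n, rfl⟩ := hK x hx
  obtain ⟨n', hn'⟩ := hK' _ hx
  exact exists_degHom_eq_pair (fun _ => hprod.mem_normP hP hi hi' hi'') hn'.symm

/-- The presentation of the diagonal subalgebra of `ℰ̄_K ⊗ ℰ̄'_K` over the stabilizer of `γ''`. -/
def presDiag (hK : ∀ x ∈ K, ∃ n, degHom hι i n = x) (hK' : ∀ x ∈ K, ∃ n, degHom hι' i' n = x) :=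
  Pres.diag (d := (degHom (diagP_injective h hι) i'').subgroupComap K)
    ((presEbar hι hi.idem_toBPγ).trunc K) ((presEbar hι' hi'.idem_toBPγ).trunc K)
    (normFst i'' hK) (normSnd (hι := hι) i'' hK')
    (fun l => Subtype.ext (degHom_fst_eq i'' hK l))
    (fun l => Subtype.ext (degHom_snd_eq (hι := hι) i'' hK' l)) (fun n n' hn => by
      obtain ⟨l, hl⟩ := exists_degHom_eq_pair (hι := hι) (hι' := hι') (i'' := i'')
        (fun _ => hprod.mem_normP hP hi hi' hi'') (n := n.1) (n' := n'.1)
        (congrArg Subtype.val hn)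
      exact ⟨⟨l, by rw [Subgroup.mem_comap, hl]; exact n.2⟩, Subtype.ext hl⟩)

theorem prodEquiv_act (n : normP i) (n' : normP i') (l : normP i'') (hn : l.1.1.1 = n)
    (hn' : l.1.1.2 = n') (x : (algBPγ i'').carrier) :
    prodEquiv hP hprod hi hi' hi'' ((algBPγ i'').act l x)
      = Algebra.TensorProduct.congr ((algBPγ i).act n) ((algBPγ i').act n')
          (prodEquiv hP hprod hi hi' hi'' x) := by
  obtain ⟨x, rfl⟩ := toBPγHom_surjective i'' x
  exact prodHom_act h hP hi hi' (l := ⟨l.1, l.2.1⟩) hn hn' x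

theorem prodEquiv_str (z : centP i'') :
    prodEquiv hP hprod hi hi' hi'' ((algBPγ i'').str z) =
      centVal i (kerFst ω ω' ⟨z.1.1, z.2.1⟩) ⊗ₜ[O] centVal i' (kerSnd ω ω' ⟨z.1.1, z.2.1⟩) := by
  have hz : ∀ u, conjKer (fibreHom ω ω') (diagP ι ι' h) u ⟨z.1.1, z.2.1⟩ = ⟨z.1.1, z.2.1⟩ :=
    fun u => (conjKer_eq_self_iff u _).mpr (z.2.2 u).symm
  rw [centVal_of_fixed i (kerFst_fixed h hz), centVal_of_fixed i' (kerSnd_fixed h hz)]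
  exact prodHom_str h hP hi hi' hz

omit [Finite G] [Finite P] [IsNoetherianRing O] [IsLocalRing O]
  [IsAdicComplete (IsLocalRing.maximalIdeal O) O] in
theorem centVal_str (z : centP i) : centVal i ⟨z.1.1, z.2.1⟩ = (algBPγ i).str z := by
  have hz : ∀ u, conjKer ω ι u ⟨z.1.1, z.2.1⟩ = ⟨z.1.1, z.2.1⟩ :=
    fun u => (conjKer_eq_self_iff u _).mpr (z.2.2 u).symm
  exact centVal_of_fixed i hz

include hP hprod hi hi' hi'' in
/-- The isomorphism `ℰ̄''_K ≃ Δ(ℰ̄_K ⊗ ℰ̄'_K)`. It is induced by `prodEquiv`, which may send the class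
of `i''` only to a conjugate of `ī ⊗ ī'`; hence the presentation of `ℰ̄''_K` is conjugated by a
unit. -/
theorem nonempty_isoEbar (hK : ∀ x ∈ K, ∃ n, degHom hι i n = x)
    (hK' : ∀ x ∈ K, ∃ n, degHom hι' i' n = x) :
    Nonempty (GradedAlg.Iso ((calEbar i'').trunc K)
      (((calEbar i).trunc K).diag ((calEbar i').trunc K))) := by
  obtain ⟨j, ⟨a, ha⟩, hj⟩ := hprod.exists_prodHom_eq hP hi hi' (conjClass_refl i)
    (conjClass_refl i')
  let ā : (algBPγ i'').carrierˣ := Units.map (toBPγHom i'').toRingHom.toMonoidHom a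
  have hā : (ā : (algBPγ i'').carrier) * toBPγ i'' i'' * (↑ā⁻¹ : (algBPγ i'').carrier)
      = toBPγ i'' j :=
    (congrArg (toBPγHom i'') ha).symm
  refine ⟨Pres.iso (Pres.conj ((presEbar (diagP_injective h hι) hi''.idem_toBPγ).trunc K)
    (fun z x => (algBPγ i'').str_mul _ x) ā) (presDiag hP hprod hi hi' hi'' hK hK')
    (prodEquiv hP hprod hi hi' hi'') (fun l x => ?_) (fun z => ?_) ?_⟩
  · exact prodEquiv_act hP hprod hi hi' hi'' (normFst i'' hK l).1
      (normSnd (hι := hι) i'' hK' l).1 l.1 rfl rfl x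
  · refine (prodEquiv_str hP hprod hi hi' hi'' _).trans ?_
    exact congrArg₂ _ (centVal_str (i := i) (kerToCent hι i
      ⟨(normFst i'' hK z.1).1, (degHom_fst_eq i'' hK z.1).trans (congrArg Subtype.val z.2)⟩))
      (centVal_str (i := i') (kerToCent hι' i'
      ⟨(normSnd (hι := hι) i'' hK' z.1).1,
        (degHom_snd_eq (hι := hι) i'' hK' z.1).trans (congrArg Subtype.val z.2)⟩))
  · rw [hā]
    exact hj

end ProductClifford

end BlockExt

end

theorem propositionp {O : Type*} [CommRing O] [IsDomain O] [IsDiscreteValuationRing O]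
    [IsAdicComplete (IsLocalRing.maximalIdeal O) O] (p : ℕ) [Fact p.Prime]
    [CharP (IsLocalRing.ResidueField O) p]
    {G G' Γ P : Type*} [Group G] [Group G'] [Group Γ] [Group P] [Finite G] [Finite G']
    (ω : G →* Γ) (ω' : G' →* Γ) (hω : Function.Surjective ω) (hω' : Function.Surjective ω')
    (b : BlockExt.InvIdem O ω) (hb : b.IsBlock) (b' : BlockExt.InvIdem O ω') (hb' : b'.IsBlock)
    (hP : IsPGroup p P) (ι : P →* G) (ι' : P →* G')
    (hι : Function.Injective ι) (hι' : Function.Injective ι') (h : ∀ u, ω (ι u) = ω' (ι' u))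
    (i : BlockExt.fixedSub b ι) (hi : BlockExt.IsLocalPoint i)
    (i' : BlockExt.fixedSub b' ι') (hi' : BlockExt.IsLocalPoint i')
    (i'' : BlockExt.fixedSub (BlockExt.prodIdem b b') (BlockExt.diagP ι ι' h))
    (hi'' : BlockExt.IsLocalPoint i'')
    (hprod : BlockExt.IsProductPoint h hι i i' i'')
    (c : (BlockExt.algBofP hι i).carrier) (hc : BlockExt.IsPointBlock hι i c)
    (c' : (BlockExt.algBofP hι' i').carrier) (hc' : BlockExt.IsPointBlock hι' i' c')
    (c'' : (BlockExt.algBofP (BlockExt.diagP_injective h hι) i'').carrier)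
    (hc'' : BlockExt.IsPointBlock (BlockExt.diagP_injective h hι) i'' c'')
    (K : Subgroup (MulAut P × Γ)) (hK : K = BlockExt.fusF i ⊓ BlockExt.fusF i') :
    K ≤ BlockExt.fusF i'' ∧
    ∃ (θ : BlockExt.GradedAlg.Iso (BlockExt.calEbar i) (BlockExt.calFbar i))
      (θ' : BlockExt.GradedAlg.Iso (BlockExt.calEbar i') (BlockExt.calFbar i'))
      (θ'' : BlockExt.GradedAlg.Iso (BlockExt.calEbar i'') (BlockExt.calFbar i''))
      (η : BlockExt.GradedAlg.Iso (BlockExt.calEbar i) (BlockExt.calEbarP hc))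
      (η' : BlockExt.GradedAlg.Iso (BlockExt.calEbar i') (BlockExt.calEbarP hc'))
      (η'' : BlockExt.GradedAlg.Iso (BlockExt.calEbar i'') (BlockExt.calEbarP hc'')),
      BlockExt.IsCanonicalEF i θ ∧ BlockExt.IsCanonicalEF i' θ' ∧ BlockExt.IsCanonicalEF i'' θ'' ∧
      BlockExt.IsCanonicalEP hc η ∧ BlockExt.IsCanonicalEP hc' η' ∧
      BlockExt.IsCanonicalEP hc'' η'' ∧
      ∃ (α : BlockExt.GradedAlg.Iso ((BlockExt.calFbar i'').trunc K)
          (((BlockExt.calFbar i).trunc K).diag ((BlockExt.calFbar i').trunc K)))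
        (β : BlockExt.GradedAlg.Iso ((BlockExt.calEbar i'').trunc K)
          (((BlockExt.calEbar i).trunc K).diag ((BlockExt.calEbar i').trunc K)))
        (δ : BlockExt.GradedAlg.Iso ((BlockExt.calEbarP hc'').trunc K)
          (((BlockExt.calEbarP hc).trunc K).diag ((BlockExt.calEbarP hc').trunc K))),
        (∀ z, α.toAlgEquiv ((θ''.trunc K).toAlgEquiv z)
          = ((θ.trunc K).diag (θ'.trunc K)).toAlgEquiv (β.toAlgEquiv z)) ∧
        (∀ z, δ.toAlgEquiv ((η''.trunc K).toAlgEquiv z)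
          = ((η.trunc K).diag (η'.trunc K)).toAlgEquiv (β.toAlgEquiv z)) := by
  have : Finite P := Finite.of_injective ι hι
  subst hK
  have hK₁ : ∀ x ∈ BlockExt.fusF i ⊓ BlockExt.fusF i', ∃ n, BlockExt.degHom hι i n = x :=
    fun x hx => BlockExt.exists_degHom_eq_of_mem_fusF hι hi x hx.1
  have hK₂ : ∀ x ∈ BlockExt.fusF i ⊓ BlockExt.fusF i', ∃ n, BlockExt.degHom hι' i' n = x :=
    fun x hx => BlockExt.exists_degHom_eq_of_mem_fusF hι' hi' x hx.2
  refine ⟨fun x hx => ?_, ?_⟩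
  · obtain ⟨l, rfl⟩ := BlockExt.exists_degHom_prod hP hprod hi hi' hi'' hK₁ hK₂ x hx
    exact BlockExt.degHom_mem_fusF _ i'' l
  obtain ⟨β⟩ := BlockExt.nonempty_isoEbar hP hprod hi hi' hi'' hK₁ hK₂
  generalize BlockExt.fusF i ⊓ BlockExt.fusF i' = K at β ⊢
  let θ := (BlockExt.isoFbarEbar hι hi).symm
  let θ' := (BlockExt.isoFbarEbar hι' hi').symm
  let θ'' := (BlockExt.isoFbarEbar (BlockExt.diagP_injective h hι) hi'').symm
  let η := BlockExt.isoEbarEbarP hc hi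
  let η' := BlockExt.isoEbarEbarP hc' hi'
  let η'' := BlockExt.isoEbarEbarP hc'' hi''
  refine ⟨θ, θ', θ'', η, η', η'', BlockExt.isCanonicalEF_symm hι hi,
    BlockExt.isCanonicalEF_symm hι' hi', BlockExt.isCanonicalEF_symm _ hi'',
    BlockExt.isCanonicalEP hc hi, BlockExt.isCanonicalEP hc' hi', BlockExt.isCanonicalEP hc'' hi'',
    (θ''.trunc K).symm.trans (β.trans ((θ.trunc K).diag (θ'.trunc K))), β,
    (η''.trunc K).symm.trans (β.trans ((η.trunc K).diag (η'.trunc K))), fun z => ?_, fun z => ?_⟩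
  · exact congrArg (fun t => ((θ.trunc K).diag (θ'.trunc K)).toAlgEquiv (β.toAlgEquiv t))
      ((θ''.trunc K).toAlgEquiv.symm_apply_apply z)
  · exact congrArg (fun t => ((η.trunc K).diag (η'.trunc K)).toAlgEquiv (β.toAlgEquiv t))
      ((η''.trunc K).toAlgEquiv.symm_apply_apply z)
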